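/- **Setting.** Let $d\in\{2,3\}$ and let $\Omega\subset\mathbb R^d$ be a bounded, connected, open set with Lipschitz boundary. Let $k\ge 1$, $1<p,q<\infty$ with $\frac1p+\frac1q=1$, $\rho>0$, and let either $j=k-1$ and $\tau\ge 0$, or $j=k$ and $\tau>0$. *Meshes.* $\mathcal T_h$ is a finite partition of $\Omega$ into open polygons or polyhedra $T$ (not necessarily convex), each of whose boundaries is the union of the closures of finitely many flat faces $e$ (relatively open polygons, or segments if $d=2$); distinct faces of the mesh are disjoint, and an interior face is shared by two elements. Let $h_T$, $h_e$ be the diameters of $T$, $e$, let $h=\max_T h_T$, and let $\mathbf n$ be the outward unit normal on $\partial T$. The mesh is shape regular with constants $\gamma>0$, $N\in\mathbb N$ if for every element $T$ and every face $e\subset\partial T$: $|T|\ge\gamma h_T^d$, $|e|\ge\gamma h_e^{d-1}$, $h_e\ge\gamma h_T$; there is a pyramid with base $e$ and some apex $A$ which is contained in $\overline T$ and satisfies $(x-A)\cdot\mathbf n\ge\gamma h_T$ for $x\in e$; and $T$ has at most $N$ faces. *Problem.* The coefficients $\boldsymbol\beta$ (vector valued) and $c$ (scalar) are constant on each $T$.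 $\Gamma_-$ is the union of the faces on $\partial\Omega$ on which $\boldsymbol\beta\cdot\mathbf n<0$, and $\Gamma_+=\partial\Omega\setminus\Gamma_-$. Let $f\in L^q(\Omega)$, $g\in L^q(\Gamma_-)$. The exact solution $u$ of $\nabla\cdot(\boldsymbol\beta u)+cu=f$ in $\Omega$, $u=g$ on $\Gamma_-$, is understood in the weak sense: $$(u,\boldsymbol\beta\cdot\nabla\sigma-c\sigma)=\langle g,\boldsymbol\beta\cdot\mathbf n\,\sigma\rangle_{\Gamma_-}-(f,\sigma)$$ for all $\sigma\in C^1(\mathbb R^d)$ with $\sigma=0$ on $\Gamma_+$ (in particular this holds if it holds for all $\sigma\in W^{1,p}(\Omega)$ with zero trace on $\Gamma_+$). *Scheme.* $P_r$ denotes the polynomials of total degree at most $r$. $M_{k-1,h}$ is the space of functions $v$ with $v|_T\in P_{k-1}(T)$ for all $T$. $W_{j,h}$ is the space of $\sigma=\{\sigma_0,\sigma_b\}$ with $\sigma_0|_T\in P_j(T)$ for all $T$ and a single-valued $\sigma_b|_e\in P_j(e)$ for all faces $e$; $W_{j,h}^{0,\Gamma_+}$ is its subspace with $\sigma_b=0$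 on $\Gamma_+$. The discrete weak gradient $\nabla_w\sigma|_T\in[P_{k-1}(T)]^d$ is defined by $$(\nabla_w\sigma,\boldsymbol\psi)_T=-(\sigma_0,\nabla\cdot\boldsymbol\psi)_T+\langle\sigma_b,\boldsymbol\psi\cdot\mathbf n\rangle_{\partial T}\qquad\forall\boldsymbol\psi\in[P_{k-1}(T)]^d .$$ With $\mathcal L\sigma_0=\boldsymbol\beta\cdot\nabla\sigma_0-c\sigma_0$ on each $T$ put $$s(\lambda,\sigma)=\sum_T\Big(\rho h_T^{1-p}\int_{\partial T}|\lambda_0-\lambda_b|^{p-1}\mathrm{sgn}(\lambda_0-\lambda_b)(\sigma_0-\sigma_b)\,ds+\tau\int_T|\mathcal L\lambda_0|^{p-1}\mathrm{sgn}(\mathcal L\lambda_0)\,\mathcal L\sigma_0\,dx\Big),$$ $$b(v,\sigma)=\sum_T(v,\boldsymbol\beta\cdot\nabla_w\sigma-c\sigma_0)_T,\qquad |||\sigma|||=s(\sigma,\sigma)^{1/p}.$$ A numerical solution is a pair $(u_h;\lambda_h)\in M_{k-1,h}\times W_{j,h}^{0,\Gamma_+}$ with $$s(\lambda_h,\sigma)+b(u_h,\sigma)=\sum_{e\subset\Gamma_-}\langle\sigma_b,\boldsymbol\beta\cdot\mathbf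 n\,g\rangle_e-(f,\sigma_0)\quad\forall\sigma\in W_{j,h}^{0,\Gamma_+},\qquad b(v,\lambda_h)=0\quad\forall v\in M_{k-1,h}.$$ **Theorem 7.1.** For all $\gamma>0$, $N\in\mathbb N$ and $B\in\mathbb R$ there is a constant $C>0$, depending only on $d,\Omega,k,j,p,q,\rho,\tau,\gamma,N,B$, such that the following holds for every mesh which is shape regular with constants $\gamma,N$ and all $\boldsymbol\beta,c,f,g$ as above with $|\boldsymbol\beta|\le B$: if the exact solution $u$ belongs to $W^{k,q}(\Omega)$ and $(u_h;\lambda_h)$ is a numerical solution, then the dual error $\epsilon_h=\lambda_h$ (the exact multiplier is $0$) satisfies $$|||\epsilon_h|||\le C\,h^{qk/p}\,\|\nabla^k u\|_{L^q(\Omega)}^{q/p}.$$ -/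

import Mathlib

open MeasureTheory Set Filter Topology
open scoped InnerProductSpace ContDiff

noncomputable section

namespace LpPDWG

/-- Euclidean space `ℝ^d`. -/
abbrev Pt (d : ℕ) := EuclideanSpace ℝ (Fin d)

/-! ### Domains -/

/-- `Ω` is a bounded connected open set with Lipschitz boundary: near each boundary point, in the
direction of a suitable unit vector `ν`, the set `Ω` is the region strictly above the graph of a
Lipschitz function `φ` of the variables orthogonal to `ν` (that is, `φ` is invariant under
translations along `ν`). -/
structure IsLipschitzDomain {d : ℕ} (Ω : Set (Pt d)) : Prop where
  isOpen : IsOpen Ω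
  isBounded : Bornology.IsBounded Ω
  isConnected : IsConnected Ω
  lipschitz_boundary : ∀ x ∈ frontier Ω, ∃ (ν : Pt d) (r : ℝ) (L : NNReal) (φ : Pt d → ℝ),
    ‖ν‖ = 1 ∧ 0 < r ∧ LipschitzWith L φ ∧ (∀ y (t : ℝ), φ (y + t • ν) = φ y) ∧
      Ω ∩ Metric.ball x r = {y | φ y < ⟪ν, y⟫_ℝ} ∩ Metric.ball x r

/-- `P` is an open polytope (not necessarily convex) of the affine subspace `A`: it is nonempty,
bounded, connected, relatively open in `A`, it is the relative interior of its closure, and its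
relative boundary is contained in finitely many proper affine subspaces of `A`. For `A = ⊤` in the
plane or in space these are the open polygons and polyhedra, for lines `A` the open segments. -/
structure IsOpenPolytope {d : ℕ} (A : AffineSubspace ℝ (Pt d)) (P : Set (Pt d)) : Prop where
  subset : P ⊆ A
  isBounded : Bornology.IsBounded P
  isConnected : IsConnected P
  relOpen : ∃ U : Set (Pt d), IsOpen U ∧ P = U ∩ A
  relRegular : ∀ U : Set (Pt d), IsOpen U → U ∩ A ⊆ closure P → U ∩ A ⊆ P
  boundary_flat : ∃ S : Finset (AffineSubspace ℝ (Pt d)), (∀ H ∈ S, H < A) ∧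
    closure P \ P ⊆ ⋃ H ∈ S, (H : Set (Pt d))

/-! ### Polytopal partitions -/

/-- A partition of `Ω` into finitely many open polytopes `elem i`, together with the set of all its
flat faces (edges for `d = 2`). The faces are relatively open and pairwise disjoint; the closures of
the faces belonging to an element make up its boundary, and a face between two elements belongs to
both of them (so hanging nodes are vertices). -/
structure PolytopalMesh {d : ℕ} (Ω : Set (Pt d)) where
  /-- number of elements -/
  numElem : ℕ
  /-- number of faces -/
  numFace : ℕ
  /-- the (open) elements -/
  elem : Fin numElem → Set (Pt d)
  /-- the (relatively open) faces -/
  face : Fin numFace → Set (Pt d)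
  /-- the hyperplane containing a face -/
  plane : Fin numFace → AffineSubspace ℝ (Pt d)
  /-- the faces of an element -/
  facesOf : Fin numElem → Finset (Fin numFace)
  /-- the unit normal of a face of an element, pointing out of the element -/
  normal : Fin numElem → Fin numFace → Pt d
  elem_polytope : ∀ i, IsOpenPolytope ⊤ (elem i)
  elem_disjoint : ∀ i i', i ≠ i' → Disjoint (elem i) (elem i')
  elem_subset : ∀ i, elem i ⊆ Ω
  cover : ⋃ i, closure (elem i) = closure Ω
  plane_finrank : ∀ e, Module.finrank ℝ (plane e).direction + 1 = d
  face_polytope : ∀ e, IsOpenPolytope (plane e) (face e)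
  face_disjoint : ∀ e e', e ≠ e' → Disjoint (face e) (face e')
  exists_elem : ∀ e, ∃ i, e ∈ facesOf i
  frontier_elem : ∀ i, frontier (elem i) = ⋃ e ∈ facesOf i, closure (face e)
  normal_norm : ∀ i, ∀ e ∈ facesOf i, ‖normal i e‖ = 1
  normal_orth : ∀ i, ∀ e ∈ facesOf i, normal i e ∈ (plane e).directionᗮ
  normal_outward : ∀ i, ∀ e ∈ facesOf i, ∀ x ∈ face e, ∃ r > 0,
    elem i ∩ Metric.ball x r = {y | ⟪y - x, normal i e⟫_ℝ < 0} ∩ Metric.ball x r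

namespace PolytopalMesh

variable {d : ℕ} {Ω : Set (Pt d)} (M : PolytopalMesh Ω)

/-- The diameter `h_T` of an element. -/
def hElem (i : Fin M.numElem) : ℝ := Metric.diam (M.elem i)

/-- The meshsize `h = max_T h_T`. -/
def meshSize : ℝ := ⨆ i, M.hElem i

/-- Shape regularity with constants `γ`, `N`. For every element `T` and each of its faces `e`:
`γ h_T ^ d ≤ |T|`, `γ h_e ^ (d-1) ≤ |e|`, `γ h_T ≤ h_e`; the closure of `T` contains a pyramid with
base `e`, some apex `A`, and (signed) height over `e` at least `γ h_T` (as the pyramid has diameter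
at most `h_T`, the angle between `x - A`, `x ∈ e`, and the outward normal is then bounded away from
`π / 2`); and `T` has at most `N` faces. -/
structure ShapeRegular (γ : ℝ) (N : ℕ) : Prop where
  volume_elem : ∀ i, ENNReal.ofReal (γ * M.hElem i ^ d) ≤ volume (M.elem i)
  area_face : ∀ e,
    ENNReal.ofReal (γ * Metric.diam (M.face e) ^ (d - 1)) ≤ μHE[d - 1] (M.face e)
  diam_face : ∀ i, ∀ e ∈ M.facesOf i, γ * M.hElem i ≤ Metric.diam (M.face e)
  pyramid : ∀ i, ∀ e ∈ M.facesOf i, ∃ A : Pt d, ∀ x ∈ M.face e,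
    segment ℝ A x ⊆ closure (M.elem i) ∧ γ * M.hElem i ≤ ⟪x - A, M.normal i e⟫_ℝ
  card_faces : ∀ i, (M.facesOf i).card ≤ N

/-- The face `e` lies on `∂Ω`. -/
def IsBoundaryFace (e : Fin M.numFace) : Prop := M.face e ⊆ frontier Ω

/-- The face `e` belongs to the inflow boundary `Γ₋`, where `β · n < 0`; here `β` is a piecewise
constant vector field, given by its values on the elements. -/
def IsInflow (β : Fin M.numElem → Pt d) (e : Fin M.numFace) : Prop :=
  M.IsBoundaryFace e ∧ ∃ i, e ∈ M.facesOf i ∧ ⟪β i, M.normal i e⟫_ℝ < 0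

/-- The face `e` belongs to the outflow boundary `Γ₊ = ∂Ω ∖ Γ₋`. -/
def IsOutflow (β : Fin M.numElem → Pt d) (e : Fin M.numFace) : Prop :=
  M.IsBoundaryFace e ∧ ¬ M.IsInflow β e

open Classical in
/-- The inflow functional `⟨g, β · n σ⟩_{Γ₋} = ∑_{e ⊆ Γ₋} ∫_e σ (β · n) g ds`, where the function
`σ` on a face `e` is given as `σ e`. -/
def inflowPairing (β : Fin M.numElem → Pt d) (g : Pt d → ℝ) (σ : Fin M.numFace → Pt d → ℝ) : ℝ :=
  ∑ i, ∑ e ∈ (M.facesOf i).filter (M.IsInflow β),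
    ∫ x in M.face e, σ e x * (⟪β i, M.normal i e⟫_ℝ * g x) ∂μHE[d - 1]

end PolytopalMesh

/-! ### Sobolev regularity -/

/-- The classical partial derivative `∂_{α 0} ⋯ ∂_{α (m-1)} φ`. -/
def partialDeriv {d m : ℕ} (α : Fin m → Fin d) (φ : Pt d → ℝ) (x : Pt d) : ℝ :=
  iteratedFDeriv ℝ m φ x (fun l => EuclideanSpace.single (α l) (1 : ℝ))

/-- `v` is the weak derivative `∂_{α 0} ⋯ ∂_{α (m-1)} u` on `Ω`. -/
def IsWeakPartial {d m : ℕ} (Ω : Set (Pt d)) (u : Pt d → ℝ) (α : Fin m → Fin d)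
    (v : Pt d → ℝ) : Prop :=
  LocallyIntegrableOn v Ω ∧
  ∀ φ : Pt d → ℝ, ContDiff ℝ ∞ φ → HasCompactSupport φ → tsupport φ ⊆ Ω →
    ∫ x in Ω, u x * partialDeriv α φ x = (-1) ^ m * ∫ x in Ω, v x * φ x

/-- `u ∈ W^{k,q}(Ω)`. -/
def MemSobolev {d : ℕ} (Ω : Set (Pt d)) (k : ℕ) (q : ℝ) (u : Pt d → ℝ) : Prop :=
  MemLp u (ENNReal.ofReal q) (volume.restrict Ω) ∧
  ∀ m ≤ k, ∀ α : Fin m → Fin d, ∃ v : Pt d → ℝ,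
    MemLp v (ENNReal.ofReal q) (volume.restrict Ω) ∧ IsWeakPartial Ω u α v

open Classical in
/-- The weak derivative of `u` (unique up to null sets), and `0` if there is none. -/
def weakPartial {d m : ℕ} (Ω : Set (Pt d)) (u : Pt d → ℝ) (α : Fin m → Fin d) : Pt d → ℝ :=
  if h : ∃ v, IsWeakPartial Ω u α v then h.choose else 0

/-- `‖∇^k u‖_{L^q(Ω)}`, with the Euclidean norm of the tensor `∇^k u`. -/
def gradNorm {d : ℕ} (Ω : Set (Pt d)) (k : ℕ) (q : ℝ) (u : Pt d → ℝ) : ℝ :=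
  (eLpNorm (fun x => √(∑ α : Fin k → Fin d, weakPartial Ω u α x ^ 2))
    (ENNReal.ofReal q) (volume.restrict Ω)).toReal

/-! ### Polynomials -/

/-- Real polynomials of total degree at most `r` in `d` variables. -/
abbrev Poly (d r : ℕ) := ↥(MvPolynomial.restrictTotalDegree (Fin d) ℝ r)

/-- The value of a polynomial at a point. -/
def val {d : ℕ} (P : MvPolynomial (Fin d) ℝ) (x : Pt d) : ℝ := MvPolynomial.eval (fun l => x l) P

/-- The transport expression `b · ∇P - c P`. -/
def transport {d : ℕ} (b : Pt d) (c : ℝ) (P : MvPolynomial (Fin d) ℝ) (x : Pt d) : ℝ :=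
  ∑ l, b l * val (MvPolynomial.pderiv l P) x - c * val P x

/-! ### The discrete weak gradient -/

section WeakGradient

variable {d : ℕ} {Ω : Set (Pt d)} (M : PolytopalMesh Ω)

/-- The space `W_{j,h}`: a polynomial of degree at most `j` on each element and one on each face,
the latter being the restriction to the face of a polynomial in the ambient variables. -/
structure WeakFun (j : ℕ) where
  interior : Fin M.numElem → Poly d j
  boundary : Fin M.numFace → Poly d j

/-- The space `M_{r,h}` of piecewise polynomials of degree at most `r`. -/
abbrev PiecewisePoly (r : ℕ) := Fin M.numElem → Poly d r

/-- `G ∈ [P_r(T)]^d` is the discrete weak gradient on `T = elem i` of the weak function with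
interior part `P` and boundary part `Q e` on the face `e`: for all `ψ ∈ [P_r(T)]^d`,
`(G, ψ)_T = -(P, ∇ · ψ)_T + ⟨Q, ψ · n⟩_{∂T}`. -/
def IsDiscreteWeakGrad (i : Fin M.numElem) {r : ℕ} (P : MvPolynomial (Fin d) ℝ)
    (Q : Fin M.numFace → MvPolynomial (Fin d) ℝ) (G : Fin d → Poly d r) : Prop :=
  ∀ ψ : Fin d → Poly d r,
    ∫ x in M.elem i, ∑ l, val (G l) x * val (ψ l) x =
      -(∫ x in M.elem i, val P x * ∑ l, val (MvPolynomial.pderiv l (ψ l).1) x) +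
      ∑ e ∈ M.facesOf i, ∫ x in M.face e,
        val (Q e) x * ∑ l, val (ψ l) x * M.normal i e l ∂μHE[d - 1]

theorem continuous_val (P : MvPolynomial (Fin d) ℝ) : Continuous (val P) :=
  (MvPolynomial.continuous_eval P).comp (by fun_prop)

theorem PolytopalMesh.isOpen_elem (i : Fin M.numElem) : IsOpen (M.elem i) := by
  obtain ⟨U, hU, h⟩ := (M.elem_polytope i).relOpen
  rw [h]; simpa using hU

theorem PolytopalMesh.measure_face_lt_top (e : Fin M.numFace) : μHE[d - 1] (M.face e) < ⊤ := by
  obtain ⟨x, hx⟩ := (M.face_polytope e).isConnected.nonempty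
  have hxp : x ∈ M.plane e := (M.face_polytope e).subset hx
  have : Nonempty (M.plane e) := ⟨⟨x, hxp⟩⟩
  have hr : d - 1 = Module.finrank ℝ (M.plane e).direction := by
    have := M.plane_finrank e; omega
  let f : (M.plane e).direction → Pt d := fun y => (y : Pt d) + x
  have hf : Isometry f := fun a b => by simp [f, Subtype.edist_eq]
  have himg : f '' (f ⁻¹' M.face e) = M.face e := by
    rw [Set.image_preimage_eq_iff]
    intro y hy
    have := AffineSubspace.vsub_mem_direction ((M.face_polytope e).subset hy) hxp
    exact ⟨⟨y - x, this⟩, by simp [f]⟩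
  rw [← himg, hf.euclideanHausdorffMeasure_image, hr]
  have hb : Bornology.IsBounded (f ⁻¹' M.face e) :=
    hf.antilipschitz.isBounded_preimage (M.face_polytope e).isBounded
  exact hb.measure_lt_top

theorem integrableOn_of_bounded {s : Set (Pt d)} {μ : Measure (Pt d)} {F : Pt d → ℝ}
    (hs : Bornology.IsBounded s) (hm : MeasurableSet s) (hμ : μ s < ⊤) (hF : Continuous F) :
    IntegrableOn F s μ := by
  obtain ⟨C, hC⟩ := (hs.isCompact_closure.bddAbove_image hF.norm.continuousOn)
  refine Measure.integrableOn_of_bounded (M := C) hμ.ne hF.aestronglyMeasurable ?_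
  refine (ae_restrict_iff' hm).2 (Eventually.of_forall fun x hx => ?_)
  exact hC ⟨x, subset_closure hx, rfl⟩

theorem PolytopalMesh.integrableOn_elem (i : Fin M.numElem) {F : Pt d → ℝ} (hF : Continuous F) :
    IntegrableOn F (M.elem i) :=
  integrableOn_of_bounded (M.elem_polytope i).isBounded (M.isOpen_elem i).measurableSet
    (M.elem_polytope i).isBounded.measure_lt_top hF

theorem PolytopalMesh.integrableOn_face (e : Fin M.numFace) {F : Pt d → ℝ} (hF : Continuous F) :
    IntegrableOn F (M.face e) μHE[d - 1] := by
  refine integrableOn_of_bounded (M.face_polytope e).isBounded ?_ (M.measure_face_lt_top e) hF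
  obtain ⟨U, hU, h⟩ := (M.face_polytope e).relOpen
  rw [h]
  exact hU.measurableSet.inter (M.plane e).closed_of_finiteDimensional.measurableSet

theorem eq_zero_of_val_eq_zero {s : Set (Pt d)} (hs : IsOpen s) (hne : s.Nonempty)
    {P : MvPolynomial (Fin d) ℝ} (h : ∀ x ∈ s, val P x = 0) : P = 0 := by
  obtain ⟨x, hx⟩ := hne
  have hs' : IsOpen {y : Fin d → ℝ | WithLp.toLp 2 y ∈ s} :=
    hs.preimage (PiLp.continuous_toLp 2 _)
  obtain ⟨ε, hε, hsub⟩ := Metric.isOpen_iff.1 hs' (fun l => x l) hx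
  refine MvPolynomial.funext_set (fun l => Metric.ball (x l) ε) (fun l => ?_) fun y hy => ?_
  · exact infinite_of_mem_nhds (x l) (Metric.ball_mem_nhds _ hε)
  · have : y ∈ Metric.ball (fun l => x l) ε := by
      rw [ball_pi _ hε]; exact hy
    simpa [val] using h _ (hsub this)

/-- The discrete weak gradient exists and is unique. -/
theorem existsUnique_discreteWeakGrad (i : Fin M.numElem) (r : ℕ) (P : MvPolynomial (Fin d) ℝ)
    (Q : Fin M.numFace → MvPolynomial (Fin d) ℝ) :
    ∃! G : Fin d → Poly d r, IsDiscreteWeakGrad M i P Q G := by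
  have hv := fun P : MvPolynomial (Fin d) ℝ => continuous_val P
  let B : (Fin d → Poly d r) →ₗ[ℝ] (Fin d → Poly d r) →ₗ[ℝ] ℝ :=
    LinearMap.mk₂ ℝ (fun G ψ => ∫ x in M.elem i, ∑ l, val (G l) x * val (ψ l) x)
      (fun G G' ψ => by
        rw [← integral_add (M.integrableOn_elem i (by fun_prop))
          (M.integrableOn_elem i (by fun_prop))]
        simp [val, add_mul, Finset.sum_add_distrib])
      (fun a G ψ => by
        rw [smul_eq_mul, ← integral_const_mul]
        simp [val, Finset.mul_sum, mul_assoc])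
      (fun G ψ ψ' => by
        rw [← integral_add (M.integrableOn_elem i (by fun_prop))
          (M.integrableOn_elem i (by fun_prop))]
        simp [val, mul_add, Finset.sum_add_distrib])
      (fun a G ψ => by
        rw [smul_eq_mul, ← integral_const_mul]
        simp [val, Finset.mul_sum, mul_left_comm])
  let ℓ : (Fin d → Poly d r) →ₗ[ℝ] ℝ :=
    { toFun := fun ψ =>
        -(∫ x in M.elem i, val P x * ∑ l, val (MvPolynomial.pderiv l (ψ l).1) x) +
          ∑ e ∈ M.facesOf i, ∫ x in M.face e,
            val (Q e) x * ∑ l, val (ψ l) x * M.normal i e l ∂μHE[d - 1]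
      map_add' := fun ψ ψ' => by
        rw [add_add_add_comm, ← neg_add, ← Finset.sum_add_distrib,
          ← integral_add (M.integrableOn_elem i (by fun_prop))
          (M.integrableOn_elem i (by fun_prop))]
        congr 1
        · simp [val, mul_add, Finset.sum_add_distrib]
        · refine Finset.sum_congr rfl fun e _ => ?_
          rw [← integral_add (M.integrableOn_face e (by fun_prop))
            (M.integrableOn_face e (by fun_prop))]
          simp [val, mul_add, add_mul, Finset.sum_add_distrib]
      map_smul' := fun a ψ => by
        rw [RingHom.id_apply, smul_eq_mul, mul_add, mul_neg, Finset.mul_sum,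
          ← integral_const_mul]
        congr 1
        · simp [val, Finset.mul_sum, mul_left_comm]
        · refine Finset.sum_congr rfl fun e _ => ?_
          rw [← integral_const_mul]
          simp [val, Finset.mul_sum, mul_left_comm, mul_assoc] }
  have hinj : Function.Injective B := by
    rw [← LinearMap.ker_eq_bot, LinearMap.ker_eq_bot']
    intro G hG
    have h0 : ∫ x in M.elem i, ∑ l, val (G l) x * val (G l) x = 0 := by
      have := congrArg (fun f => f G) hG
      simpa [B] using this
    have hnn : ∀ x : Pt d, 0 ≤ ∑ l, val (G l).1 x * val (G l).1 x := by
      intro x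
      exact Finset.sum_nonneg fun l _ => mul_self_nonneg (val (G l).1 x)
    rw [integral_eq_zero_iff_of_nonneg hnn (M.integrableOn_elem i (by fun_prop))] at h0
    have h1 := Measure.eqOn_open_of_ae_eq h0 (M.isOpen_elem i)
      (by fun_prop : Continuous _).continuousOn continuousOn_const
    funext l
    refine Subtype.ext (eq_zero_of_val_eq_zero (M.isOpen_elem i)
      (M.elem_polytope i).isConnected.nonempty fun x hx => ?_)
    have h2 := (Finset.sum_eq_zero_iff_of_nonneg fun l _ => mul_self_nonneg (val (G l) x)).1
      (h1 hx) l (Finset.mem_univ l)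
    exact mul_self_eq_zero.1 h2
  have hsurj : Function.Surjective B :=
    (LinearMap.injective_iff_surjective_of_finrank_eq_finrank
      (Subspace.dual_finrank_eq (K := ℝ) (V := Fin d → Poly d r)).symm).1 hinj
  obtain ⟨G, hG⟩ := hsurj ℓ
  refine ⟨G, fun ψ => congrArg (fun f => f ψ) hG, fun G' hG' => hinj ?_⟩
  rw [hG]
  ext1 ψ
  exact LinearMap.ext fun _ => hG' _

end WeakGradient

/-! ### The numerical scheme -/

section Scheme

variable {d : ℕ} {Ω : Set (Pt d)} (M : PolytopalMesh Ω)

/-- The discrete weak gradient `∇_{w,r,T} σ ∈ [P_r(T)]^d` on `T = elem i`. -/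
def weakGrad {j : ℕ} (r : ℕ) (σ : WeakFun M j) (i : Fin M.numElem) : Fin d → Poly d r :=
  (existsUnique_discreteWeakGrad M i r (σ.interior i).1 (fun e => (σ.boundary e).1)).choose

/-- The stabilizer `s(λ, σ)`; the coefficients `β`, `c` are piecewise constant and given by their
values on the elements. -/
def stab (β : Fin M.numElem → Pt d) (c : Fin M.numElem → ℝ) (p ρ τ : ℝ) {j : ℕ}
    (lam σ : WeakFun M j) : ℝ :=
  ∑ i, (ρ * M.hElem i ^ (1 - p) * ∑ e ∈ M.facesOf i, ∫ x in M.face e,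
      |val (lam.interior i) x - val (lam.boundary e) x| ^ (p - 1)
        * Real.sign (val (lam.interior i) x - val (lam.boundary e) x)
        * (val (σ.interior i) x - val (σ.boundary e) x) ∂μHE[d - 1]
    + τ * ∫ x in M.elem i,
      |transport (β i) (c i) (lam.interior i) x| ^ (p - 1)
        * Real.sign (transport (β i) (c i) (lam.interior i) x)
        * transport (β i) (c i) (σ.interior i) x)

/-- The form `b(v, σ) = ∑_T (v, β · ∇_w σ - c σ₀)_T` for `v ∈ M_{r,h}`, with the discrete weak
gradient taken in `[P_r(T)]^d`. -/
def bForm (β : Fin M.numElem → Pt d) (c : Fin M.numElem → ℝ) {r j : ℕ}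
    (v : PiecewisePoly M r) (σ : WeakFun M j) : ℝ :=
  ∑ i, ∫ x in M.elem i,
    val (v i) x * (∑ l, β i l * val (weakGrad M r σ i l) x - c i * val (σ.interior i) x)

/-- `∑_T (f, σ₀)_T`. -/
def loadPairing (f : Pt d → ℝ) {j : ℕ} (σ : WeakFun M j) : ℝ :=
  ∑ i, ∫ x in M.elem i, f x * val (σ.interior i) x

/-- `σ ∈ W_{j,h}^{0,Γ₊}`: the boundary part vanishes on the outflow boundary. -/
def VanishesOnOutflow (β : Fin M.numElem → Pt d) {j : ℕ} (σ : WeakFun M j) : Prop :=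
  ∀ e, M.IsOutflow β e → ∀ x ∈ M.face e, val (σ.boundary e) x = 0

/-- `(u_h; λ_h) ∈ M_{r,h} × W_{j,h}^{0,Γ₊}` solves the `L^p` primal-dual weak Galerkin scheme. -/
structure IsPDWGSolution (β : Fin M.numElem → Pt d) (c : Fin M.numElem → ℝ) (p ρ τ : ℝ)
    (f g : Pt d → ℝ) {r j : ℕ} (uh : PiecewisePoly M r) (lamh : WeakFun M j) : Prop where
  vanishes : VanishesOnOutflow M β lamh
  primal : ∀ σ : WeakFun M j, VanishesOnOutflow M β σ →
    stab M β c p ρ τ lamh σ + bForm M β c uh σ =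
      M.inflowPairing β g (fun e => val (σ.boundary e)) - loadPairing M f σ
  dual : ∀ v : PiecewisePoly M r, bForm M β c v lamh = 0

/-- The seminorm `|||σ||| = s(σ, σ)^{1/p}`. -/
def tripleNorm (β : Fin M.numElem → Pt d) (c : Fin M.numElem → ℝ) (p ρ τ : ℝ) {j : ℕ}
    (σ : WeakFun M j) : ℝ :=
  stab M β c p ρ τ σ σ ^ (1 / p)

/-- `u` is a weak solution of `∇ · (β u) + c u = f` in `Ω`, `u = g` on `Γ₋`:
`(u, β · ∇σ - c σ) = ⟨g, β · n σ⟩_{Γ₋} - (f, σ)` for all `C¹` functions `σ` vanishing on `Γ₊`.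
These `σ` belong to `W^{1,p}(Ω)` and vanish on `Γ₊`, so every solution in the sense of test
functions in `W^{1,p}` with zero trace on `Γ₊` is a solution in this sense. -/
def IsWeakSolution (β : Fin M.numElem → Pt d) (c : Fin M.numElem → ℝ) (f g u : Pt d → ℝ) : Prop :=
  ∀ σ : Pt d → ℝ, ContDiff ℝ 1 σ → (∀ e, M.IsOutflow β e → ∀ x ∈ M.face e, σ x = 0) →
    ∑ i, ∫ x in M.elem i, u x * (fderiv ℝ σ x (β i) - c i * σ x) =
      M.inflowPairing β g (fun _ => σ) - ∫ x in Ω, f x * σ x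

end Scheme

end LpPDWG

end

/-! The estimate rests on an error identity. Testing the primal equation with `lamh` removes `uh`,
since the dual equation gives b(uh, lamh) = 0. The data are then expressed through u, and b(v, lamh)
= 0 allows an arbitrary piecewise polynomial v to be subtracted from u. What remains
(`IsPDWGSolution.stab_eq`) is s(λ, λ) = Σ_T [ (u - v, Lλ₀)_T + Σ_e (β·n) ⟨u - v, λ_b - λ₀⟩_e ]. Take
v to be the elementwise L² projection of u. If j = k - 1, the volume term vanishes, because Lλ₀ has
degree at most k - 1; if j = k, the τ part of the stabilizer controls it. In the face term the trace
inequality costs h_T^(-1/q), which is the p-th root of the weight h_T^(1-p). With a_T the local part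
of s(λ, λ) and E_T the norm of ∇^k u near T, this gives Σ a_T ≤ L Σ h_T^k E_T a_T^(1/p); Hölder's
inequality for sums and a power q/p conclude. The coefficient c never enters the constants, since
Lλ₀ is always treated as a whole.

Expressing the data through u is not immediate: λ is discontinuous, while the weak formulation only
admits test functions that are C¹ on the whole space. The formulation is therefore localized. On
each element the transport equation holds almost everywhere, and on each face off the outflow
boundary the normal fluxes of the trace of u balance, or match g
(`PolytopalMesh.sum_face_eq_inflowPairing`). This uses the divergence theorem on nonconvex polytopes
(`PolytopalMesh.integral_elem_fderiv`): near interior points of faces the element is a half-space,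
and the lower-dimensional rest is cut off by functions whose gradients have size m on a set of
volume m⁻².

For the approximation, elements are only known to contain pyramids over their faces, so no Poincaré
inequality on them is used. Polynomials are instead fitted on larger patches of Ω, which satisfy one
with a constant of the right scaling because Ω is Lipschitz (`IsLipschitzDomain.exists_isPatch`,
`IsSobolevJet.exists_taylorPoly`). The number of patches through a point x is not estimated. It is
enough that their diameters sum to O(h), because the integral of |x - y|^(1-d) over a ball of radius
O(h) is O(h) (`PolytopalMesh.sum_hElem_le`), and because qk ≥ 1. -/

noncomputable section

namespace LpPDWG

/-! ### Hyperplanes -/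

section Hyperplane

variable {d : ℕ}

/-- Points in the coordinates given by the signed distance to the hyperplane through `x₀` with
normal `n` and the position along this hyperplane. -/
def hyperChart (n x₀ : Pt d) (p : ℝ × (ℝ ∙ n)ᗮ) : Pt d := x₀ + (p.2 : Pt d) + p.1 • n

theorem inner_hyperDir {n : Pt d} (y : (ℝ ∙ n)ᗮ) : ⟪(y : Pt d), n⟫_ℝ = 0 :=
  Submodule.mem_orthogonal_singleton_iff_inner_left.1 y.2

theorem inner_hyperChart {n : Pt d} (hn : ‖n‖ = 1) (x₀ : Pt d) (p : ℝ × (ℝ ∙ n)ᗮ) :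
    ⟪hyperChart n x₀ p - x₀, n⟫_ℝ = p.1 := by
  have : hyperChart n x₀ p - x₀ = p.2 + p.1 • n := by simp [hyperChart, add_assoc]
  rw [this, inner_add_left, inner_hyperDir, inner_smul_left, real_inner_self_eq_norm_sq, hn]
  simp

/-- The chart is the inverse of the orthogonal splitting along the line of `n`, composed with the
isometry between this line and ℝ; both preserve volume. It makes Fubini available across and along a
hyperplane. -/
theorem measurePreserving_hyperChart {n : Pt d} (hn : ‖n‖ = 1) (x₀ : Pt d) :
    MeasurePreserving (hyperChart n x₀) ∧ MeasurableEmbedding (hyperChart n x₀) := by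
  let e := (LinearIsometryEquiv.toSpanUnitSingleton (𝕜 := ℝ) n hn)
  have h1 := ((ℝ ∙ n).measurePreserving_measurableEquivProd x₀).symm
  rw [InnerProductSpace.euclideanHausdorffMeasure_eq_volume] at h1
  have h2 : MeasurePreserving (Prod.map e id : ℝ × (ℝ ∙ n)ᗮ → _) :=
    (e.measurePreserving).prod (MeasurePreserving.id volume)
  have h3 : hyperChart n x₀ = ((ℝ ∙ n).measurableEquivProd x₀).symm ∘ Prod.map e id := by
    funext p
    simp [hyperChart, e]
    abel
  refine ⟨h3 ▸ h1.comp h2, ?_⟩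
  rw [h3]
  refine (MeasurableEquiv.measurableEmbedding _).comp ?_
  exact (e.toHomeomorph.prodCongr (Homeomorph.refl _)).measurableEmbedding

/-- The hyperplane through `x₀` with normal `n`. -/
def hyperplane (n x₀ : Pt d) : Set (Pt d) := {x | ⟪x - x₀, n⟫_ℝ = 0}

theorem isClosed_hyperplane (n x₀ : Pt d) : IsClosed (hyperplane n x₀) :=
  isClosed_eq (by fun_prop) continuous_const

theorem range_hyperDir (n x₀ : Pt d) :
    range (fun y : (ℝ ∙ n)ᗮ => x₀ + (y : Pt d)) = hyperplane n x₀ := by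
  ext x
  constructor
  · rintro ⟨y, rfl⟩
    simp [hyperplane, inner_hyperDir]
  · intro hx
    exact ⟨⟨x - x₀, Submodule.mem_orthogonal_singleton_iff_inner_left.2 hx⟩, by simp⟩

theorem finrank_hyperDir {n : Pt d} (hn : ‖n‖ = 1) :
    Module.finrank ℝ (ℝ ∙ n)ᗮ = d - 1 := by
  have h := Submodule.finrank_add_finrank_orthogonal (ℝ ∙ n)
  rw [finrank_span_singleton (by rintro rfl; simp at hn)] at h
  simp at h
  omega

theorem measurableEmbedding_hyperDir (n x₀ : Pt d) :
    MeasurableEmbedding (fun y : (ℝ ∙ n)ᗮ => x₀ + (y : Pt d)) := by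
  have : Isometry (fun y : (ℝ ∙ n)ᗮ => x₀ + (y : Pt d)) :=
    fun a b => by simp [Subtype.edist_eq]
  exact this.isClosedEmbedding.measurableEmbedding

/-- The Euclidean normalization of the Hausdorff measure agrees with Lebesgue measure in its own
dimension and is invariant under isometries, so surface integrals over a hyperplane become Lebesgue
integrals over its direction space. -/
theorem map_hyperDir {n : Pt d} (hn : ‖n‖ = 1) (x₀ : Pt d) :
    (volume : Measure (ℝ ∙ n)ᗮ).map (fun y : (ℝ ∙ n)ᗮ => x₀ + (y : Pt d)) =
      μHE[d - 1].restrict (hyperplane n x₀) := by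
  have : Isometry (fun y : (ℝ ∙ n)ᗮ => x₀ + (y : Pt d)) :=
    fun a b => by simp [Subtype.edist_eq]
  rw [← range_hyperDir, ← this.map_euclideanHausdorffMeasure, ← finrank_hyperDir hn,
    InnerProductSpace.euclideanHausdorffMeasure_eq_volume]

theorem setIntegral_hyperplane {n : Pt d} (hn : ‖n‖ = 1) (x₀ : Pt d) (F : Pt d → ℝ) :
    ∫ x in hyperplane n x₀, F x ∂μHE[d - 1] = ∫ y : (ℝ ∙ n)ᗮ, F (x₀ + y) := by
  rw [← map_hyperDir hn, (measurableEmbedding_hyperDir n x₀).integral_map]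

theorem setLIntegral_subset_hyperplane {n : Pt d} (hn : ‖n‖ = 1) (x₀ : Pt d) {S : Set (Pt d)}
    (hS : S ⊆ hyperplane n x₀) (hm : MeasurableSet S) (F : Pt d → ENNReal) :
    ∫⁻ x in S, F x ∂μHE[d - 1] = ∫⁻ y in {y : (ℝ ∙ n)ᗮ | x₀ + (y : Pt d) ∈ S}, F (x₀ + y) := by
  have : μHE[d - 1].restrict S = (μHE[d - 1].restrict (hyperplane n x₀)).restrict S := by
    rw [Measure.restrict_restrict hm, inter_eq_self_of_subset_left hS]
  rw [this, ← map_hyperDir hn, (measurableEmbedding_hyperDir n x₀).restrict_map,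
    (measurableEmbedding_hyperDir n x₀).lintegral_map]
  rfl

/-- The divergence theorem in a half-space, for functions with compact support. -/
theorem integral_halfSpace_fderiv {n : Pt d} (hn : ‖n‖ = 1) (x₀ v : Pt d) {F : Pt d → ℝ}
    (hF : ContDiff ℝ 1 F) (hc : HasCompactSupport F) :
    ∫ x in {x | ⟪x - x₀, n⟫_ℝ < 0}, fderiv ℝ F x v =
      ⟪v, n⟫_ℝ * ∫ x in hyperplane n x₀, F x ∂μHE[d - 1] := by
  obtain ⟨hmp, hme⟩ := measurePreserving_hyperChart hn x₀
  have hpre : hyperChart n x₀ ⁻¹' {x | ⟪x - x₀, n⟫_ℝ < 0} = Iio 0 ×ˢ univ := by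
    ext p
    simp [inner_hyperChart hn]
  rw [← hmp.setIntegral_preimage_emb hme, hpre, setIntegral_hyperplane hn]
  -- The normal part of `v` is integrated along half-lines, where the fundamental theorem of
  -- calculus leaves the boundary value. The tangential part `w` integrates to zero on every
  -- parallel hyperplane.
  set w : Pt d := v - ⟪v, n⟫_ℝ • n with hw
  have hwm : w ∈ (ℝ ∙ n)ᗮ := by
    rw [Submodule.mem_orthogonal_singleton_iff_inner_left, hw, inner_sub_left, inner_smul_left,
      real_inner_self_eq_norm_sq, hn]
    simp
  have hint : ∀ u : Pt d, Integrable (fun p : ℝ × (ℝ ∙ n)ᗮ => fderiv ℝ F (hyperChart n x₀ p) u) :=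
    fun u => (hmp.integrable_comp_emb hme).2 
      (((hF.continuous_fderiv one_ne_zero).clm_apply continuous_const).integrable_of_hasCompactSupport
        (hc.fderiv_apply (𝕜 := ℝ) u))
  have hsplit : ∀ p : ℝ × (ℝ ∙ n)ᗮ, fderiv ℝ F (hyperChart n x₀ p) v =
      ⟪v, n⟫_ℝ * fderiv ℝ F (hyperChart n x₀ p) n + fderiv ℝ F (hyperChart n x₀ p) w := by
    intro p
    have : v = ⟪v, n⟫_ℝ • n + w := by rw [hw]; abel
    conv_lhs => rw [this]
    rw [map_add, map_smul, smul_eq_mul]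
  simp_rw [hsplit]
  rw [integral_add ((hint n).const_mul _).integrableOn (hint w).integrableOn,
    integral_const_mul]
  have hdiff : ∀ x, HasFDerivAt F (fderiv ℝ F x) x := fun x =>
    (hF.differentiable one_ne_zero x).hasFDerivAt
  have e1 : ∫ p in Iio (0 : ℝ) ×ˢ (univ : Set (ℝ ∙ n)ᗮ), fderiv ℝ F (hyperChart n x₀ p) n =
      ∫ y : (ℝ ∙ n)ᗮ, F (x₀ + y) := by
    rw [Measure.volume_eq_prod, ← Measure.prod_restrict, Measure.restrict_univ,
      integral_prod_symm]
    · refine integral_congr_ae (Eventually.of_forall fun y => ?_)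
      have hg : ContDiff ℝ 1 (fun s : ℝ => F (x₀ + (y : Pt d) + s • n)) :=
        hF.comp (by fun_prop)
      have hgc : HasCompactSupport (fun s : ℝ => F (x₀ + (y : Pt d) + s • n)) := by
        refine hc.comp_isClosedEmbedding (g := fun s : ℝ => x₀ + (y : Pt d) + s • n) ?_
        refine Isometry.isClosedEmbedding (Isometry.of_dist_eq fun a b => ?_)
        rw [dist_add_left, dist_eq_norm, ← sub_smul, norm_smul, hn, mul_one, dist_eq_norm]
      have := hgc.integral_Iic_deriv_eq hg 0
      rw [integral_Iic_eq_integral_Iio] at this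
      simp only [zero_smul, add_zero] at this
      simp only
      rw [← this]
      refine integral_congr_ae (Eventually.of_forall fun s => ?_)
      have h1 : HasDerivAt (fun s : ℝ => x₀ + (y : Pt d) + s • n) n s := by
        simpa using ((hasDerivAt_id s).smul_const n).const_add (x₀ + (y : Pt d))
      exact (((hdiff _).comp_hasDerivAt s h1).deriv).symm
    · rw [← Measure.restrict_univ (μ := (volume : Measure (ℝ ∙ n)ᗮ)), Measure.prod_restrict,
        ← Measure.volume_eq_prod]
      exact (hint n).integrableOn
  have e2 : ∫ p in Iio (0 : ℝ) ×ˢ (univ : Set (ℝ ∙ n)ᗮ), fderiv ℝ F (hyperChart n x₀ p) w = 0 := by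
    rw [Measure.volume_eq_prod, ← Measure.prod_restrict, Measure.restrict_univ, integral_prod]
    · refine integral_eq_zero_of_ae (Eventually.of_forall fun s => ?_)
      have hemb : Topology.IsClosedEmbedding (fun y : (ℝ ∙ n)ᗮ => x₀ + (y : Pt d) + s • n) :=
        Isometry.isClosedEmbedding fun a b => by simp [Subtype.edist_eq]
      have hg : ContDiff ℝ 1 (fun y : (ℝ ∙ n)ᗮ => F (x₀ + (y : Pt d) + s • n)) := by
        refine hF.comp ((contDiff_const.add ?_).add contDiff_const)
        exact ((ℝ ∙ n)ᗮ.subtypeL).contDiff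
      have hgc : HasCompactSupport (fun y : (ℝ ∙ n)ᗮ => F (x₀ + (y : Pt d) + s • n)) :=
        hc.comp_isClosedEmbedding hemb
      have hgf : ∀ y : (ℝ ∙ n)ᗮ, fderiv ℝ (fun y : (ℝ ∙ n)ᗮ => F (x₀ + (y : Pt d) + s • n)) y
          ⟨w, hwm⟩ = fderiv ℝ F (hyperChart n x₀ (s, y)) w := by
        intro y
        have h1 : HasFDerivAt (fun y : (ℝ ∙ n)ᗮ => x₀ + (y : Pt d) + s • n)
            ((ℝ ∙ n)ᗮ.subtypeL) y :=
          (((ℝ ∙ n)ᗮ.subtypeL.hasFDerivAt).const_add x₀).add_const _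
        have h2 := ((hdiff (x₀ + (y : Pt d) + s • n)).comp y h1).fderiv
        exact congrArg (fun A => A ⟨w, hwm⟩) h2
      have hi : Integrable (fun y : (ℝ ∙ n)ᗮ =>
          fderiv ℝ (fun y : (ℝ ∙ n)ᗮ => F (x₀ + (y : Pt d) + s • n)) y ⟨w, hwm⟩) :=
        ((hg.continuous_fderiv one_ne_zero).clm_apply
          continuous_const).integrable_of_hasCompactSupport (hgc.fderiv_apply (𝕜 := ℝ) _)
      -- Integration by parts against the constant function 1.
      have := integral_mul_fderiv_eq_neg_fderiv_mul_of_integrable (μ := volume)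
        (f := fun _ : (ℝ ∙ n)ᗮ => (1 : ℝ))
        (g := fun y : (ℝ ∙ n)ᗮ => F (x₀ + (y : Pt d) + s • n)) (v := ⟨w, hwm⟩) (by simp)
        (by simpa using hi)
        (by simpa using hg.continuous.integrable_of_hasCompactSupport hgc) (by simp)
        (fun y _ => hg.differentiable one_ne_zero y)
      simp only [one_mul, fderiv_fun_const, Pi.zero_apply, zero_apply, zero_mul, integral_zero,
        neg_zero] at this
      simp only [Pi.zero_apply]
      rw [← this]
      exact integral_congr_ae (Eventually.of_forall fun y => (hgf y).symm)
    · rw [← Measure.restrict_univ (μ := (volume : Measure (ℝ ∙ n)ᗮ)), Measure.prod_restrict,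
        ← Measure.volume_eq_prod]
      exact (hint w).integrableOn
  rw [e1, e2, add_zero]

theorem integral_fderiv_eq_zero {F : Pt d → ℝ} (hF : ContDiff ℝ 1 F) (hc : HasCompactSupport F)
    (v : Pt d) : ∫ x, fderiv ℝ F x v = 0 := by
  have hi : Integrable (fun x => fderiv ℝ F x v) :=
    ((hF.continuous_fderiv one_ne_zero).clm_apply
      continuous_const).integrable_of_hasCompactSupport (hc.fderiv_apply (𝕜 := ℝ) _)
  have := integral_mul_fderiv_eq_neg_fderiv_mul_of_integrable (μ := volume)
    (f := fun _ : Pt d => (1 : ℝ)) (g := F) (v := v) (by simp)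
    (by simpa using hi) (by simpa using hF.continuous.integrable_of_hasCompactSupport hc)
    (by simp) (fun y _ => hF.differentiable one_ne_zero y)
  simpa using this

end Hyperplane

end LpPDWG
end


noncomputable section

namespace LpPDWG

/-! ### Smooth partitions of unity on compact sets -/

/-- This glues local statements at the points of a compact set. The functions need to sum to one
only on `K`, so they can be smooth on the whole space. -/
theorem exists_partition_of_compact {d : ℕ} {K : Set (Pt d)} (hK : IsCompact K)
    (r : Pt d → ℝ) (hr : ∀ x ∈ K, 0 < r x) :
    ∃ (t : Finset (Pt d)) (ψ : Pt d → Pt d → ℝ), (∀ x ∈ t, x ∈ K) ∧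
      (∀ x ∈ t, ContDiff ℝ ∞ (ψ x) ∧ tsupport (ψ x) ⊆ Metric.ball x (r x)) ∧
      ∀ y ∈ K, ∑ x ∈ t, ψ x y = 1 := by
  obtain ⟨t, htK, hcov⟩ := hK.elim_nhds_subcover (fun x => Metric.ball x (r x))
    fun x hx => Metric.ball_mem_nhds x (hr x hx)
  obtain ⟨f, hf⟩ := SmoothPartitionOfUnity.exists_isSubordinate (modelWithCornersSelf ℝ (Pt d))
    hK.isClosed (fun x : t => Metric.ball (x : Pt d) (r x)) (fun _ => Metric.isOpen_ball)
    (hcov.trans (by simp [iUnion_subtype]))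
  classical
  refine ⟨t, fun x => if h : x ∈ t then f ⟨x, h⟩ else 0, htK, fun x hx => ?_, fun y hy => ?_⟩
  · simp only [hx, dif_pos]
    exact ⟨(f ⟨x, hx⟩).contMDiff.contDiff, hf ⟨x, hx⟩⟩
  · have := f.sum_eq_one hy
    rw [finsum_eq_sum_of_fintype] at this
    rw [← this, ← Finset.sum_coe_sort]
    refine Finset.sum_congr rfl fun x _ => ?_
    simp

/-! ### Codimension-two subspaces -/

section Codim

variable {d : ℕ}

/-- The subspace through `a` orthogonal to `n₁` and `n₂`. -/
def codimTwo (a n₁ n₂ : Pt d) : Set (Pt d) := {x | ⟪x - a, n₁⟫_ℝ = 0 ∧ ⟪x - a, n₂⟫_ℝ = 0}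

/-- In an orthonormal basis beginning with `n₁`, `n₂` the set lies in a box with two sides 2ε and
all others 2R. The factor ε² beats the gradient 1/ε of a cutoff, which is why sets of codimension
two are invisible to the divergence theorem. -/
theorem volume_slab_le (a n₁ n₂ : Pt d) (h₁ : ‖n₁‖ = 1) (h₂ : ‖n₂‖ = 1) (h₁₂ : ⟪n₁, n₂⟫_ℝ = 0)
    (R : ℝ) (hR : 0 ≤ R) : ∃ C : ℝ, 0 ≤ C ∧ ∀ ε : ℝ, 0 ≤ ε →
      volume {x | ‖x - a‖ ≤ R ∧ |⟪x - a, n₁⟫_ℝ| ≤ ε ∧ |⟪x - a, n₂⟫_ℝ| ≤ ε}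
        ≤ ENNReal.ofReal (C * ε ^ 2) := by
  have hli : Orthonormal ℝ ![n₁, n₂] := by
    rw [orthonormal_iff_ite]
    intro i j
    fin_cases i <;> fin_cases j <;> simp [h₁, h₂, h₁₂, real_inner_comm]
  have hcard : 2 ≤ d := by
    have := hli.linearIndependent.fintype_card_le_finrank
    simpa using this
  obtain ⟨m, rfl⟩ := Nat.exists_eq_add_of_le' hcard
  let v : Fin (m + 2) → Pt (m + 2) := fun i => if i = 0 then n₁ else n₂
  have hv : Orthonormal ℝ (({0, 1} : Set (Fin (m + 2))).domRestrict v) := by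
    rw [orthonormal_iff_ite]
    rintro ⟨i, hi⟩ ⟨j, hj⟩
    have h10 : (1 : Fin (m + 2)) ≠ 0 := by simp
    rcases hi with rfl | rfl <;> rcases hj with rfl | rfl <;>
      simp [v, h₁, h₂, h₁₂, real_inner_comm, Set.domRestrict, Subtype.ext_iff]
  obtain ⟨b, hb⟩ := hv.exists_orthonormalBasis_extension_of_card_eq (by simp)
  have hb0 : b 0 = n₁ := by simpa [v] using hb 0 (by simp)
  have hb1 : b 1 = n₂ := by simpa [v] using hb 1 (by simp)
  refine ⟨4 * (2 * R) ^ m, by positivity, fun ε hε => ?_⟩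
  let ℓ : Fin (m + 2) → ℝ := Fin.cons ε (Fin.cons ε fun _ => R)
  have hsub : {x | ‖x - a‖ ≤ R ∧ |⟪x - a, n₁⟫_ℝ| ≤ ε ∧ |⟪x - a, n₂⟫_ℝ| ≤ ε} ⊆
      (fun x => WithLp.ofLp (b.repr (x - a))) ⁻¹' (Set.pi univ fun i => Icc (-ℓ i) (ℓ i)) := by
    rintro x ⟨hx, hx1, hx2⟩ i -
    refine mem_Icc.2 (abs_le.1 ?_)
    change |b.repr (x - a) i| ≤ ℓ i
    rw [b.repr_apply_apply, real_inner_comm]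
    refine Fin.cases ?_ (fun i => Fin.cases ?_ (fun i => ?_) i) i
    · rw [hb0]; exact hx1
    · simpa [hb1, ℓ] using hx2
    · simp only [ℓ, Fin.cons_succ]
      refine (abs_real_inner_le_norm _ _).trans ?_
      rw [b.norm_eq_one, mul_one]
      exact hx
  have hmp : MeasurePreserving (fun x => WithLp.ofLp (b.repr (x - a))) volume
      (volume : Measure (Fin (m + 2) → ℝ)) :=
    (PiLp.volume_preserving_ofLp (Fin (m + 2))).comp
      (b.measurePreserving_repr.comp (measurePreserving_sub_right volume a))
  have hpim : MeasurableSet (Set.pi univ fun i => Icc (-ℓ i) (ℓ i)) :=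
    MeasurableSet.univ_pi fun i => measurableSet_Icc
  refine (measure_mono hsub).trans ?_
  rw [hmp.measure_preimage hpim.nullMeasurableSet, volume_pi_pi, Fin.prod_univ_succ,
    Fin.prod_univ_succ]
  simp only [ℓ, Fin.cons_zero, Fin.cons_succ, Real.volume_Icc, sub_neg_eq_add, Finset.prod_const,
    Finset.card_univ, Fintype.card_fin]
  rw [← ENNReal.ofReal_pow (by positivity), ← ENNReal.ofReal_mul (by positivity),
    ← ENNReal.ofReal_mul (by positivity)]
  exact ENNReal.ofReal_le_ofReal (le_of_eq (by ring))

/-- Two orthogonal unit vectors cannot both be parallel to `n`; the equation of one that is not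
parallel cuts out a proper affine subspace of the hyperplane. -/
theorem measure_codimTwo_inter_hyperplane (a n₁ n₂ : Pt d) (h₁ : ‖n₁‖ = 1) (h₂ : ‖n₂‖ = 1)
    (h₁₂ : ⟪n₁, n₂⟫_ℝ = 0) {n : Pt d} (hn : ‖n‖ = 1) (x₀ : Pt d) :
    μHE[d - 1] (codimTwo a n₁ n₂ ∩ hyperplane n x₀) = 0 := by
  have hcl : IsClosed (codimTwo a n₁ n₂) :=
    (isClosed_eq (by fun_prop) continuous_const).inter (isClosed_eq (by fun_prop) continuous_const)
  rw [← Measure.restrict_apply hcl.measurableSet, ← map_hyperDir hn,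
    (measurableEmbedding_hyperDir n x₀).map_apply]
  have key : ∀ w : Pt d, w ∉ (ℝ ∙ n) → ∀ c : ℝ,
      volume {y : (ℝ ∙ n)ᗮ | ⟪x₀ + (y : Pt d) - a, w⟫_ℝ = 0} = 0 := by
    intro w hw c
    let f : (ℝ ∙ n)ᗮ →ₗ[ℝ] ℝ := (innerₗ (Pt d) w).comp (ℝ ∙ n)ᗮ.subtype
    have hset : {y : (ℝ ∙ n)ᗮ | ⟪x₀ + (y : Pt d) - a, w⟫_ℝ = 0} =
        ((AffineSubspace.mk' (-⟪x₀ - a, w⟫_ℝ) ⊥).comap f.toAffineMap : Set (ℝ ∙ n)ᗮ) := by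
      ext y
      have h1 : ⟪x₀ + (y : Pt d) - a, w⟫_ℝ = ⟪x₀ - a, w⟫_ℝ + ⟪w, (y : Pt d)⟫_ℝ := by
        rw [real_inner_comm _ w, ← inner_add_left]; congr 1; abel
      simp only [mem_ofPred_eq, h1, AffineSubspace.coe_comap, mem_preimage, SetLike.mem_coe,
        AffineSubspace.mem_mk', vsub_eq_sub, Submodule.mem_bot, f, LinearMap.coe_toAffineMap,
        LinearMap.comp_apply, innerₗ_apply_apply, Submodule.subtype_apply, sub_neg_eq_add]
      rw [add_comm]
    rw [hset]
    refine Measure.addHaar_affineSubspace _ _ fun htop => hw ?_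
    rw [← Submodule.orthogonal_orthogonal (ℝ ∙ n), Submodule.mem_orthogonal]
    have hall : ∀ y : (ℝ ∙ n)ᗮ, ⟪x₀ + (y : Pt d) - a, w⟫_ℝ = 0 := by
      intro y
      have : y ∈ {y : (ℝ ∙ n)ᗮ | ⟪x₀ + (y : Pt d) - a, w⟫_ℝ = 0} := by
        rw [hset, htop]; trivial
      exact this
    intro y hy
    have e1 := hall ⟨y, hy⟩
    have e2 := hall 0
    have : y = (x₀ + y - a) - (x₀ + 0 - a) := by abel
    rw [this, inner_sub_left, e1, sub_eq_zero]
    exact e2.symm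
  by_cases hw1 : n₁ ∈ (ℝ ∙ n)
  · refine measure_mono_null (fun y hy => hy.2) (key n₂ (fun hw2 => ?_) 0)
    obtain ⟨s, rfl⟩ := Submodule.mem_span_singleton.1 hw1
    obtain ⟨t, rfl⟩ := Submodule.mem_span_singleton.1 hw2
    rw [inner_smul_left, inner_smul_right, real_inner_self_eq_norm_sq, hn] at h₁₂
    simp only [conj_trivial, one_pow, mul_one, mul_eq_zero] at h₁₂
    rcases h₁₂ with rfl | rfl
    · simp at h₁
    · simp at h₂
  · exact measure_mono_null (fun y hy => hy.1) (key n₁ hw1 0)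

/-- An affine subspace strictly contained in a hyperplane is contained in a subspace of
codimension two. -/
theorem exists_subset_codimTwo {A H : AffineSubspace ℝ (Pt d)}
    (hA : Module.finrank ℝ A.direction + 1 = d) (hH : H < A) :
    (H : Set (Pt d)) = ∅ ∨ ∃ a n₁ n₂ : Pt d, ‖n₁‖ = 1 ∧ ‖n₂‖ = 1 ∧ ⟪n₁, n₂⟫_ℝ = 0 ∧
      (H : Set (Pt d)) ⊆ codimTwo a n₁ n₂ := by
  rcases (H : Set (Pt d)).eq_empty_or_nonempty with h | ⟨a, ha⟩
  · exact Or.inl h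
  refine Or.inr ?_
  have hlt : Module.finrank ℝ H.direction < Module.finrank ℝ A.direction :=
    Submodule.finrank_lt_finrank_of_lt (AffineSubspace.direction_lt_of_nonempty hH ⟨a, ha⟩)
  have hsum := Submodule.finrank_add_finrank_orthogonal H.direction
  simp only [finrank_euclideanSpace, Fintype.card_fin] at hsum
  let b := stdOrthonormalBasis ℝ H.directionᗮ
  let i0 : Fin (Module.finrank ℝ H.directionᗮ) := ⟨0, by omega⟩
  let i1 : Fin (Module.finrank ℝ H.directionᗮ) := ⟨1, by omega⟩
  have hne : i0 ≠ i1 := by simp [i0, i1]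
  refine ⟨a, b i0, b i1, b.norm_eq_one i0, b.norm_eq_one i1, ?_, fun x hx => ⟨?_, ?_⟩⟩
  · exact b.orthonormal.2 hne
  · exact Submodule.inner_right_of_mem_orthogonal
      (AffineSubspace.vsub_mem_direction hx ha) (b i0).2
  · exact Submodule.inner_right_of_mem_orthogonal
      (AffineSubspace.vsub_mem_direction hx ha) (b i1).2

end Codim

/-! ### Geometry of the faces -/

namespace PolytopalMesh

variable {d : ℕ} {Ω : Set (Pt d)} (M : PolytopalMesh Ω)

/-- Orthogonality of the normal gives one inclusion of directions, and the dimensions agree. -/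
theorem plane_eq_hyperplane {i : Fin M.numElem} {e : Fin M.numFace} (he : e ∈ M.facesOf i)
    {x : Pt d} (hx : x ∈ M.face e) : (M.plane e : Set (Pt d)) = hyperplane (M.normal i e) x := by
  have hn := M.normal_norm i e he
  have hxp := (M.face_polytope e).subset hx
  have hle : (M.plane e).direction ≤ (ℝ ∙ M.normal i e)ᗮ := by
    intro y hy
    rw [Submodule.mem_orthogonal_singleton_iff_inner_left]
    exact Submodule.inner_right_of_mem_orthogonal hy (M.normal_orth i e he)
  have heq : (M.plane e).direction = (ℝ ∙ M.normal i e)ᗮ := by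
    refine Submodule.eq_of_le_of_finrank_eq hle ?_
    have := M.plane_finrank e
    rw [finrank_hyperDir hn]
    omega
  ext y
  rw [SetLike.mem_coe, ← AffineSubspace.vsub_right_mem_direction_iff_mem hxp, heq,
    Submodule.mem_orthogonal_singleton_iff_inner_left]
  rfl

theorem face_subset_hyperplane {i : Fin M.numElem} {e : Fin M.numFace} (he : e ∈ M.facesOf i)
    {x : Pt d} (hx : x ∈ M.face e) : M.face e ⊆ hyperplane (M.normal i e) x := by
  rw [← M.plane_eq_hyperplane he hx]
  exact (M.face_polytope e).subset

theorem measurableSet_face (e : Fin M.numFace) : MeasurableSet (M.face e) := by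
  obtain ⟨U, hU, h⟩ := (M.face_polytope e).relOpen
  rw [h]
  exact hU.measurableSet.inter (M.plane e).closed_of_finiteDimensional.measurableSet

theorem face_nonempty (e : Fin M.numFace) : (M.face e).Nonempty :=
  (M.face_polytope e).isConnected.nonempty

theorem face_subset_frontier {i : Fin M.numElem} {e : Fin M.numFace} (he : e ∈ M.facesOf i) :
    M.face e ⊆ frontier (M.elem i) := by
  rw [M.frontier_elem i]
  exact subset_closure.trans (subset_biUnion_of_mem (u := fun e => closure (M.face e)) he)

/-- Near a point of a face of an element, the element is a half-space, the face is its boundary, and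
there is no other face of this element. -/
theorem exists_ball_face {i : Fin M.numElem} {e : Fin M.numFace} (he : e ∈ M.facesOf i)
    {x : Pt d} (hx : x ∈ M.face e) : ∃ r > 0,
      M.elem i ∩ Metric.ball x r = {y | ⟪y - x, M.normal i e⟫_ℝ < 0} ∩ Metric.ball x r ∧
      M.face e ∩ Metric.ball x r = hyperplane (M.normal i e) x ∩ Metric.ball x r ∧
      ∀ e' ∈ M.facesOf i, e' ≠ e → Disjoint (M.face e') (Metric.ball x r) := by
  obtain ⟨r₁, hr₁, h₁⟩ := M.normal_outward i e he x hx
  obtain ⟨U, hU, hUe⟩ := (M.face_polytope e).relOpen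
  obtain ⟨r₂, hr₂, h₂⟩ := Metric.isOpen_iff.1 hU x (hUe ▸ hx).1
  have hpl := M.plane_eq_hyperplane he hx
  have hface : ∀ y ∈ hyperplane (M.normal i e) x, y ∈ Metric.ball x r₂ → y ∈ M.face e := by
    intro y hy hyb
    rw [hUe]
    exact ⟨h₂ hyb, by rw [hpl]; exact hy⟩
  refine ⟨min r₁ r₂, lt_min hr₁ hr₂, ?_, ?_, ?_⟩
  · have : Metric.ball x (min r₁ r₂) = Metric.ball x r₁ ∩ Metric.ball x (min r₁ r₂) :=
      (inter_eq_self_of_subset_right (Metric.ball_subset_ball (min_le_left _ _))).symm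
    rw [this, ← inter_assoc, h₁, inter_assoc]
  · refine Subset.antisymm (inter_subset_inter_left _ (M.face_subset_hyperplane he hx)) ?_
    rintro y ⟨hy, hyb⟩
    exact ⟨hface y hy (Metric.ball_subset_ball (min_le_right _ _) hyb), hyb⟩
  · intro e' he' hne
    rw [Set.disjoint_left]
    intro y hy hyb
    have hyf : y ∈ frontier (M.elem i) := M.face_subset_frontier he' hy
    have hyb₁ : y ∈ Metric.ball x r₁ := Metric.ball_subset_ball (min_le_left _ _) hyb
    -- A point of another face is a frontier point of the element. It lies neither in the half-space
    -- filled by the element nor in the opposite open half-space, which the element misses. So it is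
    -- on the hyperplane and hence on `e`, against disjointness of the faces.
    have hyh : y ∈ hyperplane (M.normal i e) x := by
      rcases lt_trichotomy ⟪y - x, M.normal i e⟫_ℝ 0 with h | h | h
      · have : y ∈ M.elem i ∩ Metric.ball x r₁ := by rw [h₁]; exact ⟨h, hyb₁⟩
        exact absurd this.1 (by
          have := hyf.2
          rwa [(M.isOpen_elem i).interior_eq] at this)
      · exact h
      · have hopen : IsOpen ({y | 0 < ⟪y - x, M.normal i e⟫_ℝ} ∩ Metric.ball x r₁) :=
          (isOpen_lt continuous_const (by fun_prop)).inter Metric.isOpen_ball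
        obtain ⟨z, ⟨hz, hzb⟩, hze⟩ := mem_closure_iff.1 hyf.1 _ hopen ⟨h, hyb₁⟩
        have : z ∈ M.elem i ∩ Metric.ball x r₁ := ⟨hze, hzb⟩
        rw [h₁] at this
        exact absurd (show ⟪z - x, M.normal i e⟫_ℝ < 0 from this.1) (not_lt.2 (le_of_lt hz))
    exact Set.disjoint_left.1 (M.face_disjoint e' e hne) hy
      (hface y hyh (Metric.ball_subset_ball (min_le_right _ _) hyb))

theorem plane_ne_top (e : Fin M.numFace) : M.plane e ≠ ⊤ := by
  intro h
  have := M.plane_finrank e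
  rw [h, AffineSubspace.direction_top, finrank_top] at this
  simp at this

theorem closure_face_subset_plane (e : Fin M.numFace) : closure (M.face e) ⊆ M.plane e :=
  closure_minimal (M.face_polytope e).subset (M.plane e).closed_of_finiteDimensional

theorem volume_frontier_elem (i : Fin M.numElem) : volume (frontier (M.elem i)) = 0 := by
  rw [M.frontier_elem i]
  exact (measure_biUnion_null_iff (M.facesOf i).countable_toSet).2 fun e _ => measure_mono_null (M.closure_face_subset_plane e)
    (Measure.addHaar_affineSubspace _ _ (M.plane_ne_top e))

end PolytopalMesh

end LpPDWG
end


noncomputable section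

namespace LpPDWG

/-! ### The divergence theorem on the elements of a mesh -/

namespace PolytopalMesh

variable {d : ℕ} {Ω : Set (Pt d)} (M : PolytopalMesh Ω)

/-- The difference of the two sides of the divergence theorem for `F • v`. -/
def divDefect (i : Fin M.numElem) (v : Pt d) (F : Pt d → ℝ) : ℝ :=
  (∫ x in M.elem i, fderiv ℝ F x v) -
    ∑ e ∈ M.facesOf i, ∫ x in M.face e, F x * ⟪v, M.normal i e⟫_ℝ ∂μHE[d - 1]

variable {M}

theorem continuous_fderiv_apply {F : Pt d → ℝ} (hF : ContDiff ℝ 1 F) (v : Pt d) :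
    Continuous (fun x => fderiv ℝ F x v) :=
  (hF.continuous_fderiv one_ne_zero).clm_apply continuous_const

theorem divDefect_sum {ι : Type*} (i : Fin M.numElem) (v : Pt d) (t : Finset ι)
    {F : ι → Pt d → ℝ} (hF : ∀ l ∈ t, ContDiff ℝ 1 (F l)) :
    M.divDefect i v (fun x => ∑ l ∈ t, F l x) = ∑ l ∈ t, M.divDefect i v (F l) := by
  simp only [divDefect, Finset.sum_sub_distrib]
  congr 1
  · rw [← integral_finsetSum t fun l hl =>
      M.integrableOn_elem i (continuous_fderiv_apply (hF l hl) v)]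
    refine integral_congr_ae (Eventually.of_forall fun x => ?_)
    simp only
    rw [fderiv_fun_sum fun l hl => (hF l hl).differentiable one_ne_zero x]
    simp
  · rw [Finset.sum_comm]
    refine Finset.sum_congr rfl fun e _ => ?_
    simp only [Finset.sum_mul]
    exact integral_finsetSum t fun l hl => M.integrableOn_face e
      ((hF l hl).continuous.mul continuous_const)

/-- Both integrals see only the closure of the element, because derivatives at points of the open
element depend on values there alone. A partition of unity on this compact closure therefore
suffices. -/
theorem divDefect_congr {i : Fin M.numElem} {v : Pt d} {F G : Pt d → ℝ}
    (h : ∀ x ∈ closure (M.elem i), F x = G x) : M.divDefect i v F = M.divDefect i v G := by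
  simp only [divDefect]
  congr 1
  · refine setIntegral_congr_fun (M.isOpen_elem i).measurableSet fun x hx => ?_
    have : F =ᶠ[𝓝 x] G := by
      filter_upwards [(M.isOpen_elem i).mem_nhds hx] with y hy using h y (subset_closure hy)
    rw [this.fderiv_eq]
  · refine Finset.sum_congr rfl fun e he => setIntegral_congr_fun (M.measurableSet_face e)
      fun x hx => ?_
    rw [h x (M.face_subset_frontier he hx).1]

theorem setIntegral_eq_of_inter_eq {μ : Measure (Pt d)} {S S' U : Set (Pt d)} {G : Pt d → ℝ}
    (hS : MeasurableSet S) (hS' : MeasurableSet S') (h : S ∩ U = S' ∩ U)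
    (hG : ∀ y ∉ U, G y = 0) : ∫ y in S, G y ∂μ = ∫ y in S', G y ∂μ := by
  have key : ∀ {A : Set (Pt d)}, MeasurableSet A → ∫ y in A ∩ U, G y ∂μ = ∫ y in A, G y ∂μ :=
    fun hA => (setIntegral_eq_of_subset_of_forall_sdiff_eq_zero hA inter_subset_left
      fun y hy => hG y fun hy' => hy.2 ⟨hy.1, hy'⟩).symm
  rw [← key hS, h, key hS']

/-- Near an interior point all terms vanish, since a derivative of a compactly supported function
integrates to zero. Near a point of a face the element is a half-space and no other face of it is
met, so the half-space formula applies. -/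
theorem exists_ball_divDefect (i : Fin M.numElem) (v : Pt d) {x : Pt d}
    (hx : x ∈ M.elem i ∨ ∃ e ∈ M.facesOf i, x ∈ M.face e) :
    ∃ r > 0, ∀ F : Pt d → ℝ, ContDiff ℝ 1 F → tsupport F ⊆ Metric.ball x r →
      M.divDefect i v F = 0 := by
  have hsupp : ∀ {r : ℝ} {F : Pt d → ℝ}, tsupport F ⊆ Metric.ball x r → HasCompactSupport F :=
    fun h => HasCompactSupport.of_support_subset_isCompact (isCompact_closedBall x _)
      (subset_tsupport _ |>.trans (h.trans Metric.ball_subset_closedBall))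
  have hz : ∀ {r : ℝ} {F : Pt d → ℝ}, tsupport F ⊆ Metric.ball x r → ∀ y ∉ Metric.ball x r,
      F y = 0 := fun h y hy => image_eq_zero_of_notMem_tsupport fun hy' => hy (h hy')
  have hz' : ∀ {r : ℝ} {F : Pt d → ℝ}, tsupport F ⊆ Metric.ball x r → ∀ y ∉ Metric.ball x r,
      fderiv ℝ F y v = 0 := by
    intro r F h y hy
    rw [fderiv_of_notMem_tsupport (𝕜 := ℝ) fun hy' => hy (h hy')]; rfl
  rcases hx with hx | ⟨e, he, hx⟩
  · obtain ⟨r, hr, hsub⟩ := Metric.isOpen_iff.1 (M.isOpen_elem i) x hx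
    refine ⟨r, hr, fun F hF hs => ?_⟩
    rw [divDefect, setIntegral_eq_integral_of_forall_compl_eq_zero
      fun y hy => hz' hs y fun hy' => hy (hsub hy'),
      integral_fderiv_eq_zero hF (hsupp hs), Finset.sum_eq_zero, sub_zero]
    intro e he
    refine setIntegral_eq_zero_of_forall_eq_zero fun y hy => ?_
    rw [hz hs y fun hy' => ?_, zero_mul]
    have := (M.face_subset_frontier he hy).2
    rw [(M.isOpen_elem i).interior_eq] at this
    exact this (hsub hy')
  · obtain ⟨r, hr, h1, h2, h3⟩ := M.exists_ball_face he hx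
    refine ⟨r, hr, fun F hF hs => ?_⟩
    have hn := M.normal_norm i e he
    have e1 : ∫ y in M.elem i, fderiv ℝ F y v =
        ∫ y in {y | ⟪y - x, M.normal i e⟫_ℝ < 0}, fderiv ℝ F y v := by
      exact setIntegral_eq_of_inter_eq (M.isOpen_elem i).measurableSet
        (isOpen_lt (by fun_prop) continuous_const).measurableSet h1 (hz' hs)
    have e2 : ∫ y in M.face e, F y ∂μHE[d - 1] =
        ∫ y in hyperplane (M.normal i e) x, F y ∂μHE[d - 1] := by
      exact setIntegral_eq_of_inter_eq (M.measurableSet_face e)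
        (isClosed_hyperplane _ _).measurableSet h2 (hz hs)
    rw [divDefect, e1, integral_halfSpace_fderiv hn x v hF (hsupp hs),
      Finset.sum_eq_single_of_mem e he, integral_mul_const, e2, mul_comm, sub_self]
    intro e' he' hne
    refine setIntegral_eq_zero_of_forall_eq_zero fun y hy => ?_
    rw [hz hs y (Set.disjoint_left.1 (h3 e' he' hne) hy), zero_mul]

/-- When the support avoids the relative boundaries of the faces, every point of the closed element
in the support is of one of the two local types, and a partition of unity adds up the local
statements. -/
theorem divDefect_eq_zero_of_disjoint (i : Fin M.numElem) (v : Pt d) {F : Pt d → ℝ}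
    (hF : ContDiff ℝ 1 F)
    (h : ∀ e ∈ M.facesOf i, Disjoint (tsupport F) (closure (M.face e) \ M.face e)) :
    M.divDefect i v F = 0 := by
  have hK : IsCompact (closure (M.elem i) ∩ tsupport F) :=
    (M.elem_polytope i).isBounded.isCompact_closure.inter_right (isClosed_tsupport F)
  have hpt : ∀ x ∈ closure (M.elem i) ∩ tsupport F,
      x ∈ M.elem i ∨ ∃ e ∈ M.facesOf i, x ∈ M.face e := by
    rintro x ⟨hx, hxs⟩
    by_cases hxi : x ∈ M.elem i
    · exact Or.inl hxi
    have : x ∈ frontier (M.elem i) := ⟨hx, by rwa [(M.isOpen_elem i).interior_eq]⟩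
    rw [M.frontier_elem i] at this
    obtain ⟨e, he, hxe⟩ := mem_iUnion₂.1 this
    refine Or.inr ⟨e, he, ?_⟩
    by_contra hxf
    exact Set.disjoint_left.1 (h e he) hxs ⟨hxe, hxf⟩
  choose! r hr hloc using fun x hx => exists_ball_divDefect i v (hpt x hx)
  obtain ⟨t, ψ, htK, hψ, hsum⟩ := exists_partition_of_compact hK r hr
  have hc : ∀ x ∈ t, ContDiff ℝ 1 (fun y => ψ x y * F y) := fun x hx =>
    ((hψ x hx).1.of_le (by norm_cast)).mul hF
  have : M.divDefect i v F = M.divDefect i v (fun y => ∑ x ∈ t, ψ x y * F y) := by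
    refine divDefect_congr fun y hy => ?_
    rw [← Finset.sum_mul]
    by_cases hys : y ∈ tsupport F
    · rw [hsum y ⟨hy, hys⟩, one_mul]
    · rw [image_eq_zero_of_notMem_tsupport hys, mul_zero]
  rw [this, divDefect_sum i v t hc]
  exact Finset.sum_eq_zero fun x hx => hloc x (htK x hx) _ (hc x hx)
    ((tsupport_mul_subset_left).trans (hψ x hx).2)

/-- A function of `x` that vanishes near `codimTwo a n₁ n₂` and is `1` away from it. -/
def codimCutoff (a n₁ n₂ : Pt d) (m : ℝ) (x : Pt d) : ℝ :=
  Real.smoothTransition ((⟪x - a, n₁⟫_ℝ ^ 2 + ⟪x - a, n₂⟫_ℝ ^ 2) * m ^ 2 - 1)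

theorem contDiff_codimCutoff (a n₁ n₂ : Pt d) (m : ℝ) : ContDiff ℝ ∞ (codimCutoff a n₁ n₂ m) := by
  refine Real.smoothTransition.contDiff.comp ?_
  have h : ∀ n : Pt d, ContDiff ℝ ∞ (fun x : Pt d => ⟪x - a, n⟫_ℝ) := fun n =>
    (contDiff_id.sub contDiff_const).inner ℝ contDiff_const
  exact ((((h n₁).pow 2).add ((h n₂).pow 2)).mul contDiff_const).sub contDiff_const

/-- The transition function is constant on both sides of [0, 1]. -/
theorem exists_deriv_smoothTransition_bound : ∃ C : ℝ, 0 ≤ C ∧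
    ∀ s, |deriv Real.smoothTransition s| ≤ C ∧ (deriv Real.smoothTransition s ≠ 0 → s ≤ 1) := by
  have hcont : Continuous (deriv Real.smoothTransition) :=
    (Real.smoothTransition.contDiff (n := 1)).continuous_deriv le_rfl
  have h1 : ∀ s, 1 < s → deriv Real.smoothTransition s = 0 := by
    intro s hs
    have : Real.smoothTransition =ᶠ[𝓝 s] fun _ => 1 := by
      filter_upwards [lt_mem_nhds hs] with t ht using Real.smoothTransition.one_of_one_le ht.le
    rw [this.deriv_eq, deriv_const]
  have h0 : ∀ s, s < 0 → deriv Real.smoothTransition s = 0 := by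
    intro s hs
    have : Real.smoothTransition =ᶠ[𝓝 s] fun _ => 0 := by
      filter_upwards [gt_mem_nhds hs] with t ht using Real.smoothTransition.zero_of_nonpos ht.le
    rw [this.deriv_eq, deriv_const]
  obtain ⟨C, hC⟩ := isCompact_Icc.exists_bound_of_continuousOn (s := Icc (0 : ℝ) 1)
    hcont.continuousOn
  refine ⟨max C 0, le_max_right _ _, fun s => ⟨?_, fun h => not_lt.1 fun hs => h (h1 s hs)⟩⟩
  by_cases hs : s ∈ Icc (0 : ℝ) 1
  · exact (hC s hs).trans (le_max_left _ _)
  · rw [mem_Icc, not_and_or, not_le, not_le] at hs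
    rw [hs.elim (h0 s) (h1 s), abs_zero]
    exact le_max_right _ _

/-- The derivative vanishes unless the squared distance times m² is at most 2. On that set the inner
products are at most 2/m, and the inner derivative is m² times such quantities, hence O(m). -/
theorem exists_fderiv_codimCutoff_bound {a n₁ n₂ : Pt d} (h₁ : ‖n₁‖ = 1) (h₂ : ‖n₂‖ = 1)
    (v : Pt d) : ∃ C : ℝ, 0 ≤ C ∧ ∀ m > 0, ∀ x,
      |fderiv ℝ (codimCutoff a n₁ n₂ m) x v| ≤ C * m ∧
      (fderiv ℝ (codimCutoff a n₁ n₂ m) x v ≠ 0 →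
        |⟪x - a, n₁⟫_ℝ| ≤ 2 / m ∧ |⟪x - a, n₂⟫_ℝ| ≤ 2 / m) := by
  obtain ⟨C, hC0, hC⟩ := exists_deriv_smoothTransition_bound
  refine ⟨C * (8 * ‖v‖), by positivity, fun m hm x => ?_⟩
  have hi : ∀ n : Pt d, HasFDerivAt (fun x : Pt d => ⟪x - a, n⟫_ℝ) (innerSL ℝ n) x := by
    intro n
    have : (fun x : Pt d => ⟪x - a, n⟫_ℝ) = fun x => innerSL ℝ n x - ⟪a, n⟫_ℝ := by
      funext x
      rw [inner_sub_left, innerSL_apply_apply, real_inner_comm]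
    rw [this]
    exact (innerSL ℝ n).hasFDerivAt.sub_const _
  have hq := ((((hi n₁).pow 2).add ((hi n₂).pow 2)).mul_const (m ^ 2)).sub_const 1
  have hS : HasDerivAt Real.smoothTransition _ _ :=
    ((Real.smoothTransition.contDiff (n := 1)).differentiable one_ne_zero
      ((⟪x - a, n₁⟫_ℝ ^ 2 + ⟪x - a, n₂⟫_ℝ ^ 2) * m ^ 2 - 1)).hasDerivAt
  have hd : fderiv ℝ (codimCutoff a n₁ n₂ m) x v =
      deriv Real.smoothTransition ((⟪x - a, n₁⟫_ℝ ^ 2 + ⟪x - a, n₂⟫_ℝ ^ 2) * m ^ 2 - 1) *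
        (m ^ 2 * (2 * ⟪x - a, n₁⟫_ℝ * ⟪n₁, v⟫_ℝ + 2 * ⟪x - a, n₂⟫_ℝ * ⟪n₂, v⟫_ℝ)) := by
    have := (hS.comp_hasFDerivAt x hq).fderiv
    unfold codimCutoff
    refine (congrArg (fun A => A v) this).trans ?_
    simp
    ring
  have hcond : fderiv ℝ (codimCutoff a n₁ n₂ m) x v ≠ 0 →
        |⟪x - a, n₁⟫_ℝ| ≤ 2 / m ∧ |⟪x - a, n₂⟫_ℝ| ≤ 2 / m := by
    intro h
    rw [hd] at h
    have hle := (hC _).2 (left_ne_zero_of_mul h)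
    have hsq : ∀ s : ℝ, s ^ 2 * m ^ 2 ≤ 2 → |s| ≤ 2 / m := by
      intro s hs
      rw [le_div_iff₀ hm]
      nlinarith [sq_abs s, abs_nonneg s, mul_nonneg (abs_nonneg s) hm.le]
    constructor
    · apply hsq
      nlinarith [mul_nonneg (sq_nonneg ⟪x - a, n₂⟫_ℝ) (sq_nonneg m)]
    · apply hsq
      nlinarith [mul_nonneg (sq_nonneg ⟪x - a, n₁⟫_ℝ) (sq_nonneg m)]
  refine ⟨?_, hcond⟩
  by_cases h0 : fderiv ℝ (codimCutoff a n₁ n₂ m) x v = 0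
  · rw [h0, abs_zero]; positivity
  obtain ⟨b1, b2⟩ := hcond h0
  have i1 : |⟪n₁, v⟫_ℝ| ≤ ‖v‖ := by simpa [h₁] using abs_real_inner_le_norm n₁ v
  have i2 : |⟪n₂, v⟫_ℝ| ≤ ‖v‖ := by simpa [h₂] using abs_real_inner_le_norm n₂ v
  have p1 : |⟪x - a, n₁⟫_ℝ * ⟪n₁, v⟫_ℝ| ≤ 2 / m * ‖v‖ := by
    rw [abs_mul]; gcongr
  have p2 : |⟪x - a, n₂⟫_ℝ * ⟪n₂, v⟫_ℝ| ≤ 2 / m * ‖v‖ := by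
    rw [abs_mul]; gcongr
  have p3 : |m ^ 2 * (2 * ⟪x - a, n₁⟫_ℝ * ⟪n₁, v⟫_ℝ + 2 * ⟪x - a, n₂⟫_ℝ * ⟪n₂, v⟫_ℝ)| ≤
      8 * ‖v‖ * m := by
    rw [abs_mul, abs_of_nonneg (sq_nonneg m)]
    have : |2 * ⟪x - a, n₁⟫_ℝ * ⟪n₁, v⟫_ℝ + 2 * ⟪x - a, n₂⟫_ℝ * ⟪n₂, v⟫_ℝ| ≤
        2 * (2 / m * ‖v‖) + 2 * (2 / m * ‖v‖) := by
      refine (abs_add_le _ _).trans ?_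
      rw [mul_assoc, mul_assoc 2 ⟪x - a, n₂⟫_ℝ, abs_mul 2, abs_mul 2, abs_two]
      gcongr
    calc m ^ 2 * _ ≤ m ^ 2 * (2 * (2 / m * ‖v‖) + 2 * (2 / m * ‖v‖)) := by gcongr
      _ = 8 * ‖v‖ * m := by field_simp; ring
  rw [hd, abs_mul, mul_assoc C]
  exact mul_le_mul (hC _).1 p3 (abs_nonneg _) hC0

end PolytopalMesh

end LpPDWG
end


/-! ### Removal of the codimension-two cutoffs and the divergence theorem on an element -/

noncomputable section

namespace LpPDWG
namespace PolytopalMesh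

variable {d : ℕ} {Ω : Set (Pt d)} {M : PolytopalMesh Ω}

theorem codimCutoff_mem_Icc (a n₁ n₂ : Pt d) (m : ℝ) (x : Pt d) :
    codimCutoff a n₁ n₂ m x ∈ Icc (0 : ℝ) 1 :=
  ⟨Real.smoothTransition.nonneg _, Real.smoothTransition.le_one _⟩

theorem tendsto_codimCutoff {a n₁ n₂ x : Pt d} (hx : x ∉ codimTwo a n₁ n₂) :
    Tendsto (fun m : ℕ => codimCutoff a n₁ n₂ (m + 1) x) atTop (𝓝 1) := by
  have hq : 0 < ⟪x - a, n₁⟫_ℝ ^ 2 + ⟪x - a, n₂⟫_ℝ ^ 2 := by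
    by_contra h
    refine hx ⟨?_, ?_⟩ <;>
      nlinarith [sq_nonneg ⟪x - a, n₁⟫_ℝ, sq_nonneg ⟪x - a, n₂⟫_ℝ]
  have h1 : Tendsto (fun m : ℕ => ((m : ℝ) + 1) ^ 2) atTop atTop :=
    (tendsto_pow_atTop two_ne_zero).comp
      (tendsto_atTop_add_const_right _ _ tendsto_natCast_atTop_atTop)
  refine tendsto_const_nhds.congr' ?_
  filter_upwards [(h1.const_mul_atTop hq).eventually_ge_atTop 2] with m hm
  exact (Real.smoothTransition.one_of_one_le (by linarith)).symm

theorem disjoint_tsupport_codimCutoff (a n₁ n₂ : Pt d) (m : ℝ) :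
    Disjoint (tsupport (codimCutoff a n₁ n₂ m)) (codimTwo a n₁ n₂) := by
  have hcl : IsClosed {x : Pt d | 1 ≤ (⟪x - a, n₁⟫_ℝ ^ 2 + ⟪x - a, n₂⟫_ℝ ^ 2) * m ^ 2} :=
    isClosed_le continuous_const (by fun_prop)
  have hsub : tsupport (codimCutoff a n₁ n₂ m) ⊆
      {x : Pt d | 1 ≤ (⟪x - a, n₁⟫_ℝ ^ 2 + ⟪x - a, n₂⟫_ℝ ^ 2) * m ^ 2} := by
    refine closure_minimal (fun x hx => ?_) hcl
    by_contra h
    refine hx (Real.smoothTransition.zero_of_nonpos ?_)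
    have : ¬ 1 ≤ (⟪x - a, n₁⟫_ℝ ^ 2 + ⟪x - a, n₂⟫_ℝ ^ 2) * m ^ 2 := h
    linarith
  refine Set.disjoint_left.2 fun x hx hxc => ?_
  have h1 : 1 ≤ (⟪x - a, n₁⟫_ℝ ^ 2 + ⟪x - a, n₂⟫_ℝ ^ 2) * m ^ 2 := hsub hx
  rw [hxc.1, hxc.2] at h1
  norm_num at h1

theorem tendsto_setIntegral_codimCutoff (a n₁ n₂ : Pt d) {μ : Measure (Pt d)} {S : Set (Pt d)}
    {G : Pt d → ℝ} (hG : IntegrableOn G S μ)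
    (hnull : μ.restrict S (codimTwo a n₁ n₂) = 0) :
    Tendsto (fun m : ℕ => ∫ x in S, codimCutoff a n₁ n₂ (m + 1) x * G x ∂μ) atTop
      (𝓝 (∫ x in S, G x ∂μ)) := by
  refine tendsto_integral_of_dominated_convergence (fun x => ‖G x‖) (fun m => ?_) hG.norm
    (fun m => Eventually.of_forall fun x => ?_) ?_
  · exact (contDiff_codimCutoff a n₁ n₂ _).continuous.aestronglyMeasurable.mul
      hG.aestronglyMeasurable
  · obtain ⟨h0, h1⟩ := codimCutoff_mem_Icc a n₁ n₂ (m + 1) x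
    rw [norm_mul, Real.norm_of_nonneg h0]
    exact mul_le_of_le_one_left (norm_nonneg _) h1
  · filter_upwards [compl_mem_ae_iff.2 hnull] with x hx
    simpa using (tendsto_codimCutoff hx).mul_const (G x)

/-- Dominated convergence removes the cutoff from all terms except the one containing its
derivative. That derivative is O(m) and lives on a set of measure O(m⁻²), so this term is O(1/m). -/
theorem divDefect_eq_zero_of_cutoff (i : Fin M.numElem) (v : Pt d) {F : Pt d → ℝ}
    (hF : ContDiff ℝ 1 F) {a n₁ n₂ : Pt d} (h₁ : ‖n₁‖ = 1) (h₂ : ‖n₂‖ = 1)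
    (h₁₂ : ⟪n₁, n₂⟫_ℝ = 0)
    (h : ∀ m : ℕ, M.divDefect i v (fun x => codimCutoff a n₁ n₂ (m + 1) x * F x) = 0) :
    M.divDefect i v F = 0 := by
  have hclosed : IsClosed (codimTwo a n₁ n₂) :=
    (isClosed_eq (by fun_prop) continuous_const).inter (isClosed_eq (by fun_prop) continuous_const)
  obtain ⟨R, hR0, hR⟩ : ∃ R : ℝ, 0 ≤ R ∧ ∀ x ∈ M.elem i, ‖x - a‖ ≤ R := by
    obtain ⟨R, hR⟩ := (M.elem_polytope i).isBounded.subset_closedBall a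
    obtain ⟨x, hx⟩ := (M.elem_polytope i).isConnected.nonempty
    have hb := fun x hx => mem_closedBall_iff_norm.1 (hR (a := x) hx)
    exact ⟨R, (norm_nonneg _).trans (hb x hx), hb⟩
  obtain ⟨Cv, hCv0, hCv⟩ := volume_slab_le a n₁ n₂ h₁ h₂ h₁₂ R hR0
  have hnullvol : volume (codimTwo a n₁ n₂ ∩ M.elem i) = 0 := by
    refine le_antisymm ?_ bot_le
    refine (measure_mono fun x hx => ?_).trans ((hCv 0 le_rfl).trans (by simp))
    exact ⟨hR x hx.2, by rw [hx.1.1, abs_zero], by rw [hx.1.2, abs_zero]⟩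
  have hc1 : ∀ m : ℕ, ContDiff ℝ 1 (codimCutoff a n₁ n₂ (m + 1)) := fun m =>
    (contDiff_codimCutoff a n₁ n₂ _).of_le (by norm_cast)
  have hfd : ∀ (m : ℕ) x, fderiv ℝ (fun x => codimCutoff a n₁ n₂ (m + 1) x * F x) x v =
      codimCutoff a n₁ n₂ (m + 1) x * fderiv ℝ F x v +
        F x * fderiv ℝ (codimCutoff a n₁ n₂ (m + 1)) x v := by
    intro m x
    rw [fderiv_fun_mul ((hc1 m).differentiable one_ne_zero x) (hF.differentiable one_ne_zero x)]
    simp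
  obtain ⟨Cf, hCf0, hCf⟩ := exists_fderiv_codimCutoff_bound (a := a) h₁ h₂ v
  obtain ⟨CF, hCF⟩ := (M.elem_polytope i).isBounded.isCompact_closure.exists_bound_of_continuousOn
    hF.continuous.continuousOn
  have hrem : Tendsto (fun m : ℕ => ∫ x in M.elem i,
      F x * fderiv ℝ (codimCutoff a n₁ n₂ (m + 1)) x v) atTop (𝓝 0) := by
    have hlim : Tendsto (fun m : ℕ => (|CF| * Cf * Cv * 4) * (1 / ((m : ℝ) + 1))) atTop (𝓝 0) := by
      simpa using tendsto_one_div_add_atTop_nhds_zero_nat.const_mul (|CF| * Cf * Cv * 4)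
    refine squeeze_zero_norm (fun m => ?_) hlim
    have hm : (0 : ℝ) < m + 1 := by positivity
    let D : Set (Pt d) := {x | ‖x - a‖ ≤ R ∧ |⟪x - a, n₁⟫_ℝ| ≤ 2 / ((m : ℝ) + 1) ∧
      |⟪x - a, n₂⟫_ℝ| ≤ 2 / ((m : ℝ) + 1)}
    have hD : volume D ≤ ENNReal.ofReal (Cv * (2 / ((m : ℝ) + 1)) ^ 2) := hCv _ (by positivity)
    have hDr : volume.real (M.elem i ∩ D) ≤ Cv * (2 / ((m : ℝ) + 1)) ^ 2 :=
      ENNReal.toReal_le_of_le_ofReal (by positivity) ((measure_mono inter_subset_right).trans hD)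
    have hDm : MeasurableSet D :=
      (measurableSet_le (f := fun x : Pt d => ‖x - a‖) (by fun_prop) (by fun_prop)).inter
        ((measurableSet_le (f := fun x : Pt d => |⟪x - a, n₁⟫_ℝ|) (by fun_prop) (by fun_prop)).inter
        (measurableSet_le (f := fun x : Pt d => |⟪x - a, n₂⟫_ℝ|) (by fun_prop) (by fun_prop)))
    have hzero : ∀ x ∈ M.elem i \ (M.elem i ∩ D),
        F x * fderiv ℝ (codimCutoff a n₁ n₂ (m + 1)) x v = 0 := by
      rintro x ⟨hx, hxD⟩
      by_contra hne
      exact hxD ⟨hx, hR x hx, (hCf _ hm x).2 (right_ne_zero_of_mul hne)⟩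
    rw [setIntegral_eq_of_subset_of_forall_sdiff_eq_zero (M.isOpen_elem i).measurableSet
      inter_subset_left hzero]
    refine (norm_setIntegral_le_of_norm_le_const (C := |CF| * (Cf * (m + 1))) ?_ ?_).trans ?_
    · exact (measure_mono inter_subset_right).trans_lt (hD.trans_lt ENNReal.ofReal_lt_top)
    · rintro x ⟨hx, -⟩
      rw [norm_mul]
      exact mul_le_mul ((hCF x (subset_closure hx)).trans (le_abs_self _)) (hCf _ hm x).1
        (norm_nonneg _) (abs_nonneg _)
    · refine (mul_le_mul_of_nonneg_left hDr (by positivity)).trans (le_of_eq ?_)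
      field_simp
      ring
  have hlim : Tendsto (fun m : ℕ => M.divDefect i v
      (fun x => codimCutoff a n₁ n₂ (m + 1) x * F x)) atTop (𝓝 (M.divDefect i v F)) := by
    unfold divDefect
    refine Tendsto.sub ?_ (tendsto_finsetSum _ fun e he => ?_)
    · have h1 := (tendsto_setIntegral_codimCutoff a n₁ n₂ (μ := volume)
        (M.integrableOn_elem i (continuous_fderiv_apply hF v)) (by
          rw [Measure.restrict_apply hclosed.measurableSet]; exact hnullvol)).add hrem
      rw [add_zero] at h1
      refine h1.congr fun m => ?_
      simp only [hfd]
      rw [integral_add]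
      · exact M.integrableOn_elem i
          ((hc1 m).continuous.mul (continuous_fderiv_apply hF v))
      · exact M.integrableOn_elem i
          (hF.continuous.mul (continuous_fderiv_apply (hc1 m) v))
    · simp only [mul_assoc]
      refine tendsto_setIntegral_codimCutoff a n₁ n₂
        (M.integrableOn_face e (hF.continuous.mul continuous_const)) ?_
      obtain ⟨x, hx⟩ := M.face_nonempty e
      rw [Measure.restrict_apply hclosed.measurableSet]
      exact measure_mono_null (inter_subset_inter_right _ (M.face_subset_hyperplane he hx))
        (measure_codimTwo_inter_hyperplane a n₁ n₂ h₁ h₂ h₁₂ (M.normal_norm i e he) x)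
  refine tendsto_nhds_unique hlim ?_
  simp only [h]
  exact tendsto_const_nhds

/-- The divergence theorem on an element of a polytopal mesh. -/
theorem integral_elem_fderiv (M : PolytopalMesh Ω) (i : Fin M.numElem) (v : Pt d) {F : Pt d → ℝ}
    (hF : ContDiff ℝ 1 F) :
    ∫ x in M.elem i, fderiv ℝ F x v =
      ∑ e ∈ M.facesOf i, ∫ x in M.face e, F x * ⟪v, M.normal i e⟫_ℝ ∂μHE[d - 1] := by
  classical
  have hbd := fun e => (M.face_polytope e).boundary_flat
  choose S hS hSc using hbd
  -- The flats containing the relative boundaries of the faces are removed one at a time from the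
  -- list of sets which the support has to avoid: multiplying by a cutoff restores the missing
  -- condition for one flat and keeps those for the others.
  have key : ∀ T : Finset (AffineSubspace ℝ (Pt d)), (∀ H ∈ T, ∃ e, H < M.plane e) →
      (∀ F : Pt d → ℝ, ContDiff ℝ 1 F → (∀ H ∈ T, Disjoint (tsupport F) H) →
        M.divDefect i v F = 0) → ∀ F : Pt d → ℝ, ContDiff ℝ 1 F → M.divDefect i v F = 0 := by
    intro T
    induction T using Finset.induction_on with
    | empty => exact fun _ h F hF => h F hF (by simp)
    | insert H T _ ih =>
      intro hlt h
      refine ih (fun H' hH' => hlt H' (Finset.mem_insert_of_mem hH')) fun F hF hd => ?_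
      obtain ⟨e, he⟩ := hlt H (Finset.mem_insert_self _ _)
      rcases exists_subset_codimTwo (M.plane_finrank e) he with hem | ⟨a, n₁, n₂, h₁, h₂, h₁₂, hsub⟩
      · refine h F hF fun H' hH' => ?_
        rcases Finset.mem_insert.1 hH' with rfl | hH'
        · rw [hem]; exact Set.disjoint_empty _
        · exact hd H' hH'
      · refine divDefect_eq_zero_of_cutoff (a := a) i v hF h₁ h₂ h₁₂ fun m => ?_
        refine h _ (((contDiff_codimCutoff a n₁ n₂ _).of_le (by norm_cast)).mul hF)
          fun H' hH' => ?_
        rcases Finset.mem_insert.1 hH' with rfl | hH'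
        · exact ((disjoint_tsupport_codimCutoff a n₁ n₂ (m + 1)).mono_right hsub).mono_left
            tsupport_mul_subset_left
        · exact (hd H' hH').mono_left tsupport_mul_subset_right
  have := key (Finset.univ.biUnion S) (by
    intro H hH
    obtain ⟨e, -, he⟩ := Finset.mem_biUnion.1 hH
    exact ⟨e, hS e H he⟩) (by
    intro F hF hd
    refine divDefect_eq_zero_of_disjoint i v hF fun e _ => ?_
    refine Set.disjoint_left.2 fun x hx hxe => ?_
    obtain ⟨H, hH, hxH⟩ := mem_iUnion₂.1 (hSc e hxe)
    exact Set.disjoint_left.1 (hd H (Finset.mem_biUnion.2 ⟨e, Finset.mem_univ _, hH⟩)) hx hxH)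
    F hF
  exact sub_eq_zero.1 this

end PolytopalMesh
end LpPDWG
end


noncomputable section

namespace LpPDWG

/-! ### Integral inequalities for continuously differentiable functions -/

section Basic

open ENNReal

/-- Jensen's inequality for powers. -/
theorem rpow_lintegral_le {α : Type*} [MeasurableSpace α] {μ : Measure α} (hμ : μ univ ≤ 1)
    {q : ℝ} (hq : 1 ≤ q) {f : α → ℝ≥0∞} (hf : Measurable f) :
    (∫⁻ a, f a ∂μ) ^ q ≤ ∫⁻ a, f a ^ q ∂μ := by
  have h := eLpNorm'_le_eLpNorm'_mul_rpow_measure_univ (μ := μ) one_pos hq hf.aestronglyMeasurable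
  simp only [eLpNorm', enorm_eq_self, ENNReal.rpow_one, div_one] at h
  have h2 : μ univ ^ (1 - 1 / q) ≤ 1 := ENNReal.rpow_le_one hμ (by
    rw [sub_nonneg, div_le_one (by linarith)]; exact hq)
  have h3 := h.trans (mul_le_of_le_one_right' h2)
  calc (∫⁻ a, f a ∂μ) ^ q ≤ ((∫⁻ a, f a ^ q ∂μ) ^ (1 / q)) ^ q := by gcongr
    _ = _ := by rw [← ENNReal.rpow_mul, one_div_mul_cancel (by linarith), ENNReal.rpow_one]

/-- This is a change of variables. Restricting to s ≥ 1/2 bounds the Jacobian by a constant, and of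
the weights s and 1 - s on a segment at least one qualifies. -/
theorem lintegral_comp_add_smul_le {E : Type*} [NormedAddCommGroup E] [NormedSpace ℝ E]
    [FiniteDimensional ℝ E] [MeasurableSpace E] [BorelSpace E] (μ : Measure E) [μ.IsAddHaarMeasure]
    (G : E → ℝ≥0∞) (a : E) {s : ℝ} (hs : 1 / 2 ≤ s) :
    ∫⁻ y, G (a + s • y) ∂μ ≤ 2 ^ Module.finrank ℝ E * ∫⁻ y, G y ∂μ := by
  have hs0 : 0 < s := by linarith
  have he := (Homeomorph.smulOfNeZero s hs0.ne' (α := E)).measurableEmbedding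
  have h1 : ∫⁻ y, G (a + s • y) ∂μ = ∫⁻ y, G (a + y) ∂(μ.map (s • ·)) :=
    (he.lintegral_map fun y => G (a + y)).symm
  rw [h1, Measure.map_addHaar_smul μ hs0.ne', lintegral_smul_measure,
    lintegral_add_left_eq_self G a, smul_eq_mul]
  gcongr
  rw [abs_of_nonneg (by positivity), ← inv_pow]
  calc ENNReal.ofReal (s⁻¹ ^ Module.finrank ℝ E) ≤ ENNReal.ofReal (2 ^ Module.finrank ℝ E) := by
        apply ENNReal.ofReal_le_ofReal
        gcongr
        rw [inv_le_comm₀ hs0 two_pos]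
        linarith
    _ = _ := by rw [ENNReal.ofReal_pow zero_le_two]; norm_num

/-- The fundamental theorem of calculus combined with Jensen's inequality, which costs no constant
on an interval of length at most one. -/
theorem enorm_sub_rpow_le {f f' : ℝ → ℝ} (hf : ∀ t, HasDerivAt f (f' t) t) (hc : Continuous f')
    {a t b : ℝ} (hat : a ≤ t) (htb : t ≤ b) (hab : b - a ≤ 1) {q : ℝ} (hq : 1 ≤ q) :
    ‖f b - f t‖ₑ ^ q ≤ ∫⁻ s in Ioc a b, ‖f' s‖ₑ ^ q := by
  rw [← intervalIntegral.integral_eq_sub_of_hasDerivAt (fun s _ => hf s)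
    (hc.intervalIntegrable _ _), intervalIntegral.integral_of_le htb]
  calc ‖∫ s in Ioc t b, f' s‖ₑ ^ q ≤ (∫⁻ s in Ioc t b, ‖f' s‖ₑ) ^ q := by
        gcongr; exact enorm_integral_le_lintegral_enorm _
    _ ≤ (∫⁻ s in Ioc a b, ‖f' s‖ₑ) ^ q := by
        gcongr
    _ ≤ _ := by
        refine rpow_lintegral_le ?_ hq hc.enorm.measurable
        rw [Measure.restrict_apply_univ, Real.volume_Ioc]
        exact ENNReal.ofReal_le_one.2 hab

variable {d : ℕ}

/-- Comparison of the values of a function at two points of a ray with its gradient. -/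
theorem enorm_sub_rpow_le_ray {z : Pt d → ℝ} (hz : ContDiff ℝ 1 z) (A w : Pt d)
    {a t b : ℝ} (hat : a ≤ t) (htb : t ≤ b) (hab : b - a ≤ 1) {q : ℝ} (hq : 1 ≤ q) :
    ‖z (A + b • w) - z (A + t • w)‖ₑ ^ q ≤
      ‖w‖ₑ ^ q * ∫⁻ s in Ioc a b, ‖fderiv ℝ z (A + s • w)‖ₑ ^ q := by
  have hcf : Continuous (fun s : ℝ => fderiv ℝ z (A + s • w)) :=
    (hz.continuous_fderiv one_ne_zero).comp (by fun_prop)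
  have hd : ∀ s : ℝ, HasDerivAt (fun s : ℝ => z (A + s • w)) (fderiv ℝ z (A + s • w) w) s := by
    intro s
    have h1 : HasDerivAt (fun s : ℝ => A + s • w) w s := by
      simpa using ((hasDerivAt_id s).smul_const w).const_add A
    exact ((hz.differentiable one_ne_zero _).hasFDerivAt).comp_hasDerivAt s h1
  refine (enorm_sub_rpow_le hd (hcf.clm_apply continuous_const) hat htb hab hq).trans ?_
  rw [← lintegral_const_mul _ (by fun_prop)]
  gcongr with s
  rw [← ENNReal.mul_rpow_of_nonneg _ _ (by linarith), mul_comm]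
  gcongr
  exact ContinuousLinearMap.le_opENorm _ _

/-- The key estimate behind the Poincaré inequality. -/
theorem lintegral_lintegral_enorm_sub_rpow_le {z : Pt d → ℝ} (hz : ContDiff ℝ 1 z)
    {S V W : Set (Pt d)} (hS : MeasurableSet S) (hV : MeasurableSet V) (hW : MeasurableSet W)
    (hseg : ∀ x ∈ S, ∀ y ∈ V, segment ℝ y x ⊆ W) {D : ℝ≥0∞}
    (hD : ∀ x ∈ S, ∀ y ∈ V, ‖x - y‖ₑ ≤ D) {q : ℝ} (hq : 1 ≤ q) :
    ∫⁻ x in S, ∫⁻ y in V, ‖z x - z y‖ₑ ^ q ≤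
      D ^ q * 2 ^ d * (volume S + volume V) * ∫⁻ x in W, ‖fderiv ℝ z x‖ₑ ^ q := by
  -- Extension by zero outside `W` allows integration over the whole space after a substitution.
  set G : Pt d → ℝ≥0∞ := W.indicator fun x => ‖fderiv ℝ z x‖ₑ ^ q with hG
  have hcf := hz.continuous_fderiv one_ne_zero
  have hGm : Measurable G := Measurable.indicator (by fun_prop) hW
  have h1 : ∀ x ∈ S, ∀ y ∈ V, ‖z x - z y‖ₑ ^ q ≤ D ^ q * ∫⁻ t in Ioc (0 : ℝ) 1,
      G (y + t • (x - y)) := by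
    intro x hx y hy
    have := enorm_sub_rpow_le_ray hz y (x - y) le_rfl zero_le_one (by norm_num) hq
    simp only [one_smul, zero_smul, add_zero, add_sub_cancel] at this
    refine this.trans (mul_le_mul' ?_ ?_)
    · exact ENNReal.rpow_le_rpow (hD x hx y hy) (by linarith)
    · refine setLIntegral_mono' measurableSet_Ioc fun t ht => ?_
      rw [hG, indicator_of_mem]
      refine hseg x hx y hy ?_
      rw [segment_eq_image']
      exact ⟨t, ⟨ht.1.le, ht.2⟩, rfl⟩
  have hI : ∫⁻ x in W, ‖fderiv ℝ z x‖ₑ ^ q = ∫⁻ x, G x := (lintegral_indicator hW _).symm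
  have hJ : Measurable (fun p : (Pt d × Pt d) × ℝ => G (p.1.2 + p.2 • (p.1.1 - p.1.2))) :=
    hGm.comp (by fun_prop)
  have hfin := Module.finrank_fin_fun ℝ (n := d)
  -- For t ≤ 1/2 the substitution is made in `y`, whose coefficient is 1 - t, and for t ≥ 1/2 in
  -- `x`, whose coefficient is t; in neither case does the Jacobian degenerate.
  have h2 : ∀ t ∈ Ioc (0 : ℝ) 1, ∫⁻ x in S, ∫⁻ y in V, G (y + t • (x - y)) ≤
      2 ^ d * (volume S + volume V) * ∫⁻ x, G x := by
    intro t ht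
    rcases le_total t (1 / 2) with h | h
    · calc ∫⁻ x in S, ∫⁻ y in V, G (y + t • (x - y))
          ≤ ∫⁻ x in S, 2 ^ d * ∫⁻ y, G y := by
            refine lintegral_mono fun x => (setLIntegral_le_lintegral _ _).trans ?_
            have := lintegral_comp_add_smul_le volume G (t • x) (s := 1 - t) (by linarith)
            rw [finrank_euclideanSpace, Fintype.card_fin] at this
            refine le_trans (le_of_eq (lintegral_congr fun y => ?_)) this
            congr 1
            module
        _ = 2 ^ d * volume S * ∫⁻ y, G y := by rw [setLIntegral_const]; ring
        _ ≤ _ := by gcongr; exact le_self_add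
    · rw [lintegral_lintegral_swap (by
        refine Measurable.aemeasurable ?_
        exact hJ.comp (f := fun p : Pt d × Pt d => ((p.1, p.2), t)) (by fun_prop))]
      calc ∫⁻ y in V, ∫⁻ x in S, G (y + t • (x - y))
          ≤ ∫⁻ y in V, 2 ^ d * ∫⁻ y, G y := by
            refine lintegral_mono fun y => (setLIntegral_le_lintegral _ _).trans ?_
            have := lintegral_comp_add_smul_le volume G ((1 - t) • y) (s := t) (by linarith)
            rw [finrank_euclideanSpace, Fintype.card_fin] at this
            refine le_trans (le_of_eq (lintegral_congr fun x => ?_)) this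
            congr 1
            module
        _ = 2 ^ d * volume V * ∫⁻ y, G y := by rw [setLIntegral_const]; ring
        _ ≤ _ := by gcongr; exact le_add_self
  calc ∫⁻ x in S, ∫⁻ y in V, ‖z x - z y‖ₑ ^ q
      ≤ ∫⁻ x in S, ∫⁻ y in V, D ^ q * ∫⁻ t in Ioc (0 : ℝ) 1, G (y + t • (x - y)) :=
        setLIntegral_mono' hS fun x hx => setLIntegral_mono' hV fun y hy => h1 x hx y hy
    _ = D ^ q * ∫⁻ t in Ioc (0 : ℝ) 1, ∫⁻ x in S, ∫⁻ y in V, G (y + t • (x - y)) := by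
        have m1 : Measurable fun p : Pt d × Pt d => ∫⁻ t in Ioc (0 : ℝ) 1,
            G (p.2 + t • (p.1 - p.2)) := hJ.lintegral_prod_right'
        have m2 : ∀ x : Pt d, Measurable fun y => ∫⁻ t in Ioc (0 : ℝ) 1, G (y + t • (x - y)) :=
          fun x => m1.comp (f := fun y : Pt d => (x, y)) (by fun_prop)
        simp_rw [lintegral_const_mul _ (m2 _)]
        have m3 : Measurable fun p : Pt d × ℝ => ∫⁻ y in V, G (y + p.2 • (p.1 - y)) := by
          have : Measurable fun p : (Pt d × ℝ) × Pt d => G (p.2 + p.1.2 • (p.1.1 - p.2)) :=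
            hGm.comp (by fun_prop)
          exact this.lintegral_prod_right'
        have m4 : Measurable fun x : Pt d => ∫⁻ y in V, ∫⁻ t in Ioc (0 : ℝ) 1,
            G (y + t • (x - y)) := m1.lintegral_prod_right'
        rw [lintegral_const_mul _ m4]
        congr 1
        have sw : ∀ x : Pt d, ∫⁻ y in V, ∫⁻ t in Ioc (0 : ℝ) 1, G (y + t • (x - y)) =
            ∫⁻ t in Ioc (0 : ℝ) 1, ∫⁻ y in V, G (y + t • (x - y)) := fun x =>
          lintegral_lintegral_swap (by
            refine Measurable.aemeasurable ?_
            exact hJ.comp (f := fun p : Pt d × ℝ => ((x, p.1), p.2)) (by fun_prop))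
        simp_rw [sw]
        exact lintegral_lintegral_swap m3.aemeasurable
    _ ≤ D ^ q * ∫⁻ t in Ioc (0 : ℝ) 1, 2 ^ d * (volume S + volume V) * ∫⁻ x, G x := by
        gcongr 1
        exact setLIntegral_mono' measurableSet_Ioc h2
    _ = _ := by
        rw [setLIntegral_const, Real.volume_Ioc, hI]
        simp only [sub_zero, ENNReal.ofReal_one, mul_one]
        ring

/-! ### The trace inequality on a pyramid -/

/-- Integration over (the part near the base of) a pyramid. -/
theorem lintegral_pyramid_le {n : Pt d} (hn : ‖n‖ = 1) (A : Pt d) {H : ℝ} (hH : 0 < H)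
    {S W : Set (Pt d)} (hS : MeasurableSet S) (hW : MeasurableSet W)
    (hSn : ∀ x ∈ S, ⟪x - A, n⟫_ℝ = H) (hseg : ∀ x ∈ S, segment ℝ A x ⊆ W)
    {g : Pt d → ℝ≥0∞} (hg : Measurable g) :
    ∫⁻ t in Ioc (1 / 2 : ℝ) 1, ∫⁻ x in S, g (A + t • (x - A)) ∂μHE[d - 1] ≤
      2 ^ (d - 1) * ENNReal.ofReal H⁻¹ * ∫⁻ x in W, g x := by
  set G : Pt d → ℝ≥0∞ := W.indicator g with hG
  have hGm : Measurable G := hg.indicator hW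
  rw [← lintegral_indicator hW]
  have hSx : S ⊆ hyperplane n (A + H • n) := by
    intro x hx
    have h1 : x - (A + H • n) = (x - A) - H • n := by abel
    simp only [hyperplane, mem_ofPred_eq]
    rw [h1, inner_sub_left, hSn x hx, inner_smul_left, real_inner_self_eq_norm_sq, hn]
    simp
  obtain ⟨hmp, hme⟩ := measurePreserving_hyperChart hn A
  -- The slice at relative height t is the base shrunk by t towards the apex; undoing this dilation
  -- within the hyperplane costs at most 2^(d-1), as t ≥ 1/2.
  have h1 : ∀ t ∈ Ioc (1 / 2 : ℝ) 1, ∫⁻ x in S, g (A + t • (x - A)) ∂μHE[d - 1] ≤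
      2 ^ (d - 1) * ∫⁻ y : (ℝ ∙ n)ᗮ, G (hyperChart n A (t * H, y)) := by
    intro t ht
    have e1 : ∫⁻ x in S, g (A + t • (x - A)) ∂μHE[d - 1] =
        ∫⁻ x in S, G (A + t • (x - A)) ∂μHE[d - 1] := by
      refine setLIntegral_congr_fun hS fun x hx => ?_
      have : A + t • (x - A) ∈ W := by
        refine hseg x hx ?_
        rw [segment_eq_image']
        exact ⟨t, ⟨by linarith [ht.1], ht.2⟩, rfl⟩
      rw [hG, indicator_of_mem this]
    rw [e1, setLIntegral_subset_hyperplane hn _ hSx hS]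
    refine (setLIntegral_le_lintegral _ _).trans ?_
    have := lintegral_comp_add_smul_le (volume : Measure (ℝ ∙ n)ᗮ)
      (fun y => G (hyperChart n A (t * H, y))) 0 ht.1.le
    rw [finrank_hyperDir hn] at this
    refine le_trans (le_of_eq (lintegral_congr fun y => ?_)) this
    simp only [hyperChart, zero_add, Submodule.coe_smul]
    congr 1
    module
  have hm : Measurable fun t : ℝ => ∫⁻ y : (ℝ ∙ n)ᗮ, G (hyperChart n A (t, y)) :=
    (hGm.comp hme.measurable).lintegral_prod_right'
  calc ∫⁻ t in Ioc (1 / 2 : ℝ) 1, ∫⁻ x in S, g (A + t • (x - A)) ∂μHE[d - 1]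
      ≤ ∫⁻ t in Ioc (1 / 2 : ℝ) 1, 2 ^ (d - 1) * ∫⁻ y : (ℝ ∙ n)ᗮ, G (hyperChart n A (t * H, y)) :=
        setLIntegral_mono' measurableSet_Ioc h1
    _ ≤ ∫⁻ t : ℝ, 2 ^ (d - 1) * ∫⁻ y : (ℝ ∙ n)ᗮ, G (hyperChart n A (t * H, y)) :=
        setLIntegral_le_lintegral _ _
    _ = 2 ^ (d - 1) * ∫⁻ t : ℝ, ∫⁻ y : (ℝ ∙ n)ᗮ, G (hyperChart n A (t * H, y)) :=
        lintegral_const_mul _ (hm.comp (by fun_prop))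
    _ = 2 ^ (d - 1) * (ENNReal.ofReal H⁻¹ * ∫⁻ t : ℝ, ∫⁻ y : (ℝ ∙ n)ᗮ, G (hyperChart n A (t, y))) := by
        congr 1
        have he := (Homeomorph.mulRight₀ H hH.ne').measurableEmbedding
        have h1 : ∫⁻ t : ℝ, ∫⁻ y : (ℝ ∙ n)ᗮ, G (hyperChart n A (t * H, y)) =
            ∫⁻ t, (∫⁻ y : (ℝ ∙ n)ᗮ, G (hyperChart n A (t, y))) ∂(volume.map (· * H)) :=
          (he.lintegral_map fun t => ∫⁻ y : (ℝ ∙ n)ᗮ, G (hyperChart n A (t, y))).symm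
        rw [h1, Real.map_volume_mul_right hH.ne', lintegral_smul_measure, smul_eq_mul,
          abs_of_pos (inv_pos.2 hH)]
    _ = _ := by
        rw [← lintegral_prod (fun p : ℝ × (ℝ ∙ n)ᗮ => G (hyperChart n A p))
          (hGm.comp hme.measurable).aemeasurable, ← Measure.volume_eq_prod,
          hmp.lintegral_comp_emb hme, mul_assoc]

/-- The trace inequality on a pyramid with base `S` and apex `A`. -/
theorem lintegral_trace_le {n : Pt d} (hn : ‖n‖ = 1) (A : Pt d) {H : ℝ} (hH : 0 < H)
    {S W : Set (Pt d)} (hS : MeasurableSet S) (hW : MeasurableSet W)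
    (hSn : ∀ x ∈ S, ⟪x - A, n⟫_ℝ = H) (hseg : ∀ x ∈ S, segment ℝ A x ⊆ W) {D : ℝ≥0∞}
    (hD : ∀ x ∈ S, ‖x - A‖ₑ ≤ D) {q : ℝ} (hq : 1 ≤ q) {z : Pt d → ℝ} (hz : ContDiff ℝ 1 z)
    (hfin : μHE[d - 1] S < ⊤) :
    ∫⁻ x in S, ‖z x‖ₑ ^ q ∂μHE[d - 1] ≤ 2 ^ q * 2 ^ (d - 1) * ENNReal.ofReal H⁻¹ *
      ((∫⁻ x in W, ‖z x‖ₑ ^ q) + D ^ q * ∫⁻ x in W, ‖fderiv ℝ z x‖ₑ ^ q) := by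
  have hcf := hz.continuous_fderiv one_ne_zero
  have hcz := hz.continuous
  have : IsFiniteMeasure (μHE[d - 1].restrict S) := ⟨by simpa using hfin⟩
  have m1 : Measurable fun p : ℝ × Pt d => ‖z (A + p.1 • (p.2 - A))‖ₑ ^ q :=
    (hcz.comp (by fun_prop : Continuous fun p : ℝ × Pt d =>
      A + p.1 • (p.2 - A))).enorm.measurable.pow_const q
  have m2 : Measurable fun p : ℝ × Pt d => ‖fderiv ℝ z (A + p.1 • (p.2 - A))‖ₑ ^ q := by fun_prop
  set I1 := ∫⁻ t in Ioc (1 / 2 : ℝ) 1, ∫⁻ x in S, ‖z (A + t • (x - A))‖ₑ ^ q ∂μHE[d - 1] with hI1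
  set I2 := ∫⁻ t in Ioc (1 / 2 : ℝ) 1, ∫⁻ x in S, ‖fderiv ℝ z (A + t • (x - A))‖ₑ ^ q ∂μHE[d - 1]
    with hI2
  have hI2' : ∫⁻ x in S, (∫⁻ s in Ioc (1 / 2 : ℝ) 1, ‖fderiv ℝ z (A + s • (x - A))‖ₑ ^ q)
      ∂μHE[d - 1] = I2 := by
    refine lintegral_lintegral_swap ?_
    exact (m2.comp measurable_swap).aemeasurable
  -- The value at a base point is compared with the value at relative height t on the ray from the
  -- apex. Averaging over t in (1/2, 1], an interval of length 1/2, turns the bound into volume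
  -- integrals and raises 2^(q-1) to 2^q.
  have h1 : ∀ t ∈ Ioc (1 / 2 : ℝ) 1, ∫⁻ x in S, ‖z x‖ₑ ^ q ∂μHE[d - 1] ≤
      2 ^ (q - 1) * ((∫⁻ x in S, ‖z (A + t • (x - A))‖ₑ ^ q ∂μHE[d - 1]) + D ^ q * I2) := by
    intro t ht
    have m3 : Measurable fun x : Pt d => ‖z (A + t • (x - A))‖ₑ ^ q :=
      m1.comp (f := fun x : Pt d => (t, x)) (by fun_prop)
    have m4 : Measurable fun x : Pt d => ∫⁻ s in Ioc (1 / 2 : ℝ) 1,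
        ‖fderiv ℝ z (A + s • (x - A))‖ₑ ^ q := (m2.comp measurable_swap).lintegral_prod_right'
    have m5 : Measurable fun x : Pt d => ‖z (A + t • (x - A))‖ₑ ^ q + D ^ q *
        ∫⁻ s in Ioc (1 / 2 : ℝ) 1, ‖fderiv ℝ z (A + s • (x - A))‖ₑ ^ q := m3.add (m4.const_mul _)
    rw [← hI2', ← lintegral_const_mul _ m4, ← lintegral_add_left m3,
      ← lintegral_const_mul _ m5]
    refine setLIntegral_mono' hS fun x hx => ?_
    have hr := enorm_sub_rpow_le_ray hz A (x - A) ht.1.le ht.2 (by norm_num) hq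
    simp only [one_smul, add_sub_cancel] at hr
    calc ‖z x‖ₑ ^ q = ‖z (A + t • (x - A)) + (z x - z (A + t • (x - A)))‖ₑ ^ q := by
          rw [add_sub_cancel]
      _ ≤ (‖z (A + t • (x - A))‖ₑ + ‖z x - z (A + t • (x - A))‖ₑ) ^ q := by
          gcongr; exact enorm_add_le _ _
      _ ≤ 2 ^ (q - 1) * (‖z (A + t • (x - A))‖ₑ ^ q + ‖z x - z (A + t • (x - A))‖ₑ ^ q) :=
          ENNReal.rpow_add_le_mul_rpow_add_rpow _ _ hq
      _ ≤ _ := by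
          gcongr
          refine hr.trans ?_
          gcongr
          exact hD x hx
  have h2 : ∫⁻ _ in Ioc (1 / 2 : ℝ) 1, ∫⁻ x in S, ‖z x‖ₑ ^ q ∂μHE[d - 1] ≤
      2 ^ (q - 1) * (I1 + D ^ q * I2) := by
    refine (setLIntegral_mono' measurableSet_Ioc h1).trans ?_
    have m5 : Measurable fun t : ℝ => ∫⁻ x in S, ‖z (A + t • (x - A))‖ₑ ^ q ∂μHE[d - 1] :=
      m1.lintegral_prod_right'
    rw [lintegral_const_mul _ (m5.add_const _), lintegral_add_left m5, setLIntegral_const]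
    gcongr 2 ^ (q - 1) * (_ + ?_)
    refine mul_le_of_le_one_right' ?_
    rw [Real.volume_Ioc]
    exact ENNReal.ofReal_le_one.2 (by norm_num)
  have hhalf : volume (Ioc (1 / 2 : ℝ) 1) = 2⁻¹ := by
    rw [Real.volume_Ioc, show (1 : ℝ) - 1 / 2 = 2⁻¹ by norm_num, ENNReal.ofReal_inv_of_pos two_pos]
    simp
  rw [setLIntegral_const, hhalf] at h2
  have h3 := mul_le_mul_left h2 2
  rw [mul_assoc, ENNReal.inv_mul_cancel two_ne_zero ofNat_ne_top, mul_one] at h3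
  refine h3.trans ?_
  have b1 : I1 ≤ _ := lintegral_pyramid_le hn A hH hS hW hSn hseg
    (g := fun x => ‖z x‖ₑ ^ q) (by fun_prop)
  have b2 : I2 ≤ _ := lintegral_pyramid_le hn A hH hS hW hSn hseg
    (g := fun x => ‖fderiv ℝ z x‖ₑ ^ q) (by fun_prop)
  have h22 : (2 : ℝ≥0∞) ^ q = 2 ^ (q - 1) * 2 := by
    have := ENNReal.rpow_add (q - 1) 1 two_ne_zero (ofNat_ne_top (n := 2))
    rwa [sub_add_cancel, ENNReal.rpow_one] at this
  calc 2 ^ (q - 1) * (I1 + D ^ q * I2) * 2 ≤ 2 ^ (q - 1) *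
      (2 ^ (d - 1) * ENNReal.ofReal H⁻¹ * (∫⁻ x in W, ‖z x‖ₑ ^ q) +
        D ^ q * (2 ^ (d - 1) * ENNReal.ofReal H⁻¹ * ∫⁻ x in W, ‖fderiv ℝ z x‖ₑ ^ q)) * 2 := by
        gcongr
    _ = _ := by rw [h22]; ring

end Basic

end LpPDWG
end


noncomputable section

namespace LpPDWG

/-! ### Lipschitz domains are locally star-shaped -/

section Star

variable {d : ℕ}

/-- `U` is a neighbourhood in `Ω` of the points of `Ω` at distance at most `h` from `x₀`; it has
diameter comparable to `h` and is star-shaped with respect to the ball `ball z h`. -/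
structure IsStarNhd (Ω : Set (Pt d)) (x₀ : Pt d) (h κ : ℝ) (U : Set (Pt d)) (z : Pt d) : Prop where
  isOpen : IsOpen U
  closedBall_subset : Metric.closedBall x₀ h ∩ Ω ⊆ U
  subset : U ⊆ Ω
  subset_ball : U ⊆ Metric.ball x₀ (κ * h)
  ball_subset : Metric.ball z h ⊆ U
  segment_subset : ∀ x ∈ U, ∀ y ∈ Metric.ball z h, segment ℝ y x ⊆ U

theorem IsStarNhd.mono {Ω : Set (Pt d)} {x₀ : Pt d} {h κ κ' : ℝ} {U : Set (Pt d)} {z : Pt d}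
    (hs : IsStarNhd Ω x₀ h κ U z) (hκ : κ ≤ κ') (hh : 0 ≤ h) : IsStarNhd Ω x₀ h κ' U z :=
  { hs with
    subset_ball := hs.subset_ball.trans
      (Metric.ball_subset_ball (mul_le_mul_of_nonneg_right hκ hh)) }

theorem isStarNhd_ball {Ω : Set (Pt d)} {x₀ : Pt d} {h : ℝ} (hh : 0 < h)
    (hsub : Metric.ball x₀ (2 * h) ⊆ Ω) : IsStarNhd Ω x₀ h 2 (Metric.ball x₀ (2 * h)) x₀ where
  isOpen := Metric.isOpen_ball
  closedBall_subset := inter_subset_left.trans (Metric.closedBall_subset_ball (by linarith))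
  subset := hsub
  subset_ball := subset_rfl
  ball_subset := Metric.ball_subset_ball (by linarith)
  segment_subset := fun x hx y hy => (convex_ball x₀ (2 * h)).segment_subset
    (Metric.ball_subset_ball (by linarith) hy) hx

/-- The part of a cylinder around the direction `ν` that lies above the graph of `φ`. -/
def graphCylinder (ν : Pt d) (φ : Pt d → ℝ) (K h : ℝ) (x₀ : Pt d) : Set (Pt d) :=
  {y | ‖(y - x₀) - ⟪ν, y - x₀⟫_ℝ • ν‖ < 2 * h ∧ φ y < ⟪ν, y⟫_ℝ ∧
    ⟪ν, x₀⟫_ℝ - 2 * h < ⟪ν, y⟫_ℝ ∧ ⟪ν, y⟫_ℝ < ⟪ν, x₀⟫_ℝ + K * h}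

/-- Over the base of radius 2h the graph lies less than 2Lh above `x₀`, so every point of the
cylinder at height 3Lh or more above `x₀` is above the graph. The ball sits higher than (6L + 1)h,
so a segment from a point below height 3Lh into the ball rises by at least 3Lh while moving
horizontally by at most 3h. Its slope is then at least L, and the graph cannot overtake it. -/
theorem isStarNhd_graphCylinder {Ω : Set (Pt d)} {c ν : Pt d} {r : ℝ} {L : NNReal} {φ : Pt d → ℝ}
    (hν : ‖ν‖ = 1) (hφ : LipschitzWith L φ) (hinv : ∀ y (t : ℝ), φ (y + t • ν) = φ y)
    (hgraph : Ω ∩ Metric.ball c r = {y | φ y < ⟪ν, y⟫_ℝ} ∩ Metric.ball c r)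
    {x₀ : Pt d} (hx₀ : x₀ ∈ Ω) {h : ℝ} (hh : 0 < h)
    (hsmall : Metric.ball x₀ ((6 * L + 6) * h) ⊆ Metric.ball c r) :
    IsStarNhd Ω x₀ h (6 * L + 6) (graphCylinder ν φ (6 * L + 4) h x₀)
      (x₀ + ((6 * L + 2) * h) • ν) := by
  have hL : (0 : ℝ) ≤ L := L.2
  have hνν : ⟪ν, ν⟫_ℝ = 1 := by rw [real_inner_self_eq_norm_sq, hν]; norm_num
  set a : ℝ := ⟪ν, x₀⟫_ℝ with ha
  let P : Pt d → Pt d := fun w => w - ⟪ν, w⟫_ℝ • ν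
  have hPadd : ∀ w w' : Pt d, P (w + w') = P w + P w' := by
    intro w w'
    simp only [P, inner_add_right, add_smul]; abel
  have hPsmul : ∀ (s : ℝ) (w : Pt d), P (s • w) = s • P w := by
    intro s w
    simp only [P, inner_smul_right, mul_smul, smul_sub]
  have hPle : ∀ w, ‖P w‖ ≤ ‖w‖ := by
    intro w
    have h1 : ‖P w‖ ^ 2 = ‖w‖ ^ 2 - ⟪ν, w⟫_ℝ ^ 2 := by
      simp only [P]
      rw [norm_sub_sq_real, inner_smul_right, norm_smul, hν, real_inner_comm, Real.norm_eq_abs,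
        mul_one, sq_abs]
      ring
    refine le_of_sq_le_sq ?_ (norm_nonneg _)
    nlinarith [sq_nonneg ⟪ν, w⟫_ℝ]
  have hφP : ∀ y w : Pt d, φ (y + w) = φ (y + P w) := by
    intro y w
    have : y + w = (y + P w) + ⟪ν, w⟫_ℝ • ν := by simp only [P]; abel
    rw [this, hinv]
  have hφle : ∀ y w : Pt d, φ (y + w) ≤ φ y + L * ‖P w‖ := by
    intro y w
    rw [hφP]
    have := hφ.dist_le_mul (y + P w) y
    rw [dist_eq_norm, dist_eq_norm, add_sub_cancel_left, Real.norm_eq_abs] at this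
    linarith [le_abs_self (φ (y + P w) - φ y)]
  have hx₀b : x₀ ∈ Metric.ball c r := hsmall (Metric.mem_ball_self (by positivity))
  have hφx₀ : φ x₀ < a := by
    have : x₀ ∈ Ω ∩ Metric.ball c r := ⟨hx₀, hx₀b⟩
    rw [hgraph] at this
    exact this.1
  have hcyl : ∀ y, y ∈ graphCylinder ν φ (6 * L + 4) h x₀ ↔ ‖P (y - x₀)‖ < 2 * h ∧
      φ y < ⟪ν, y⟫_ℝ ∧ a - 2 * h < ⟪ν, y⟫_ℝ ∧ ⟪ν, y⟫_ℝ < a + (6 * L + 4) * h := fun y => Iff.rfl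
  have hhigh : ∀ y, ‖P (y - x₀)‖ < 2 * h → a + 3 * L * h ≤ ⟪ν, y⟫_ℝ → φ y < ⟪ν, y⟫_ℝ := by
    intro y hy hy'
    have := hφle x₀ (y - x₀)
    rw [add_sub_cancel] at this
    nlinarith [mul_nonneg hL hh.le, mul_le_mul_of_nonneg_left hy.le hL]
  have hsubball : graphCylinder ν φ (6 * L + 4) h x₀ ⊆ Metric.ball x₀ ((6 * L + 6) * h) := by
    intro y hy
    obtain ⟨h1, -, h3, h4⟩ := (hcyl y).1 hy
    have h5 : y - x₀ = P (y - x₀) + ⟪ν, y - x₀⟫_ℝ • ν := by simp only [P]; abel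
    rw [mem_ball_iff_norm, h5]
    refine (norm_add_le _ _).trans_lt ?_
    rw [norm_smul, hν, mul_one, inner_sub_right, Real.norm_eq_abs]
    have : |⟪ν, y⟫_ℝ - ⟪ν, x₀⟫_ℝ| ≤ (6 * L + 4) * h := by
      rw [abs_le]
      constructor <;> nlinarith [mul_nonneg hL hh.le]
    nlinarith
  have hballz : ∀ y ∈ Metric.ball (x₀ + ((6 * L + 2) * h) • ν) h, ‖P (y - x₀)‖ < h ∧
      a + (6 * L + 1) * h < ⟪ν, y⟫_ℝ ∧ ⟪ν, y⟫_ℝ < a + (6 * L + 3) * h := by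
    intro y hy
    rw [mem_ball_iff_norm] at hy
    set w := y - (x₀ + ((6 * L + 2) * h) • ν) with hw
    have h1 : y - x₀ = w + ((6 * L + 2) * h) • ν := by rw [hw]; abel
    have h2 : ⟪ν, y⟫_ℝ = a + ⟪ν, w⟫_ℝ + (6 * L + 2) * h := by
      have : y = x₀ + w + ((6 * L + 2) * h) • ν := by rw [hw]; abel
      rw [this, inner_add_right, inner_add_right, inner_smul_right, hνν]; ring
    have h3 : |⟪ν, w⟫_ℝ| < h := by
      refine (abs_real_inner_le_norm ν w).trans_lt ?_
      rwa [hν, one_mul]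
    refine ⟨?_, ?_, ?_⟩
    · rw [h1, hPadd]
      have : P (((6 * L + 2) * h) • ν) = 0 := by
        rw [hPsmul]; simp only [P, hνν, one_smul, sub_self, smul_zero]
      rw [this, add_zero]
      exact (hPle w).trans_lt hy
    · rw [h2]; nlinarith [neg_abs_le ⟪ν, w⟫_ℝ]
    · rw [h2]; nlinarith [le_abs_self ⟪ν, w⟫_ℝ]
  refine ⟨?_, ?_, ?_, hsubball, ?_, ?_⟩
  · have hc := hφ.continuous
    have c1 : Continuous fun y : Pt d => ‖(y - x₀) - ⟪ν, y - x₀⟫_ℝ • ν‖ := by fun_prop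
    have c2 : Continuous fun y : Pt d => ⟪ν, y⟫_ℝ := by fun_prop
    exact (isOpen_lt c1 continuous_const).inter ((isOpen_lt hc c2).inter
      ((isOpen_lt continuous_const c2).inter (isOpen_lt c2 continuous_const)))
  · rintro y ⟨hy, hyΩ⟩
    rw [mem_closedBall_iff_norm] at hy
    have h1 : |⟪ν, y - x₀⟫_ℝ| ≤ h := by
      refine (abs_real_inner_le_norm ν _).trans ?_
      rwa [hν, one_mul]
    rw [inner_sub_right, abs_le] at h1
    have hyb : y ∈ Metric.ball c r := hsmall (by rw [mem_ball_iff_norm]; nlinarith)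
    have hyg : y ∈ Ω ∩ Metric.ball c r := ⟨hyΩ, hyb⟩
    rw [hgraph] at hyg
    exact ⟨(hPle _).trans_lt (by linarith), hyg.1, by linarith [h1.1], by
      nlinarith [h1.2, mul_nonneg hL hh.le]⟩
  · intro y hy
    have : y ∈ {y | φ y < ⟪ν, y⟫_ℝ} ∩ Metric.ball c r := ⟨hy.2.1, hsmall (hsubball hy)⟩
    rw [← hgraph] at this
    exact this.1
  · intro y hy
    obtain ⟨h1, h2, h3⟩ := hballz y hy
    have hLh := mul_nonneg hL hh.le
    exact ⟨by linarith, hhigh y (by linarith) (by nlinarith), by nlinarith, by nlinarith⟩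
  · intro x hx b hb
    obtain ⟨hb1, hb2, hb3⟩ := hballz b hb
    obtain ⟨hx1, hx2, hx3, hx4⟩ := (hcyl x).1 hx
    have hLh := mul_nonneg hL hh.le
    rw [segment_symm, segment_eq_image']
    rintro y ⟨t, ⟨ht0, ht1⟩, rfl⟩
    simp only
    have hin : ⟪ν, x + t • (b - x)⟫_ℝ = (1 - t) * ⟪ν, x⟫_ℝ + t * ⟪ν, b⟫_ℝ := by
      rw [inner_add_right, inner_smul_right, inner_sub_right]; ring
    have hPy : ‖P (x + t • (b - x) - x₀)‖ < 2 * h := by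
      have : x + t • (b - x) - x₀ = (1 - t) • (x - x₀) + t • (b - x₀) := by module
      rw [this, hPadd, hPsmul, hPsmul]
      refine (norm_add_le _ _).trans_lt ?_
      rw [norm_smul, norm_smul, Real.norm_of_nonneg ht0, Real.norm_of_nonneg (by linarith)]
      rcases ht0.eq_or_lt with rfl | ht
      · simpa using hx1
      · nlinarith [mul_le_mul_of_nonneg_left hx1.le (sub_nonneg.2 ht1)]
    have hmid1 : a - 2 * h < ⟪ν, x + t • (b - x)⟫_ℝ := by
      rw [hin]
      rcases ht0.eq_or_lt with rfl | ht
      · simpa using hx3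
      · nlinarith [mul_le_mul_of_nonneg_left hx3.le (sub_nonneg.2 ht1)]
    have hmid2 : ⟪ν, x + t • (b - x)⟫_ℝ < a + (6 * L + 4) * h := by
      rw [hin]
      rcases ht0.eq_or_lt with rfl | ht
      · simpa using hx4
      · nlinarith [mul_le_mul_of_nonneg_left hx4.le (sub_nonneg.2 ht1)]
    refine (hcyl _).2 ⟨hPy, ?_, hmid1, hmid2⟩
    -- Either both endpoints are so high that the whole segment is above the graph, or the segment
    -- is steep enough for the Lipschitz bound along it.
    rcases le_total (a + 3 * L * h) ⟪ν, x⟫_ℝ with hc | hc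
    · refine hhigh _ hPy ?_
      rw [hin]
      have h1 : a + 3 * L * h ≤ ⟪ν, b⟫_ℝ := by nlinarith
      nlinarith [mul_le_mul_of_nonneg_left hc (sub_nonneg.2 ht1), mul_le_mul_of_nonneg_left h1 ht0]
    · have h1 := hφle x (t • (b - x))
      have h2 : ‖P (t • (b - x))‖ ≤ t * (3 * h) := by
        rw [hPsmul, norm_smul, Real.norm_of_nonneg ht0]
        refine mul_le_mul_of_nonneg_left ?_ ht0
        have : b - x = (b - x₀) + (-1 : ℝ) • (x - x₀) := by module
        rw [this, hPadd, hPsmul]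
        refine (norm_add_le _ _).trans ?_
        rw [norm_smul]
        norm_num
        linarith
      rw [hin]
      have h3 : 3 * L * h ≤ ⟪ν, b⟫_ℝ - ⟪ν, x⟫_ℝ := by nlinarith
      nlinarith [mul_le_mul_of_nonneg_left h2 hL, mul_le_mul_of_nonneg_left h3 ht0]

/-- Balls work near points of Ω and graph cylinders near boundary points. Compactness of the closure
makes the admissible radius and the size ratio uniform. -/
theorem IsLipschitzDomain.exists_isStarNhd {Ω : Set (Pt d)} (hΩ : IsLipschitzDomain Ω) :
    ∃ r > 0, ∃ κ ≥ 1, ∀ x₀ ∈ Ω, ∀ h, 0 < h → h ≤ r → ∃ U z, IsStarNhd Ω x₀ h κ U z := by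
  have hcpt : IsCompact (closure Ω) := hΩ.isBounded.isCompact_closure
  have := hcpt.induction_on (p := fun s => ∃ r > (0 : ℝ), ∃ κ ≥ (1 : ℝ), ∀ x₀ ∈ Ω, x₀ ∈ s →
    ∀ h, 0 < h → h ≤ r → ∃ U z, IsStarNhd Ω x₀ h κ U z) ?_ ?_ ?_ ?_
  · obtain ⟨r, hr, κ, hκ, H⟩ := this
    exact ⟨r, hr, κ, hκ, fun x₀ hx₀ => H x₀ hx₀ (subset_closure hx₀)⟩
  · exact ⟨1, one_pos, 1, le_rfl, fun _ _ h => absurd h (notMem_empty _)⟩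
  · rintro s t hst ⟨r, hr, κ, hκ, H⟩
    exact ⟨r, hr, κ, hκ, fun x₀ hx₀ hs => H x₀ hx₀ (hst hs)⟩
  · rintro s t ⟨r, hr, κ, hκ, H⟩ ⟨r', hr', κ', hκ', H'⟩
    refine ⟨min r r', lt_min hr hr', max κ κ', hκ.trans (le_max_left _ _), ?_⟩
    rintro x₀ hx₀ (hs | ht) h hh hle
    · obtain ⟨U, z, hU⟩ := H x₀ hx₀ hs h hh (hle.trans (min_le_left _ _))
      exact ⟨U, z, hU.mono (le_max_left _ _) hh.le⟩
    · obtain ⟨U, z, hU⟩ := H' x₀ hx₀ ht h hh (hle.trans (min_le_right _ _))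
      exact ⟨U, z, hU.mono (le_max_right _ _) hh.le⟩
  · intro x hx
    by_cases hxΩ : x ∈ Ω
    · obtain ⟨R, hR, hsub⟩ := Metric.isOpen_iff.1 hΩ.isOpen x hxΩ
      refine ⟨Metric.ball x (R / 3), mem_nhdsWithin_of_mem_nhds
        (Metric.ball_mem_nhds _ (by positivity)), R / 3, by positivity, 2, by norm_num,
        fun x₀ _ hx₀ h hh hle => ⟨_, _, isStarNhd_ball hh ?_⟩⟩
      refine (Metric.ball_subset_ball' ?_).trans hsub
      rw [Metric.mem_ball] at hx₀
      linarith
    · have hfr : x ∈ frontier Ω := ⟨hx, by rwa [hΩ.isOpen.interior_eq]⟩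
      obtain ⟨ν, r, L, φ, hν, hr, hφ, hinv, hgraph⟩ := hΩ.lipschitz_boundary x hfr
      have hL : (0 : ℝ) ≤ L := L.2
      refine ⟨Metric.ball x (r / 2), mem_nhdsWithin_of_mem_nhds
        (Metric.ball_mem_nhds _ (by positivity)), r / 2 / (6 * L + 6), by positivity, 6 * L + 6,
        by linarith, fun x₀ hx₀ hx₀b h hh hle =>
          ⟨_, _, isStarNhd_graphCylinder hν hφ hinv hgraph hx₀ hh ?_⟩⟩
      refine Metric.ball_subset_ball' ?_
      rw [Metric.mem_ball] at hx₀b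
      rw [le_div_iff₀ (by positivity)] at hle
      linarith

end Star

end LpPDWG
end


noncomputable section

namespace LpPDWG

/-! ### Poincaré inequalities for continuously differentiable functions -/

section Poincare

open ENNReal

variable {d : ℕ}

theorem lintegral_biUnion_finset_le {α β : Type*} [MeasurableSpace α] (μ : Measure α)
    (t : Finset β) (s : β → Set α) (f : α → ℝ≥0∞) :
    ∫⁻ x in ⋃ i ∈ t, s i, f x ∂μ ≤ ∑ i ∈ t, ∫⁻ x in s i, f x ∂μ := by
  classical
  induction t using Finset.induction_on with
  | empty => simp
  | insert a t ha ih =>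
    rw [Finset.sum_insert ha, Finset.set_biUnion_insert]
    exact (lintegral_union_le _ _ _).trans (by gcongr)

/-- The Poincaré inequality on `U`, for continuously differentiable functions whose mean over `b`
is subtracted. -/
def HasPoincare (q : ℝ) (U b : Set (Pt d)) (C : ℝ≥0∞) : Prop :=
  ∀ z : Pt d → ℝ, ContDiff ℝ 1 z →
    ∫⁻ x in U, ‖z x - ⨍ y in b, z y‖ₑ ^ q ≤ C * ∫⁻ x in U, ‖fderiv ℝ z x‖ₑ ^ q

/-- Jensen's inequality for the normalized measure on `b`, after writing the difference to the mean
as a mean of differences. -/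
theorem lintegral_enorm_sub_average_le {q : ℝ} (hq : 1 ≤ q) {U b : Set (Pt d)}
    (hb0 : volume b ≠ 0) (hb : volume b ≠ ⊤) {z : Pt d → ℝ} (hz : ContDiff ℝ 1 z)
    (hzb : IntegrableOn z b) :
    ∫⁻ x in U, ‖z x - ⨍ y in b, z y‖ₑ ^ q ≤
      (volume b)⁻¹ * ∫⁻ x in U, ∫⁻ y in b, ‖z x - z y‖ₑ ^ q := by
  have hcz := hz.continuous
  have m1 : Measurable fun p : Pt d × Pt d => ‖z p.1 - z p.2‖ₑ ^ q :=
    ((hcz.comp continuous_fst).sub (hcz.comp continuous_snd)).enorm.measurable.pow_const q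
  rw [← lintegral_const_mul _ m1.lintegral_prod_right']
  refine lintegral_mono fun x => ?_
  have : IsFiniteMeasure (volume.restrict b) := ⟨by simpa using hb.lt_top⟩
  have : NeZero (volume.restrict b) := ⟨by simpa using hb0⟩
  have hm : ((volume.restrict b) univ)⁻¹ • (volume.restrict b) =
      (volume b)⁻¹ • (volume.restrict b) := by rw [Measure.restrict_apply_univ]
  have h1 : z x - ⨍ y in b, z y = ⨍ y in b, (z x - z y) := by
    rw [average_eq, average_eq, integral_sub (integrable_const _) hzb, integral_const, smul_sub,
      smul_smul, inv_mul_cancel₀, one_smul]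
    rw [measureReal_def, Measure.restrict_apply_univ]
    exact (ENNReal.toReal_ne_zero.2 ⟨hb0, hb⟩)
  calc ‖z x - ⨍ y in b, z y‖ₑ ^ q
      ≤ (∫⁻ y, ‖z x - z y‖ₑ ∂((volume b)⁻¹ • volume.restrict b)) ^ q := by
        rw [h1, average, hm]
        gcongr
        exact enorm_integral_le_lintegral_enorm _
    _ ≤ ∫⁻ y, ‖z x - z y‖ₑ ^ q ∂((volume b)⁻¹ • volume.restrict b) := by
        refine rpow_lintegral_le ?_ hq (continuous_const.sub hcz).enorm.measurable
        rw [Measure.smul_apply, Measure.restrict_apply_univ, smul_eq_mul,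
          ENNReal.inv_mul_cancel hb0 hb]
    _ = _ := by rw [lintegral_smul_measure, smul_eq_mul]

theorem measure_mul_lintegral_sub_le {q : ℝ} (hq : 1 ≤ q) (S V : Set (Pt d))
    {z : Pt d → ℝ} (hz : ContDiff ℝ 1 z) (m : ℝ) :
    volume V * ∫⁻ x in S, ‖z x - m‖ₑ ^ q ≤
      2 ^ (q - 1) * ((∫⁻ x in S, ∫⁻ y in V, ‖z x - z y‖ₑ ^ q) +
        volume S * ∫⁻ y in V, ‖z y - m‖ₑ ^ q) := by
  have hcz := hz.continuous
  have m1 : Measurable fun p : Pt d × Pt d => ‖z p.1 - z p.2‖ₑ ^ q :=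
    ((hcz.comp continuous_fst).sub (hcz.comp continuous_snd)).enorm.measurable.pow_const q
  have m2 : Measurable fun x : Pt d => ∫⁻ y in V, ‖z x - z y‖ₑ ^ q := m1.lintegral_prod_right'
  have m3 : Measurable fun x : Pt d => ‖z x - m‖ₑ ^ q :=
    (hcz.sub continuous_const).enorm.measurable.pow_const q
  have m4 : ∀ x, Measurable fun y : Pt d => ‖z x - z y‖ₑ ^ q := fun x =>
    (continuous_const.sub hcz).enorm.measurable.pow_const q
  have e1 : volume V * ∫⁻ x in S, ‖z x - m‖ₑ ^ q = ∫⁻ x in S, ∫⁻ _ in V, ‖z x - m‖ₑ ^ q := by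
    simp_rw [setLIntegral_const]
    rw [lintegral_mul_const _ m3, mul_comm]
  have e2 : volume S * ∫⁻ y in V, ‖z y - m‖ₑ ^ q = ∫⁻ _ in S, ∫⁻ y in V, ‖z y - m‖ₑ ^ q := by
    rw [setLIntegral_const, mul_comm]
  have m5 : Measurable fun x : Pt d => (∫⁻ y in V, ‖z x - z y‖ₑ ^ q) +
      ∫⁻ y in V, ‖z y - m‖ₑ ^ q := m2.add measurable_const
  rw [e1, e2, ← lintegral_add_left m2, ← lintegral_const_mul _ m5]
  refine lintegral_mono fun x => ?_
  change _ ≤ 2 ^ (q - 1) * ((∫⁻ y in V, ‖z x - z y‖ₑ ^ q) + ∫⁻ y in V, ‖z y - m‖ₑ ^ q)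
  have m6 : Measurable fun y : Pt d => ‖z x - z y‖ₑ ^ q + ‖z y - m‖ₑ ^ q := (m4 x).add m3
  rw [← lintegral_add_left (m4 x), ← lintegral_const_mul _ m6]
  refine lintegral_mono fun y => ?_
  calc ‖z x - m‖ₑ ^ q = ‖(z x - z y) + (z y - m)‖ₑ ^ q := by rw [sub_add_sub_cancel]
    _ ≤ (‖z x - z y‖ₑ + ‖z y - m‖ₑ) ^ q := by gcongr; exact enorm_add_le _ _
    _ ≤ _ := ENNReal.rpow_add_le_mul_rpow_add_rpow _ _ hq

/-- If the oscillation of z between `S` and `V` is controlled, control of z - m passes from `V` to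
`S`, with a constant independent of z and m. This moves the Poincaré inequality along chains of
overlapping sets while the subtracted mean stays fixed. -/
theorem lintegral_sub_le_of_lintegral_sub_le {q : ℝ} (hq : 1 ≤ q) {S V : Set (Pt d)}
    (hS : volume S ≠ ⊤) (hV0 : volume V ≠ 0) (hV : volume V ≠ ⊤) {C₁ C₂ : ℝ≥0∞}
    (h₁ : C₁ ≠ ⊤) (h₂ : C₂ ≠ ⊤) : ∃ C : ℝ≥0∞, C ≠ ⊤ ∧
      ∀ (z : Pt d → ℝ) (m : ℝ) (I : ℝ≥0∞), ContDiff ℝ 1 z →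
        ∫⁻ x in S, ∫⁻ y in V, ‖z x - z y‖ₑ ^ q ≤ C₁ * I → ∫⁻ y in V, ‖z y - m‖ₑ ^ q ≤ C₂ * I →
          ∫⁻ x in S, ‖z x - m‖ₑ ^ q ≤ C * I := by
  refine ⟨(volume V)⁻¹ * (2 ^ (q - 1) * (C₁ + volume S * C₂)), ?_, fun z m I hz hI₁ hI₂ => ?_⟩
  · have : (2 : ℝ≥0∞) ^ (q - 1) ≠ ⊤ := by simp [ENNReal.rpow_eq_top_iff]
    finiteness
  have h := measure_mul_lintegral_sub_le hq S V hz m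
  calc ∫⁻ x in S, ‖z x - m‖ₑ ^ q = (volume V)⁻¹ * (volume V * ∫⁻ x in S, ‖z x - m‖ₑ ^ q) := by
        rw [← mul_assoc, ENNReal.inv_mul_cancel hV0 hV, one_mul]
    _ ≤ (volume V)⁻¹ * (2 ^ (q - 1) * (C₁ * I + volume S * (C₂ * I))) := by
        refine mul_le_mul_right (h.trans ?_) _
        gcongr
    _ = _ := by ring

variable {Ω : Set (Pt d)} {x₀ z₀ : Pt d} {h κ : ℝ} {U : Set (Pt d)}

theorem IsStarNhd.enorm_sub_le (hs : IsStarNhd Ω x₀ h κ U z₀) {x y : Pt d}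
    (hx : x ∈ U) (hy : y ∈ U) : ‖x - y‖ₑ ≤ ENNReal.ofReal (2 * κ * h) := by
  rw [← ofReal_norm]
  refine ENNReal.ofReal_le_ofReal ?_
  have h1 := mem_ball_iff_norm.1 (hs.subset_ball hx)
  have h2 := mem_ball_iff_norm'.1 (hs.subset_ball hy)
  have : x - y = (x - x₀) + (x₀ - y) := by abel
  rw [this]
  refine (norm_add_le _ _).trans ?_
  linarith

theorem IsStarNhd.volume_ne_top (hs : IsStarNhd Ω x₀ h κ U z₀) : volume U ≠ ⊤ :=
  ((measure_mono hs.subset_ball).trans_lt measure_ball_lt_top).ne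

theorem IsStarNhd.lintegral_lintegral_le (hs : IsStarNhd Ω x₀ h κ U z₀) {q : ℝ} (hq : 1 ≤ q)
    {z : Pt d → ℝ} (hz : ContDiff ℝ 1 z) :
    ∫⁻ x in U, ∫⁻ y in Metric.ball z₀ h, ‖z x - z y‖ₑ ^ q ≤
      ENNReal.ofReal (2 * κ * h) ^ q * 2 ^ d * (volume U + volume (Metric.ball z₀ h)) *
        ∫⁻ x in U, ‖fderiv ℝ z x‖ₑ ^ q :=
  lintegral_lintegral_enorm_sub_rpow_le hz hs.isOpen.measurableSet measurableSet_ball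
    hs.isOpen.measurableSet hs.segment_subset
    (fun _ hx _ hy => hs.enorm_sub_le hx (hs.ball_subset hy)) hq

theorem integrableOn_ball_of_continuous {z : Pt d → ℝ} (hz : Continuous z) (c : Pt d) (r : ℝ) :
    IntegrableOn z (Metric.ball c r) :=
  integrableOn_of_bounded Metric.isBounded_ball measurableSet_ball measure_ball_lt_top hz

/-- The Poincaré inequality on a star-shaped neighbourhood. -/
theorem IsStarNhd.hasPoincare (hs : IsStarNhd Ω x₀ h κ U z₀) (hh : 0 < h) (hκ : 1 ≤ κ) {q : ℝ}
    (hq : 1 ≤ q) : HasPoincare q U (Metric.ball z₀ h)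
      (ENNReal.ofReal (2 * κ) ^ q * 2 ^ d * (ENNReal.ofReal κ ^ d + 1) * ENNReal.ofReal h ^ q) := by
  intro z hz
  have hb0 : volume (Metric.ball z₀ h) ≠ 0 := (Metric.measure_ball_pos _ _ hh).ne'
  have hbt : volume (Metric.ball z₀ h) ≠ ⊤ := measure_ball_lt_top.ne
  have hvol : volume U ≤ ENNReal.ofReal κ ^ d * volume (Metric.ball z₀ h) := by
    refine (measure_mono hs.subset_ball).trans (le_of_eq ?_)
    rw [Measure.addHaar_ball_mul_of_pos volume x₀ (by linarith), finrank_euclideanSpace, Fintype.card_fin,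
      ENNReal.ofReal_pow (by linarith), Measure.addHaar_ball_center volume z₀]
  refine (lintegral_enorm_sub_average_le hq hb0 hbt hz
    (integrableOn_ball_of_continuous hz.continuous _ _)).trans ?_
  calc (volume (Metric.ball z₀ h))⁻¹ * ∫⁻ x in U, ∫⁻ y in Metric.ball z₀ h, ‖z x - z y‖ₑ ^ q
      ≤ (volume (Metric.ball z₀ h))⁻¹ * (ENNReal.ofReal (2 * κ * h) ^ q * 2 ^ d *
        (ENNReal.ofReal κ ^ d * volume (Metric.ball z₀ h) + volume (Metric.ball z₀ h)) *
        ∫⁻ x in U, ‖fderiv ℝ z x‖ₑ ^ q) := by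
        gcongr
        refine (hs.lintegral_lintegral_le hq hz).trans ?_
        gcongr
    _ = ((volume (Metric.ball z₀ h))⁻¹ * volume (Metric.ball z₀ h)) *
        (ENNReal.ofReal (2 * κ * h) ^ q * 2 ^ d * (ENNReal.ofReal κ ^ d + 1) *
        ∫⁻ x in U, ‖fderiv ℝ z x‖ₑ ^ q) := by ring
    _ = _ := by
        rw [ENNReal.inv_mul_cancel hb0 hbt, one_mul, ENNReal.ofReal_mul (by linarith : 0 ≤ 2 * κ),
          ENNReal.mul_rpow_of_nonneg _ _ (by linarith : 0 ≤ q)]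
        ring

/-- The Poincaré inequality on a bounded connected Lipschitz domain. -/
theorem IsLipschitzDomain.exists_hasPoincare (hΩ : IsLipschitzDomain Ω) {q : ℝ} (hq : 1 ≤ q) :
    ∃ (c : Pt d) (r : ℝ), 0 < r ∧ Metric.ball c r ⊆ Ω ∧
      ∃ C : ℝ≥0∞, C ≠ ⊤ ∧ HasPoincare q Ω (Metric.ball c r) C := by
  obtain ⟨r, hr, κ, hκ, H⟩ := hΩ.exists_isStarNhd
  have H' := fun x₀ hx₀ => H x₀ hx₀ r hr le_rfl
  choose! U c hU using H'
  obtain ⟨a, ha⟩ := hΩ.isConnected.nonempty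
  set b := Metric.ball (c a) r with hb
  have hbU : b ⊆ U a := (hU a ha).ball_subset
  let I : (Pt d → ℝ) → ℝ≥0∞ := fun z => ∫⁻ x in Ω, ‖fderiv ℝ z x‖ₑ ^ q
  have hIle : ∀ x ∈ Ω, ∀ z : Pt d → ℝ, ∫⁻ y in U x, ‖fderiv ℝ z y‖ₑ ^ q ≤ I z := fun x hx z =>
    lintegral_mono_set (hU x hx).subset
  -- The points near which z, minus its mean over the fixed ball `b`, is controlled by the gradient
  -- on all of Ω, with a constant that may depend on the point.
  let Good : Pt d → Prop := fun x => ∃ C : ℝ≥0∞, C ≠ ⊤ ∧ ∀ z : Pt d → ℝ, ContDiff ℝ 1 z →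
    ∫⁻ y in Ω ∩ Metric.ball x r, ‖z y - ⨍ w in b, z w‖ₑ ^ q ≤ C * I z
  have hsubU : ∀ x ∈ Ω, Ω ∩ Metric.ball x r ⊆ U x := fun x hx y hy =>
    (hU x hx).closedBall_subset ⟨Metric.ball_subset_closedBall hy.2, hy.1⟩
  have hbase : Good a := by
    refine ⟨_, ?_, fun z hz => (lintegral_mono_set (hsubU a ha)).trans
      (((hU a ha).hasPoincare hr hκ hq z hz).trans (mul_le_mul_right (hIle a ha z) _))⟩
    finiteness
  -- Control passes from the overlap `V` of the two balls to the ball `B` in the star-shaped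
  -- neighbourhood of `y`, and from `B` to that whole neighbourhood. Two transfers are needed
  -- because the segment property is relative to `B` only.
  have hstep : ∀ x ∈ Ω, ∀ y ∈ Ω, dist x y < r → Good x → Good y := by
    rintro x hx y hy hxy ⟨C, hC, hCz⟩
    set V := Ω ∩ Metric.ball x r ∩ Metric.ball y r with hV
    have hVo : IsOpen V := (hΩ.isOpen.inter Metric.isOpen_ball).inter Metric.isOpen_ball
    have hV0 : volume V ≠ 0 := (hVo.measure_pos volume
      ⟨x, ⟨hx, Metric.mem_ball_self hr⟩, by rwa [Metric.mem_ball]⟩).ne'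
    have hVt : volume V ≠ ⊤ :=
      ((measure_mono inter_subset_right).trans_lt (measure_ball_lt_top (x := y) (r := r))).ne
    have hVU : V ⊆ U y := fun w hw => hsubU y hy ⟨hw.1.1, hw.2⟩
    set B := Metric.ball (c y) r with hB
    have hB0 : volume B ≠ 0 := (Metric.measure_ball_pos _ _ hr).ne'
    have hBt : volume B ≠ ⊤ := measure_ball_lt_top.ne
    set K := ENNReal.ofReal (2 * κ * r) ^ q * 2 ^ d * (volume (U y) + volume B) with hK
    have hKt : K ≠ ⊤ := by
      have := (hU y hy).volume_ne_top
      finiteness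
    obtain ⟨C', hC', h'⟩ := lintegral_sub_le_of_lintegral_sub_le hq hBt hV0 hVt hKt hC
    obtain ⟨C'', hC'', h''⟩ := lintegral_sub_le_of_lintegral_sub_le hq (hU y hy).volume_ne_top
      hB0 hBt hKt hC'
    refine ⟨C'', hC'', fun z hz => (lintegral_mono_set (hsubU y hy)).trans ?_⟩
    have hst : ∫⁻ x in U y, ∫⁻ w in B, ‖z x - z w‖ₑ ^ q ≤ K * I z :=
      ((hU y hy).lintegral_lintegral_le hq hz).trans (mul_le_mul_right (hIle y hy z) _)
    refine h'' z _ _ hz hst (h' z _ _ hz ?_ ?_)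
    · have hcz := hz.continuous
      have m1 : Measurable fun p : Pt d × Pt d => ‖z p.1 - z p.2‖ₑ ^ q :=
        ((hcz.comp continuous_fst).sub (hcz.comp continuous_snd)).enorm.measurable.pow_const q
      calc ∫⁻ x in B, ∫⁻ w in V, ‖z x - z w‖ₑ ^ q
          = ∫⁻ w in V, ∫⁻ x in B, ‖z x - z w‖ₑ ^ q := lintegral_lintegral_swap m1.aemeasurable
        _ = ∫⁻ w in V, ∫⁻ x in B, ‖z w - z x‖ₑ ^ q := by simp_rw [enorm_sub_rev]
        _ ≤ ∫⁻ w in U y, ∫⁻ x in B, ‖z w - z x‖ₑ ^ q := lintegral_mono_set hVU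
        _ ≤ _ := hst
    · exact (lintegral_mono_set inter_subset_left).trans (hCz z hz)
  -- The transfer has the fixed reach `r`, so the good points form an open and relatively closed
  -- subset of the connected set Ω.
  have hall : Ω ⊆ {x | Good x ∧ x ∈ Ω} := by
    refine hΩ.isConnected.isPreconnected.subset_of_closure_inter_subset ?_ ⟨a, ha, hbase, ha⟩ ?_
    · rw [Metric.isOpen_iff]
      rintro x ⟨hx, hxΩ⟩
      obtain ⟨s, hs, hsub⟩ := Metric.isOpen_iff.1 hΩ.isOpen x hxΩ
      refine ⟨min r s, lt_min hr hs, fun y hy => ?_⟩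
      have hyΩ := hsub (Metric.ball_subset_ball (min_le_right _ _) hy)
      exact ⟨hstep x hxΩ y hyΩ (Metric.mem_ball'.1 
        (Metric.ball_subset_ball (min_le_left _ _) hy)) hx, hyΩ⟩
    · rintro y ⟨hy, hyΩ⟩
      obtain ⟨x, ⟨hx, hxΩ⟩, hxy⟩ := Metric.mem_closure_iff.1 hy r hr
      exact ⟨hstep x hxΩ y hyΩ (by rwa [dist_comm]) hx, hyΩ⟩
  refine ⟨c a, r, hr, hbU.trans (hU a ha).subset, ?_⟩
  have hcpt : IsCompact (closure Ω) := hΩ.isBounded.isCompact_closure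
  have hcov : ∃ t : Finset (Pt d), (∀ x ∈ t, x ∈ Ω) ∧ Ω ⊆ ⋃ x ∈ t, Metric.ball x r := by
    obtain ⟨t, ht⟩ := hcpt.elim_finite_subcover (fun x : Ω => Metric.ball (x : Pt d) r)
      (fun _ => Metric.isOpen_ball) (fun y hy => by
        obtain ⟨x, hx, hxy⟩ := Metric.mem_closure_iff.1 hy r hr
        exact mem_iUnion.2 ⟨⟨x, hx⟩, hxy⟩)
    classical
    refine ⟨t.image Subtype.val, ?_, ?_⟩
    · simp +contextual
    · refine subset_closure.trans (ht.trans ?_)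
      simp
  obtain ⟨t, htΩ, ht⟩ := hcov
  choose! C hC hCz using fun x hx => (hall (a := x) hx).1
  refine ⟨∑ x ∈ t, C x, (ENNReal.sum_ne_top.2 fun x hx => hC x (htΩ x hx)), fun z hz => ?_⟩
  have hsub : Ω ⊆ ⋃ x ∈ t, Ω ∩ Metric.ball x r := by
    intro y hy
    obtain ⟨x, hx, hxy⟩ := mem_iUnion₂.1 (ht hy)
    exact mem_iUnion₂.2 ⟨x, hx, hy, hxy⟩
  rw [Finset.sum_mul]
  refine (lintegral_mono_set hsub).trans ?_
  refine (lintegral_biUnion_finset_le _ t _ _).trans ?_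
  exact Finset.sum_le_sum fun x hx => hCz x (htΩ x hx) z hz

end Poincare

end LpPDWG
end


noncomputable section

namespace LpPDWG

/-! ### Mollification -/

section Mollify

open ENNReal Convolution

variable {d : ℕ}

theorem eLpNorm_rpow_eq {α : Type*} [MeasurableSpace α] (μ : Measure α) {q : ℝ} (hq : 1 ≤ q)
    (f : α → ℝ) : eLpNorm f (ENNReal.ofReal q) μ ^ q = ∫⁻ x, ‖f x‖ₑ ^ q ∂μ := by
  have hq0 : 0 < q := by linarith
  rw [eLpNorm_eq_lintegral_rpow_enorm_toReal (by simpa using hq0) ofReal_ne_top,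
    toReal_ofReal hq0.le, ← ENNReal.rpow_mul, one_div_mul_cancel hq0.ne', ENNReal.rpow_one]

/-- Translations act continuously on `L^q`. -/
theorem tendsto_eLpNorm_translate {q : ℝ≥0∞} (hq1 : 1 ≤ q) (hq : q ≠ ⊤) {G : Pt d → ℝ}
    (hG : MemLp G q volume) :
    Tendsto (fun y : Pt d => eLpNorm (fun x => G (x - y) - G x) q volume) (𝓝 0) (𝓝 0) := by
  have : Fact (1 ≤ q) := ⟨hq1⟩
  have : Fact (q ≠ ⊤) := ⟨hq⟩
  have h1 : Tendsto (fun y : Pt d => DomAddAct.mk (-y) +ᵥ hG.toLp G) (𝓝 0)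
      (𝓝 (DomAddAct.mk (-(0 : Pt d)) +ᵥ hG.toLp G)) := by
    have : Continuous fun y : Pt d => DomAddAct.mk (-y) +ᵥ hG.toLp G :=
      (DomAddAct.continuous_mk.comp continuous_neg).vadd continuous_const
    exact this.tendsto 0
  rw [tendsto_iff_edist_tendsto_0] at h1
  refine h1.congr fun y => ?_
  rw [DomAddAct.mk_vadd_toLp, DomAddAct.mk_vadd_toLp, Lp.edist_toLp_toLp]
  refine eLpNorm_congr_ae (Eventually.of_forall fun x => ?_)
  simp [sub_eq_neg_add]

/-- A smooth probability density supported in the ball of radius `s` about the origin. -/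
structure IsMollifier (K : Pt d → ℝ) (s : ℝ) : Prop where
  contDiff : ContDiff ℝ ∞ K
  nonneg : ∀ x, 0 ≤ K x
  integral_eq_one : ∫ x, K x = 1
  tsupport_subset : tsupport K ⊆ Metric.closedBall 0 s

/-- The convolution of `G` with `K`. -/
def mollify (G K : Pt d → ℝ) : Pt d → ℝ :=
  convolution G K (ContinuousLinearMap.mul ℝ ℝ) volume

theorem mollify_apply (G K : Pt d → ℝ) (x : Pt d) : mollify G K x = ∫ y, G y * K (x - y) := rfl

theorem IsMollifier.hasCompactSupport {K : Pt d → ℝ} {s : ℝ} (hK : IsMollifier K s) :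
    HasCompactSupport K :=
  HasCompactSupport.of_support_subset_isCompact (isCompact_closedBall (0 : Pt d) s)
    (subset_closure.trans hK.tsupport_subset)

theorem IsMollifier.mollify_sub_eq {K : Pt d → ℝ} {s : ℝ} (hK : IsMollifier K s) {G : Pt d → ℝ}
    (hG : LocallyIntegrable G) (x : Pt d) :
    mollify G K x - G x = ∫ y, (G (x - y) - G x) * K y := by
  have h1 : mollify G K x = ∫ y, G (x - y) * K y := by
    rw [mollify_apply, ← integral_sub_left_eq_self _ _ x]
    simp
  have h2 : Integrable fun y => G (x - y) * K y := by
    have := (hK.hasCompactSupport.convolutionExists_right (ContinuousLinearMap.mul ℝ ℝ) hG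
      hK.contDiff.continuous x).integrable_swap
    simpa using this
  have h3 : Integrable K := hK.contDiff.continuous.integrable_of_hasCompactSupport
    hK.hasCompactSupport
  simp_rw [sub_mul]
  rw [integral_sub h2 (h3.const_mul _), integral_const_mul, hK.integral_eq_one, mul_one, h1]

/-- The mollification error is an average of translation differences against the probability measure
with density `K`; Jensen's inequality and Tonelli's theorem transfer the bound on single
translations to the average. -/
theorem IsMollifier.eLpNorm_mollify_sub_le {K : Pt d → ℝ} {s : ℝ} (hK : IsMollifier K s)
    {q : ℝ} (hq : 1 ≤ q) {G : Pt d → ℝ} (hG : MemLp G (ENNReal.ofReal q) volume)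
    (hGm : Measurable G) {δ : ℝ≥0∞} (hδ : ∀ y ∈ Metric.closedBall (0 : Pt d) s,
      eLpNorm (fun x => G (x - y) - G x) (ENNReal.ofReal q) volume ≤ δ) :
    eLpNorm (fun x => mollify G K x - G x) (ENNReal.ofReal q) volume ≤ δ := by
  have hq0 : 0 < q := by linarith
  have hGl : LocallyIntegrable G := hG.locallyIntegrable (by simpa using hq)
  have hKm : Measurable fun y => ENNReal.ofReal (K y) :=
    hK.contDiff.continuous.measurable.ennreal_ofReal
  set ν : Measure (Pt d) := volume.withDensity fun y => ENNReal.ofReal (K y) with hν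
  have hν1 : ν univ = 1 := by
    rw [hν, withDensity_apply _ MeasurableSet.univ, Measure.restrict_univ,
      ← ofReal_integral_eq_lintegral_ofReal
        (hK.contDiff.continuous.integrable_of_hasCompactSupport hK.hasCompactSupport)
        (Eventually.of_forall hK.nonneg), hK.integral_eq_one, ENNReal.ofReal_one]
  have : IsProbabilityMeasure ν := ⟨hν1⟩
  have hF : Measurable fun z : Pt d × Pt d => ‖G (z.1 - z.2) - G z.1‖ₑ ^ q :=
    (((hGm.comp (measurable_fst.sub measurable_snd)).sub
      (hGm.comp measurable_fst)).enorm).pow_const q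
  have hpt : ∀ x, ‖mollify G K x - G x‖ₑ ^ q ≤ ∫⁻ y, ‖G (x - y) - G x‖ₑ ^ q ∂ν := by
    intro x
    have hm : Measurable fun y => ‖G (x - y) - G x‖ₑ :=
      ((hGm.comp (measurable_const.sub measurable_id)).sub_const _).enorm
    refine le_trans ?_ (rpow_lintegral_le hν1.le hq hm)
    gcongr
    rw [hK.mollify_sub_eq hGl]
    refine (enorm_integral_le_lintegral_enorm _).trans (le_of_eq ?_)
    rw [hν, lintegral_withDensity_eq_lintegral_mul _ hKm hm]
    refine lintegral_congr fun y => ?_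
    rw [enorm_mul, Pi.mul_apply, mul_comm, Real.enorm_of_nonneg (hK.nonneg y)]
  rw [← ENNReal.rpow_le_rpow_iff hq0, eLpNorm_rpow_eq _ hq]
  calc ∫⁻ x, ‖mollify G K x - G x‖ₑ ^ q ≤ ∫⁻ x, ∫⁻ y, ‖G (x - y) - G x‖ₑ ^ q ∂ν :=
        lintegral_mono hpt
    _ = ∫⁻ y, (∫⁻ x, ‖G (x - y) - G x‖ₑ ^ q) ∂ν :=
        lintegral_lintegral_swap hF.aemeasurable
    _ ≤ ∫⁻ _, δ ^ q ∂ν := by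
        refine lintegral_mono_ae ?_
        rw [hν, ae_withDensity_iff hKm]
        refine Eventually.of_forall fun y hy => ?_
        rw [← eLpNorm_rpow_eq _ hq]
        gcongr
        refine hδ y (hK.tsupport_subset (subset_tsupport _ ?_))
        intro h0
        simp [h0] at hy
    _ = δ ^ q := by simp

theorem tendsto_eLpNorm_mollify_sub {q : ℝ} (hq : 1 ≤ q) {G : Pt d → ℝ}
    (hG : MemLp G (ENNReal.ofReal q) volume) {K : ℕ → Pt d → ℝ} {s : ℕ → ℝ}
    (hK : ∀ n, IsMollifier (K n) (s n)) (hs : Tendsto s atTop (𝓝 0)) :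
    Tendsto (fun n => eLpNorm (fun x => mollify G (K n) x - G x) (ENNReal.ofReal q) volume)
      atTop (𝓝 0) := by
  -- Tonelli's theorem for (x, y) ↦ G (x - y) is applied to a measurable representative of `G`.
  wlog hGm : Measurable G generalizing G
  · have h := hG.aestronglyMeasurable
    have he : G =ᵐ[volume] h.mk G := h.ae_eq_mk
    refine (this ((memLp_congr_ae he).1 hG) h.stronglyMeasurable_mk.measurable).congr fun n => ?_
    refine eLpNorm_congr_ae ?_
    filter_upwards [he] with x hx
    rw [hx]
    congr 1
    exact integral_congr_ae (by filter_upwards [he] with y hy; rw [hy])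
  rw [ENNReal.tendsto_nhds_zero]
  intro δ hδ
  have h := tendsto_eLpNorm_translate (by simpa using hq) ofReal_ne_top hG
  rw [ENNReal.tendsto_nhds_zero] at h
  obtain ⟨ε, hε, hball⟩ := Metric.eventually_nhds_iff.1 (h δ hδ)
  filter_upwards [hs.eventually (gt_mem_nhds hε)] with n hn
  refine (hK n).eLpNorm_mollify_sub_le hq hG hGm fun y hy => hball ?_
  exact (Metric.mem_closedBall.1 hy).trans_lt hn

theorem IsMollifier.contDiff_mollify {K : Pt d → ℝ} {s : ℝ} (hK : IsMollifier K s) {G : Pt d → ℝ}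
    (hG : LocallyIntegrable G) : ContDiff ℝ ∞ (mollify G K) :=
  hK.hasCompactSupport.contDiff_convolution_right _ hG hK.contDiff

theorem IsMollifier.fderiv_mollify {K : Pt d → ℝ} {s : ℝ} (hK : IsMollifier K s) {G : Pt d → ℝ}
    (hG : LocallyIntegrable G) (x v : Pt d) :
    fderiv ℝ (mollify G K) x v = ∫ y, G y * fderiv ℝ K (x - y) v := by
  have h1 : ContDiff ℝ 1 K := hK.contDiff.of_le (by exact_mod_cast le_top)
  rw [mollify, (hK.hasCompactSupport.hasFDerivAt_convolution_right
    (ContinuousLinearMap.mul ℝ ℝ) hG h1 x).fderiv,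
    convolution_precompR_apply _ hG (hK.hasCompactSupport.fderiv ℝ)
      (h1.continuous_fderiv one_ne_zero)]
  rfl

/-- Centring the bump at `c` instead of the origin produces kernels that sample only in a prescribed
direction. The radius ‖c‖ + ε is measured from the origin because convergence needs the kernels to
shrink to it. -/
theorem exists_isMollifier (c : Pt d) {ε : ℝ} (hε : 0 < ε) :
    ∃ K : Pt d → ℝ, IsMollifier K (‖c‖ + ε) ∧ tsupport K = Metric.closedBall c ε := by
  let f : ContDiffBump c := ⟨ε / 2, ε, by linarith, by linarith⟩
  refine ⟨f.normed volume, ⟨f.contDiff_normed, f.nonneg_normed, f.integral_normed, ?_⟩,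
    f.tsupport_normed_eq⟩
  rw [f.tsupport_normed_eq]
  refine Metric.closedBall_subset_closedBall' ?_
  rw [dist_zero_right, add_comm]

/-- Near every point of the closure of a Lipschitz domain there are mollifiers looking into the
domain. -/
theorem IsLipschitzDomain.exists_mollifiers {Ω : Set (Pt d)} (hΩ : IsLipschitzDomain Ω)
    {x₀ : Pt d} (hx₀ : x₀ ∈ closure Ω) :
    ∃ r > 0, ∃ (K : ℕ → Pt d → ℝ) (s : ℕ → ℝ), (∀ n, IsMollifier (K n) (s n)) ∧
      Tendsto s atTop (𝓝 0) ∧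
      ∀ n, ∀ x ∈ Ω, ∀ y ∈ Metric.ball x₀ r, x - y ∈ tsupport (K n) → y ∈ Ω := by
  have hlim : ∀ a : ℝ, Tendsto (fun n : ℕ => a * (1 / ((n : ℝ) + 1))) atTop (𝓝 0) := fun a => by
    simpa using tendsto_one_div_add_atTop_nhds_zero_nat.const_mul a
  by_cases hx : x₀ ∈ Ω
  · obtain ⟨r, hr, hb⟩ := Metric.isOpen_iff.1 hΩ.isOpen x₀ hx
    choose K hK _ using fun n : ℕ => exists_isMollifier (0 : Pt d)
      (ε := 1 * (1 / ((n : ℝ) + 1))) (by positivity)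
    exact ⟨r, hr, K, _, hK, by simpa using hlim 1, fun n x _ y hy _ => hb hy⟩
  obtain ⟨ν, r, L, φ, hν, hr, hL, hφ, hΩr⟩ :=
    hΩ.lipschitz_boundary x₀ (by rw [hΩ.isOpen.frontier_eq]; exact ⟨hx₀, hx⟩)
  have hL0 : (0 : ℝ) ≤ L := L.2
  -- With this choice the total displacement, at most (L + 2)ε with ε ≤ a, does not exceed r/2, so
  -- points near `x₀` stay in the ball where Ω is a region above a graph.
  set a : ℝ := r / (2 * (L + 2)) with ha
  have ha0 : 0 < a := by positivity
  have har : a * (L + 2) = r / 2 := by rw [ha]; field_simp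
  set ε : ℕ → ℝ := fun n => a * (1 / ((n : ℝ) + 1)) with hε
  have hε0 : ∀ n, 0 < ε n := fun n => by positivity
  have hεa : ∀ n, ε n ≤ a := fun n => by
    refine mul_le_of_le_one_right ha0.le ?_
    rw [div_le_one (by positivity)]
    simp
  -- The convolution samples at points raised by (L + 1)ε along ν, up to an error `w` of norm at
  -- most ε. That error can raise the graph by at most Lε and lower the point by at most ε, so the
  -- sampled point remains strictly above the graph.
  choose K hK hKs using fun n : ℕ => exists_isMollifier (-((L + 1) * ε n) • ν) (hε0 n)
  refine ⟨r / 2, by positivity, K, _, hK, ?_, fun n x hx y hy hxy => ?_⟩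
  · have : ∀ n, ‖-((L + 1) * ε n) • ν‖ + ε n = (L + 2) * a * (1 / ((n : ℝ) + 1)) := fun n => by
      rw [norm_smul, hν, norm_neg, Real.norm_of_nonneg (by have := hε0 n; positivity), hε]
      ring
    simp_rw [this]
    exact hlim _
  · rw [hKs n] at hxy
    set w : Pt d := x - y - -((L + 1) * ε n) • ν with hw
    have hwn : ‖w‖ ≤ ε n := by rwa [Metric.mem_closedBall, dist_eq_norm] at hxy
    have hy2 : y = (x - w) + ((L + 1) * ε n) • ν := by rw [hw]; module
    have hdist : dist x y ≤ r / 2 := by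
      rw [dist_eq_norm, show x - y = w - ((L + 1) * ε n) • ν by rw [hw]; module]
      refine (norm_sub_le _ _).trans ?_
      rw [norm_smul, hν, Real.norm_of_nonneg (by have := hε0 n; positivity)]
      nlinarith [hεa n]
    have hxb : x ∈ Metric.ball x₀ r := by
      have := dist_triangle x y x₀
      rw [Metric.mem_ball] at hy ⊢
      linarith
    have hyb : y ∈ Metric.ball x₀ r := Metric.ball_subset_ball (by linarith) hy
    have h1 : φ x < ⟪ν, x⟫_ℝ := by
      have : x ∈ Ω ∩ Metric.ball x₀ r := ⟨hx, hxb⟩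
      rw [hΩr] at this
      exact this.1
    have h2 : φ y ≤ φ x + L * ε n := by
      rw [hy2, hφ]
      have h3 := hL.dist_le_mul (x - w) x
      rw [Real.dist_eq, dist_eq_norm] at h3
      have h4 : ‖x - w - x‖ ≤ ε n := by rw [sub_sub_cancel_left, norm_neg]; exact hwn
      have h5 := (abs_le.1 h3).2
      nlinarith
    have h6 : ⟪ν, y⟫_ℝ = ⟪ν, x⟫_ℝ - ⟪ν, w⟫_ℝ + (L + 1) * ε n := by
      rw [hy2, inner_add_right, inner_sub_right, inner_smul_right, real_inner_self_eq_norm_sq, hν]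
      ring
    have h7 : ⟪ν, w⟫_ℝ ≤ ε n := by
      have := real_inner_le_norm ν w
      rw [hν] at this
      linarith
    have : y ∈ Ω ∩ Metric.ball x₀ r := by
      rw [hΩr]
      refine ⟨?_, hyb⟩
      change φ y < ⟪ν, y⟫_ℝ
      rw [h6]
      linarith
    exact this.1

/-- `g` is the weak gradient of `w` on `Ω`. -/
def HasWeakGrad (Ω : Set (Pt d)) (w : Pt d → ℝ) (g : Fin d → Pt d → ℝ) : Prop :=
  ∀ l, ∀ φ : Pt d → ℝ, ContDiff ℝ ∞ φ → HasCompactSupport φ → tsupport φ ⊆ Ω →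
    ∫ x in Ω, w x * fderiv ℝ φ x (EuclideanSpace.single l 1) = -∫ x in Ω, g l x * φ x

theorem memLp_smooth_mul {q : ℝ≥0∞} {μ : Measure (Pt d)} {ψ w : Pt d → ℝ} (hψ : Continuous ψ)
    (hc : HasCompactSupport ψ) (hw : MemLp w q μ) : MemLp (fun x => ψ x * w x) q μ := by
  obtain ⟨C, hC⟩ := hc.exists_bound_of_continuous hψ
  exact hw.of_le_mul (hψ.aestronglyMeasurable.mul hw.1) (c := C) (Eventually.of_forall fun x => by
    rw [norm_mul]; gcongr; exact hC x)

/-- The derivatives of a mollified localization of a weakly differentiable function. -/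
theorem HasWeakGrad.fderiv_mollify {Ω : Set (Pt d)} (hΩ : IsOpen Ω) {q : ℝ≥0∞} (hq : 1 ≤ q)
    {w : Pt d → ℝ} {g : Fin d → Pt d → ℝ} (hwg : HasWeakGrad Ω w g)
    (hw : MemLp w q (volume.restrict Ω)) (hg : ∀ l, MemLp (g l) q (volume.restrict Ω))
    {ψ : Pt d → ℝ} (hψ : ContDiff ℝ ∞ ψ) (hψc : HasCompactSupport ψ) {K : Pt d → ℝ} {s : ℝ}
    (hK : IsMollifier K s) {x : Pt d}
    (hsub : ∀ y ∈ tsupport ψ, x - y ∈ tsupport K → y ∈ Ω) (l : Fin d) :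
    fderiv ℝ (mollify (Ω.indicator fun y => ψ y * w y) K) x (EuclideanSpace.single l 1) =
      mollify (Ω.indicator fun y => fderiv ℝ ψ y (EuclideanSpace.single l 1) * w y +
        ψ y * g l y) K x := by
  set v : Pt d := EuclideanSpace.single l 1
  have h1ψ : ContDiff ℝ 1 ψ := hψ.of_le (by exact_mod_cast le_top)
  have h1K : ContDiff ℝ 1 K := hK.contDiff.of_le (by exact_mod_cast le_top)
  have hψ'c : HasCompactSupport fun y => fderiv ℝ ψ y v := hψc.fderiv_apply ℝ v
  have hψ' : Continuous fun y => fderiv ℝ ψ y v :=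
    (h1ψ.continuous_fderiv one_ne_zero).clm_apply continuous_const
  have hK' : Continuous fun y => fderiv ℝ K (x - y) v :=
    ((h1K.continuous_fderiv one_ne_zero).comp (by fun_prop)).clm_apply continuous_const
  have hGl : LocallyIntegrable (Ω.indicator fun y => ψ y * w y) :=
    ((memLp_indicator_iff_restrict hΩ.measurableSet).2
      (memLp_smooth_mul hψ.continuous hψc hw)).locallyIntegrable hq
  have hint : ∀ (a b : Pt d → ℝ), Continuous a → HasCompactSupport a →
      MemLp b q (volume.restrict Ω) → IntegrableOn (fun y => b y * a y) Ω := by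
    intro a b ha hac hb
    have : LocallyIntegrable (Ω.indicator b) :=
      ((memLp_indicator_iff_restrict hΩ.measurableSet).2 hb).locallyIntegrable hq
    have := this.integrable_smul_right_of_hasCompactSupport ha hac
    rw [← integrable_indicator_iff hΩ.measurableSet]
    refine this.congr (Eventually.of_forall fun y => ?_)
    by_cases hy : y ∈ Ω <;> simp [hy]
  rw [hK.fderiv_mollify hGl, mollify_apply]
  -- This product is an admissible test function on Ω because the kernel looks into Ω. That is why
  -- extension by zero outside Ω creates no boundary contribution in the derivative.
  have hφ : ContDiff ℝ ∞ fun y => ψ y * K (x - y) :=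
    hψ.mul (hK.contDiff.comp (contDiff_const.sub contDiff_id))
  have hφs : tsupport (fun y => ψ y * K (x - y)) ⊆ Ω := by
    intro y hy
    refine hsub y (tsupport_mul_subset_left hy) ?_
    have := tsupport_mul_subset_right hy
    exact tsupport_comp_subset_preimage K (f := fun y => x - y) (by fun_prop) this
  have hφ' : ∀ y, fderiv ℝ (fun y => ψ y * K (x - y)) y v =
      fderiv ℝ ψ y v * K (x - y) - ψ y * fderiv ℝ K (x - y) v := by
    intro y
    have hd : HasFDerivAt (fun y => K (x - y)) (-(fderiv ℝ K (x - y))) y := by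
      have h2 : HasFDerivAt (fun y : Pt d => x - y) (-ContinuousLinearMap.id ℝ (Pt d)) y := by
        simpa using (hasFDerivAt_id y).const_sub x
      have h3 := HasFDerivAt.comp y (f := fun y : Pt d => x - y)
        ((h1K.differentiable one_ne_zero) (x - y)).hasFDerivAt h2
      rw [ContinuousLinearMap.comp_neg, ContinuousLinearMap.comp_id] at h3
      exact h3
    rw [(((h1ψ.differentiable one_ne_zero) y).hasFDerivAt.fun_mul hd).fderiv]
    simp
    ring
  have key := hwg l _ hφ (hψc.mul_right) hφs
  change ∫ y in Ω, w y * fderiv ℝ (fun y => ψ y * K (x - y)) y v = _ at key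
  simp_rw [hφ'] at key
  have hKx : Continuous fun y => K (x - y) := hK.contDiff.continuous.comp (by fun_prop)
  have e1 : ∫ y, (Ω.indicator fun y => ψ y * w y) y * fderiv ℝ K (x - y) v =
      ∫ y in Ω, w y * (ψ y * fderiv ℝ K (x - y) v) := by
    rw [← integral_indicator hΩ.measurableSet]
    refine integral_congr_ae (Eventually.of_forall fun y => ?_)
    by_cases hy : y ∈ Ω <;> simp [hy]
    ring
  have e2 : ∫ y, (Ω.indicator fun y => fderiv ℝ ψ y v * w y + ψ y * g l y) y * K (x - y) =
      ∫ y in Ω, (w y * (fderiv ℝ ψ y v * K (x - y)) + g l y * (ψ y * K (x - y))) := by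
    rw [← integral_indicator hΩ.measurableSet]
    refine integral_congr_ae (Eventually.of_forall fun y => ?_)
    by_cases hy : y ∈ Ω <;> simp [hy]
    ring
  have i1 := hint (fun y => fderiv ℝ ψ y v * K (x - y)) w (hψ'.mul hKx) hψ'c.mul_right hw
  have i2 := hint (fun y => ψ y * fderiv ℝ K (x - y) v) w (hψ.continuous.mul hK') hψc.mul_right hw
  have i3 := hint (fun y => ψ y * K (x - y)) (g l) (hψ.continuous.mul hKx) hψc.mul_right (hg l)
  rw [e1, e2, integral_add i1 i3]
  simp_rw [mul_sub] at key
  rw [integral_sub i1 i2] at key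
  linarith

/-- Smooth functions on the whole space are dense in the Sobolev spaces of first order on a
Lipschitz domain. -/
theorem IsLipschitzDomain.exists_smooth_approx {Ω : Set (Pt d)} (hΩ : IsLipschitzDomain Ω)
    {q : ℝ} (hq : 1 ≤ q) {w : Pt d → ℝ} {g : Fin d → Pt d → ℝ} (hwg : HasWeakGrad Ω w g)
    (hw : MemLp w (ENNReal.ofReal q) (volume.restrict Ω))
    (hg : ∀ l, MemLp (g l) (ENNReal.ofReal q) (volume.restrict Ω)) :
    ∃ φ : ℕ → Pt d → ℝ, (∀ n, ContDiff ℝ ∞ (φ n)) ∧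
      Tendsto (fun n => eLpNorm (fun x => φ n x - w x) (ENNReal.ofReal q) (volume.restrict Ω))
        atTop (𝓝 0) ∧
      ∀ l, Tendsto (fun n => eLpNorm (fun x => fderiv ℝ (φ n) x (EuclideanSpace.single l 1) -
        g l x) (ENNReal.ofReal q) (volume.restrict Ω)) atTop (𝓝 0) := by
  have hq1 : 1 ≤ ENNReal.ofReal q := by simpa using hq
  choose! r hr K s hK hs hin using fun x₀ (hx₀ : x₀ ∈ closure Ω) => hΩ.exists_mollifiers hx₀
  obtain ⟨t, ψ, ht, hψ, hsum⟩ := exists_partition_of_compact hΩ.isBounded.isCompact_closure r hr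
  have hψc : ∀ i ∈ t, HasCompactSupport (ψ i) := fun i hi =>
    HasCompactSupport.of_support_subset_isCompact (isCompact_closedBall i (r i))
      ((subset_tsupport _).trans ((hψ i hi).2.trans Metric.ball_subset_closedBall))
  have hψ1 : ∀ i ∈ t, ContDiff ℝ 1 (ψ i) := fun i hi => (hψ i hi).1.of_le (by exact_mod_cast le_top)
  set W : Pt d → Pt d → ℝ := fun i => Ω.indicator fun y => ψ i y * w y with hWdef
  set G : Pt d → Fin d → Pt d → ℝ := fun i l => Ω.indicator fun y =>
    fderiv ℝ (ψ i) y (EuclideanSpace.single l 1) * w y + ψ i y * g l y with hGdef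
  have hW : ∀ i ∈ t, MemLp (W i) (ENNReal.ofReal q) volume := fun i hi =>
    (memLp_indicator_iff_restrict hΩ.isOpen.measurableSet).2
      (memLp_smooth_mul (hψ i hi).1.continuous (hψc i hi) hw)
  have hG : ∀ i ∈ t, ∀ l, MemLp (G i l) (ENNReal.ofReal q) volume := fun i hi l =>
    (memLp_indicator_iff_restrict hΩ.isOpen.measurableSet).2
      ((memLp_smooth_mul (((hψ1 i hi).continuous_fderiv one_ne_zero).clm_apply continuous_const)
        ((hψc i hi).fderiv_apply ℝ _) hw).add
        (memLp_smooth_mul (hψ i hi).1.continuous (hψc i hi) (hg l)))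
  have hsmooth : ∀ i ∈ t, ∀ n, ContDiff ℝ ∞ (mollify (W i) (K i n)) := fun i hi n =>
    (hK i (ht i hi) n).contDiff_mollify ((hW i hi).locallyIntegrable hq1)
  -- Used twice, for the functions and for their derivatives: in both cases the error on Ω is a
  -- finite sum of mollification errors of functions in L^q.
  have hconv : ∀ (F : Pt d → Pt d → ℝ), (∀ i ∈ t, MemLp (F i) (ENNReal.ofReal q) volume) →
      ∀ (D : ℕ → Pt d → ℝ), (∀ n, ∀ x ∈ Ω, D n x = ∑ i ∈ t, (mollify (F i) (K i n) x - F i x)) →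
      Tendsto (fun n => eLpNorm (D n) (ENNReal.ofReal q) (volume.restrict Ω)) atTop (𝓝 0) := by
    intro F hF D hD
    have hlim : Tendsto (fun n => ∑ i ∈ t, eLpNorm (fun x => mollify (F i) (K i n) x - F i x)
        (ENNReal.ofReal q) volume) atTop (𝓝 0) := by
      rw [show (0 : ℝ≥0∞) = ∑ i ∈ t, 0 by simp]
      exact tendsto_finsetSum _ fun i hi =>
        tendsto_eLpNorm_mollify_sub hq (hF i hi) (hK i (ht i hi)) (hs i (ht i hi))
    refine tendsto_of_tendsto_of_tendsto_of_le_of_le tendsto_const_nhds hlim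
      (fun _ => zero_le) fun n => ?_
    have he : eLpNorm (D n) (ENNReal.ofReal q) (volume.restrict Ω) =
        eLpNorm (∑ i ∈ t, fun x => mollify (F i) (K i n) x - F i x) (ENNReal.ofReal q)
          (volume.restrict Ω) := by
      refine eLpNorm_congr_ae ?_
      filter_upwards [ae_restrict_mem hΩ.isOpen.measurableSet] with x hx
      rw [hD n x hx, Finset.sum_apply]
    change eLpNorm (D n) _ _ ≤ _
    rw [he]
    refine (eLpNorm_mono_measure _ Measure.restrict_le_self).trans (eLpNorm_sum_le ?_ hq1)
    intro i hi
    exact (((hK i (ht i hi) n).contDiff_mollify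
      ((hF i hi).locallyIntegrable hq1)).continuous.aestronglyMeasurable).sub (hF i hi).1
  refine ⟨fun n x => ∑ i ∈ t, mollify (W i) (K i n) x, fun n => ContDiff.sum fun i hi =>
    hsmooth i hi n, hconv W hW _ fun n x hx => ?_, fun l => hconv (fun i => G i l)
      (fun i hi => hG i hi l) _ fun n x hx => ?_⟩
  · rw [Finset.sum_sub_distrib]
    congr 1
    simp_rw [hWdef, indicator_of_mem hx]
    rw [← Finset.sum_mul, hsum x (subset_closure hx), one_mul]
  · rw [Finset.sum_sub_distrib, fderiv_fun_sum fun i hi =>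
      (hsmooth i hi n).differentiable (by simp) x]
    rw [_root_.sum_apply]
    congr 1
    · refine Finset.sum_congr rfl fun i hi => ?_
      exact hwg.fderiv_mollify hΩ.isOpen hq1 hw hg (hψ i hi).1 (hψc i hi) (hK i (ht i hi) n)
        (fun y hy hxy => hin i (ht i hi) n x hx y ((hψ i hi).2 hy) hxy) l
    · simp_rw [hGdef, indicator_of_mem hx]
      rw [Finset.sum_add_distrib, ← Finset.sum_mul, ← Finset.sum_mul,
        hsum x (subset_closure hx), one_mul]
      -- The partition sums to one on a neighbourhood of x, so the derivatives falling on it cancel.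
      have h0 : ∑ i ∈ t, fderiv ℝ (ψ i) x (EuclideanSpace.single l 1) = 0 := by
        rw [← _root_.sum_apply, ← fderiv_fun_sum fun i hi =>
          (hψ1 i hi).differentiable one_ne_zero x]
        have : (fun y => ∑ i ∈ t, ψ i y) =ᶠ[𝓝 x] fun _ => 1 := by
          filter_upwards [hΩ.isOpen.mem_nhds hx] with y hy using hsum y (subset_closure hy)
        rw [this.fderiv_eq]
        simp
      rw [h0]
      ring

end Mollify

end LpPDWG
end


noncomputable section

namespace LpPDWG

/-! ### Poincaré inequalities for weakly differentiable functions -/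

section WeakPoincare

open ENNReal

variable {d : ℕ}

theorem enorm_le_sum_single (L : Pt d →L[ℝ] ℝ) :
    ‖L‖ₑ ≤ ∑ l, ‖L (EuclideanSpace.single l 1)‖ₑ := by
  have h : ‖L‖ ≤ ∑ l, ‖L (EuclideanSpace.single l 1)‖ := by
    refine L.opNorm_le_bound (Finset.sum_nonneg fun _ _ => norm_nonneg _) fun x => ?_
    have hx : x = ∑ l, x l • EuclideanSpace.single l (1 : ℝ) := by
      ext i
      simp [Finset.sum_apply, Pi.single_apply]
    conv_lhs => rw [hx]
    rw [map_sum, Finset.sum_mul]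
    refine (norm_sum_le _ _).trans (Finset.sum_le_sum fun l _ => ?_)
    rw [map_smul, norm_smul, mul_comm]
    gcongr
    exact PiLp.norm_apply_le x l
  rw [← ofReal_norm, ← Finset.sum_congr rfl fun l _ => ofReal_norm _,
    ← ENNReal.ofReal_sum_of_nonneg fun _ _ => norm_nonneg _]
  exact ENNReal.ofReal_le_ofReal h

theorem tendsto_integral_of_tendsto_eLpNorm {α : Type*} [MeasurableSpace α] {μ : Measure α}
    [IsFiniteMeasure μ] {q : ℝ≥0∞} (hq : 1 ≤ q) {F : ℕ → α → ℝ} {f : α → ℝ}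
    (hF : ∀ n, MemLp (F n) q μ) (hf : MemLp f q μ)
    (h : Tendsto (fun n => eLpNorm (fun x => F n x - f x) q μ) atTop (𝓝 0)) :
    Tendsto (fun n => ∫ x, F n x ∂μ) atTop (𝓝 (∫ x, f x ∂μ)) := by
  refine tendsto_integral_of_L1' f (hf.integrable hq).aestronglyMeasurable
    (Eventually.of_forall fun n => (hF n).integrable hq) ?_
  have hc : μ univ ^ (1 / (1 : ℝ≥0∞).toReal - 1 / q.toReal) ≠ ⊤ := by
    refine (ENNReal.rpow_lt_top_of_nonneg ?_ (measure_ne_top μ _)).ne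
    rcases eq_or_ne q ⊤ with rfl | hq'
    · simp
    · have : 1 ≤ q.toReal := by
        rwa [← ENNReal.toReal_one, ENNReal.toReal_le_toReal one_ne_top hq']
      rw [ENNReal.toReal_one, one_div_one, sub_nonneg, div_le_one (by linarith)]
      exact this
  have h2 := ENNReal.Tendsto.mul_const h (Or.inr hc)
  rw [zero_mul] at h2
  exact tendsto_of_tendsto_of_tendsto_of_le_of_le tendsto_const_nhds h2 (fun _ => zero_le)
    fun n => eLpNorm_le_eLpNorm_mul_rpow_measure_univ hq ((hF n).1.sub hf.1)

theorem memLp_restrict_of_continuous {q : ℝ≥0∞} {s : Set (Pt d)} (hs : Bornology.IsBounded s)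
    {μ : Measure (Pt d)} (hμ : μ s ≠ ⊤) {F : Pt d → ℝ} (hF : Continuous F) :
    MemLp F q (μ.restrict s) := by
  have : IsFiniteMeasure (μ.restrict s) := ⟨by rw [Measure.restrict_apply_univ]; exact hμ.lt_top⟩
  obtain ⟨C, hC⟩ := hs.isCompact_closure.bddAbove_image hF.norm.continuousOn
  refine MemLp.of_bound hF.aestronglyMeasurable C ?_
  have : ∀ᵐ x ∂μ.restrict (closure s), ‖F x‖ ≤ C :=
    (ae_restrict_iff' isClosed_closure.measurableSet).2
      (Eventually.of_forall fun x hx => hC ⟨x, hx, rfl⟩)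
  exact ae_mono (Measure.restrict_mono subset_closure le_rfl) this

theorem eLpNorm_fderiv_le {q : ℝ≥0∞} (hq : 1 ≤ q) {μ : Measure (Pt d)} {z : Pt d → ℝ}
    (hz : ContDiff ℝ 1 z) :
    eLpNorm (fun x => fderiv ℝ z x) q μ ≤
      ∑ l, eLpNorm (fun x => fderiv ℝ z x (EuclideanSpace.single l 1)) q μ := by
  have hc : ∀ l, Continuous fun x => fderiv ℝ z x (EuclideanSpace.single l 1) := fun l =>
    (hz.continuous_fderiv one_ne_zero).clm_apply continuous_const
  have h2 : eLpNorm (fun x => fderiv ℝ z x) q μ ≤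
      eLpNorm (∑ l, fun x => ‖fderiv ℝ z x (EuclideanSpace.single l 1)‖) q μ := by
    refine eLpNorm_mono_enorm fun x => (enorm_le_sum_single _).trans ?_
    rw [Finset.sum_apply, Real.enorm_of_nonneg (Finset.sum_nonneg fun _ _ => norm_nonneg _),
      ENNReal.ofReal_sum_of_nonneg fun _ _ => norm_nonneg _]
    exact le_of_eq (Finset.sum_congr rfl fun l _ => (ofReal_norm _).symm)
  refine h2.trans ((eLpNorm_sum_le (fun l _ => (hc l).norm.aestronglyMeasurable) hq).trans
    (le_of_eq ?_))
  exact Finset.sum_congr rfl fun l _ => eLpNorm_norm _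

theorem HasPoincare.eLpNorm_le {q : ℝ} (hq : 1 ≤ q) {U b : Set (Pt d)} {C : ℝ≥0∞}
    (h : HasPoincare q U b C) {z : Pt d → ℝ} (hz : ContDiff ℝ 1 z) :
    eLpNorm (fun x => z x - ⨍ y in b, z y) (ENNReal.ofReal q) (volume.restrict U) ≤
      C ^ (1 / q) * ∑ l, eLpNorm (fun x => fderiv ℝ z x (EuclideanSpace.single l 1))
        (ENNReal.ofReal q) (volume.restrict U) := by
  have hq0 : 0 < q := by linarith
  refine le_trans ?_ (mul_le_mul_right (eLpNorm_fderiv_le (by simpa using hq) hz) _)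
  rw [← ENNReal.rpow_le_rpow_iff hq0, ENNReal.mul_rpow_of_nonneg _ _ hq0.le,
    ← ENNReal.rpow_mul, one_div_mul_cancel hq0.ne', ENNReal.rpow_one, eLpNorm_rpow_eq _ hq]
  refine (h z hz).trans (le_of_eq ?_)
  congr 1
  rw [← eLpNorm_norm, eLpNorm_rpow_eq _ hq]
  simp

/-- The Poincaré inequality on a subset `U` of a Lipschitz domain, for weakly differentiable
functions whose mean over a ball vanishes. -/
theorem HasPoincare.of_hasWeakGrad {Ω : Set (Pt d)} (hΩ : IsLipschitzDomain Ω)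
    {q : ℝ} (hq : 1 ≤ q) {U : Set (Pt d)} (hU : U ⊆ Ω) {z₀ : Pt d} {r : ℝ}
    (hb : Metric.ball z₀ r ⊆ U) {C : ℝ≥0∞} (hC : C ≠ ⊤)
    (h : HasPoincare q U (Metric.ball z₀ r) C)
    {w : Pt d → ℝ} {g : Fin d → Pt d → ℝ} (hwg : HasWeakGrad Ω w g)
    (hw : MemLp w (ENNReal.ofReal q) (volume.restrict Ω))
    (hg : ∀ l, MemLp (g l) (ENNReal.ofReal q) (volume.restrict Ω))
    (h0 : ∫ x in Metric.ball z₀ r, w x = 0) :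
    eLpNorm w (ENNReal.ofReal q) (volume.restrict U) ≤
      C ^ (1 / q) * ∑ l, eLpNorm (g l) (ENNReal.ofReal q) (volume.restrict U) := by
  have hq0 : 0 < q := by linarith
  have hq1 : 1 ≤ ENNReal.ofReal q := by simpa using hq
  obtain ⟨φ, hφ, hlim, hlim'⟩ := hΩ.exists_smooth_approx hq hwg hw hg
  have hφ1 : ∀ n, ContDiff ℝ 1 (φ n) := fun n => (hφ n).of_le (by exact_mod_cast le_top)
  have hUb : Bornology.IsBounded U := hΩ.isBounded.subset hU
  have hle := Measure.restrict_mono_set volume hU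
  have hleb := Measure.restrict_mono_set volume (hb.trans hU)
  have hzero : ∀ {μ : Measure (Pt d)}, μ ≤ volume.restrict Ω → ∀ {D : ℕ → Pt d → ℝ},
      Tendsto (fun n => eLpNorm (D n) (ENNReal.ofReal q) (volume.restrict Ω)) atTop (𝓝 0) →
      Tendsto (fun n => eLpNorm (D n) (ENNReal.ofReal q) μ) atTop (𝓝 0) := fun hμ D hD =>
    tendsto_of_tendsto_of_tendsto_of_le_of_le tendsto_const_nhds hD (fun _ => zero_le)
      fun n => eLpNorm_mono_measure _ hμ
  have hfin : IsFiniteMeasure (volume.restrict (Metric.ball z₀ r)) :=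
    ⟨by rw [Measure.restrict_apply_univ]; exact Metric.isBounded_ball.measure_lt_top⟩
  have havg : Tendsto (fun n => ⨍ y in Metric.ball z₀ r, φ n y) atTop (𝓝 0) := by
    have := tendsto_integral_of_tendsto_eLpNorm (μ := volume.restrict (Metric.ball z₀ r)) hq1
      (fun n => memLp_restrict_of_continuous Metric.isBounded_ball
        Metric.isBounded_ball.measure_lt_top.ne (hφ n).continuous)
      (hw.mono_measure hleb) (hzero hleb hlim)
    rw [h0] at this
    simp_rw [average_eq, smul_eq_mul]
    simpa using this.const_mul _
  set c : ℕ → ℝ := fun n => ⨍ y in Metric.ball z₀ r, φ n y with hcdef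
  have hgm : ∀ l, AEStronglyMeasurable (g l) (volume.restrict U) := fun l => (hg l).1.mono_measure hle
  have hwm : AEStronglyMeasurable w (volume.restrict U) := hw.1.mono_measure hle
  have hd : ∀ n l, Continuous fun x => fderiv ℝ (φ n) x (EuclideanSpace.single l 1) := fun n l =>
    ((hφ1 n).continuous_fderiv one_ne_zero).clm_apply continuous_const
  -- The function is split into approximation error, deviation of the approximant from its mean over
  -- the ball, and that mean `c n`, which tends to zero because `w` has mean zero there.
  have hbound : ∀ n, eLpNorm w (ENNReal.ofReal q) (volume.restrict U) ≤
      eLpNorm (fun x => φ n x - w x) (ENNReal.ofReal q) (volume.restrict U) +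
        (C ^ (1 / q) * ∑ l, (eLpNorm (fun x => fderiv ℝ (φ n) x (EuclideanSpace.single l 1) - g l x)
          (ENNReal.ofReal q) (volume.restrict U) +
          eLpNorm (g l) (ENNReal.ofReal q) (volume.restrict U)) +
        ‖c n‖ₑ * volume U ^ (1 / q)) := by
    intro n
    have e1 : w = fun x => (w x - φ n x) + ((φ n x - c n) + c n) := by ext x; ring
    have e2 : eLpNorm (w - φ n) (ENNReal.ofReal q) (volume.restrict U) =
        eLpNorm (fun x => φ n x - w x) (ENNReal.ofReal q) (volume.restrict U) :=
      eLpNorm_sub_comm w (φ n) _ _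
    have e3 : eLpNorm (fun _ : Pt d => c n) (ENNReal.ofReal q) (volume.restrict U) ≤
        ‖c n‖ₑ * volume U ^ (1 / q) := by
      rw [eLpNorm_const' _ (by simpa using hq0) ofReal_ne_top, ENNReal.toReal_ofReal hq0.le,
        Measure.restrict_apply_univ]
    have m1 : AEStronglyMeasurable (fun x => φ n x - c n) (volume.restrict U) :=
      ((hφ n).continuous.sub continuous_const).aestronglyMeasurable
    conv_lhs => rw [e1]
    refine (eLpNorm_add_le (hwm.sub (hφ n).continuous.aestronglyMeasurable)
      (m1.add aestronglyMeasurable_const) hq1).trans ?_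
    rw [e2]
    gcongr
    refine (eLpNorm_add_le m1 aestronglyMeasurable_const hq1).trans ?_
    gcongr
    refine (h.eLpNorm_le hq (hφ1 n)).trans ?_
    gcongr with l
    have e4 : (fun x => fderiv ℝ (φ n) x (EuclideanSpace.single l 1)) =
        fun x => (fderiv ℝ (φ n) x (EuclideanSpace.single l 1) - g l x) + g l x := by
      ext x; ring
    conv_lhs => rw [e4]
    exact eLpNorm_add_le ((hd n l).aestronglyMeasurable.sub (hgm l)) (hgm l) hq1
  refine ge_of_tendsto' (x := atTop) ?_ hbound
  have hCq : C ^ (1 / q) ≠ ⊤ := (ENNReal.rpow_lt_top_of_nonneg (by positivity) hC).ne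
  have hUq : volume U ^ (1 / q) ≠ ⊤ :=
    (ENNReal.rpow_lt_top_of_nonneg (by positivity) hUb.measure_lt_top.ne).ne
  have t1 := hzero hle hlim
  have t2 : Tendsto (fun n => ∑ l, (eLpNorm (fun x => fderiv ℝ (φ n) x
      (EuclideanSpace.single l 1) - g l x) (ENNReal.ofReal q) (volume.restrict U) +
      eLpNorm (g l) (ENNReal.ofReal q) (volume.restrict U))) atTop
      (𝓝 (∑ l, (0 + eLpNorm (g l) (ENNReal.ofReal q) (volume.restrict U)))) :=
    tendsto_finsetSum _ fun l _ => (hzero hle (hlim' l)).add tendsto_const_nhds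
  have t3 : Tendsto (fun n => ‖c n‖ₑ * volume U ^ (1 / q)) atTop (𝓝 0) := by
    have := ENNReal.Tendsto.mul_const (f := atTop) (m := fun n => ‖c n‖ₑ) (a := 0)
      (b := volume U ^ (1 / q)) (by simpa using havg.enorm) (Or.inr hUq)
    simpa using this
  have := t1.add ((ENNReal.Tendsto.const_mul t2 (Or.inr hCq)).add t3)
  simpa using this

end WeakPoincare

end LpPDWG
end


noncomputable section

namespace LpPDWG

/-! ### Polynomials -/

section Polynomials

open MvPolynomial

variable {d : ℕ}

@[simp] theorem val_add (P Q : MvPolynomial (Fin d) ℝ) (x : Pt d) :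
    val (P + Q) x = val P x + val Q x := map_add _ _ _

@[simp] theorem val_sub (P Q : MvPolynomial (Fin d) ℝ) (x : Pt d) :
    val (P - Q) x = val P x - val Q x := map_sub _ _ _

@[simp] theorem val_mul (P Q : MvPolynomial (Fin d) ℝ) (x : Pt d) :
    val (P * Q) x = val P x * val Q x := map_mul _ _ _

@[simp] theorem val_smul (a : ℝ) (P : MvPolynomial (Fin d) ℝ) (x : Pt d) :
    val (a • P) x = a * val P x := by simp [val]

@[simp] theorem val_C (a : ℝ) (x : Pt d) : val (C a) x = a := eval_C _

@[simp] theorem val_zero (x : Pt d) : val 0 x = 0 := map_zero _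

@[simp] theorem val_X (l : Fin d) (x : Pt d) : val (X l) x = x l := eval_X _

theorem val_sum {ι : Type*} (s : Finset ι) (P : ι → MvPolynomial (Fin d) ℝ) (x : Pt d) :
    val (∑ i ∈ s, P i) x = ∑ i ∈ s, val (P i) x := map_sum _ _ _

theorem hasFDerivAt_val (P : MvPolynomial (Fin d) ℝ) (x : Pt d) :
    HasFDerivAt (val P) (∑ l, val (pderiv l P) x • (EuclideanSpace.proj l : Pt d →L[ℝ] ℝ)) x := by
  induction P using MvPolynomial.induction_on with
  | C a =>
    have : val (C a : MvPolynomial (Fin d) ℝ) = fun _ => a := funext fun _ => val_C a _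
    rw [this]
    simpa using hasFDerivAt_const a x
  | add P Q hP hQ =>
    have : val (P + Q) = fun x => val P x + val Q x := funext fun _ => val_add _ _ _
    rw [this]
    refine (hP.fun_add hQ).congr_fderiv ?_
    simp only [map_add, val_add, add_smul, Finset.sum_add_distrib]
  | mul_X P i hP =>
    have hX : HasFDerivAt (val (X i : MvPolynomial (Fin d) ℝ))
        (EuclideanSpace.proj i : Pt d →L[ℝ] ℝ) x := by
      have : val (X i : MvPolynomial (Fin d) ℝ) = fun y : Pt d => y i := by
        ext y
        rw [val_X]
      rw [this]
      exact (EuclideanSpace.proj i : Pt d →L[ℝ] ℝ).hasFDerivAt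
    have : val (P * X i) = fun x => val P x * val (X i) x := funext fun _ => val_mul _ _ _
    rw [this]
    refine (hP.fun_mul hX).congr_fderiv ?_
    have h1 : ∀ l, val (pderiv l (P * X i)) x = val P x * val (pderiv l (X i)) x +
        x i * val (pderiv l P) x := fun l => by
      rw [Derivation.leibniz, smul_eq_mul, smul_eq_mul, val_add, val_mul, val_mul, val_X]
    simp_rw [h1, add_smul, Finset.sum_add_distrib, Finset.smul_sum, smul_smul, val_X]
    congr 1
    rw [Finset.sum_eq_single i]
    · rw [pderiv_X_self, ← C_1, val_C, mul_one]
    · intro l _ hl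
      rw [pderiv_X_of_ne hl.symm, val_zero, mul_zero, zero_smul]
    · simp

theorem contDiff_val (P : MvPolynomial (Fin d) ℝ) {n : WithTop ℕ∞} : ContDiff ℝ n (val P) := by
  induction P using MvPolynomial.induction_on with
  | C a =>
    have : val (C a : MvPolynomial (Fin d) ℝ) = fun _ => a := funext fun _ => val_C a _
    rw [this]
    exact contDiff_const
  | add P Q hP hQ =>
    have : val (P + Q) = fun x => val P x + val Q x := funext fun _ => val_add _ _ _
    rw [this]
    exact hP.add hQ
  | mul_X P i hP =>
    have : val (P * X i) = fun x => val P x * (EuclideanSpace.proj i : Pt d →L[ℝ] ℝ) x :=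
      funext fun _ => by simp
    rw [this]
    exact hP.mul (ContinuousLinearMap.contDiff _)

theorem fderiv_val (P : MvPolynomial (Fin d) ℝ) (x v : Pt d) :
    fderiv ℝ (val P) x v = ∑ l, v l * val (pderiv l P) x := by
  rw [(hasFDerivAt_val P x).fderiv]
  simp [mul_comm]

theorem fderiv_val_single (P : MvPolynomial (Fin d) ℝ) (x : Pt d) (l : Fin d) :
    fderiv ℝ (val P) x (EuclideanSpace.single l 1) = val (pderiv l P) x := by
  rw [fderiv_val, Finset.sum_eq_single l]
  · simp
  · intro i _ hi
    simp [hi]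
  · simp

/-- The polynomial of degree less than `k` with derivatives `C (a + m)` at the origin. -/
def taylorPoly (k : ℕ) (C : (Fin d →₀ ℕ) → ℝ) (a : Fin d →₀ ℕ) : MvPolynomial (Fin d) ℝ :=
  ∑ m ∈ (Finsupp.finite_of_degree_le (σ := Fin d) k).toFinset,
    monomial m (C (a + m) / ∏ l, ((m l).factorial : ℝ))

theorem coeff_taylorPoly {k : ℕ} {C : (Fin d →₀ ℕ) → ℝ} (hC : ∀ a, k ≤ a.degree → C a = 0)
    (a m : Fin d →₀ ℕ) :
    coeff m (taylorPoly k C a) = C (a + m) / ∏ l, ((m l).factorial : ℝ) := by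
  classical
  rw [taylorPoly, coeff_sum]
  simp_rw [coeff_monomial]
  rw [Finset.sum_ite_eq']
  split_ifs with h
  · rfl
  · rw [hC, zero_div]
    rw [Finite.mem_toFinset, mem_ofPred_eq] at h
    rw [map_add]
    omega

/-- The multi-index argument is a shift of the coefficient family, so the members of the family are
exactly the derivatives of the one at 0. Derivatives of all orders can thus be handled within a
single family. -/
theorem pderiv_taylorPoly {k : ℕ} {C : (Fin d →₀ ℕ) → ℝ} (hC : ∀ a, k ≤ a.degree → C a = 0)
    (a : Fin d →₀ ℕ) (l : Fin d) :
    pderiv l (taylorPoly k C a) = taylorPoly k C (a + Finsupp.single l 1) := by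
  ext m
  rw [coeff_pderiv, coeff_taylorPoly hC, coeff_taylorPoly hC, add_right_comm a, ← add_assoc]
  have h : ∏ i, (((m + Finsupp.single l 1 : Fin d →₀ ℕ) i).factorial : ℝ) =
      (m l + 1) * ∏ i, ((m i).factorial : ℝ) := by
    rw [← Finset.mul_prod_erase _ _ (Finset.mem_univ l),
      ← Finset.mul_prod_erase _ (fun i => ((m i).factorial : ℝ)) (Finset.mem_univ l), ← mul_assoc]
    congr 1
    · simp [Nat.factorial_succ]
    · refine Finset.prod_congr rfl fun i hi => ?_
      have : i ≠ l := Finset.ne_of_mem_erase hi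
      simp [this.symm]
  have h0 : ∏ i, ((m i).factorial : ℝ) ≠ 0 :=
    Finset.prod_ne_zero_iff.2 fun i _ => by positivity
  have h1 : ((m l : ℝ) + 1) ≠ 0 := by positivity
  rw [h]
  field_simp

theorem taylorPoly_mem {k : ℕ} (hk : 1 ≤ k) {C : (Fin d →₀ ℕ) → ℝ}
    (hC : ∀ a, k ≤ a.degree → C a = 0) (a : Fin d →₀ ℕ) :
    taylorPoly k C a ∈ restrictTotalDegree (Fin d) ℝ (k - 1) := by
  rw [mem_restrictTotalDegree, totalDegree]
  refine Finset.sup_le fun m hm => ?_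
  by_contra hlt
  rw [mem_support_iff, coeff_taylorPoly hC, hC, zero_div] at hm
  · exact hm rfl
  · rw [map_add]
    have : m.degree = m.sum fun _ e => e := by
      rw [Finsupp.degree_apply, Finsupp.sum]
    omega

/-- A polynomial of degree less than `k` all of whose derivatives have prescribed means. -/
theorem exists_taylorPoly_integral_eq {b : Set (Pt d)} (hb : Bornology.IsBounded b)
    (hbm : MeasurableSet b) (hb0 : volume b ≠ 0) (k : ℕ) (c : (Fin d →₀ ℕ) → ℝ) :
    ∃ C : (Fin d →₀ ℕ) → ℝ, (∀ a, k ≤ a.degree → C a = 0) ∧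
      ∀ a, a.degree < k → ∫ x in b, val (taylorPoly k C a) x = c a := by
  have hV : volume.real b ≠ 0 := by
    rw [measureReal_def, ENNReal.toReal_ne_zero]
    exact ⟨hb0, hb.measure_lt_top.ne⟩
  -- Coefficients are fixed from the highest order downwards. Changing those of one order adds a
  -- constant to the derivatives of that order and leaves all higher derivatives alone.
  suffices ∀ n ≤ k, ∃ C : (Fin d →₀ ℕ) → ℝ, (∀ a, k ≤ a.degree → C a = 0) ∧
      ∀ a, k - n ≤ a.degree → a.degree < k → ∫ x in b, val (taylorPoly k C a) x = c a by
    obtain ⟨C, h1, h2⟩ := this k le_rfl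
    exact ⟨C, h1, fun a ha => h2 a (by omega) ha⟩
  intro n
  induction n with
  | zero => exact fun _ => ⟨0, fun _ _ => rfl, fun a h1 h2 => absurd h1 (by omega)⟩
  | succ n ih =>
    intro hn
    obtain ⟨D, hD, hDc⟩ := ih (by omega)
    set δ : (Fin d →₀ ℕ) → ℝ := fun a => (c a - ∫ x in b, val (taylorPoly k D a) x) / volume.real b
    set D' : (Fin d →₀ ℕ) → ℝ := fun a => if a.degree = k - (n + 1) then D a + δ a else D a
      with hD'def
    have hD' : ∀ a, k ≤ a.degree → D' a = 0 := fun a ha => by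
      rw [hD'def]
      simp only
      rw [if_neg (by omega), hD a ha]
    refine ⟨D', hD', fun a h1 h2 => ?_⟩
    rcases eq_or_ne a.degree (k - (n + 1)) with he | he
    · have hT : taylorPoly k D' a = taylorPoly k D a + C (δ a) := by
        ext m
        rw [coeff_add, coeff_taylorPoly hD', coeff_taylorPoly hD, coeff_C]
        rcases eq_or_ne m 0 with rfl | hm
        · simp [hD'def, he]
        · have : (a + m).degree ≠ k - (n + 1) := by
            rw [map_add, he]
            have : m.degree ≠ 0 := by rwa [ne_eq, Finsupp.degree_eq_zero_iff]
            omega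
          simp [hD'def, -map_add, this, hm.symm]
      have hi : IntegrableOn (fun x => val (taylorPoly k D a) x) b :=
        integrableOn_of_bounded hb hbm hb.measure_lt_top (continuous_val _)
      rw [hT]
      simp_rw [val_add, val_C]
      rw [integral_add hi (integrableOn_const hb.measure_lt_top.ne), setIntegral_const, smul_eq_mul]
      simp only [δ]
      field_simp
      ring
    · have hT : taylorPoly k D' a = taylorPoly k D a := by
        ext m
        rw [coeff_taylorPoly hD', coeff_taylorPoly hD]
        have : (a + m).degree ≠ k - (n + 1) := by
          rw [map_add]
          omega
        simp [hD'def, -map_add, this]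
      rw [hT]
      exact hDc a (by omega) h2

theorem totalDegree_pderiv_le (l : Fin d) (P : MvPolynomial (Fin d) ℝ) :
    (pderiv l P).totalDegree ≤ P.totalDegree - 1 := by
  refine Finset.sup_le fun m hm => ?_
  rw [mem_support_iff, coeff_pderiv] at hm
  have h := le_totalDegree (mem_support_iff.2 (left_ne_zero_of_mul hm))
  rw [Finsupp.sum_add_index' (fun _ => rfl) fun _ _ _ => rfl,
    Finsupp.sum_single_index rfl] at h
  omega

/-- The zero set of a nonzero polynomial is a null set. -/
theorem volume_setOf_val_eq_zero {P : MvPolynomial (Fin d) ℝ} (hP : P ≠ 0) :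
    volume {x : Pt d | val P x = 0} = 0 := by
  induction hn : P.totalDegree using Nat.strong_induction_on generalizing P with
  | _ n ih =>
  by_cases hall : ∀ l, pderiv l P = 0
  · have hconst : ∀ x, val P x = val P 0 := by
      intro x
      refine is_const_of_fderiv_eq_zero (𝕜 := ℝ)
        (fun y => (hasFDerivAt_val P y).differentiableAt) (fun y => ?_) x 0
      rw [(hasFDerivAt_val P y).fderiv]
      simp [hall]
    have h0 : val P 0 ≠ 0 := by
      intro h0
      exact hP (eq_zero_of_val_eq_zero isOpen_univ ⟨0, mem_univ _⟩ fun x _ => by rw [hconst x, h0])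
    have : {x : Pt d | val P x = 0} = ∅ := by
      ext x
      simp [hconst x, h0]
    rw [this, measure_empty]
  · push Not at hall
    obtain ⟨l, hl⟩ := hall
    -- On a line in direction l, zeros of `P` with nonvanishing l-th derivative are isolated, hence
    -- countable, so `S` is null. The other zeros are zeros of a nonzero polynomial of smaller
    -- degree.
    set S : Set (Pt d) := {x | val P x = 0 ∧ val (pderiv l P) x ≠ 0} with hS
    have hdeg : (pderiv l P).totalDegree < n := by
      have h1 := totalDegree_pderiv_le l P
      have h2 : P.totalDegree ≠ 0 := fun h => hl (by
        rw [totalDegree_eq_zero_iff_eq_C.1 h, pderiv_C])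
      omega
    have hSm : MeasurableSet S :=
      ((isClosed_singleton (x := (0 : ℝ))).preimage (continuous_val P)).measurableSet.inter
        ((isOpen_compl_singleton (x := (0 : ℝ))).preimage (continuous_val _)).measurableSet
    have hS0 : volume S = 0 := by
      have := ae_mem_of_ae_add_linearMap_mem (μ := (volume : Measure ℝ))
        (ν := (volume : Measure (Pt d))) (s := Sᶜ)
        ((LinearMap.toSpanSingleton ℝ (Pt d) (EuclideanSpace.single l 1))) hSm.compl fun y => ?_
      · exact measure_eq_zero_iff_ae_notMem.2 this
      · have hc : Set.Countable {t : ℝ | val P (y + t • EuclideanSpace.single l 1) = 0 ∧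
            val (pderiv l P) (y + t • EuclideanSpace.single l 1) ≠ 0} := by
          refine (countable_setOfPred_isolated_right_within (s := {t : ℝ |
            val P (y + t • EuclideanSpace.single l 1) = 0})).mono fun t ht => ?_
          refine ⟨ht.1, ?_⟩
          have hd : HasDerivAt (fun t : ℝ => val P (y + t • EuclideanSpace.single l 1))
              (val (pderiv l P) (y + t • EuclideanSpace.single l 1)) t := by
            have h2 : HasDerivAt (fun t : ℝ => y + t • EuclideanSpace.single l (1 : ℝ))
                (EuclideanSpace.single l 1) t := by
              simpa using ((hasDerivAt_id t).smul_const (EuclideanSpace.single l (1 : ℝ))).const_add y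
            have h3 := (hasFDerivAt_val P (y + t • EuclideanSpace.single l 1)).comp_hasDerivAt t h2
            rwa [← (hasFDerivAt_val P _).fderiv, fderiv_val_single] at h3
          have h3 := hd.eventually_ne (c := 0) ht.2
          rw [← Filter.eventually_false_iff_eq_bot]
          have h4 : 𝓝[{t : ℝ | val P (y + t • EuclideanSpace.single l 1) = 0} ∩ Ioi t] t ≤ 𝓝[≠] t :=
            nhdsWithin_mono _ fun z hz => (ne_of_gt hz.2)
          filter_upwards [h4 h3, self_mem_nhdsWithin] with z h5 h6
          exact h5 h6.1
        have h0 := hc.measure_zero volume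
        exact measure_eq_zero_iff_ae_notMem.1 h0
    refine measure_mono_null (t := S ∪ {x | val (pderiv l P) x = 0}) (fun x hx => ?_)
      (measure_union_null hS0 (ih _ hdeg hl rfl))
    by_cases h : val (pderiv l P) x = 0
    · exact Or.inr h
    · exact Or.inl ⟨hx, h⟩

end Polynomials

end LpPDWG
end


noncomputable section

namespace LpPDWG

/-! ### Equivalence of norms on polynomials -/

section NormEquiv

open MvPolynomial

variable {d : ℕ}

/-- Composition of a polynomial with the map `y ↦ x₀ + h y`. -/
theorem exists_val_comp_affine {r : ℕ} (P : Poly d r) (x₀ : Pt d) (h : ℝ) :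
    ∃ Q : Poly d r, ∀ y, val Q.1 y = val P.1 (x₀ + h • y) := by
  refine ⟨⟨aeval (fun l => C (x₀ l) + C h * X l) P.1, ?_⟩, fun y => ?_⟩
  · have hP := (mem_restrictTotalDegree _ _ _).1 P.2
    rw [mem_restrictTotalDegree, aeval_def, eval₂_eq']
    refine (totalDegree_finsetSum _ _).trans (Finset.sup_le fun m hm => ?_)
    refine (totalDegree_mul _ _).trans ?_
    have h1 : (algebraMap ℝ (MvPolynomial (Fin d) ℝ) (coeff m P.1)).totalDegree = 0 :=
      totalDegree_C _
    rw [h1, zero_add]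
    refine (totalDegree_finsetProd _ _).trans ?_
    have h2 : ∀ l : Fin d, ((C (x₀ l) + C h * X l : MvPolynomial (Fin d) ℝ)).totalDegree ≤ 1 := by
      intro l
      refine (totalDegree_add _ _).trans (max_le (by simp) ((totalDegree_mul _ _).trans ?_))
      simp
    refine le_trans (Finset.sum_le_sum fun l _ => (totalDegree_pow _ _).trans
      (Nat.mul_le_mul_left (m l) (h2 l))) ?_
    simp_rw [mul_one]
    refine le_trans ?_ ((le_totalDegree hm).trans hP)
    rw [Finsupp.sum_fintype _ _ fun _ => rfl]
  · simp only [val, aeval_def, eval₂_eq', map_sum, map_mul, map_prod, map_pow, map_add, eval_C,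
      eval_X, algebraMap_eq]
    rw [eval_eq']
    exact Finset.sum_congr rfl fun m _ => by simp

/-- Polynomials of bounded degree are controlled on the unit ball by their norm in `L²` of a
subset of at least a given measure. -/
theorem exists_sq_val_le_unit (d r : ℕ) {γ : ℝ} (hγ : 0 < γ) :
    ∃ C : ℝ, 0 < C ∧ ∀ P : Poly d r, ∀ T ⊆ Metric.closedBall (0 : Pt d) 1, MeasurableSet T →
      ENNReal.ofReal γ ≤ volume T → ∀ x ∈ Metric.closedBall (0 : Pt d) 1,
        val P.1 x ^ 2 ≤ C * ∫ y in T, val P.1 y ^ 2 := by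
  set b := Module.finBasis ℝ (Poly d r)
  set n := Module.finrank ℝ (Poly d r)
  set F : (Fin n → ℝ) → Poly d r := fun c => ∑ i, c i • b i with hF
  have hFv : ∀ c y, val (F c).1 y = ∑ i, c i * val (b i).1 y := by
    intro c y
    simp [hF, val_sum]
  have hcomp : IsCompact (Metric.closedBall (0 : Pt d) 1) := isCompact_closedBall _ _
  obtain ⟨m₀, hm₀⟩ : ∃ m₀ : ℝ, ∀ i, ∀ y ∈ Metric.closedBall (0 : Pt d) 1, |val (b i).1 y| ≤ m₀ := by
    choose m hm using fun i => hcomp.bddAbove_image (continuous_val (b i).1).abs.continuousOn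
    refine ⟨∑ i, |m i|, fun i y hy => ?_⟩
    exact (hm i ⟨y, hy, rfl⟩).trans ((le_abs_self _).trans
      (Finset.single_le_sum (f := fun i => |m i|) (fun j _ => abs_nonneg _) (Finset.mem_univ i)))
  set K : ℝ := n * |m₀| + 1
  have hK : 0 < K := by positivity
  have hbound : ∀ c y, y ∈ Metric.closedBall (0 : Pt d) 1 → |val (F c).1 y| ≤ K * ‖c‖ := by
    intro c y hy
    rw [hFv]
    calc |∑ i, c i * val (b i).1 y| ≤ ∑ i, |c i * val (b i).1 y| := Finset.abs_sum_le_sum_abs _ _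
      _ ≤ ∑ _i : Fin n, ‖c‖ * |m₀| := by
          refine Finset.sum_le_sum fun i _ => ?_
          rw [abs_mul]
          exact mul_le_mul (norm_le_pi_norm c i) ((hm₀ i y hy).trans (le_abs_self _))
            (abs_nonneg _) (norm_nonneg _)
      _ = n * |m₀| * ‖c‖ := by simp; ring
      _ ≤ K * ‖c‖ := by gcongr; simp [K]
  have hsub : ∀ c c' y, val (F c).1 y - val (F c').1 y = val (F (c - c')).1 y := by
    intro c c' y
    simp [hFv, sub_mul, Finset.sum_sub_distrib]
  have hsmul : ∀ (a : ℝ) c y, val (F (a • c)).1 y = a * val (F c).1 y := by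
    intro a c y
    simp [hFv, Finset.mul_sum, mul_assoc]
  obtain ⟨m, hm, hlow⟩ : ∃ m > 0, ∀ c ∈ Metric.sphere (0 : Fin n → ℝ) 1,
      ∀ T ⊆ Metric.closedBall (0 : Pt d) 1, MeasurableSet T → ENNReal.ofReal γ ≤ volume T →
        m ≤ ∫ y in T, val (F c).1 y ^ 2 := by
    -- Compactness of the coefficient sphere reduces the claim to a neighbourhood of one nonzero
    -- polynomial. Its sublevel sets shrink to a null set, so it exceeds some δ off a set of measure
    -- below γ/2. Nearby coefficients keep the bound δ/2, and at least γ/2 of every admissible `T`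
    -- remains, whatever its shape.
    refine (isCompact_sphere (0 : Fin n → ℝ) 1).induction_on (p := fun s => ∃ m > 0, ∀ c ∈ s,
      ∀ T ⊆ Metric.closedBall (0 : Pt d) 1, MeasurableSet T → ENNReal.ofReal γ ≤ volume T →
        m ≤ ∫ y in T, val (F c).1 y ^ 2) ⟨1, one_pos, fun c hc => hc.elim⟩ ?_ ?_ ?_
    · rintro s t hst ⟨m, hm, h⟩
      exact ⟨m, hm, fun c hc => h c (hst hc)⟩
    · rintro s t ⟨m, hm, h⟩ ⟨m', hm', h'⟩
      refine ⟨min m m', lt_min hm hm', fun c hc T hT hTm hTv => ?_⟩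
      rcases hc with hc | hc
      · exact (min_le_left _ _).trans (h c hc T hT hTm hTv)
      · exact (min_le_right _ _).trans (h' c hc T hT hTm hTv)
    · intro c hc
      have hFc : (F c).1 ≠ 0 := by
        intro h0
        have h1 : F c = 0 := Subtype.ext h0
        have h2 : ∀ i, c i = 0 := Fintype.linearIndependent_iff.1 b.linearIndependent c h1
        have : c = 0 := funext h2
        rw [this] at hc
        simp at hc
      set A : ℕ → Set (Pt d) := fun k =>
        {y | |val (F c).1 y| ≤ 1 / ((k : ℝ) + 1)} ∩ Metric.closedBall 0 1 with hA
      have hAm : ∀ k, MeasurableSet (A k) := fun k =>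
        ((isClosed_le (continuous_val _).abs continuous_const).inter
          Metric.isClosed_closedBall).measurableSet
      have hAanti : Antitone A := by
        intro k l hkl y hy
        have h1 : |val (F c).1 y| ≤ 1 / ((l : ℝ) + 1) := hy.1
        refine ⟨show |val (F c).1 y| ≤ 1 / ((k : ℝ) + 1) from h1.trans ?_, hy.2⟩
        gcongr
      have hA0 : volume (⋂ k, A k) = 0 := by
        refine measure_mono_null (fun y hy => ?_) (volume_setOf_val_eq_zero hFc)
        rw [mem_iInter] at hy
        have : |val (F c).1 y| ≤ 0 :=
          ge_of_tendsto' tendsto_one_div_add_atTop_nhds_zero_nat fun k => (hy k).1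
        exact abs_nonpos_iff.1 this
      have hlim := tendsto_measure_iInter_atTop (μ := volume)
        (fun k => (hAm k).nullMeasurableSet) hAanti
        ⟨0, ((measure_mono inter_subset_right).trans_lt hcomp.measure_lt_top).ne⟩
      rw [hA0] at hlim
      obtain ⟨k, hk⟩ := (hlim.eventually (gt_mem_nhds
        (ENNReal.ofReal_pos.2 (half_pos hγ)))).exists
      set δ : ℝ := 1 / ((k : ℝ) + 1) with hδ
      have hδ0 : 0 < δ := by positivity
      refine ⟨Metric.ball c (δ / (2 * K)), mem_nhdsWithin_of_mem_nhds
        (Metric.ball_mem_nhds c (by positivity)), (δ / 2) ^ 2 * (γ / 2), by positivity,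
        fun c' hc' T hT hTm hTv => ?_⟩
      have hTfin : volume T ≠ ⊤ := ((measure_mono hT).trans_lt hcomp.measure_lt_top).ne
      have hint : IntegrableOn (fun y => val (F c').1 y ^ 2) T :=
        ((continuous_val _).pow 2).continuousOn.integrableOn_compact hcomp |>.mono_set hT
      have hlow : ∀ y ∈ T \ A k, (δ / 2) ^ 2 ≤ val (F c').1 y ^ 2 := by
        intro y hy
        have hyB := hT hy.1
        have h1 : δ < |val (F c).1 y| := by
          by_contra hle
          exact hy.2 ⟨not_lt.1 hle, hyB⟩
        have h2 := hbound (c - c') y hyB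
        rw [← hsub] at h2
        have h3 : K * ‖c - c'‖ ≤ δ / 2 := by
          rw [Metric.mem_ball, dist_comm, dist_eq_norm, lt_div_iff₀ (by positivity)] at hc'
          linarith
        have h4 := abs_sub_abs_le_abs_sub (val (F c).1 y) (val (F c').1 y)
        rw [← sq_abs (val (F c').1 y)]
        gcongr
        linarith
      have hvol : ENNReal.ofReal (γ / 2) ≤ volume (T \ A k) := by
        have h1 := le_measure_sdiff (μ := volume) (s₁ := T) (s₂ := A k)
        refine le_trans ?_ h1
        refine le_trans ?_ (tsub_le_tsub hTv hk.le)
        rw [← ENNReal.ofReal_sub _ (by positivity)]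
        exact ENNReal.ofReal_le_ofReal (by linarith)
      have hTAfin : volume (T \ A k) ≠ ⊤ := (measure_mono sdiff_subset |>.trans_lt hTfin.lt_top).ne
      have hvol' : γ / 2 ≤ volume.real (T \ A k) := by
        rw [measureReal_def]
        exact (ENNReal.ofReal_le_iff_le_toReal hTAfin).1 hvol
      calc (δ / 2) ^ 2 * (γ / 2) ≤ (δ / 2) ^ 2 * volume.real (T \ A k) := by gcongr
        _ ≤ ∫ y in T \ A k, val (F c').1 y ^ 2 :=
            setIntegral_ge_of_const_le_real (hTm.diff (hAm k)) hTAfin hlow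
              (hint.mono_set sdiff_subset)
        _ ≤ ∫ y in T, val (F c').1 y ^ 2 :=
            setIntegral_mono_set hint (Eventually.of_forall fun y => sq_nonneg _)
              (Eventually.of_forall sdiff_subset)
  refine ⟨K ^ 2 / m, by positivity, fun P T hT hTm hTv x hx => ?_⟩
  set c : Fin n → ℝ := b.equivFun P with hc
  have hPc : P = F c := (b.sum_equivFun P).symm
  have h1 : m * ‖c‖ ^ 2 ≤ ∫ y in T, val P.1 y ^ 2 := by
    rcases eq_or_ne c 0 with h0 | h0
    · rw [h0, norm_zero]
      simpa using integral_nonneg fun y => sq_nonneg (val P.1 y)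
    · have hn : ‖c‖ ≠ 0 := norm_ne_zero_iff.2 h0
      have h2 := hlow (‖c‖⁻¹ • c) (by simp [norm_smul, hn]) T hT hTm hTv
      simp_rw [hsmul, mul_pow] at h2
      rw [integral_const_mul, ← hPc, inv_pow, ← div_eq_inv_mul,
        le_div_iff₀ (by positivity)] at h2
      exact h2
  calc val P.1 x ^ 2 ≤ (K * ‖c‖) ^ 2 := by
        rw [← sq_abs]
        have := hbound c x hx
        rw [← hPc] at this
        gcongr
    _ = K ^ 2 / m * (m * ‖c‖ ^ 2) := by field_simp
    _ ≤ _ := by gcongr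

/-- Polynomials of bounded degree are controlled on a ball by their norm in `L²` of a subset of
comparable measure. -/
theorem exists_sq_val_le (d r : ℕ) {γ : ℝ} (hγ : 0 < γ) :
    ∃ C : ℝ, 0 < C ∧ ∀ P : Poly d r, ∀ (x₀ : Pt d) (h : ℝ), 0 < h →
      ∀ T ⊆ Metric.closedBall x₀ h, MeasurableSet T →
      ENNReal.ofReal (γ * h ^ d) ≤ volume T → ∀ x ∈ Metric.closedBall x₀ h,
        val P.1 x ^ 2 ≤ C * (h ^ d)⁻¹ * ∫ y in T, val P.1 y ^ 2 := by
  obtain ⟨C, hC, hCP⟩ := exists_sq_val_le_unit d r hγ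
  refine ⟨C, hC, fun P x₀ h hh T hT hTm hTv x hx => ?_⟩
  obtain ⟨Q, hQ⟩ := exists_val_comp_affine P x₀ h
  set A : Pt d → Pt d := fun y => x₀ + h • y with hA
  have hAm : Measurable A := by fun_prop
  have hAball : ∀ y, A y ∈ Metric.closedBall x₀ h ↔ y ∈ Metric.closedBall (0 : Pt d) 1 := by
    intro y
    rw [Metric.mem_closedBall, Metric.mem_closedBall, dist_eq_norm, hA, add_sub_cancel_left,
      norm_smul, Real.norm_of_nonneg hh.le, dist_zero_right, mul_le_iff_le_one_right hh]
  have hpre : A ⁻¹' T = (fun y => h • y) ⁻¹' ((fun y => x₀ + y) ⁻¹' T) := rfl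
  have hd : Module.finrank ℝ (Pt d) = d := by simp
  have hpos : 0 < (h ^ d)⁻¹ := by positivity
  have hvol : ENNReal.ofReal γ ≤ volume (A ⁻¹' T) := by
    rw [hpre, Measure.addHaar_preimage_smul _ hh.ne', measure_preimage_add, hd,
      abs_of_pos hpos]
    refine le_trans (le_of_eq ?_) (mul_le_mul_right hTv _)
    rw [← ENNReal.ofReal_mul hpos.le]
    congr 1
    field_simp
  have hval := hCP Q (A ⁻¹' T) (fun y hy => (hAball y).1 (hT hy)) (hAm hTm) hvol (h⁻¹ • (x - x₀))
    ((hAball _).1 (by simpa [hA, smul_smul, hh.ne'] using hx))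
  rw [hQ] at hval
  simp only [smul_smul, mul_inv_cancel₀ hh.ne', one_smul, add_sub_cancel] at hval
  refine hval.trans (le_of_eq ?_)
  rw [mul_assoc]
  congr 1
  simp_rw [hQ]
  rw [← integral_indicator (hAm hTm), ← integral_indicator hTm]
  have h1 := Measure.integral_comp_smul (volume : Measure (Pt d))
    (fun y => T.indicator (fun y => val P.1 y ^ 2) (x₀ + y)) h
  rw [hd, abs_of_pos hpos, integral_add_left_eq_self (fun y => T.indicator (fun y => val P.1 y ^ 2) y),
    smul_eq_mul] at h1
  exact h1

theorem _root_.MeasureTheory.IntegrableOn.mul_continuous_of_bounded {T : Set (Pt d)}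
    {μ : Measure (Pt d)} {z : Pt d → ℝ} (hz : IntegrableOn z T μ) (hT : MeasurableSet T)
    (hTb : Bornology.IsBounded T) {F : Pt d → ℝ} (hF : Continuous F) :
    IntegrableOn (fun x => z x * F x) T μ := by
  obtain ⟨C, hC⟩ := hTb.isCompact_closure.bddAbove_image hF.norm.continuousOn
  refine hz.mul_bdd (c := C) hF.aestronglyMeasurable ?_
  exact (ae_restrict_iff' hT).2 (Eventually.of_forall fun x hx => hC ⟨x, subset_closure hx, rfl⟩)

/-- The projection onto polynomials in `L²` of an open set. -/
theorem exists_projection {T : Set (Pt d)} (hT : IsOpen T) (hTb : Bornology.IsBounded T)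
    (hne : T.Nonempty) (r : ℕ) {z : Pt d → ℝ} (hz : IntegrableOn z T) :
    ∃ Q : Poly d r, ∀ ψ : Poly d r,
      ∫ x in T, val Q.1 x * val ψ.1 x = ∫ x in T, z x * val ψ.1 x := by
  have hi : ∀ {F : Pt d → ℝ}, Continuous F → IntegrableOn F T := fun hF =>
    integrableOn_of_bounded hTb hT.measurableSet hTb.measure_lt_top hF
  have hiz : ∀ P : MvPolynomial (Fin d) ℝ, IntegrableOn (fun x => z x * val P x) T :=
    fun P => hz.mul_continuous_of_bounded hT.measurableSet hTb (continuous_val P)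
  have hv := fun P : MvPolynomial (Fin d) ℝ => continuous_val P
  let B : Poly d r →ₗ[ℝ] Poly d r →ₗ[ℝ] ℝ :=
    LinearMap.mk₂ ℝ (fun P ψ => ∫ x in T, val P.1 x * val ψ.1 x)
      (fun P P' ψ => by
        rw [← integral_add (hi (by fun_prop)) (hi (by fun_prop))]
        simp [add_mul])
      (fun a P ψ => by
        rw [smul_eq_mul, ← integral_const_mul]
        simp [mul_assoc])
      (fun P ψ ψ' => by
        rw [← integral_add (hi (by fun_prop)) (hi (by fun_prop))]
        simp [mul_add])
      (fun a P ψ => by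
        rw [smul_eq_mul, ← integral_const_mul]
        simp [mul_left_comm])
  let ℓ : Poly d r →ₗ[ℝ] ℝ :=
    { toFun := fun ψ => ∫ x in T, z x * val ψ.1 x
      map_add' := fun ψ ψ' => by
        rw [← integral_add (hiz _) (hiz _)]
        simp [mul_add]
      map_smul' := fun a ψ => by
        rw [RingHom.id_apply, smul_eq_mul, ← integral_const_mul]
        simp [mul_left_comm] }
  have hinj : Function.Injective B := by
    rw [← LinearMap.ker_eq_bot, LinearMap.ker_eq_bot']
    intro P hP
    have h0 : ∫ x in T, val P.1 x * val P.1 x = 0 := by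
      have := congrArg (fun f => f P) hP
      simpa [B] using this
    rw [integral_eq_zero_iff_of_nonneg (fun x => mul_self_nonneg (val P.1 x))
      (hi (by fun_prop))] at h0
    have h1 := Measure.eqOn_open_of_ae_eq h0 hT
      (by fun_prop : Continuous _).continuousOn continuousOn_const
    exact Subtype.ext (eq_zero_of_val_eq_zero hT hne fun x hx => mul_self_eq_zero.1 (h1 hx))
  have hsurj : Function.Surjective B :=
    (LinearMap.injective_iff_surjective_of_finrank_eq_finrank
      (Subspace.dual_finrank_eq (K := ℝ) (V := Poly d r)).symm).1 hinj
  obtain ⟨Q, hQ⟩ := hsurj ℓ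
  exact ⟨Q, fun ψ => congrArg (fun f => f ψ) hQ⟩

/-- Stability of the projection onto polynomials. -/
theorem exists_projection_bound (d r : ℕ) {γ : ℝ} (hγ : 0 < γ) :
    ∃ C : ℝ, 0 < C ∧ ∀ (x₀ : Pt d) (h : ℝ), 0 < h → ∀ T ⊆ Metric.closedBall x₀ h, IsOpen T →
      T.Nonempty → ENNReal.ofReal (γ * h ^ d) ≤ volume T → ∀ z : Pt d → ℝ, IntegrableOn z T →
      ∃ Q : Poly d r, (∀ ψ : Poly d r,
        ∫ x in T, val Q.1 x * val ψ.1 x = ∫ x in T, z x * val ψ.1 x) ∧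
        ∀ x ∈ Metric.closedBall x₀ h, |val Q.1 x| ≤ C * (h ^ d)⁻¹ * ∫ x in T, |z x| := by
  obtain ⟨C, hC, hCP⟩ := exists_sq_val_le d r hγ
  refine ⟨C, hC, fun x₀ h hh T hT hTo hne hTv z hz => ?_⟩
  obtain ⟨Q, hQ⟩ := exists_projection hTo (Metric.isBounded_closedBall.subset hT) hne r hz
  refine ⟨Q, hQ, ?_⟩
  -- With m the maximum of |Q| on the ball, m² ≤ C h^(-d) ∫ Q² = C h^(-d) ∫ z Q ≤ C h^(-d) m ∫ |z|;
  -- one factor m cancels, and the projection is bounded pointwise by an L¹ norm.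
  obtain ⟨y, hy, hmax⟩ := (isCompact_closedBall x₀ h).exists_isMaxOn
    ⟨x₀, Metric.mem_closedBall_self hh.le⟩ (continuous_val Q.1).abs.continuousOn
  suffices hs : |val Q.1 y| ≤ C * (h ^ d)⁻¹ * ∫ x in T, |z x| from
    fun x hx => (hmax hx).trans hs
  rcases eq_or_lt_of_le (abs_nonneg (val Q.1 y)) with h0 | h0
  · rw [← h0]
    have : 0 ≤ ∫ x in T, |z x| := integral_nonneg fun x => abs_nonneg _
    positivity
  have h1 := hCP Q x₀ h hh T hT hTo.measurableSet hTv y hy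
  have h2 : ∫ x in T, val Q.1 x ^ 2 ≤ |val Q.1 y| * ∫ x in T, |z x| := by
    simp_rw [sq]
    rw [hQ Q, ← integral_const_mul]
    refine setIntegral_mono_on (hz.mul_continuous_of_bounded hTo.measurableSet
      (Metric.isBounded_closedBall.subset hT) (continuous_val Q.1)) (hz.abs.const_mul _)
      hTo.measurableSet fun x hx => ?_
    refine (le_abs_self _).trans ?_
    rw [abs_mul, mul_comm]
    exact mul_le_mul_of_nonneg_right (hmax (hT hx)) (abs_nonneg _)
  rw [← sq_abs, sq] at h1
  refine le_of_mul_le_mul_right (h1.trans ?_) h0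
  have : 0 ≤ C * (h ^ d)⁻¹ := by positivity
  calc C * (h ^ d)⁻¹ * ∫ x in T, val Q.1 x ^ 2 ≤ C * (h ^ d)⁻¹ * (|val Q.1 y| * ∫ x in T, |z x|) := by
        gcongr
    _ = _ := by ring

end NormEquiv

end LpPDWG
end


noncomputable section

namespace LpPDWG

/-! ### Weak derivatives indexed by multi-indices -/

section Jets

open ENNReal

variable {d : ℕ}

/-- Iterated partial derivatives, indexed by words. -/
def listDeriv : List (Fin d) → (Pt d → ℝ) → Pt d → ℝ
  | [], φ => φ
  | l :: L, φ => listDeriv L fun x => fderiv ℝ φ x (EuclideanSpace.single l 1)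

theorem contDiff_fderiv_single {φ : Pt d → ℝ} (hφ : ContDiff ℝ ∞ φ) (v : Pt d) :
    ContDiff ℝ ∞ fun x => fderiv ℝ φ x v :=
  (hφ.fderiv_right (m := ∞) (by simp)).clm_apply contDiff_const

theorem fderiv_fderiv_comm {φ : Pt d → ℝ} (hφ : ContDiff ℝ ∞ φ) (v w x : Pt d) :
    fderiv ℝ (fun y => fderiv ℝ φ y v) x w = fderiv ℝ (fun y => fderiv ℝ φ y w) x v := by
  have hd : DifferentiableAt ℝ (fderiv ℝ φ) x :=
    ((hφ.fderiv_right (m := ∞) (by simp)).differentiable (by simp)) x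
  have h : ∀ v w, fderiv ℝ (fun y => fderiv ℝ φ y v) x w = fderiv ℝ (fderiv ℝ φ) x w v := by
    intro v w
    rw [fderiv_clm_apply hd (differentiableAt_const v)]
    simp
  rw [h, h]
  exact (hφ.contDiffAt.isSymmSndFDerivAt
    (by rw [minSmoothness_of_isRCLikeNormedField]; exact ENat.LEInfty.out)) w v

/-- Symmetry of second derivatives is the case of an adjacent transposition, and these generate all
permutations. Hence only the multi-index of a word matters. -/
theorem listDeriv_perm {L L' : List (Fin d)} (h : L.Perm L') {φ : Pt d → ℝ}
    (hφ : ContDiff ℝ ∞ φ) : listDeriv L φ = listDeriv L' φ := by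
  induction h generalizing φ with
  | nil => rfl
  | cons l _ ih => exact ih (contDiff_fderiv_single hφ _)
  | swap a b L =>
    change listDeriv L _ = listDeriv L _
    congr 1
    ext x
    exact fderiv_fderiv_comm hφ _ _ _
  | trans _ _ ih1 ih2 => exact (ih1 hφ).trans (ih2 hφ)

theorem partialDeriv_eq_listDeriv {m : ℕ} (α : Fin m → Fin d) {φ : Pt d → ℝ}
    (hφ : ContDiff ℝ ∞ φ) : partialDeriv α φ = listDeriv (List.ofFn α) φ := by
  -- The innermost derivative is the last vector for `iteratedFDeriv` but the head of the list for
  -- `listDeriv`; reversing the word aligns the two recursions.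
  rw [listDeriv_perm (List.reverse_perm (List.ofFn α)).symm hφ]
  induction m generalizing φ with
  | zero =>
    ext x
    simp [partialDeriv, listDeriv]
  | succ m ih =>
    rw [List.ofFn_succ', List.concat_eq_append, List.reverse_append, List.reverse_singleton,
      List.singleton_append, listDeriv, ← ih _ (contDiff_fderiv_single hφ _)]
    ext x
    rw [partialDeriv, partialDeriv, iteratedFDeriv_succ_apply_right]
    set v : Pt d := EuclideanSpace.single (α (Fin.last m)) 1
    have h := (ContinuousLinearMap.apply ℝ ℝ v).iteratedFDeriv_comp_left
      (f := fderiv ℝ φ) (x := x) (n := ∞) (hφ.fderiv_right (m := ∞) (by simp)).contDiffAt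
      (i := m) (by exact_mod_cast le_top)
    have h2 : (ContinuousLinearMap.apply ℝ ℝ v) ∘ (fderiv ℝ φ) = fun y => fderiv ℝ φ y v := rfl
    rw [h2] at h
    rw [h]
    rfl

theorem isWeakPartial_iff_listDeriv {Ω : Set (Pt d)} {m : ℕ} {u v : Pt d → ℝ} {α : Fin m → Fin d} :
    IsWeakPartial Ω u α v ↔ LocallyIntegrableOn v Ω ∧
      ∀ φ : Pt d → ℝ, ContDiff ℝ ∞ φ → HasCompactSupport φ → tsupport φ ⊆ Ω →
        ∫ x in Ω, u x * listDeriv (List.ofFn α) φ x = (-1) ^ m * ∫ x in Ω, v x * φ x := by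
  refine and_congr_right fun _ => forall_congr' fun φ => forall_congr' fun hφ => ?_
  rw [partialDeriv_eq_listDeriv α hφ]

/-- The fundamental lemma of the calculus of variations on an open set. It yields uniqueness of weak
derivatives, and later the pointwise transport equation. -/
theorem ae_eq_of_setIntegral_mul_eq {Ω : Set (Pt d)} (hΩ : IsOpen Ω) {v w : Pt d → ℝ}
    (hv : LocallyIntegrableOn v Ω) (hw : LocallyIntegrableOn w Ω)
    (h : ∀ φ : Pt d → ℝ, ContDiff ℝ ∞ φ → HasCompactSupport φ → tsupport φ ⊆ Ω →
      ∫ x in Ω, v x * φ x = ∫ x in Ω, w x * φ x) : v =ᵐ[volume.restrict Ω] w := by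
  have h0 := hΩ.ae_eq_zero_of_integral_contDiff_smul_eq_zero (f := fun x => v x - w x)
    (hv.sub hw) fun φ hφ hc hs => ?_
  · refine (ae_restrict_iff' hΩ.measurableSet).2 ?_
    filter_upwards [h0] with x hx hxΩ
    exact sub_eq_zero.1 (hx hxΩ)
  · have hi : ∀ f : Pt d → ℝ, LocallyIntegrableOn f Ω → IntegrableOn (fun x => f x * φ x) Ω := by
      intro f hf
      have h1 : IntegrableOn f (tsupport φ) := hf.integrableOn_compact_subset hs hc
      obtain ⟨C, hC⟩ := hc.exists_bound_of_continuous hφ.continuous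
      have h2 : IntegrableOn (fun x => f x * φ x) (tsupport φ) :=
        h1.mul_bdd (c := C) hφ.continuous.aestronglyMeasurable (Eventually.of_forall hC)
      have h3 : Integrable fun x => f x * φ x := by
        rw [← integrableOn_iff_integrable_of_support_subset (s := tsupport φ)]
        · exact h2
        · intro x hx
          exact subset_tsupport _ (right_ne_zero_of_mul hx)
      exact h3.integrableOn
    have h1 : ∫ x, φ x • (v x - w x) = ∫ x in Ω, φ x • (v x - w x) := by
      rw [setIntegral_eq_integral_of_forall_compl_eq_zero]
      intro x hx
      rw [image_eq_zero_of_notMem_tsupport fun hx' => hx (hs hx'), zero_smul]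
    rw [h1]
    simp_rw [smul_eq_mul, mul_comm (φ _), sub_mul]
    rw [integral_sub (hi v hv) (hi w hw), h φ hφ hc hs, sub_self]

theorem memLp_locallyIntegrableOn {Ω : Set (Pt d)} {q : ℝ≥0∞} (hq : 1 ≤ q) {v : Pt d → ℝ}
    (hv : MemLp v q (volume.restrict Ω)) : LocallyIntegrableOn v Ω :=
  locallyIntegrableOn_of_locallyIntegrable_restrict (hv.locallyIntegrable hq)

/-- A Sobolev function together with its weak derivatives, indexed by multi-indices. -/
structure IsSobolevJet (Ω : Set (Pt d)) (k : ℕ) (q : ℝ) (v : (Fin d →₀ ℕ) → Pt d → ℝ) : Prop where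
  memLp : ∀ a, a.degree ≤ k → MemLp (v a) (ENNReal.ofReal q) (volume.restrict Ω)
  hasWeakGrad : ∀ a, a.degree < k → HasWeakGrad Ω (v a) fun l => v (a + Finsupp.single l 1)

/-- One word is chosen for each multi-index. The first-order relations between the resulting
derivatives follow by inserting ∂_l φ as test function, since the order of differentiation is
irrelevant on smooth functions. -/
theorem MemSobolev.exists_jet {Ω : Set (Pt d)} (hΩ : IsOpen Ω) {k : ℕ} {q : ℝ} (hq : 1 ≤ q)
    {u : Pt d → ℝ} (hu : MemSobolev Ω k q u) :
    ∃ v, IsSobolevJet Ω k q v ∧ v 0 = u ∧ ∀ a, a.degree = k →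
      ∀ᵐ x ∂volume.restrict Ω, ‖v a x‖ ≤ √(∑ α : Fin k → Fin d, weakPartial Ω u α x ^ 2) := by
  have hq1 : 1 ≤ ENNReal.ofReal q := by simpa using hq
  set W : (Fin d →₀ ℕ) → List (Fin d) := fun a => (Finsupp.toMultiset a).toList with hW
  have hWlen : ∀ a, (W a).length = a.degree := by
    intro a
    rw [hW, Multiset.length_toList, Finsupp.card_toMultiset]
    rfl
  have hex : ∀ a, a.degree ≤ k → ∃ v, MemLp v (ENNReal.ofReal q) (volume.restrict Ω) ∧
      (a = 0 → v = u) ∧ ∀ φ : Pt d → ℝ, ContDiff ℝ ∞ φ → HasCompactSupport φ → tsupport φ ⊆ Ω →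
        ∫ x in Ω, u x * listDeriv (W a) φ x = (-1) ^ a.degree * ∫ x in Ω, v x * φ x := by
    intro a ha
    rcases eq_or_ne a 0 with rfl | ha0
    · refine ⟨u, hu.1, fun _ => rfl, fun φ _ _ _ => ?_⟩
      simp [hW, listDeriv]
    · obtain ⟨v, hv, hvw⟩ := hu.2 (W a).length (by rw [hWlen]; exact ha) (W a).get
      refine ⟨v, hv, fun h => absurd h ha0, ?_⟩
      have := (isWeakPartial_iff_listDeriv.1 hvw).2
      rwa [List.ofFn_get, hWlen] at this
  choose! v hv hv0 hvw using hex
  refine ⟨v, ⟨hv, fun a ha l φ hφ hc hs => ?_⟩, hv0 0 (by simp) rfl, fun a ha => ?_⟩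
  · set e : Pt d := EuclideanSpace.single l 1
    have hdeg : (a + Finsupp.single l 1).degree = a.degree + 1 := by
      rw [map_add, Finsupp.degree_single]
    have h1 := hvw a ha.le _ (contDiff_fderiv_single hφ e) (hc.fderiv_apply ℝ e)
      ((tsupport_fderiv_apply_subset ℝ e).trans hs)
    have h2 := hvw (a + Finsupp.single l 1) (by omega) φ hφ hc hs
    have hperm : (W (a + Finsupp.single l 1)).Perm (l :: W a) := by
      rw [← Multiset.coe_eq_coe, hW, Multiset.coe_toList, ← Multiset.cons_coe, Multiset.coe_toList,
        Finsupp.toMultiset_add, Finsupp.toMultiset_single, one_smul, add_comm]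
      rfl
    rw [listDeriv_perm hperm hφ, hdeg] at h2
    change _ = _ at h2
    rw [listDeriv] at h2
    -- The identity for `a` tested with ∂_l φ and the identity for the raised index tested with φ
    -- have the same left side.
    rw [h2, pow_succ, mul_assoc] at h1
    have h3 := mul_left_cancel₀ (pow_ne_zero _ (by norm_num)) h1
    rw [← h3]
    ring
  · set α : Fin k → Fin d := fun i => (W a).get (i.cast (by rw [hWlen, ha]))
    have hα : List.ofFn α = W a := by
      apply List.ext_getElem
      · rw [List.length_ofFn, hWlen, ha]
      · intro n h1 h2
        simp [α]
    have hex : ∃ v, IsWeakPartial Ω u α v := by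
      obtain ⟨v, _, h⟩ := hu.2 k le_rfl α
      exact ⟨v, h⟩
    have hw : IsWeakPartial Ω u α (weakPartial Ω u α) := by
      rw [weakPartial, dif_pos hex]
      exact hex.choose_spec
    have hae : v a =ᵐ[volume.restrict Ω] weakPartial Ω u α := by
      refine ae_eq_of_setIntegral_mul_eq hΩ (memLp_locallyIntegrableOn hq1 (hv a ha.le)) hw.1
        fun φ hφ hc hs => ?_
      have h1 := hvw a ha.le φ hφ hc hs
      have h2 := (isWeakPartial_iff_listDeriv.1 hw).2 φ hφ hc hs
      rw [hα, h1, ha] at h2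
      exact mul_left_cancel₀ (pow_ne_zero _ (by norm_num)) h2
    filter_upwards [hae] with x hx
    rw [hx, Real.norm_eq_abs]
    refine Real.abs_le_sqrt ?_
    exact Finset.single_le_sum (f := fun α => weakPartial Ω u α x ^ 2) (fun _ _ => sq_nonneg _)
      (Finset.mem_univ α)

/-! ### Polynomial approximation -/

theorem hasWeakGrad_val (Ω : Set (Pt d)) (hΩ : MeasurableSet Ω) (hb : Bornology.IsBounded Ω)
    (P : MvPolynomial (Fin d) ℝ) :
    HasWeakGrad Ω (val P) fun l => val (MvPolynomial.pderiv l P) := by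
  intro l φ hφ hc hs
  set e : Pt d := EuclideanSpace.single l 1
  have hφ1 : ContDiff ℝ 1 φ := hφ.of_le (by exact_mod_cast le_top)
  have hi : ∀ {F : Pt d → ℝ}, Continuous F → IntegrableOn F Ω := fun hF =>
    integrableOn_of_bounded hb hΩ hb.measure_lt_top hF
  have h1 : ∀ x, fderiv ℝ (fun y => val P y * φ y) x e =
      val P x * fderiv ℝ φ x e + val (MvPolynomial.pderiv l P) x * φ x := by
    intro x
    have := ((contDiff_val P (n := 1)).differentiable one_ne_zero x).hasFDerivAt.fun_mul
      (hφ1.differentiable one_ne_zero x).hasFDerivAt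
    rw [this.fderiv]
    simp [e, fderiv_val_single, mul_comm]
  have h2 := integral_fderiv_eq_zero ((contDiff_val P).mul hφ1) (hc.mul_left (f := val P)) e
  have h3 : ∫ x in Ω, fderiv ℝ (fun y => val P y * φ y) x e = 0 := by
    rw [setIntegral_eq_integral_of_forall_compl_eq_zero]
    · exact h2
    · intro x hx
      rw [h1, image_eq_zero_of_notMem_tsupport fun hx' => hx (hs hx'),
        image_eq_zero_of_notMem_tsupport fun hx' => hx (hs (tsupport_fderiv_apply_subset ℝ e hx'))]
      simp
  simp_rw [h1] at h3
  have hc1 : Continuous fun x => fderiv ℝ φ x e :=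
    (hφ1.continuous_fderiv one_ne_zero).clm_apply continuous_const
  rw [integral_add (hi (F := fun x => val P x * fderiv ℝ φ x e) ((continuous_val P).mul hc1))
    (hi (F := fun x => val (MvPolynomial.pderiv l P) x * φ x)
      ((continuous_val _).mul hφ.continuous))] at h3
  linarith

theorem HasWeakGrad.sub {Ω : Set (Pt d)} (hΩ : MeasurableSet Ω) (hb : Bornology.IsBounded Ω)
    {v w : Pt d → ℝ} {f g : Fin d → Pt d → ℝ} (hv : HasWeakGrad Ω v f) (hw : HasWeakGrad Ω w g)
    (iv : IntegrableOn v Ω) (iw : IntegrableOn w Ω) (jf : ∀ l, IntegrableOn (f l) Ω)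
    (jg : ∀ l, IntegrableOn (g l) Ω) :
    HasWeakGrad Ω (fun x => v x - w x) fun l x => f l x - g l x := by
  intro l φ hφ hc hs
  have hφ1 : ContDiff ℝ 1 φ := hφ.of_le (by exact_mod_cast le_top)
  have hc1 : Continuous fun x => fderiv ℝ φ x (EuclideanSpace.single l 1) :=
    (hφ1.continuous_fderiv one_ne_zero).clm_apply continuous_const
  simp_rw [sub_mul]
  rw [integral_sub (iv.mul_continuous_of_bounded hΩ hb hc1) (iw.mul_continuous_of_bounded hΩ hb hc1),
    integral_sub ((jf l).mul_continuous_of_bounded hΩ hb hφ.continuous)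
      ((jg l).mul_continuous_of_bounded hΩ hb hφ.continuous), hv l φ hφ hc hs, hw l φ hφ hc hs]
  ring

/-- The Bramble–Hilbert lemma. -/
theorem IsSobolevJet.exists_taylorPoly {Ω : Set (Pt d)} (hΩ : IsLipschitzDomain Ω) {k : ℕ} {q : ℝ}
    (hq : 1 ≤ q) {v : (Fin d →₀ ℕ) → Pt d → ℝ} (hv : IsSobolevJet Ω k q v) {U : Set (Pt d)}
    (hU : U ⊆ Ω) {z₀ : Pt d} {r : ℝ} (hr : 0 < r) (hb : Metric.ball z₀ r ⊆ U) {C : ℝ≥0∞}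
    (hC : C ≠ ⊤) (h : HasPoincare q U (Metric.ball z₀ r) C) {E : ℝ≥0∞}
    (hE : ∀ a, a.degree = k → eLpNorm (v a) (ENNReal.ofReal q) (volume.restrict U) ≤ E) :
    ∃ c : (Fin d →₀ ℕ) → ℝ, (∀ a, k ≤ a.degree → c a = 0) ∧ ∀ n ≤ k, ∀ a, a.degree = k - n →
      eLpNorm (fun x => v a x - val (taylorPoly k c a) x) (ENNReal.ofReal q) (volume.restrict U) ≤
        (C ^ (1 / q) * d) ^ n * E := by
  have hq1 : 1 ≤ ENNReal.ofReal q := by simpa using hq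
  have hΩm := hΩ.isOpen.measurableSet
  have hfinΩ : IsFiniteMeasure (volume.restrict Ω) :=
    ⟨by rw [Measure.restrict_apply_univ]; exact hΩ.isBounded.measure_lt_top⟩
  obtain ⟨c, hc, hcm⟩ := exists_taylorPoly_integral_eq (b := Metric.ball z₀ r)
    Metric.isBounded_ball measurableSet_ball (Metric.measure_ball_pos _ _ hr).ne' k
    fun a => ∫ x in Metric.ball z₀ r, v a x
  refine ⟨c, hc, fun n => ?_⟩
  have hpoly : ∀ P : MvPolynomial (Fin d) ℝ, MemLp (val P) (ENNReal.ofReal q) (volume.restrict Ω) :=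
    fun P => memLp_restrict_of_continuous hΩ.isBounded hΩ.isBounded.measure_lt_top.ne
      (continuous_val P)
  -- The polynomial has the same means over the ball as v in every derivative of order below k. The
  -- Poincaré inequality thus bounds the error in order k - (n + 1) by the d errors in order k - n.
  -- In order k the polynomial contributes nothing.
  induction n with
  | zero =>
    intro _ a ha
    have h0 : taylorPoly k c a = 0 := by
      ext m
      rw [coeff_taylorPoly hc, hc _ (by rw [map_add]; omega), zero_div, MvPolynomial.coeff_zero]
    simp only [h0, val_zero, sub_zero, pow_zero, one_mul]
    exact hE a (by omega)
  | succ n ih =>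
    intro hn a ha
    have hak : a.degree < k := by omega
    have hdeg : ∀ l, (a + Finsupp.single l 1).degree = k - n := fun l => by
      rw [map_add, Finsupp.degree_single]
      omega
    have hM := hv.memLp a hak.le
    have hMl : ∀ l, MemLp (v (a + Finsupp.single l 1)) (ENNReal.ofReal q) (volume.restrict Ω) :=
      fun l => hv.memLp _ (by rw [hdeg]; omega)
    have hw : HasWeakGrad Ω (fun x => v a x - val (taylorPoly k c a) x)
        fun l x => v (a + Finsupp.single l 1) x - val (taylorPoly k c (a + Finsupp.single l 1)) x := by
      have h1 := hasWeakGrad_val Ω hΩm hΩ.isBounded (taylorPoly k c a)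
      simp_rw [pderiv_taylorPoly hc] at h1
      exact (hv.hasWeakGrad a hak).sub hΩm hΩ.isBounded h1 (hM.integrable hq1)
        ((hpoly _).integrable hq1) (fun l => (hMl l).integrable hq1)
        fun l => (hpoly _).integrable hq1
    have hbΩ : volume.restrict (Metric.ball z₀ r) ≤ volume.restrict Ω :=
      Measure.restrict_mono_set volume (hb.trans hU)
    have h2 := h.of_hasWeakGrad hΩ hq hU hb hC hw (hM.sub (hpoly _))
      (fun l => (hMl l).sub (hpoly _)) (by
        rw [integral_sub ((hM.integrable hq1).mono_measure hbΩ)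
          (((hpoly _).integrable hq1).mono_measure hbΩ), hcm a hak, sub_self])
    refine h2.trans ((mul_le_mul_right (Finset.sum_le_sum fun l _ => ih (by omega) _ (hdeg l)) _).trans
      (le_of_eq ?_))
    rw [Finset.sum_const, Finset.card_univ, Fintype.card_fin, nsmul_eq_mul, pow_succ]
    ring

end Jets

end LpPDWG
end


noncomputable section

namespace LpPDWG

/-! ### Neighbourhoods of the elements -/

section Patches

open ENNReal

variable {d : ℕ}

theorem HasPoincare.mono {q : ℝ} {U b : Set (Pt d)} {C C' : ℝ≥0∞} (h : HasPoincare q U b C)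
    (hC : C ≤ C') : HasPoincare q U b C' :=
  fun z hz => (h z hz).trans (mul_le_mul_left hC _)

/-- An open subset of `Ω` containing the part of a ball in `Ω`, contained in a larger ball, with a
Poincaré inequality that scales correctly. -/
structure IsPatch (Ω : Set (Pt d)) (q : ℝ) (x₀ : Pt d) (h κ c : ℝ) (U : Set (Pt d)) : Prop where
  isOpen : IsOpen U
  subset : U ⊆ Ω
  closedBall_subset : Metric.closedBall x₀ h ∩ Ω ⊆ U
  subset_ball : U ⊆ Metric.ball x₀ (κ * h)
  hasPoincare : ∃ z r, 0 < r ∧ Metric.ball z r ⊆ U ∧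
    HasPoincare q U (Metric.ball z r) (ENNReal.ofReal (c * h) ^ q)

/-- Small `h` are served by star-shaped neighbourhoods. For h > r the whole of Ω is a patch: its
diameter is at most a multiple of h, and its fixed Poincaré constant has q-th root at most b r ≤ b
h. -/
theorem IsLipschitzDomain.exists_isPatch {Ω : Set (Pt d)} (hΩ : IsLipschitzDomain Ω) {q : ℝ}
    (hq : 1 ≤ q) : ∃ κ ≥ 1, ∃ c ≥ 0, ∀ x₀ ∈ Ω, ∀ h > 0, ∃ U, IsPatch Ω q x₀ h κ c U := by
  have hq0 : 0 < q := by linarith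
  have hroot : ∀ A : ℝ≥0∞, A ≠ ⊤ → A = ENNReal.ofReal (A ^ (1 / q)).toReal ^ q := fun A hA => by
    rw [ENNReal.ofReal_toReal (ENNReal.rpow_lt_top_of_nonneg (by positivity) hA).ne,
      ← ENNReal.rpow_mul, one_div_mul_cancel hq0.ne', ENNReal.rpow_one]
  obtain ⟨r, hr, κ, hκ, H⟩ := hΩ.exists_isStarNhd
  obtain ⟨z, s, hs, hzs, C, hC, hP⟩ := hΩ.exists_hasPoincare hq
  set A : ℝ≥0∞ := ENNReal.ofReal (2 * κ) ^ q * 2 ^ d * (ENNReal.ofReal κ ^ d + 1) with hA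
  have hAt : A ≠ ⊤ := by
    refine ENNReal.mul_ne_top (ENNReal.mul_ne_top
      (ENNReal.rpow_lt_top_of_nonneg hq0.le ofReal_ne_top).ne (by finiteness)) (by finiteness)
  set a : ℝ := (A ^ (1 / q)).toReal
  set b : ℝ := (C ^ (1 / q)).toReal / r
  have ha : 0 ≤ a := ENNReal.toReal_nonneg
  have hb : 0 ≤ b := by positivity
  refine ⟨max κ ((Metric.diam Ω + 1) / r), le_max_of_le_left hκ, max a b, le_max_of_le_left ha,
    fun x₀ hx₀ h hh => ?_⟩
  rcases le_or_gt h r with hhr | hhr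
  · obtain ⟨U, z, hU⟩ := H x₀ hx₀ h hh hhr
    refine ⟨U, hU.isOpen, hU.subset, hU.closedBall_subset, hU.subset_ball.trans
      (Metric.ball_subset_ball (by gcongr; exact le_max_left _ _)), z, h, hh, hU.ball_subset,
      (hU.hasPoincare hh hκ hq).mono ?_⟩
    rw [← hA, hroot A hAt, ENNReal.ofReal_mul (le_max_of_le_left ha),
      ENNReal.mul_rpow_of_nonneg _ _ hq0.le]
    gcongr
    exact le_max_left _ _
  · refine ⟨Ω, hΩ.isOpen, subset_rfl, inter_subset_right, fun y hy => ?_, z, s, hs, hzs,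
      hP.mono ?_⟩
    · rw [Metric.mem_ball]
      have h1 := Metric.dist_le_diam_of_mem hΩ.isBounded hy hx₀
      have h2 : Metric.diam Ω + 1 ≤ max κ ((Metric.diam Ω + 1) / r) * h := by
        calc Metric.diam Ω + 1 = (Metric.diam Ω + 1) / r * r := by field_simp
          _ ≤ _ := by
            have := Metric.diam_nonneg (s := Ω)
            gcongr
            exact le_max_right _ _
      linarith
    · rw [hroot C hC]
      gcongr
      calc (C ^ (1 / q)).toReal = b * r := by simp only [b]; field_simp
        _ ≤ _ := by gcongr; exact le_max_right _ _

/-- In polar coordinates the weight cancels the Jacobian t^(d-1), so the integral is linear in the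
radius. This is what sums diameters, rather than volumes, of disjoint elements. -/
theorem lintegral_inv_norm_pow (hd : 1 ≤ d) (x : Pt d) {ρ : ℝ} (hρ : 0 ≤ ρ) :
    ∫⁻ y in Metric.ball x ρ, ENNReal.ofReal ((‖y - x‖ ^ (d - 1))⁻¹) =
      ENNReal.ofReal (d * volume.real (Metric.ball (0 : Pt d) 1) * ρ) := by
  have : Nonempty (Fin d) := ⟨⟨0, hd⟩⟩
  set f : ℝ → ℝ := (Iio ρ).indicator fun t => (t ^ (d - 1))⁻¹ with hf
  have hfd : Module.finrank ℝ (Pt d) = d := by simp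
  have hone : EqOn (fun t : ℝ => t ^ (d - 1) • f t) ((Iio ρ).indicator 1) (Ioi 0) := by
    intro t ht
    have ht0 : t ^ (d - 1) ≠ 0 := pow_ne_zero _ (ne_of_gt ht)
    by_cases h : t ∈ Iio ρ <;> simp [hf, h, ht0]
  have hint : Integrable (fun y : Pt d => f ‖y‖) := by
    rw [integrable_fun_norm_addHaar, hfd, integrableOn_congr_fun hone measurableSet_Ioi]
    rw [IntegrableOn, integrable_indicator_iff measurableSet_Iio, IntegrableOn,
      Measure.restrict_restrict measurableSet_Iio]
    exact integrableOn_const (by rw [Iio_inter_Ioi]; simp)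
  have hval : ∫ y : Pt d, f ‖y‖ = d * volume.real (Metric.ball (0 : Pt d) 1) * ρ := by
    rw [integral_fun_norm_addHaar, hfd, setIntegral_congr_fun measurableSet_Ioi hone,
      integral_indicator measurableSet_Iio, Measure.restrict_restrict measurableSet_Iio,
      Iio_inter_Ioi]
    simp [hρ, mul_assoc]
  rw [← hval, ofReal_integral_eq_lintegral_ofReal hint, ← lintegral_indicator measurableSet_ball]
  · rw [← lintegral_sub_right_eq_self (fun y : Pt d => ENNReal.ofReal (f ‖y‖)) x]
    refine lintegral_congr fun y => ?_
    by_cases h : ‖y - x‖ < ρ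
    · rw [indicator_of_mem (by rwa [Metric.mem_ball, dist_eq_norm]), hf,
        indicator_of_mem (show ‖y - x‖ ∈ Iio ρ from h)]
    · rw [indicator_of_notMem (by rwa [Metric.mem_ball, dist_eq_norm]), hf,
        indicator_of_notMem (show ‖y - x‖ ∉ Iio ρ from h),
        ENNReal.ofReal_zero]
  · refine Eventually.of_forall fun y => ?_
    exact indicator_apply_nonneg fun _ => by positivity

namespace PolytopalMesh

variable {Ω : Set (Pt d)} (M : PolytopalMesh Ω)

theorem hElem_pos (hd : 1 ≤ d) (i : Fin M.numElem) : 0 < M.hElem i := by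
  have : Nonempty (Fin d) := ⟨⟨0, hd⟩⟩
  refine Metric.diam_pos ?_ (M.elem_polytope i).isBounded
  obtain ⟨x, hx⟩ := (M.elem_polytope i).isConnected.nonempty
  exact infinite_of_mem_nhds x ((M.isOpen_elem i).mem_nhds hx) |>.nontrivial

theorem hElem_le_meshSize (i : Fin M.numElem) : M.hElem i ≤ M.meshSize :=
  le_ciSup (Finite.bddAbove_range _) i

theorem meshSize_nonneg : 0 ≤ M.meshSize := Real.iSup_nonneg fun _ => Metric.diam_nonneg

/-- The diameters of the elements having a given point in their patches add up to at most a
multiple of the meshsize. -/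
theorem sum_hElem_le (hd : 1 ≤ d) {γ : ℝ} (hγ : 0 < γ)
    (hvol : ∀ i, ENNReal.ofReal (γ * M.hElem i ^ d) ≤ volume (M.elem i)) {κ : ℝ} (hκ : 1 ≤ κ)
    {x : Pt d} (s : Finset (Fin M.numElem))
    (hs : ∀ i ∈ s, M.elem i ⊆ Metric.ball x ((κ + 1) * M.hElem i)) :
    ∑ i ∈ s, M.hElem i ≤
      γ⁻¹ * (κ + 1) ^ d * (d * volume.real (Metric.ball (0 : Pt d) 1)) * M.meshSize := by
  have hh := M.meshSize_nonneg
  -- On such an element the weight is at least ((κ + 1) h_i)^(1-d), and the volume is at least γ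
  -- h_i^d, so its integral over the element dominates a multiple of h_i. Disjointness then bounds
  -- the sum by the integral over a single ball.
  have key : ∀ i ∈ s, ENNReal.ofReal (γ * M.hElem i) ≤
      ENNReal.ofReal ((κ + 1) ^ (d - 1)) * ∫⁻ y in M.elem i,
        ENNReal.ofReal ((‖y - x‖ ^ (d - 1))⁻¹) := by
    intro i hi
    have hi0 := M.hElem_pos hd i
    have h1 : ENNReal.ofReal ((M.hElem i ^ (d - 1))⁻¹) * volume (M.elem i) ≤
        ENNReal.ofReal ((κ + 1) ^ (d - 1)) * ∫⁻ y in M.elem i,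
          ENNReal.ofReal ((‖y - x‖ ^ (d - 1))⁻¹) := by
      rw [← setLIntegral_const, ← lintegral_const_mul' _ _ ofReal_ne_top]
      refine lintegral_mono_ae ?_
      have hne : ∀ᵐ y : Pt d, y ≠ x := by
        have : Nonempty (Fin d) := ⟨⟨0, hd⟩⟩
        exact Measure.ae_ne volume x
      filter_upwards [ae_restrict_mem (M.isOpen_elem i).measurableSet,
        ae_restrict_of_ae hne] with y hy hyx
      rw [← ENNReal.ofReal_mul (by positivity)]
      refine ENNReal.ofReal_le_ofReal ?_
      have h2 : ‖y - x‖ < (κ + 1) * M.hElem i := by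
        simpa [dist_eq_norm] using hs i hi hy
      have h3 : 0 < ‖y - x‖ := norm_pos_iff.2 (sub_ne_zero.2 hyx)
      rw [← div_eq_mul_inv, inv_le_comm₀ (by positivity) (by positivity), inv_div,
        div_le_iff₀ (by positivity), ← mul_pow, mul_comm]
      gcongr
    refine le_trans ?_ h1
    refine le_trans (le_of_eq ?_) (mul_le_mul_right (hvol i) _)
    rw [← ENNReal.ofReal_mul (by positivity)]
    congr 1
    obtain ⟨n, rfl⟩ : ∃ n, d = n + 1 := ⟨d - 1, by omega⟩
    rw [Nat.add_sub_cancel, pow_succ]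
    field_simp
  have hsub : ∀ i ∈ s, M.elem i ⊆ Metric.ball x ((κ + 1) * M.meshSize) := fun i hi =>
    (hs i hi).trans (Metric.ball_subset_ball (by gcongr; exact M.hElem_le_meshSize i))
  have hsum : ENNReal.ofReal (γ * ∑ i ∈ s, M.hElem i) ≤
      ENNReal.ofReal ((κ + 1) ^ (d - 1)) * ENNReal.ofReal
        (d * volume.real (Metric.ball (0 : Pt d) 1) * ((κ + 1) * M.meshSize)) := by
    rw [Finset.mul_sum, ENNReal.ofReal_sum_of_nonneg fun i _ =>
      mul_nonneg hγ.le (M.hElem_pos hd i).le]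
    refine (Finset.sum_le_sum key).trans ?_
    rw [← Finset.mul_sum, ← lintegral_biUnion_finset (fun i _ i' _ hii => M.elem_disjoint i i' hii)
      fun i _ => (M.isOpen_elem i).measurableSet,
      ← lintegral_inv_norm_pow hd x (by positivity)]
    gcongr
    exact iUnion₂_subset hsub
  rw [← ENNReal.ofReal_mul (by positivity), ENNReal.ofReal_le_ofReal_iff (by positivity)] at hsum
  rw [← mul_le_mul_iff_right₀ hγ]
  refine hsum.trans (le_of_eq ?_)
  obtain ⟨n, rfl⟩ : ∃ n, d = n + 1 := ⟨d - 1, by omega⟩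
  rw [Nat.add_sub_cancel, pow_succ]
  field_simp

/-- Summation of local quantities over overlapping patches. -/
theorem sum_lintegral_patch_le (hd : 1 ≤ d) {γ : ℝ} (hγ : 0 < γ)
    (hvol : ∀ i, ENNReal.ofReal (γ * M.hElem i ^ d) ≤ volume (M.elem i)) {κ : ℝ} (hκ : 1 ≤ κ)
    {x : Fin M.numElem → Pt d} (hx : ∀ i, x i ∈ M.elem i) {U : Fin M.numElem → Set (Pt d)}
    (hUo : ∀ i, IsOpen (U i)) (hU : ∀ i, U i ⊆ Metric.ball (x i) (κ * M.hElem i))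
    (hUΩ : ∀ i, U i ⊆ Ω) {s : ℝ} (hs : 1 ≤ s) {G : Pt d → ℝ≥0∞}
    (hG : AEMeasurable G (volume.restrict Ω)) :
    ∑ i, ENNReal.ofReal (M.hElem i ^ s) * ∫⁻ y in U i, G y ≤
      ENNReal.ofReal (γ⁻¹ * (κ + 1) ^ d * (d * volume.real (Metric.ball (0 : Pt d) 1)) *
        M.meshSize ^ s) * ∫⁻ y in Ω, G y := by
  classical
  have hh := M.meshSize_nonneg
  have h1 : ∀ i, ENNReal.ofReal (M.hElem i ^ s) * ∫⁻ y in U i, G y =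
      ∫⁻ y in Ω, (U i).indicator (fun y => ENNReal.ofReal (M.hElem i ^ s) * G y) y := by
    intro i
    rw [← lintegral_const_mul' _ _ ofReal_ne_top, lintegral_indicator (hUo i).measurableSet,
      Measure.restrict_restrict (hUo i).measurableSet, inter_eq_left.2 (hUΩ i)]
  simp_rw [h1]
  rw [← lintegral_finsetSum' _ fun i _ => (hG.const_mul _).indicator (hUo i).measurableSet,
    ← lintegral_const_mul' _ _ ofReal_ne_top]
  refine lintegral_mono fun y => ?_
  have h2 : ∀ i, (U i).indicator (fun y => ENNReal.ofReal (M.hElem i ^ s) * G y) y =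
      (if y ∈ U i then ENNReal.ofReal (M.hElem i ^ s) else 0) * G y := by
    intro i
    by_cases hy : y ∈ U i <;> simp [hy]
  simp_rw [h2]
  rw [← Finset.sum_mul, ← Finset.sum_filter,
    ← ENNReal.ofReal_sum_of_nonneg fun i _ => Real.rpow_nonneg (M.hElem_pos hd i).le _]
  gcongr
  have hsplit : ∀ {t : ℝ}, 0 ≤ t → t ^ s = t ^ (s - 1) * t := fun {t} ht => by
    rcases eq_or_lt_of_le ht with h0 | h0
    · rw [← h0, Real.zero_rpow (by linarith), mul_zero]
    · rw [← Real.rpow_add_one h0.ne', sub_add_cancel]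
  -- Only one power of the diameters is summed; the other s - 1 ≥ 0 powers are estimated by the
  -- meshsize.
  calc ∑ i with y ∈ U i, M.hElem i ^ s ≤ ∑ i with y ∈ U i, M.meshSize ^ (s - 1) * M.hElem i := by
        refine Finset.sum_le_sum fun i _ => ?_
        have h0 := M.hElem_pos hd i
        rw [hsplit h0.le]
        gcongr
        exact M.hElem_le_meshSize i
    _ = M.meshSize ^ (s - 1) * ∑ i with y ∈ U i, M.hElem i := by rw [Finset.mul_sum]
    _ ≤ M.meshSize ^ (s - 1) * _ := by
        refine mul_le_mul_of_nonneg_left (M.sum_hElem_le hd hγ hvol hκ (x := y) _ fun i hi z hz => ?_)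
          (Real.rpow_nonneg hh _)
        have h3 := hU i (Finset.mem_filter.1 hi).2
        have h4 := Metric.dist_le_diam_of_mem (M.elem_polytope i).isBounded hz (hx i)
        rw [Metric.mem_ball] at h3 ⊢
        have h5 := dist_triangle z (x i) y
        rw [dist_comm (x i) y] at h5
        have h6 : Metric.diam (M.elem i) = M.hElem i := rfl
        linarith
    _ = _ := by rw [hsplit hh]; ring

end PolytopalMesh

end Patches

end LpPDWG
end


noncomputable section

namespace LpPDWG

/-! ### Traces on the faces -/

section Traces

open ENNReal

variable {d : ℕ}

theorem exists_memLp_limit {α : Type*} [MeasurableSpace α] {μ : Measure α} {q : ℝ≥0∞} (hq : 1 ≤ q)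
    {F : ℕ → α → ℝ} (hF : ∀ n, MemLp (F n) q μ) {b : ℕ → ℝ≥0∞} (hb : Tendsto b atTop (𝓝 0))
    (h : ∀ n m, eLpNorm (fun x => F n x - F m x) q μ ≤ b n + b m) :
    ∃ f, MemLp f q μ ∧ Tendsto (fun n => eLpNorm (fun x => F n x - f x) q μ) atTop (𝓝 0) := by
  have : Fact (1 ≤ q) := ⟨hq⟩
  have hc : CauchySeq fun n => (hF n).toLp (F n) := by
    rw [EMetric.cauchySeq_iff]
    intro ε hε
    obtain ⟨N, hN⟩ := eventually_atTop.1 (hb.eventually (gt_mem_nhds (ENNReal.half_pos hε.ne')))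
    refine ⟨N, fun n hn m hm => ?_⟩
    rw [Lp.edist_toLp_toLp]
    refine (h n m).trans_lt ?_
    rw [← ENNReal.add_halves ε]
    exact ENNReal.add_lt_add (hN n hn) (hN m hm)
  obtain ⟨f, hf⟩ := cauchySeq_tendsto_of_complete hc
  refine ⟨f, Lp.memLp f, ?_⟩
  have h2 : Tendsto (fun n => (hF n).toLp (F n)) atTop (𝓝 ((Lp.memLp f).toLp f)) := by
    rwa [Lp.toLp_coeFn]
  exact (Lp.tendsto_Lp_iff_tendsto_eLpNorm'' F hF f (Lp.memLp f)).1 h2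

theorem ae_restrict_norm_le {s : Set (Pt d)} (hs : Bornology.IsBounded s) (hsm : MeasurableSet s)
    (μ : Measure (Pt d)) {σ : Pt d → ℝ} (hσ : Continuous σ) :
    ∃ C : ℝ, 0 ≤ C ∧ ∀ᵐ x ∂μ.restrict s, ‖σ x‖ ≤ C := by
  obtain ⟨C, hC⟩ := hs.isCompact_closure.bddAbove_image hσ.norm.continuousOn
  refine ⟨max C 0, le_max_right _ _, (ae_restrict_iff' hsm).2 (Eventually.of_forall fun x hx => ?_)⟩
  exact (hC ⟨x, subset_closure hx, rfl⟩).trans (le_max_left _ _)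

theorem tendsto_setIntegral_mul {s : Set (Pt d)} (hs : Bornology.IsBounded s)
    (hsm : MeasurableSet s) {μ : Measure (Pt d)} (hμ : μ s < ⊤) {q : ℝ≥0∞} (hq : 1 ≤ q)
    {F : ℕ → Pt d → ℝ} {f : Pt d → ℝ} (hF : ∀ n, MemLp (F n) q (μ.restrict s))
    (hf : MemLp f q (μ.restrict s))
    (h : Tendsto (fun n => eLpNorm (fun x => F n x - f x) q (μ.restrict s)) atTop (𝓝 0))
    {σ : Pt d → ℝ} (hσ : Continuous σ) :
    Tendsto (fun n => ∫ x in s, F n x * σ x ∂μ) atTop (𝓝 (∫ x in s, f x * σ x ∂μ)) := by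
  have : IsFiniteMeasure (μ.restrict s) := ⟨by rwa [Measure.restrict_apply_univ]⟩
  obtain ⟨C, hC0, hC⟩ := ae_restrict_norm_le hs hsm μ hσ
  have hm : ∀ {v : Pt d → ℝ}, MemLp v q (μ.restrict s) →
      MemLp (fun x => v x * σ x) q (μ.restrict s) := fun {v} hv => by
    refine hv.of_le_mul (c := C) (hv.1.mul hσ.aestronglyMeasurable) ?_
    filter_upwards [hC] with x hx
    rw [norm_mul, mul_comm]
    gcongr
  refine tendsto_integral_of_tendsto_eLpNorm hq (fun n => hm (hF n)) (hm hf) ?_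
  have h2 := ENNReal.Tendsto.const_mul h (Or.inr (ENNReal.ofReal_ne_top (r := C)))
  rw [mul_zero] at h2
  refine tendsto_of_tendsto_of_tendsto_of_le_of_le tendsto_const_nhds h2 (fun _ => zero_le)
    fun n => eLpNorm_le_mul_eLpNorm_of_ae_le_mul ?_ q
  filter_upwards [hC] with x hx
  rw [← sub_mul, norm_mul, mul_comm]
  gcongr

namespace PolytopalMesh

variable {Ω : Set (Pt d)} (M : PolytopalMesh Ω)

theorem restrict_closure_elem (i : Fin M.numElem) :
    (volume : Measure (Pt d)).restrict (closure (M.elem i)) = volume.restrict (M.elem i) :=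
  Measure.restrict_congr_set (closure_ae_eq_of_null_frontier (M.volume_frontier_elem i))

/-- The constant of the trace inequality on an element of diameter `h`. -/
def traceConst (d : ℕ) (q γ h : ℝ) : ℝ≥0∞ :=
  (2 ^ q * 2 ^ (d - 1) * ENNReal.ofReal (γ * h)⁻¹) ^ (1 / q)

theorem traceConst_ne_top (d : ℕ) {q : ℝ} (hq : 1 ≤ q) (γ h : ℝ) : traceConst d q γ h ≠ ⊤ := by
  refine (ENNReal.rpow_lt_top_of_nonneg (by positivity) ?_).ne
  exact ENNReal.mul_ne_top (ENNReal.mul_ne_top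
    (ENNReal.rpow_lt_top_of_nonneg (by linarith) (by simp)).ne (by finiteness)) ofReal_ne_top

variable {M}

/-- The trace inequality for the pyramid supplied by shape regularity. Its height is constant along
the flat face and at least γh, and it lies in the closed element, which has the same measure as the
open one. -/
theorem ShapeRegular.eLpNorm_face_le {γ : ℝ} {N : ℕ} (hsr : M.ShapeRegular γ N) (hγ : 0 < γ)
    (hd : 1 ≤ d) {q : ℝ} (hq : 1 ≤ q) {i : Fin M.numElem} {e : Fin M.numFace}
    (he : e ∈ M.facesOf i) {z : Pt d → ℝ} (hz : ContDiff ℝ 1 z) :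
    eLpNorm z (ENNReal.ofReal q) (μHE[d - 1].restrict (M.face e)) ≤
      traceConst d q γ (M.hElem i) *
        (eLpNorm z (ENNReal.ofReal q) (volume.restrict (M.elem i)) +
          ENNReal.ofReal (M.hElem i) * ∑ l, eLpNorm (fun x => fderiv ℝ z x
            (EuclideanSpace.single l 1)) (ENNReal.ofReal q) (volume.restrict (M.elem i))) := by
  have hq0 : 0 < q := by linarith
  have hh := M.hElem_pos hd i
  obtain ⟨A, hA⟩ := hsr.pyramid i e he
  obtain ⟨x₀, hx₀⟩ := M.face_nonempty e
  set H : ℝ := ⟪x₀ - A, M.normal i e⟫_ℝ with hH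
  have hHγ : γ * M.hElem i ≤ H := (hA x₀ hx₀).2
  have hH0 : 0 < H := lt_of_lt_of_le (by positivity) hHγ
  have hflat : ∀ x ∈ M.face e, ⟪x - A, M.normal i e⟫_ℝ = H := by
    intro x hx
    have h1 : ⟪x - x₀, M.normal i e⟫_ℝ = 0 := M.face_subset_hyperplane he hx₀ hx
    rw [hH, ← sub_add_sub_cancel x x₀ A, inner_add_left, h1, zero_add]
  have hdist : ∀ x ∈ M.face e, ‖x - A‖ₑ ≤ ENNReal.ofReal (M.hElem i) := by
    intro x hx
    have h1 := (hA x hx).1 (right_mem_segment ℝ A x)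
    have h2 := (hA x hx).1 (left_mem_segment ℝ A x)
    rw [← ofReal_norm, ← dist_eq_norm]
    refine ENNReal.ofReal_le_ofReal ?_
    have := Metric.dist_le_diam_of_mem (M.elem_polytope i).isBounded.closure h1 h2
    rwa [Metric.diam_closure] at this
  have h := lintegral_trace_le (M.normal_norm i e he) A hH0 (M.measurableSet_face e)
    isClosed_closure.measurableSet hflat (fun x hx => (hA x hx).1) hdist hq hz
    (M.measure_face_lt_top e)
  rw [M.restrict_closure_elem] at h
  have hfd : ∫⁻ x in M.elem i, ‖fderiv ℝ z x‖ₑ ^ q =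
      eLpNorm (fun x => fderiv ℝ z x) (ENNReal.ofReal q) (volume.restrict (M.elem i)) ^ q := by
    rw [← eLpNorm_norm, eLpNorm_rpow_eq _ hq]
    simp
  rw [hfd, ← eLpNorm_rpow_eq _ hq, ← eLpNorm_rpow_eq _ hq,
    ← ENNReal.mul_rpow_of_nonneg _ _ hq0.le] at h
  rw [← ENNReal.rpow_le_rpow_iff hq0, ENNReal.mul_rpow_of_nonneg _ _ hq0.le, traceConst,
    ← ENNReal.rpow_mul, one_div_mul_cancel hq0.ne', ENNReal.rpow_one]
  refine h.trans ?_
  gcongr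
  refine (ENNReal.add_rpow_le_rpow_add _ _ hq).trans ?_
  gcongr
  exact eLpNorm_fderiv_le (by simpa using hq) hz

/-- The trace on a face is the L^q limit of one sequence of smooth approximations on all of Ω. The
sequence serves every adjacent element, which makes the trace single-valued, and both the trace
inequality and integration by parts survive the limit. -/
theorem ShapeRegular.exists_trace (hΩ : IsLipschitzDomain Ω) {γ : ℝ} {N : ℕ}
    (hsr : M.ShapeRegular γ N) (hγ : 0 < γ) (hd : 1 ≤ d) {q : ℝ} (hq : 1 ≤ q) {w : Pt d → ℝ}
    {g : Fin d → Pt d → ℝ} (hwg : HasWeakGrad Ω w g)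
    (hw : MemLp w (ENNReal.ofReal q) (volume.restrict Ω))
    (hg : ∀ l, MemLp (g l) (ENNReal.ofReal q) (volume.restrict Ω)) :
    ∃ tr : Fin M.numFace → Pt d → ℝ,
      (∀ e, MemLp (tr e) (ENNReal.ofReal q) (μHE[d - 1].restrict (M.face e))) ∧
      (∀ i, ∀ e ∈ M.facesOf i, ∀ z : Pt d → ℝ, ContDiff ℝ 1 z →
        eLpNorm (fun x => tr e x - z x) (ENNReal.ofReal q) (μHE[d - 1].restrict (M.face e)) ≤
          traceConst d q γ (M.hElem i) *
            (eLpNorm (fun x => w x - z x) (ENNReal.ofReal q) (volume.restrict (M.elem i)) +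
              ENNReal.ofReal (M.hElem i) * ∑ l, eLpNorm (fun x => g l x - fderiv ℝ z x
                (EuclideanSpace.single l 1)) (ENNReal.ofReal q) (volume.restrict (M.elem i)))) ∧
      ∀ i l, ∀ σ : Pt d → ℝ, ContDiff ℝ 1 σ →
        ∫ x in M.elem i, (w x * fderiv ℝ σ x (EuclideanSpace.single l 1) + g l x * σ x) =
          ∑ e ∈ M.facesOf i, ∫ x in M.face e, tr e x * (σ x * M.normal i e l) ∂μHE[d - 1] := by
  have hq0 : 0 < q := by linarith
  have hq1 : 1 ≤ ENNReal.ofReal q := by simpa using hq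
  obtain ⟨φ, hφ, hlim, hlim'⟩ := hΩ.exists_smooth_approx hq hwg hw hg
  have hφ1 : ∀ n, ContDiff ℝ 1 (φ n) := fun n => (hφ n).of_le (by exact_mod_cast le_top)
  have hd' : ∀ {z : Pt d → ℝ}, ContDiff ℝ 1 z → ∀ l,
      Continuous fun x => fderiv ℝ z x (EuclideanSpace.single l 1) := fun hz l =>
    (hz.continuous_fderiv one_ne_zero).clm_apply continuous_const
  have hle : ∀ i, volume.restrict (M.elem i) ≤ volume.restrict Ω := fun i =>
    Measure.restrict_mono_set volume (M.elem_subset i)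
  have hzero : ∀ i {D : ℕ → Pt d → ℝ},
      Tendsto (fun n => eLpNorm (D n) (ENNReal.ofReal q) (volume.restrict Ω)) atTop (𝓝 0) →
      Tendsto (fun n => eLpNorm (D n) (ENNReal.ofReal q) (volume.restrict (M.elem i)))
        atTop (𝓝 0) := fun i D hD =>
    tendsto_of_tendsto_of_tendsto_of_le_of_le tendsto_const_nhds hD (fun _ => zero_le)
      fun n => eLpNorm_mono_measure _ (hle i)
  have hmE : ∀ i {F : Pt d → ℝ}, Continuous F → MemLp F (ENNReal.ofReal q)
      (volume.restrict (M.elem i)) := fun i F hF =>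
    memLp_restrict_of_continuous (M.elem_polytope i).isBounded
      (M.elem_polytope i).isBounded.measure_lt_top.ne hF
  have hmF : ∀ e {F : Pt d → ℝ}, Continuous F → MemLp F (ENNReal.ofReal q)
      (μHE[d - 1].restrict (M.face e)) := fun e F hF =>
    memLp_restrict_of_continuous (M.face_polytope e).isBounded (M.measure_face_lt_top e).ne hF
  -- the error of the `n`-th approximation on an element
  set a : Fin M.numElem → ℕ → ℝ≥0∞ := fun i n =>
    eLpNorm (fun x => φ n x - w x) (ENNReal.ofReal q) (volume.restrict (M.elem i)) +
      ENNReal.ofReal (M.hElem i) * ∑ l, eLpNorm (fun x => fderiv ℝ (φ n) x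
        (EuclideanSpace.single l 1) - g l x) (ENNReal.ofReal q) (volume.restrict (M.elem i)) with ha
  have halim : ∀ i, Tendsto (a i) atTop (𝓝 0) := by
    intro i
    have h1 : Tendsto (fun n => ∑ l, eLpNorm (fun x => fderiv ℝ (φ n) x
        (EuclideanSpace.single l 1) - g l x) (ENNReal.ofReal q) (volume.restrict (M.elem i)))
        atTop (𝓝 (∑ _l : Fin d, 0)) :=
      tendsto_finsetSum _ fun l _ => hzero i (hlim' l)
    have h2 := (hzero i hlim).add (ENNReal.Tendsto.const_mul h1
      (Or.inr (ENNReal.ofReal_ne_top (r := M.hElem i))))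
    simpa using h2
  have haK : ∀ i, Tendsto (fun n => traceConst d q γ (M.hElem i) * a i n) atTop (𝓝 0) := by
    intro i
    have := ENNReal.Tendsto.const_mul (halim i) (Or.inr (traceConst_ne_top d hq γ (M.hElem i)))
    simpa using this
  have htri : ∀ i {f f' f'' : Pt d → ℝ}, MemLp f (ENNReal.ofReal q) (volume.restrict (M.elem i)) →
      MemLp f' (ENNReal.ofReal q) (volume.restrict (M.elem i)) →
      MemLp f'' (ENNReal.ofReal q) (volume.restrict (M.elem i)) →
      eLpNorm (fun x => f x - f'' x) (ENNReal.ofReal q) (volume.restrict (M.elem i)) ≤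
        eLpNorm (fun x => f x - f' x) (ENNReal.ofReal q) (volume.restrict (M.elem i)) +
        eLpNorm (fun x => f' x - f'' x) (ENNReal.ofReal q) (volume.restrict (M.elem i)) := by
    intro i f f' f'' hf hf' hf''
    have : (fun x => f x - f'' x) = (fun x => f x - f' x) + fun x => f' x - f'' x := by
      ext x; simp
    rw [this]
    exact eLpNorm_add_le (hf.sub hf').1 (hf'.sub hf'').1 hq1
  -- trace inequality for the difference of an approximation and a smooth function
  have hface : ∀ i, ∀ e ∈ M.facesOf i, ∀ n, ∀ z : Pt d → ℝ, ContDiff ℝ 1 z →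
      eLpNorm (fun x => φ n x - z x) (ENNReal.ofReal q) (μHE[d - 1].restrict (M.face e)) ≤
        traceConst d q γ (M.hElem i) * (a i n +
            (eLpNorm (fun x => w x - z x) (ENNReal.ofReal q) (volume.restrict (M.elem i)) +
              ENNReal.ofReal (M.hElem i) * ∑ l, eLpNorm (fun x => g l x - fderiv ℝ z x
                (EuclideanSpace.single l 1)) (ENNReal.ofReal q) (volume.restrict (M.elem i)))) := by
    intro i e he n z hz
    refine (hsr.eLpNorm_face_le hγ hd hq he ((hφ1 n).sub hz)).trans (mul_le_mul_right ?_ _)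
    have h1 : ∀ l x, fderiv ℝ (fun x => φ n x - z x) x (EuclideanSpace.single l 1) =
        fderiv ℝ (φ n) x (EuclideanSpace.single l 1) - fderiv ℝ z x (EuclideanSpace.single l 1) := by
      intro l x
      rw [fderiv_fun_sub ((hφ1 n).differentiable one_ne_zero x) (hz.differentiable one_ne_zero x)]
      rfl
    simp_rw [h1]
    rw [ha, add_add_add_comm, ← mul_add, ← Finset.sum_add_distrib]
    gcongr with l
    · exact htri i (hmE i (hφ n).continuous) (hw.mono_measure (hle i)) (hmE i hz.continuous)
    · exact htri i (hmE i (hd' (hφ1 n) l)) ((hg l).mono_measure (hle i)) (hmE i (hd' hz l))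
  have hlimF : ∀ e, ∃ f, MemLp f (ENNReal.ofReal q) (μHE[d - 1].restrict (M.face e)) ∧
      Tendsto (fun n => eLpNorm (fun x => φ n x - f x) (ENNReal.ofReal q)
        (μHE[d - 1].restrict (M.face e))) atTop (𝓝 0) := by
    intro e
    -- Any one adjacent element gives the Cauchy estimate on the face.
    obtain ⟨i, hi⟩ := M.exists_elem e
    refine exists_memLp_limit hq1 (fun n => hmF e (hφ n).continuous) (haK i) fun n m => ?_
    refine (hface i e hi n (φ m) (hφ1 m)).trans (le_of_eq ?_)
    rw [← mul_add]
    congr 2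
    rw [ha]
    congr 1
    · exact eLpNorm_sub_comm w (φ m) _ _
    · congr 1
      refine Finset.sum_congr rfl fun l _ => ?_
      exact eLpNorm_sub_comm (g l) (fun x => fderiv ℝ (φ m) x (EuclideanSpace.single l 1)) _ _
  choose tr htr htrlim using hlimF
  refine ⟨tr, htr, fun i e he z hz => ?_, fun i l σ hσ => ?_⟩
  · set R := eLpNorm (fun x => w x - z x) (ENNReal.ofReal q) (volume.restrict (M.elem i)) +
      ENNReal.ofReal (M.hElem i) * ∑ l, eLpNorm (fun x => g l x - fderiv ℝ z x
        (EuclideanSpace.single l 1)) (ENNReal.ofReal q) (volume.restrict (M.elem i))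
    have hb : ∀ n, eLpNorm (fun x => tr e x - z x) (ENNReal.ofReal q)
        (μHE[d - 1].restrict (M.face e)) ≤ eLpNorm (fun x => φ n x - tr e x) (ENNReal.ofReal q)
          (μHE[d - 1].restrict (M.face e)) + (traceConst d q γ (M.hElem i) * a i n +
          traceConst d q γ (M.hElem i) * R) := by
      intro n
      have h1 : (fun x => tr e x - z x) = (fun x => tr e x - φ n x) + fun x => φ n x - z x := by
        ext x; simp
      rw [h1, ← mul_add]
      refine (eLpNorm_add_le ((htr e).sub (hmF e (hφ n).continuous)).1
        ((hφ n).continuous.sub hz.continuous).aestronglyMeasurable hq1).trans ?_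
      exact add_le_add (le_of_eq (eLpNorm_sub_comm (tr e) (φ n) _ _)) (hface i e he n z hz)
    refine ge_of_tendsto' (x := atTop) ?_ hb
    have := (htrlim e).add ((haK i).add (tendsto_const_nhds (x := traceConst d q γ (M.hElem i) * R)))
    simpa using this
  · have hbd := (M.elem_polytope i).isBounded
    have hEm := (M.isOpen_elem i).measurableSet
    have hEv : volume (M.elem i) < ⊤ := hbd.measure_lt_top
    have hn : ∀ n, (∫ x in M.elem i, φ n x * fderiv ℝ σ x (EuclideanSpace.single l 1)) +
        ∫ x in M.elem i, fderiv ℝ (φ n) x (EuclideanSpace.single l 1) * σ x =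
        ∑ e ∈ M.facesOf i, ∫ x in M.face e, φ n x * (σ x * M.normal i e l) ∂μHE[d - 1] := by
      intro n
      rw [← integral_add
        (M.integrableOn_elem i (F := fun x => φ n x * fderiv ℝ σ x (EuclideanSpace.single l 1))
          ((hφ n).continuous.mul (hd' hσ l)))
        (M.integrableOn_elem i (F := fun x => fderiv ℝ (φ n) x (EuclideanSpace.single l 1) * σ x)
          ((hd' (hφ1 n) l).mul hσ.continuous))]
      have h1 := M.integral_elem_fderiv i (EuclideanSpace.single l 1) ((hφ1 n).mul hσ)
      have h2 : ∀ x, fderiv ℝ (fun x => φ n x * σ x) x (EuclideanSpace.single l 1) =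
          φ n x * fderiv ℝ σ x (EuclideanSpace.single l 1) +
            fderiv ℝ (φ n) x (EuclideanSpace.single l 1) * σ x := by
        intro x
        rw [(((hφ1 n).differentiable one_ne_zero x).hasFDerivAt.fun_mul
          (hσ.differentiable one_ne_zero x).hasFDerivAt).fderiv]
        simp [mul_comm]
      simp_rw [h2] at h1
      rw [h1]
      refine Finset.sum_congr rfl fun e _ => integral_congr_ae (Eventually.of_forall fun x => ?_)
      simp [EuclideanSpace.inner_single_left, mul_assoc]
    have t1 := (tendsto_setIntegral_mul hbd hEm hEv hq1 (fun n => hmE i (hφ n).continuous)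
      (hw.mono_measure (hle i)) (hzero i hlim) (hd' hσ l)).add
      (tendsto_setIntegral_mul hbd hEm hEv hq1 (fun n => hmE i (hd' (hφ1 n) l))
      ((hg l).mono_measure (hle i)) (hzero i (hlim' l)) hσ.continuous)
    have t2 : Tendsto (fun n => ∑ e ∈ M.facesOf i,
        ∫ x in M.face e, φ n x * (σ x * M.normal i e l) ∂μHE[d - 1]) atTop
        (𝓝 (∑ e ∈ M.facesOf i, ∫ x in M.face e, tr e x * (σ x * M.normal i e l) ∂μHE[d - 1])) :=
      tendsto_finsetSum _ fun e _ => tendsto_setIntegral_mul (M.face_polytope e).isBounded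
        (M.measurableSet_face e) (M.measure_face_lt_top e) hq1
        (fun n => hmF e (hφ n).continuous) (htr e) (htrlim e)
        (hσ.continuous.mul continuous_const)
    simp_rw [hn] at t1
    rw [← tendsto_nhds_unique t1 t2]
    have hfin : IsFiniteMeasure (volume.restrict (M.elem i)) :=
      ⟨by rwa [Measure.restrict_apply_univ]⟩
    exact integral_add
      (IntegrableOn.mul_continuous_of_bounded ((hw.mono_measure (hle i)).integrable hq1) hEm hbd
        (hd' hσ l))
      (IntegrableOn.mul_continuous_of_bounded (((hg l).mono_measure (hle i)).integrable hq1) hEm hbd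
        hσ.continuous)

end PolytopalMesh

end Traces

end LpPDWG
end


noncomputable section

namespace LpPDWG

/-! ### The equation on the elements and on the faces -/

section Equation

open ENNReal

namespace PolytopalMesh

variable {d : ℕ} {Ω : Set (Pt d)} (M : PolytopalMesh Ω)

theorem elem_disjoint_face (i : Fin M.numElem) (e : Fin M.numFace) :
    Disjoint (M.elem i) (M.face e) := by
  obtain ⟨j, hj⟩ := M.exists_elem e
  rw [Set.disjoint_left]
  intro x hx hxe
  have hxf := M.face_subset_frontier hj hxe
  rcases eq_or_ne i j with rfl | hij
  · have h2 := hxf.2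
    rw [(M.isOpen_elem i).interior_eq] at h2
    exact h2 hx
  · obtain ⟨y, hy, hyj⟩ := mem_closure_iff.1 hxf.1 _ (M.isOpen_elem i) hx
    exact Set.disjoint_left.1 (M.elem_disjoint i j hij) hy hyj

theorem iUnion_elem_ae_eq : (⋃ i, M.elem i) =ᵐ[volume] Ω := by
  have hsub : Ω \ ⋃ i, M.elem i ⊆ ⋃ i, frontier (M.elem i) := by
    rintro x ⟨hx, hxn⟩
    have h1 : x ∈ ⋃ i, closure (M.elem i) := by rw [M.cover]; exact subset_closure hx
    obtain ⟨i, hi⟩ := mem_iUnion.1 h1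
    refine mem_iUnion.2 ⟨i, hi, fun h => hxn (mem_iUnion.2 ⟨i, ?_⟩)⟩
    exact interior_subset h
  have h0 : volume (Ω \ ⋃ i, M.elem i) = 0 :=
    measure_mono_null hsub (measure_iUnion_null fun i => M.volume_frontier_elem i)
  exact (LE.le.eventuallyLE (iUnion_subset M.elem_subset)).antisymm
    (ae_le_set.2 h0)

theorem setIntegral_eq_sum_elem {F : Pt d → ℝ} (hF : IntegrableOn F Ω) :
    ∫ x in Ω, F x = ∑ i, ∫ x in M.elem i, F x := by
  rw [← setIntegral_congr_set (M.iUnion_elem_ae_eq)]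
  exact integral_iUnion_fintype (fun i => (M.isOpen_elem i).measurableSet)
    (fun i j hij => M.elem_disjoint i j hij) fun i => hF.mono_set (M.elem_subset i)

/-- The points of a face lying on the closure of another face form a null set. -/
theorem measure_face_inter_closure (e : Fin M.numFace) {e' : Fin M.numFace} (h : e' ≠ e) :
    μHE[d - 1] (M.face e ∩ closure (M.face e')) = 0 := by
  obtain ⟨i, hi⟩ := M.exists_elem e
  obtain ⟨x, hx⟩ := M.face_nonempty e
  obtain ⟨S, hS, hcov⟩ := (M.face_polytope e').boundary_flat
  refine measure_mono_null (t := ⋃ H ∈ S, ((H : Set (Pt d)) ∩ hyperplane (M.normal i e) x)) ?_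
    ((measure_biUnion_null_iff S.countable_toSet).2 fun H hH => ?_)
  · rintro y ⟨hy, hy'⟩
    have h1 := hcov ⟨hy', fun hy'' => Set.disjoint_left.1 (M.face_disjoint e' e h) hy'' hy⟩
    obtain ⟨H, hH, hyH⟩ := mem_iUnion₂.1 h1
    exact mem_iUnion₂.2 ⟨H, hH, hyH, M.face_subset_hyperplane hi hx hy⟩
  · rcases exists_subset_codimTwo (M.plane_finrank e') (hS H hH) with h0 | ⟨a, n₁, n₂, h₁, h₂, h₁₂, hsub⟩
    · rw [h0, empty_inter, measure_empty]
    · exact measure_mono_null (inter_subset_inter_left _ hsub)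
        (measure_codimTwo_inter_hyperplane a n₁ n₂ h₁ h₂ h₁₂ (M.normal_norm i e hi) x)

variable {M}

theorem fderiv_eq_sum_single (φ : Pt d → ℝ) (x v : Pt d) :
    fderiv ℝ φ x v = ∑ l, v l * fderiv ℝ φ x (EuclideanSpace.single l 1) := by
  have hx : v = ∑ l, v l • EuclideanSpace.single l (1 : ℝ) := by
    ext i
    simp [Finset.sum_apply, Pi.single_apply]
  conv_lhs => rw [hx]
  rw [map_sum]
  simp

/-- The transport equation holds almost everywhere on the elements. -/
theorem ae_eq_of_isWeakSolution {q : ℝ} (hq : 1 ≤ q)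
    {β : Fin M.numElem → Pt d} {c : Fin M.numElem → ℝ} {f g u : Pt d → ℝ}
    {u' : Fin d → Pt d → ℝ} (hu : MemLp u (ENNReal.ofReal q) (volume.restrict Ω))
    (hu' : ∀ l, MemLp (u' l) (ENNReal.ofReal q) (volume.restrict Ω))
    (hf : MemLp f (ENNReal.ofReal q) (volume.restrict Ω)) (hw : HasWeakGrad Ω u u')
    (hsol : IsWeakSolution M β c f g u) (i : Fin M.numElem) :
    f =ᵐ[volume.restrict (M.elem i)] fun x => ∑ l, β i l * u' l x + c i * u x := by
  have hq1 : 1 ≤ ENNReal.ofReal q := by simpa using hq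
  have hle := Measure.restrict_mono_set volume (M.elem_subset i)
  have hbd := (M.elem_polytope i).isBounded
  have hEm := (M.isOpen_elem i).measurableSet
  have hfin : IsFiniteMeasure (volume.restrict (M.elem i)) :=
    ⟨by rw [Measure.restrict_apply_univ]; exact hbd.measure_lt_top⟩
  have hi : ∀ {F : Pt d → ℝ}, MemLp F (ENNReal.ofReal q) (volume.restrict Ω) →
      IntegrableOn F (M.elem i) := fun hF => (hF.mono_measure hle).integrable hq1
  have hrhs : IntegrableOn (fun x => ∑ l, β i l * u' l x + c i * u x) (M.elem i) :=
    (integrable_finsetSum _ fun l _ => (hi (hu' l)).const_mul _).add ((hi hu).const_mul _)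
  refine ae_eq_of_setIntegral_mul_eq (M.isOpen_elem i) (hi hf).locallyIntegrableOn
    hrhs.locallyIntegrableOn fun φ hφ hφc hφs => ?_
  have hφ1 : ContDiff ℝ 1 φ := hφ.of_le (by exact_mod_cast le_top)
  have hd' : ∀ l, Continuous fun x => fderiv ℝ φ x (EuclideanSpace.single l 1) := fun l =>
    (hφ1.continuous_fderiv one_ne_zero).clm_apply continuous_const
  -- A test function supported in one open element vanishes on all faces, so it is admissible and no
  -- boundary term survives.
  have hface : ∀ e, ∀ x ∈ M.face e, φ x = 0 := fun e x hx =>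
    image_eq_zero_of_notMem_tsupport fun hx' =>
      Set.disjoint_left.1 (M.elem_disjoint_face i e) (hφs hx') hx
  have h1 := hsol φ hφ1 fun e _ => hface e
  have hinflow : M.inflowPairing β g (fun _ => φ) = 0 := by
    refine Finset.sum_eq_zero fun j _ => Finset.sum_eq_zero fun e _ => ?_
    refine setIntegral_eq_zero_of_forall_eq_zero fun x hx => ?_
    change φ x * _ = 0
    rw [hface e x hx, zero_mul]
  have hout : ∀ {s : Set (Pt d)}, M.elem i ⊆ s → ∀ F : Pt d → ℝ, (∀ x ∉ tsupport φ, F x = 0) →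
      ∫ x in s, F x = ∫ x in M.elem i, F x := by
    intro s hs F hF
    rw [setIntegral_eq_integral_of_forall_compl_eq_zero fun x hx => hF x fun h => hx (hs (hφs h)),
      setIntegral_eq_integral_of_forall_compl_eq_zero fun x hx => hF x fun h => hx (hφs h)]
  have hφ0 : ∀ x ∉ tsupport φ, φ x = 0 := fun x hx => image_eq_zero_of_notMem_tsupport hx
  have hφ0' : ∀ v, ∀ x ∉ tsupport φ, fderiv ℝ φ x v = 0 := fun v x hx =>
    image_eq_zero_of_notMem_tsupport (f := fun x => fderiv ℝ φ x v)
      fun h => hx (tsupport_fderiv_apply_subset ℝ v h)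
  rw [hinflow, zero_sub, hout (M.elem_subset i) _ fun x hx => by rw [hφ0 x hx, mul_zero],
    Finset.sum_eq_single i] at h1
  · have h2 : ∀ l, ∫ x in M.elem i, u x * fderiv ℝ φ x (EuclideanSpace.single l 1) =
        -∫ x in M.elem i, u' l x * φ x := by
      intro l
      have := hw l φ hφ hφc (hφs.trans (M.elem_subset i))
      rwa [hout (M.elem_subset i) _ fun x hx => by rw [hφ0' _ x hx, mul_zero],
        hout (M.elem_subset i) _ fun x hx => by rw [hφ0 x hx, mul_zero]] at this
    have i1 : ∀ l, IntegrableOn (fun x => β i l * (u x * fderiv ℝ φ x (EuclideanSpace.single l 1)))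
        (M.elem i) := fun l => ((hi hu).mul_continuous_of_bounded hEm hbd (hd' l)).const_mul _
    have i2 : IntegrableOn (fun x => c i * (u x * φ x)) (M.elem i) :=
      ((hi hu).mul_continuous_of_bounded hEm hbd hφ.continuous).const_mul _
    have i3 : ∀ l, IntegrableOn (fun x => β i l * (u' l x * φ x)) (M.elem i) := fun l =>
      ((hi (hu' l)).mul_continuous_of_bounded hEm hbd hφ.continuous).const_mul _
    have h3 : ∫ x in M.elem i, u x * (fderiv ℝ φ x (β i) - c i * φ x) =
        ∑ l, β i l * (-∫ x in M.elem i, u' l x * φ x) - c i * ∫ x in M.elem i, u x * φ x := by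
      simp_rw [← h2, ← integral_const_mul]
      rw [← integral_finsetSum _ fun l _ => i1 l, ← integral_sub (integrable_finsetSum _
        fun l _ => i1 l) i2]
      refine integral_congr_ae (Eventually.of_forall fun x => ?_)
      simp only
      rw [fderiv_eq_sum_single, mul_sub, Finset.mul_sum]
      congr 1
      · exact Finset.sum_congr rfl fun l _ => by ring
      · ring
    have h4 : ∫ x in M.elem i, (∑ l, β i l * u' l x + c i * u x) * φ x =
        ∑ l, β i l * (∫ x in M.elem i, u' l x * φ x) + c i * ∫ x in M.elem i, u x * φ x := by
      simp_rw [← integral_const_mul]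
      rw [← integral_finsetSum _ fun l _ => i3 l, ← integral_add (integrable_finsetSum _
        fun l _ => i3 l) i2]
      refine integral_congr_ae (Eventually.of_forall fun x => ?_)
      simp only
      rw [add_mul, Finset.sum_mul]
      congr 1
      · exact Finset.sum_congr rfl fun l _ => by ring
      · ring
    rw [h3] at h1
    rw [h4]
    simp_rw [mul_neg] at h1
    rw [Finset.sum_neg_distrib] at h1
    linarith
  · intro j _ hj
    refine setIntegral_eq_zero_of_forall_eq_zero fun x hx => ?_
    have hx' : x ∉ tsupport φ := fun h =>
      Set.disjoint_left.1 (M.elem_disjoint j i hj) hx (hφs h)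
    rw [hφ0 x hx', hφ0' _ x hx']
    simp
  · simp

open Classical in
/-- The boundary datum on the inflow faces, extended by zero to the other faces. -/
def inflowDatum (M : PolytopalMesh Ω) (β : Fin M.numElem → Pt d) (g : Pt d → ℝ)
    (e : Fin M.numFace) : Pt d → ℝ :=
  if M.IsInflow β e then g else 0

open Classical in
/-- The sum of the normal components of the fluxes on the sides of a face. -/
def fluxSum (M : PolytopalMesh Ω) (β : Fin M.numElem → Pt d) (e : Fin M.numFace) : ℝ :=
  ∑ i with e ∈ M.facesOf i, ⟪β i, M.normal i e⟫_ℝ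

/-- The double sum is regrouped by faces. Since t is single-valued, each face carries one
coefficient, the sum of β·n over its sides; on an interior face this is the jump of the normal
component of β. -/
theorem sum_face_sub_inflowPairing {β : Fin M.numElem → Pt d} {g : Pt d → ℝ}
    {t σ : Fin M.numFace → Pt d → ℝ}
    (ht : ∀ e, IntegrableOn (fun x => t e x * σ e x) (M.face e) μHE[d - 1])
    (hg : ∀ e, IntegrableOn (fun x => inflowDatum M β g e x * σ e x) (M.face e) μHE[d - 1]) :
    ∑ i, ∑ e ∈ M.facesOf i, ⟪β i, M.normal i e⟫_ℝ * ∫ x in M.face e, t e x * σ e x ∂μHE[d - 1] -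
      M.inflowPairing β g σ =
    ∑ e, fluxSum M β e *
      ∫ x in M.face e, (t e x - inflowDatum M β g e x) * σ e x ∂μHE[d - 1] := by
  classical
  have h1 : M.inflowPairing β g σ = ∑ i, ∑ e ∈ M.facesOf i, ⟪β i, M.normal i e⟫_ℝ *
      ∫ x in M.face e, inflowDatum M β g e x * σ e x ∂μHE[d - 1] := by
    rw [inflowPairing]
    refine Finset.sum_congr rfl fun i _ => ?_
    rw [Finset.sum_filter]
    refine Finset.sum_congr rfl fun e _ => ?_
    by_cases he : M.IsInflow β e
    · rw [if_pos he, ← integral_const_mul, inflowDatum, if_pos he]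
      refine integral_congr_ae (Eventually.of_forall fun x => ?_)
      simp only
      ring
    · rw [if_neg he, inflowDatum, if_neg he]
      simp
  rw [h1, ← Finset.sum_sub_distrib]
  simp_rw [← Finset.sum_sub_distrib, ← mul_sub]
  have h2 : ∀ e, (∫ x in M.face e, t e x * σ e x ∂μHE[d - 1]) -
      ∫ x in M.face e, inflowDatum M β g e x * σ e x ∂μHE[d - 1] =
      ∫ x in M.face e, (t e x - inflowDatum M β g e x) * σ e x ∂μHE[d - 1] := by
    intro e
    rw [← integral_sub (ht e) (hg e)]
    simp_rw [sub_mul]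
  simp_rw [h2, fluxSum, Finset.sum_mul]
  exact Finset.sum_comm' (by simp)

/-- Integration by parts in the transport equation on an element. -/
theorem integral_elem_add_integral_elem {q : ℝ} (hq : 1 ≤ q) {i : Fin M.numElem} {b : Pt d} {c : ℝ}
    {f u : Pt d → ℝ} {u' : Fin d → Pt d → ℝ} {tr : Fin M.numFace → Pt d → ℝ}
    (hu : MemLp u (ENNReal.ofReal q) (volume.restrict Ω))
    (hu' : ∀ l, MemLp (u' l) (ENNReal.ofReal q) (volume.restrict Ω))
    (hf : MemLp f (ENNReal.ofReal q) (volume.restrict Ω))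
    (hae : f =ᵐ[volume.restrict (M.elem i)] fun x => ∑ l, b l * u' l x + c * u x)
    (hibp : ∀ l, ∀ σ : Pt d → ℝ, ContDiff ℝ 1 σ →
      ∫ x in M.elem i, (u x * fderiv ℝ σ x (EuclideanSpace.single l 1) + u' l x * σ x) =
        ∑ e ∈ M.facesOf i, ∫ x in M.face e, tr e x * (σ x * M.normal i e l) ∂μHE[d - 1])
    {s : Pt d → ℝ} (hs : ContDiff ℝ 1 s) :
    (∫ x in M.elem i, u x * (fderiv ℝ s x b - c * s x)) + ∫ x in M.elem i, f x * s x =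
      ∑ e ∈ M.facesOf i, ⟪b, M.normal i e⟫_ℝ * ∫ x in M.face e, tr e x * s x ∂μHE[d - 1] := by
  have hq1 : 1 ≤ ENNReal.ofReal q := by simpa using hq
  have hd' : ∀ l, Continuous fun x => fderiv ℝ s x (EuclideanSpace.single l 1) := fun l =>
    (hs.continuous_fderiv one_ne_zero).clm_apply continuous_const
  have hfinE : IsFiniteMeasure (volume.restrict (M.elem i)) :=
    ⟨by rw [Measure.restrict_apply_univ]; exact (M.elem_polytope i).isBounded.measure_lt_top⟩
  have hbd := (M.elem_polytope i).isBounded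
  have hEm := (M.isOpen_elem i).measurableSet
  have hle := Measure.restrict_mono_set volume (M.elem_subset i)
  have hi : ∀ {F : Pt d → ℝ}, MemLp F (ENNReal.ofReal q) (volume.restrict Ω) →
      IntegrableOn F (M.elem i) := fun hF => (hF.mono_measure hle).integrable hq1
  have i1 : ∀ l, IntegrableOn (fun x => u x * fderiv ℝ s x (EuclideanSpace.single l 1))
      (M.elem i) := fun l => (hi hu).mul_continuous_of_bounded hEm hbd (hd' l)
  have i2 : ∀ l, IntegrableOn (fun x => u' l x * s x) (M.elem i) := fun l =>
    (hi (hu' l)).mul_continuous_of_bounded hEm hbd hs.continuous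
  have i4 : IntegrableOn (fun x => u x * (fderiv ℝ s x (b) - c * s x)) (M.elem i) :=
    (hi hu).mul_continuous_of_bounded hEm hbd
      (((hs.continuous_fderiv one_ne_zero).clm_apply continuous_const).sub
        (continuous_const.mul hs.continuous))
  have i6 : IntegrableOn (fun x => f x * s x) (M.elem i) :=
    (hi hf).mul_continuous_of_bounded hEm hbd hs.continuous
  rw [← integral_add i4 i6]
  have h2 : ∫ x in M.elem i, (u x * (fderiv ℝ s x (b) - c * s x) + f x * s x) =
      ∫ x in M.elem i, ∑ l, b l * (u x * fderiv ℝ s x (EuclideanSpace.single l 1) +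
        u' l x * s x) := by
    refine integral_congr_ae ?_
    filter_upwards [hae] with x hx
    rw [hx, fderiv_eq_sum_single]
    simp_rw [mul_add, Finset.sum_add_distrib, add_mul, mul_sub, Finset.mul_sum, Finset.sum_mul]
    have e1 : ∀ l, u x * (b l * fderiv ℝ s x (EuclideanSpace.single l 1)) =
      b l * (u x * fderiv ℝ s x (EuclideanSpace.single l 1)) := fun l => by ring
    have e2 : ∀ l, b l * u' l x * s x = b l * (u' l x * s x) := fun l => by ring
    simp_rw [e1, e2]
    ring
  have i5 : ∀ l, IntegrableOn (fun x => b l * (u x * fderiv ℝ s x (EuclideanSpace.single l 1) +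
      u' l x * s x)) (M.elem i) := fun l => ((i1 l).add (i2 l)).const_mul _
  rw [h2, integral_finsetSum _ fun l _ => i5 l]
  simp_rw [integral_const_mul, hibp _ s hs, Finset.mul_sum]
  rw [Finset.sum_comm]
  refine Finset.sum_congr rfl fun e _ => ?_
  simp_rw [← mul_assoc, integral_mul_const]
  rw [PiLp.inner_apply, Finset.sum_mul]
  refine Finset.sum_congr rfl fun l _ => ?_
  simp
  ring

/-- The boundary condition and the continuity of the normal flux, tested with functions on the
faces. -/
theorem sum_face_eq_inflowPairing (hΩ : IsOpen Ω) (hb : Bornology.IsBounded Ω) {q : ℝ}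
    (hq : 1 ≤ q) {β : Fin M.numElem → Pt d} {c : Fin M.numElem → ℝ} {f g u : Pt d → ℝ}
    {u' : Fin d → Pt d → ℝ} {tr : Fin M.numFace → Pt d → ℝ}
    (hu : MemLp u (ENNReal.ofReal q) (volume.restrict Ω))
    (hu' : ∀ l, MemLp (u' l) (ENNReal.ofReal q) (volume.restrict Ω))
    (hf : MemLp f (ENNReal.ofReal q) (volume.restrict Ω))
    (hg : ∀ e, M.IsInflow β e → MemLp g (ENNReal.ofReal q) (μHE[d - 1].restrict (M.face e)))
    (hw : HasWeakGrad Ω u u')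
    (htr : ∀ e, MemLp (tr e) (ENNReal.ofReal q) (μHE[d - 1].restrict (M.face e)))
    (hibp : ∀ i l, ∀ σ : Pt d → ℝ, ContDiff ℝ 1 σ →
      ∫ x in M.elem i, (u x * fderiv ℝ σ x (EuclideanSpace.single l 1) + u' l x * σ x) =
        ∑ e ∈ M.facesOf i, ∫ x in M.face e, tr e x * (σ x * M.normal i e l) ∂μHE[d - 1])
    (hsol : IsWeakSolution M β c f g u) {σ : Fin M.numFace → Pt d → ℝ}
    (hσ : ∀ e, Continuous (σ e)) (hσ0 : ∀ e, M.IsOutflow β e → ∀ x ∈ M.face e, σ e x = 0) :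
    ∑ i, ∑ e ∈ M.facesOf i, ⟪β i, M.normal i e⟫_ℝ *
      ∫ x in M.face e, tr e x * σ e x ∂μHE[d - 1] = M.inflowPairing β g σ := by
  classical
  have hq1 : 1 ≤ ENNReal.ofReal q := by simpa using hq
  have hfinF : ∀ e, IsFiniteMeasure (μHE[d - 1].restrict (M.face e)) := fun e =>
    ⟨by rw [Measure.restrict_apply_univ]; exact M.measure_face_lt_top e⟩
  have hfinE : ∀ i, IsFiniteMeasure (volume.restrict (M.elem i)) := fun i =>
    ⟨by rw [Measure.restrict_apply_univ]; exact (M.elem_polytope i).isBounded.measure_lt_top⟩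
  have itr : ∀ e, IntegrableOn (tr e) (M.face e) μHE[d - 1] := fun e => (htr e).integrable hq1
  have ig : ∀ e, IntegrableOn (inflowDatum M β g e) (M.face e) μHE[d - 1] := by
    intro e
    by_cases he : M.IsInflow β e
    · rw [inflowDatum, if_pos he]
      exact (hg e he).integrable hq1
    · rw [inflowDatum, if_neg he]
      exact integrable_zero _ _ _
  have hmul : ∀ e {F : Pt d → ℝ}, IntegrableOn F (M.face e) μHE[d - 1] → ∀ {s : Pt d → ℝ},
      Continuous s → IntegrableOn (fun x => F x * s x) (M.face e) μHE[d - 1] := fun e F hF s hs =>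
    hF.mul_continuous_of_bounded (M.measurableSet_face e) (M.face_polytope e).isBounded hs
  -- the identity for continuously differentiable test functions
  have key : ∀ s : Pt d → ℝ, ContDiff ℝ 1 s →
      (∀ e, M.IsOutflow β e → ∀ x ∈ M.face e, s x = 0) →
      ∑ e, fluxSum M β e *
        ∫ x in M.face e, (tr e x - inflowDatum M β g e x) * s x ∂μHE[d - 1] = 0 := by
    intro s hs hs0
    rw [← sum_face_sub_inflowPairing (σ := fun _ => s) (fun e => hmul e (itr e) hs.continuous)
      fun e => hmul e (ig e) hs.continuous, sub_eq_zero]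
    have h1 := hsol s hs hs0
    have hd' : ∀ l, Continuous fun x => fderiv ℝ s x (EuclideanSpace.single l 1) := fun l =>
      (hs.continuous_fderiv one_ne_zero).clm_apply continuous_const
    have hfinΩ : IsFiniteMeasure (volume.restrict Ω) :=
      ⟨by rw [Measure.restrict_apply_univ]; exact hb.measure_lt_top⟩
    have hfs : IntegrableOn (fun x => f x * s x) Ω :=
      IntegrableOn.mul_continuous_of_bounded (hf.integrable hq1) hΩ.measurableSet hb hs.continuous
    rw [M.setIntegral_eq_sum_elem hfs, eq_sub_iff_add_eq, ← Finset.sum_add_distrib] at h1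
    rw [← h1]
    refine Finset.sum_congr rfl fun i _ => ?_
    exact (integral_elem_add_integral_elem hq hu hu' hf
      (ae_eq_of_isWeakSolution hq hu hu' hf hw hsol i) (hibp i) hs).symm
  -- localization to a single face
  have hzero : ∀ e, ¬ M.IsOutflow β e → ∀ᵐ x ∂μHE[d - 1].restrict (M.face e),
      fluxSum M β e * (tr e x - inflowDatum M β g e x) = 0 := by
    intro e he
    -- This open set contains almost all of `e` and meets no other face. Test functions supported in
    -- it isolate the integral over `e`, and they are admissible because `e` is not an outflow face.
    set V : Set (Pt d) := (⋃ e' ∈ {e' | e' ≠ e}, closure (M.face e'))ᶜ with hV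
    have hVo : IsOpen V :=
      ((Set.toFinite _).isClosed_biUnion fun _ _ => isClosed_closure).isOpen_compl
    have hloc : Integrable (fun x => fluxSum M β e * (tr e x - inflowDatum M β g e x))
      (μHE[d - 1].restrict (M.face e)) := ((itr e).sub (ig e)).const_mul _
    have hae := hVo.ae_eq_zero_of_integral_contDiff_smul_eq_zero
      (μ := μHE[d - 1].restrict (M.face e))
      (f := fun x => fluxSum M β e * (tr e x - inflowDatum M β g e x))
      (hloc.locallyIntegrable.locallyIntegrableOn V) fun φ hφ _ hφs => ?_
    · have hnull : ∀ᵐ x ∂μHE[d - 1].restrict (M.face e), x ∈ V := by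
        refine (ae_restrict_iff' (M.measurableSet_face e)).2 ?_
        have : μHE[d - 1] (⋃ e' ∈ {e' | e' ≠ e}, M.face e ∩ closure (M.face e')) = 0 :=
          (measure_biUnion_null_iff (Set.to_countable _)).2 fun e' he' =>
            M.measure_face_inter_closure e he'
        filter_upwards [measure_eq_zero_iff_ae_notMem.1 this] with x hx hxe hxV
        obtain ⟨e', he', hxe'⟩ := mem_iUnion₂.1 hxV
        exact hx (mem_iUnion₂.2 ⟨e', he', hxe, hxe'⟩)
      filter_upwards [hae, hnull] with x h1 h2 using h1 h2
    · have hφ0 : ∀ e' ≠ e, ∀ x ∈ M.face e', φ x = 0 := fun e' he' x hx =>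
        image_eq_zero_of_notMem_tsupport fun h =>
          hφs h (mem_iUnion₂.2 ⟨e', he', subset_closure hx⟩)
      have h1 := key φ (hφ.of_le (by exact_mod_cast le_top)) fun e' he' =>
        hφ0 e' fun h => he (h ▸ he')
      rw [Finset.sum_eq_single e] at h1
      · rw [← h1, ← integral_const_mul]
        refine integral_congr_ae (Eventually.of_forall fun x => ?_)
        simp only [smul_eq_mul]
        ring
      · intro e' _ he'
        rw [setIntegral_eq_zero_of_forall_eq_zero fun x hx => by rw [hφ0 e' he' x hx, mul_zero],
          mul_zero]
      · simp
  rw [← sub_eq_zero, sum_face_sub_inflowPairing (fun e => hmul e (itr e) (hσ e))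
    fun e => hmul e (ig e) (hσ e)]
  -- The faces now decouple: on outflow faces the test function vanishes, and elsewhere the flux
  -- defect does. Functions unrelated from face to face are therefore allowed.
  refine Finset.sum_eq_zero fun e _ => ?_
  by_cases he : M.IsOutflow β e
  · rw [setIntegral_eq_zero_of_forall_eq_zero fun x hx => by rw [hσ0 e he x hx, mul_zero], mul_zero]
  · rw [← integral_const_mul]
    refine integral_eq_zero_of_ae ?_
    filter_upwards [hzero e he] with x hx
    rw [← mul_assoc, hx, zero_mul]
    rfl

end PolytopalMesh

end Equation

end LpPDWG
end


noncomputable section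

namespace LpPDWG

/-! ### Local approximation -/

section LocalApproximation

open ENNReal

namespace PolytopalMesh

variable {d : ℕ} {Ω : Set (Pt d)} {M : PolytopalMesh Ω}

/-- This exposes the factor h^(-1/q), which the weight h^(1-p) of the stabilizer compensates. -/
theorem traceConst_eq (d : ℕ) {q γ h : ℝ} (hγ : 0 < γ) (hh : 0 < h) :
    traceConst d q γ h =
      ENNReal.ofReal ((2 ^ q * 2 ^ (d - 1) * γ⁻¹) ^ (1 / q) * h ^ (-(1 / q))) := by
  have h1 : (2 : ℝ≥0∞) ^ q * 2 ^ (d - 1) * ENNReal.ofReal (γ * h)⁻¹ =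
      ENNReal.ofReal (2 ^ q * 2 ^ (d - 1) * γ⁻¹ * h⁻¹) := by
    rw [mul_inv, mul_assoc (2 ^ q * 2 ^ (d - 1) : ℝ),
      ENNReal.ofReal_mul (p := 2 ^ q * 2 ^ (d - 1)) (by positivity),
      ENNReal.ofReal_mul (p := 2 ^ q) (by positivity), ← ENNReal.ofReal_rpow_of_pos two_pos,
      ENNReal.ofReal_pow two_pos.le, ENNReal.ofReal_ofNat]
  rw [traceConst, h1, ENNReal.ofReal_rpow_of_pos (by positivity), Real.mul_rpow (by positivity)
    (by positivity), Real.inv_rpow hh.le, Real.rpow_neg hh.le]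

/-- The trace inequality for the constant function 1. -/
theorem ShapeRegular.measure_face_rpow_le {γ : ℝ} {N : ℕ} (hsr : M.ShapeRegular γ N) (hγ : 0 < γ)
    (hd : 1 ≤ d) {q : ℝ} (hq : 1 ≤ q) {i : Fin M.numElem} {e : Fin M.numFace}
    (he : e ∈ M.facesOf i) :
    μHE[d - 1] (M.face e) ^ (1 / q) ≤
      traceConst d q γ (M.hElem i) * volume (M.elem i) ^ (1 / q) := by
  have hq0 : 0 < q := by linarith
  have hn : ∀ μ : Measure (Pt d), eLpNorm (fun _ : Pt d => (1 : ℝ)) (ENNReal.ofReal q) μ =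
      μ univ ^ (1 / q) := by
    intro μ
    rw [eLpNorm_const' _ (by simpa using hq0) ofReal_ne_top, ENNReal.toReal_ofReal hq0.le]
    simp
  have := hsr.eLpNorm_face_le hγ hd hq he (z := fun _ => 1) contDiff_const
  simpa [hn] using this

/-- The projection of a function which is small in `L^q` is small on an element and on its faces. -/
theorem exists_projection_eLpNorm_le (hd : 1 ≤ d) (r : ℕ) {q : ℝ} (hq : 1 ≤ q) {γ : ℝ}
    (hγ : 0 < γ) :
    ∃ K : ℝ, 0 ≤ K ∧ ∀ {Ω : Set (Pt d)} {M : PolytopalMesh Ω} {N : ℕ}, M.ShapeRegular γ N →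
      ∀ i, ∀ z : Pt d → ℝ, MemLp z (ENNReal.ofReal q) (volume.restrict (M.elem i)) →
      ∃ Q : Poly d r, (∀ ψ : Poly d r,
        ∫ x in M.elem i, val Q.1 x * val ψ.1 x = ∫ x in M.elem i, z x * val ψ.1 x) ∧
        eLpNorm (val Q.1) (ENNReal.ofReal q) (volume.restrict (M.elem i)) ≤
          ENNReal.ofReal K * eLpNorm z (ENNReal.ofReal q) (volume.restrict (M.elem i)) ∧
        ∀ e ∈ M.facesOf i, eLpNorm (val Q.1) (ENNReal.ofReal q) (μHE[d - 1].restrict (M.face e)) ≤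
          traceConst d q γ (M.hElem i) * (ENNReal.ofReal K *
            eLpNorm z (ENNReal.ofReal q) (volume.restrict (M.elem i))) := by
  have hq0 : 0 < q := by linarith
  have hq1 : 1 ≤ ENNReal.ofReal q := by simpa using hq
  obtain ⟨C, hC, H⟩ := exists_projection_bound d r hγ
  set ϖ : ℝ := volume.real (Metric.closedBall (0 : Pt d) 1) with hϖ
  refine ⟨C * ϖ, by positivity, fun {Ω M N} hsr i z hz => ?_⟩
  set h := M.hElem i with hh
  have hh0 : 0 < h := M.hElem_pos hd i
  obtain ⟨x₀, hx₀⟩ := (M.elem_polytope i).isConnected.nonempty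
  have hsub : M.elem i ⊆ Metric.closedBall x₀ h := fun x hx =>
    Metric.mem_closedBall.2 (Metric.dist_le_diam_of_mem (M.elem_polytope i).isBounded hx hx₀)
  have hcl : closure (M.elem i) ⊆ Metric.closedBall x₀ h :=
    closure_minimal hsub Metric.isClosed_closedBall
  have hfin : IsFiniteMeasure (volume.restrict (M.elem i)) :=
    ⟨by rw [Measure.restrict_apply_univ]; exact (M.elem_polytope i).isBounded.measure_lt_top⟩
  have hzi : IntegrableOn z (M.elem i) := hz.integrable hq1
  obtain ⟨Q, hQ, hQb⟩ := H x₀ h hh0 _ hsub (M.isOpen_elem i)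
    (M.elem_polytope i).isConnected.nonempty (hsr.volume_elem i) z hzi
  set S : ℝ := C * (h ^ d)⁻¹ * ∫ x in M.elem i, |z x| with hS
  set n := eLpNorm z (ENNReal.ofReal q) (volume.restrict (M.elem i)) with hn
  have hS0 : 0 ≤ S := mul_nonneg (by positivity) (integral_nonneg fun _ => abs_nonneg _)
  have hV : volume (M.elem i) ≠ ⊤ := (M.elem_polytope i).isBounded.measure_lt_top.ne
  have hVle : volume (M.elem i) ≤ ENNReal.ofReal (h ^ d * ϖ) := by
    refine (measure_mono hsub).trans ?_
    rw [Measure.addHaar_closedBall' _ _ hh0.le, finrank_euclideanSpace_fin,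
      ENNReal.ofReal_mul (by positivity), hϖ, measureReal_def, ENNReal.ofReal_toReal]
    exact (Metric.isBounded_closedBall.measure_lt_top).ne
  have hSn : ENNReal.ofReal S ≤ ENNReal.ofReal (C * (h ^ d)⁻¹) *
      (n * volume (M.elem i) ^ (1 - 1 / q)) := by
    rw [hS, ENNReal.ofReal_mul (by positivity)]
    refine mul_le_mul_right ?_ _
    have h1 : ENNReal.ofReal (∫ x in M.elem i, |z x|) =
        eLpNorm z 1 (volume.restrict (M.elem i)) := by
      rw [eLpNorm_one_eq_lintegral_enorm, ofReal_integral_eq_lintegral_ofReal hzi.abs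
        (Eventually.of_forall fun _ => abs_nonneg _)]
      simp_rw [← Real.norm_eq_abs, ofReal_norm]
    rw [h1]
    refine (eLpNorm_le_eLpNorm_mul_rpow_measure_univ hq1 hz.1).trans (le_of_eq ?_)
    rw [Measure.restrict_apply_univ, ENNReal.toReal_one, ENNReal.toReal_ofReal hq0.le, div_one]
  -- The pointwise bound `S` is h^(-d) times an L¹ norm. Hölder's inequality contributes
  -- |T|^(1-1/q), which joins |T|^(1/q) to give |T|, and |T| ≤ ϖ h^d cancels the factor h^(-d).
  have hVS : volume (M.elem i) ^ (1 / q) * ENNReal.ofReal S ≤ ENNReal.ofReal (C * ϖ) * n := by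
    calc volume (M.elem i) ^ (1 / q) * ENNReal.ofReal S
        ≤ volume (M.elem i) ^ (1 / q) * (ENNReal.ofReal (C * (h ^ d)⁻¹) *
          (n * volume (M.elem i) ^ (1 - 1 / q))) := mul_le_mul_right hSn _
      _ = ENNReal.ofReal (C * (h ^ d)⁻¹) * n *
          (volume (M.elem i) ^ (1 / q) * volume (M.elem i) ^ (1 - 1 / q)) := by ring
      _ = ENNReal.ofReal (C * (h ^ d)⁻¹) * n * volume (M.elem i) := by
          rw [← ENNReal.rpow_add_of_nonneg _ _ (by positivity)
            (by rw [sub_nonneg, div_le_one hq0]; exact hq), add_sub_cancel, ENNReal.rpow_one]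
      _ ≤ ENNReal.ofReal (C * (h ^ d)⁻¹) * n * ENNReal.ofReal (h ^ d * ϖ) :=
          mul_le_mul_right hVle _
      _ = ENNReal.ofReal (C * ϖ) * n := by
          rw [mul_right_comm, ← ENNReal.ofReal_mul (by positivity)]
          congr 2
          field_simp
  have hbound : ∀ (μ : Measure (Pt d)) (s : Set (Pt d)), MeasurableSet s →
      s ⊆ Metric.closedBall x₀ h →
      eLpNorm (val Q.1) (ENNReal.ofReal q) (μ.restrict s) ≤ μ s ^ (1 / q) * ENNReal.ofReal S := by
    intro μ s hs hsb
    refine (eLpNorm_le_of_ae_bound (C := S) ((ae_restrict_iff' hs).2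
      (Eventually.of_forall fun x hx => hQb x (hsb hx)))).trans (le_of_eq ?_)
    rw [Measure.restrict_apply_univ, ENNReal.toReal_ofReal hq0.le, one_div]
  refine ⟨Q, hQ, (hbound _ _ (M.isOpen_elem i).measurableSet hsub).trans hVS, fun e he => ?_⟩
  refine (hbound _ _ (M.measurableSet_face e) fun x hx =>
    hcl (M.face_subset_frontier he hx).1).trans ?_
  refine (mul_le_mul_left (hsr.measure_face_rpow_le hγ hd hq he) _).trans ?_
  rw [mul_assoc]
  exact mul_le_mul_right hVS _

/-- Approximation by piecewise polynomials, on the elements and on their faces. -/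
theorem ShapeRegular.exists_local_approx (hΩ : IsLipschitzDomain Ω) (hd : 1 ≤ d) {k : ℕ}
    (hk : 1 ≤ k) {q : ℝ} (hq : 1 ≤ q) {γ : ℝ} (hγ : 0 < γ) :
    ∃ κ : ℝ, 1 ≤ κ ∧ ∃ K : ℝ, 0 ≤ K ∧ ∀ {M : PolytopalMesh Ω} {N : ℕ}, M.ShapeRegular γ N →
      ∀ {v : (Fin d →₀ ℕ) → Pt d → ℝ}, IsSobolevJet Ω k q v →
      ∀ {G : Pt d → ℝ}, (∀ a, a.degree = k → ∀ᵐ x ∂volume.restrict Ω, ‖v a x‖ ≤ G x) →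
      ∀ {tr : Fin M.numFace → Pt d → ℝ},
        (∀ e, MemLp (tr e) (ENNReal.ofReal q) (μHE[d - 1].restrict (M.face e))) →
        (∀ i, ∀ e ∈ M.facesOf i, ∀ z : Pt d → ℝ, ContDiff ℝ 1 z →
          eLpNorm (fun x => tr e x - z x) (ENNReal.ofReal q) (μHE[d - 1].restrict (M.face e)) ≤
            traceConst d q γ (M.hElem i) *
              (eLpNorm (fun x => v 0 x - z x) (ENNReal.ofReal q) (volume.restrict (M.elem i)) +
                ENNReal.ofReal (M.hElem i) * ∑ l, eLpNorm (fun x => v (Finsupp.single l 1) x -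
                  fderiv ℝ z x (EuclideanSpace.single l 1)) (ENNReal.ofReal q)
                  (volume.restrict (M.elem i)))) →
      ∀ i, ∀ x₀ ∈ M.elem i, ∃ U, IsOpen U ∧ U ⊆ Ω ∧ U ⊆ Metric.ball x₀ (κ * M.hElem i) ∧
        ∃ P : Poly d (k - 1),
          (∀ ψ : Poly d (k - 1), ∫ x in M.elem i, (v 0 x - val P.1 x) * val ψ.1 x = 0) ∧
          eLpNorm (fun x => v 0 x - val P.1 x) (ENNReal.ofReal q) (volume.restrict (M.elem i)) ≤
            ENNReal.ofReal (K * M.hElem i ^ k) * eLpNorm G (ENNReal.ofReal q) (volume.restrict U) ∧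
          ∀ e ∈ M.facesOf i, eLpNorm (fun x => tr e x - val P.1 x) (ENNReal.ofReal q)
            (μHE[d - 1].restrict (M.face e)) ≤ traceConst d q γ (M.hElem i) *
            (ENNReal.ofReal (K * M.hElem i ^ k) *
              eLpNorm G (ENNReal.ofReal q) (volume.restrict U)) := by
  have hq0 : 0 < q := by linarith
  have hq1 : 1 ≤ ENNReal.ofReal q := by simpa using hq
  obtain ⟨κ, hκ, c, hc, hpatch⟩ := hΩ.exists_isPatch hq
  obtain ⟨K, hK, hproj⟩ := exists_projection_eLpNorm_le hd (k - 1) hq hγ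
  -- The first summand comes from the error in the function, the second from its d first
  -- derivatives, each multiplied by h in the trace inequality.
  set A : ℝ := (c * d) ^ k + d * (c * d) ^ (k - 1) with hA
  have hA0 : 0 ≤ A := by positivity
  refine ⟨κ, hκ, (1 + K) * A, by positivity, ?_⟩
  intro M N hsr v hv G hG tr htr htrb i x₀ hx₀
  set h := M.hElem i with hh
  have hh0 : 0 < h := M.hElem_pos hd i
  obtain ⟨U, hU⟩ := hpatch x₀ (M.elem_subset i hx₀) h hh0
  obtain ⟨z, r, hr, hzr, hP⟩ := hU.hasPoincare
  set T := volume.restrict (M.elem i) with hT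
  set E := eLpNorm G (ENNReal.ofReal q) (volume.restrict U) with hE
  have hTU : M.elem i ⊆ U := fun x hx => hU.closedBall_subset
    ⟨Metric.mem_closedBall.2 (Metric.dist_le_diam_of_mem (M.elem_polytope i).isBounded hx hx₀),
      M.elem_subset i hx⟩
  obtain ⟨b, hb, hbE⟩ := hv.exists_taylorPoly hΩ hq hU.subset hr hzr
    (ENNReal.rpow_lt_top_of_nonneg hq0.le ofReal_ne_top).ne hP (E := E) fun a ha =>
      eLpNorm_mono_ae_real (ae_mono (Measure.restrict_mono_set _ hU.subset) (hG a ha))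
  rw [one_div, ENNReal.rpow_rpow_inv hq0.ne'] at hbE
  set P : MvPolynomial (Fin d) ℝ := taylorPoly k b 0 with hPdef
  have hPmem : P ∈ MvPolynomial.restrictTotalDegree (Fin d) ℝ (k - 1) := taylorPoly_mem hk hb 0
  have hofR : ∀ n : ℕ, (ENNReal.ofReal (c * h) * d) ^ n = ENNReal.ofReal ((c * h * d) ^ n) := by
    intro n
    rw [ENNReal.ofReal_pow (by positivity), ENNReal.ofReal_mul (p := c * h) (by positivity),
      ENNReal.ofReal_natCast]
  have h0 : eLpNorm (fun x => v 0 x - val P x) (ENNReal.ofReal q) T ≤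
      ENNReal.ofReal ((c * h * d) ^ k) * E := by
    refine (eLpNorm_mono_measure _ (Measure.restrict_mono_set _ hTU)).trans ?_
    rw [← hofR]
    exact hbE k le_rfl 0 (by simp)
  have h1 : ∀ l, eLpNorm (fun x => v (Finsupp.single l 1) x -
      fderiv ℝ (val P) x (EuclideanSpace.single l 1)) (ENNReal.ofReal q) T ≤
      ENNReal.ofReal ((c * h * d) ^ (k - 1)) * E := by
    intro l
    refine (eLpNorm_mono_measure _ (Measure.restrict_mono_set _ hTU)).trans ?_
    simp_rw [fderiv_val_single, hPdef, pderiv_taylorPoly hb, zero_add]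
    rw [← hofR]
    exact hbE (k - 1) (by omega) _ (by rw [Finsupp.degree_single]; omega)
  have h2 : eLpNorm (fun x => v 0 x - val P x) (ENNReal.ofReal q) T + ENNReal.ofReal h *
      ∑ l, eLpNorm (fun x => v (Finsupp.single l 1) x -
        fderiv ℝ (val P) x (EuclideanSpace.single l 1)) (ENNReal.ofReal q) T ≤
      ENNReal.ofReal (A * h ^ k) * E := by
    calc _ ≤ ENNReal.ofReal ((c * h * d) ^ k) * E + ENNReal.ofReal h *
        ∑ l : Fin d, ENNReal.ofReal ((c * h * d) ^ (k - 1)) * E :=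
          add_le_add h0 (mul_le_mul_right (Finset.sum_le_sum fun l _ => h1 l) _)
      _ = ENNReal.ofReal (A * h ^ k) * E := by
          rw [Finset.sum_const, Finset.card_univ, Fintype.card_fin, nsmul_eq_mul,
            ← ENNReal.ofReal_natCast d, ← mul_assoc, ← mul_assoc, ← ENNReal.ofReal_mul hh0.le,
            ← ENNReal.ofReal_mul (by positivity), ← add_mul,
            ← ENNReal.ofReal_add (by positivity) (by positivity)]
          congr 2
          obtain ⟨m, rfl⟩ : ∃ m, k = m + 1 := ⟨k - 1, by omega⟩
          simp only [hA, Nat.add_sub_cancel]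
          ring
  have hfin : IsFiniteMeasure T :=
    ⟨by rw [hT, Measure.restrict_apply_univ]; exact (M.elem_polytope i).isBounded.measure_lt_top⟩
  have hpolyE : ∀ R : MvPolynomial (Fin d) ℝ, MemLp (val R) (ENNReal.ofReal q) T := fun R =>
    memLp_restrict_of_continuous (M.elem_polytope i).isBounded
      (M.elem_polytope i).isBounded.measure_lt_top.ne (continuous_val R)
  have hvT : MemLp (v 0) (ENNReal.ofReal q) T :=
    (hv.memLp 0 (by simp)).mono_measure (Measure.restrict_mono_set _ (M.elem_subset i))
  have hzT : MemLp (fun x => v 0 x - val P x) (ENNReal.ofReal q) T := hvT.sub (hpolyE P)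
  -- The Taylor polynomial approximates on the patch, but its error is not orthogonal to polynomials
  -- on the element. Adding the projection `Q` of the error yields the L² projection of the
  -- function, and stability of the projection keeps the bounds.
  obtain ⟨Q, hQ, hQT, hQe⟩ := hproj hsr i _ hzT
  have h3 : eLpNorm (fun x => v 0 x - val P x) (ENNReal.ofReal q) T ≤
      ENNReal.ofReal (A * h ^ k) * E := le_self_add.trans h2
  have hfinal : ∀ a b : ℝ≥0∞, a ≤ ENNReal.ofReal (A * h ^ k) * E →
      b ≤ ENNReal.ofReal K * (ENNReal.ofReal (A * h ^ k) * E) →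
      a + b ≤ ENNReal.ofReal ((1 + K) * A * h ^ k) * E := by
    intro a b ha hb
    refine (add_le_add ha hb).trans (le_of_eq ?_)
    rw [mul_assoc (1 + K), ENNReal.ofReal_mul (p := 1 + K) (by positivity), ENNReal.ofReal_add zero_le_one hK,
      ENNReal.ofReal_one]
    ring
  have hsplit : ∀ x, val (P + Q.1) x = val P x + val Q.1 x := fun x => by rw [val_add]
  refine ⟨U, hU.isOpen, hU.subset, hU.subset_ball, ⟨P + Q.1, Submodule.add_mem _ hPmem Q.2⟩,
    fun ψ => ?_, ?_, fun e he => ?_⟩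
  · have i1 : IntegrableOn (fun x => (v 0 x - val P x) * val ψ.1 x) (M.elem i) :=
      IntegrableOn.mul_continuous_of_bounded (hzT.integrable hq1)
        (M.isOpen_elem i).measurableSet (M.elem_polytope i).isBounded (continuous_val ψ.1)
    have i2 : IntegrableOn (fun x => val Q.1 x * val ψ.1 x) (M.elem i) :=
      M.integrableOn_elem i ((continuous_val _).mul (continuous_val _))
    have := hQ ψ
    rw [← sub_eq_zero, ← integral_sub i2 i1] at this
    rw [← neg_eq_zero, ← this, ← integral_neg]
    refine integral_congr_ae (Eventually.of_forall fun x => ?_)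
    simp only [hsplit]
    ring
  · have h4 : (fun x => v 0 x - val (P + Q.1) x) = (fun x => v 0 x - val P x) - val Q.1 := by
      funext x
      simp only [hsplit, Pi.sub_apply]
      ring
    rw [h4]
    exact (eLpNorm_sub_le hzT.1 (hpolyE _).1 hq1).trans
      (hfinal _ _ h3 (hQT.trans (mul_le_mul_right h3 _)))
  · have h4 : (fun x => tr e x - val (P + Q.1) x) = (fun x => tr e x - val P x) - val Q.1 := by
      funext x
      simp only [hsplit, Pi.sub_apply]
      ring
    rw [h4]
    refine (eLpNorm_sub_le ((htr e).1.sub (continuous_val P).aestronglyMeasurable)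
      (continuous_val _).aestronglyMeasurable hq1).trans ?_
    refine (add_le_add ((htrb i e he _ ((contDiff_val P).of_le le_top)).trans
      (mul_le_mul_right h2 _)) ((hQe e he).trans
      (mul_le_mul_right (mul_le_mul_right h3 _) _))).trans ?_
    rw [← mul_add]
    exact mul_le_mul_right (hfinal _ _ le_rfl le_rfl) _

end PolytopalMesh

end LocalApproximation

end LpPDWG
end


noncomputable section

namespace LpPDWG

/-! ### The error estimate -/

section ErrorEstimate

open ENNReal

variable {d : ℕ} {Ω : Set (Pt d)} {M : PolytopalMesh Ω}

theorem abs_rpow_sub_one_mul_sign_mul {p : ℝ} (hp : 0 < p) (a : ℝ) :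
    |a| ^ (p - 1) * Real.sign a * a = |a| ^ p := by
  have h : ∀ b : ℝ, 0 < b → b ^ (p - 1) * b = b ^ p := fun b hb => by
    rw [← Real.rpow_add_one hb.ne', sub_add_cancel]
  rcases lt_trichotomy a 0 with ha | rfl | ha
  · rw [Real.sign_of_neg ha, abs_of_neg ha, ← h _ (neg_pos.2 ha)]
    ring
  · simp [Real.zero_rpow hp.ne']
  · rw [Real.sign_of_pos ha, abs_of_pos ha, ← h _ ha, mul_one]

theorem stab_self (β : Fin M.numElem → Pt d) (c : Fin M.numElem → ℝ) {p : ℝ} (hp : 0 < p)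
    (ρ τ : ℝ) {j : ℕ} (σ : WeakFun M j) :
    stab M β c p ρ τ σ σ = ∑ i, (ρ * M.hElem i ^ (1 - p) * ∑ e ∈ M.facesOf i, ∫ x in M.face e,
      |val (σ.interior i) x - val (σ.boundary e) x| ^ p ∂μHE[d - 1] +
      τ * ∫ x in M.elem i, |transport (β i) (c i) (σ.interior i) x| ^ p) := by
  simp_rw [stab, abs_rpow_sub_one_mul_sign_mul hp]

/-- The transport polynomial. -/
def transportPoly (b : Pt d) (c : ℝ) (P : MvPolynomial (Fin d) ℝ) : MvPolynomial (Fin d) ℝ :=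
  ∑ l, b l • MvPolynomial.pderiv l P - c • P

theorem val_transportPoly (b : Pt d) (c : ℝ) (P : MvPolynomial (Fin d) ℝ) (x : Pt d) :
    val (transportPoly b c P) x = transport b c P x := by
  rw [transportPoly, transport, val_sub, val_sum, val_smul]
  simp_rw [val_smul]

/-- With constant coefficients the transport expression does not raise the degree, which makes it a
legitimate test polynomial for the projection when j = k - 1. -/
theorem transportPoly_mem {r : ℕ} (b : Pt d) (c : ℝ) {P : MvPolynomial (Fin d) ℝ}
    (hP : P ∈ MvPolynomial.restrictTotalDegree (Fin d) ℝ r) :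
    transportPoly b c P ∈ MvPolynomial.restrictTotalDegree (Fin d) ℝ r := by
  refine Submodule.sub_mem _ (Submodule.sum_mem _ fun l _ => Submodule.smul_mem _ _ ?_)
    (Submodule.smul_mem _ _ hP)
  rw [MvPolynomial.mem_restrictTotalDegree] at hP ⊢
  exact (totalDegree_pderiv_le l P).trans (by omega)

theorem continuous_transport (b : Pt d) (c : ℝ) (P : MvPolynomial (Fin d) ℝ) :
    Continuous (transport b c P) := by
  have : transport b c P = val (transportPoly b c P) := funext fun x =>
    (val_transportPoly b c P x).symm
  rw [this]
  exact continuous_val _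

/-- The form `b` in terms of the differential operator. -/
theorem bForm_eq (β : Fin M.numElem → Pt d) (c : Fin M.numElem → ℝ) {r j : ℕ}
    (v : PiecewisePoly M r) (σ : WeakFun M j) :
    bForm M β c v σ = ∑ i, ((∫ x in M.elem i, val (v i) x * transport (β i) (c i) (σ.interior i) x) +
      ∑ e ∈ M.facesOf i, ⟪β i, M.normal i e⟫_ℝ * ∫ x in M.face e,
        val (v i) x * (val (σ.boundary e) x - val (σ.interior i) x) ∂μHE[d - 1]) := by
  rw [bForm]
  refine Finset.sum_congr rfl fun i _ => ?_
  set P := (σ.interior i).1 with hP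
  have hv := fun P : MvPolynomial (Fin d) ℝ => continuous_val P
  -- The weak gradient is tested with ψ = β v. Integrating by parts back on the element leaves the
  -- boundary part only through its difference to the interior part.
  have hspec := (existsUnique_discreteWeakGrad M i r P (fun e => (σ.boundary e).1)).choose_spec.1
    fun l => β i l • v i
  have hIE : ∀ {F : Pt d → ℝ}, Continuous F → IntegrableOn F (M.elem i) := M.integrableOn_elem i
  have hIF : ∀ {F : Pt d → ℝ} e, Continuous F → IntegrableOn F (M.face e) μHE[d - 1] :=
    fun e => M.integrableOn_face e
  have hinner : ∀ e, ∑ l, β i l * M.normal i e l = ⟪β i, M.normal i e⟫_ℝ := fun e => by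
    rw [PiLp.inner_apply]
    exact Finset.sum_congr rfl fun l _ => by simp [mul_comm]
  have hibp := M.integral_elem_fderiv i (β i) ((contDiff_val ((v i).1 * P)).of_le le_top)
  have h1 : (∫ x in M.elem i, val (v i) x * ∑ l, β i l * val (weakGrad M r σ i l) x) =
      -(∫ x in M.elem i, val P x * ∑ l, β i l * val (MvPolynomial.pderiv l (v i).1) x) +
      ∑ e ∈ M.facesOf i, ⟪β i, M.normal i e⟫_ℝ * ∫ x in M.face e,
        val (v i) x * val (σ.boundary e) x ∂μHE[d - 1] := by
    convert hspec using 1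
    · refine integral_congr_ae (Eventually.of_forall fun x => ?_)
      simp only [Submodule.coe_smul, val_smul, Finset.mul_sum]
      refine Finset.sum_congr rfl fun l _ => ?_
      change _ = val (weakGrad M r σ i l) x * _
      ring
    · congr 1
      · simp only [Submodule.coe_smul, (MvPolynomial.pderiv _).map_smul, val_smul]
      · refine Finset.sum_congr rfl fun e _ => ?_
        rw [← integral_const_mul]
        refine integral_congr_ae (Eventually.of_forall fun x => ?_)
        simp only [Submodule.coe_smul, val_smul]
        rw [← hinner, Finset.mul_sum, Finset.sum_mul]
        exact Finset.sum_congr rfl fun l _ => by ring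
  have h2 : (∫ x in M.elem i, val (v i) x * ∑ l, β i l * val (MvPolynomial.pderiv l P) x) +
      (∫ x in M.elem i, val P x * ∑ l, β i l * val (MvPolynomial.pderiv l (v i).1) x) =
      ∑ e ∈ M.facesOf i, ⟪β i, M.normal i e⟫_ℝ * ∫ x in M.face e,
        val (v i) x * val P x ∂μHE[d - 1] := by
    rw [← integral_add (hIE (by fun_prop)) (hIE (by fun_prop))]
    convert hibp using 1
    · refine integral_congr_ae (Eventually.of_forall fun x => ?_)
      simp only [fderiv_val, Derivation.leibniz, smul_eq_mul, val_add, val_mul, Finset.mul_sum,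
        mul_add, Finset.sum_add_distrib]
      congr 1 <;> exact Finset.sum_congr rfl fun l _ => by ring
    · refine Finset.sum_congr rfl fun e _ => ?_
      rw [integral_mul_const, mul_comm]
      simp only [val_mul]
  have h3 : (∫ x in M.elem i, val (v i) x * (∑ l, β i l * val (weakGrad M r σ i l) x -
      c i * val P x)) = (∫ x in M.elem i, val (v i) x * ∑ l, β i l * val (weakGrad M r σ i l) x) -
      ∫ x in M.elem i, val (v i) x * (c i * val P x) := by
    rw [← integral_sub (hIE (by fun_prop)) (hIE (by fun_prop))]
    simp_rw [mul_sub]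
  have h4 : (∫ x in M.elem i, val (v i) x * transport (β i) (c i) P x) =
      (∫ x in M.elem i, val (v i) x * ∑ l, β i l * val (MvPolynomial.pderiv l P) x) -
      ∫ x in M.elem i, val (v i) x * (c i * val P x) := by
    rw [← integral_sub (hIE (by fun_prop)) (hIE (by fun_prop))]
    simp_rw [transport, mul_sub]
  have h5 : ∑ e ∈ M.facesOf i, ⟪β i, M.normal i e⟫_ℝ * ∫ x in M.face e,
      val (v i) x * (val (σ.boundary e) x - val P x) ∂μHE[d - 1] =
      (∑ e ∈ M.facesOf i, ⟪β i, M.normal i e⟫_ℝ * ∫ x in M.face e,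
        val (v i) x * val (σ.boundary e) x ∂μHE[d - 1]) -
      ∑ e ∈ M.facesOf i, ⟪β i, M.normal i e⟫_ℝ * ∫ x in M.face e,
        val (v i) x * val P x ∂μHE[d - 1] := by
    rw [← Finset.sum_sub_distrib]
    refine Finset.sum_congr rfl fun e _ => ?_
    rw [← mul_sub, ← integral_sub (hIF e (by fun_prop)) (hIF e (by fun_prop))]
    simp_rw [mul_sub]
  rw [h3, h4, h5, h1]
  linarith

/-- The error identity. -/
theorem IsPDWGSolution.stab_eq (hΩ : IsOpen Ω) (hb : Bornology.IsBounded Ω) {q : ℝ}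
    (hq : 1 ≤ q) {β : Fin M.numElem → Pt d} {c : Fin M.numElem → ℝ} {p ρ τ : ℝ}
    {f g u : Pt d → ℝ} {u' : Fin d → Pt d → ℝ} {tr : Fin M.numFace → Pt d → ℝ}
    (hu : MemLp u (ENNReal.ofReal q) (volume.restrict Ω))
    (hu' : ∀ l, MemLp (u' l) (ENNReal.ofReal q) (volume.restrict Ω))
    (hf : MemLp f (ENNReal.ofReal q) (volume.restrict Ω))
    (hg : ∀ e, M.IsInflow β e → MemLp g (ENNReal.ofReal q) (μHE[d - 1].restrict (M.face e)))
    (hw : HasWeakGrad Ω u u')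
    (htr : ∀ e, MemLp (tr e) (ENNReal.ofReal q) (μHE[d - 1].restrict (M.face e)))
    (hibp : ∀ i l, ∀ σ : Pt d → ℝ, ContDiff ℝ 1 σ →
      ∫ x in M.elem i, (u x * fderiv ℝ σ x (EuclideanSpace.single l 1) + u' l x * σ x) =
        ∑ e ∈ M.facesOf i, ∫ x in M.face e, tr e x * (σ x * M.normal i e l) ∂μHE[d - 1])
    (hsol : IsWeakSolution M β c f g u) {r j : ℕ} {uh : PiecewisePoly M r} {lamh : WeakFun M j}
    (h : IsPDWGSolution M β c p ρ τ f g uh lamh) (v : PiecewisePoly M r) :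
    stab M β c p ρ τ lamh lamh = ∑ i,
      ((∫ x in M.elem i, (u x - val (v i) x) * transport (β i) (c i) (lamh.interior i) x) +
      ∑ e ∈ M.facesOf i, ⟪β i, M.normal i e⟫_ℝ * ∫ x in M.face e,
        (tr e x - val (v i) x) * (val (lamh.boundary e) x - val (lamh.interior i) x) ∂μHE[d - 1]) := by
  have hq1 : 1 ≤ ENNReal.ofReal q := by simpa using hq
  have hv := fun P : MvPolynomial (Fin d) ℝ => continuous_val P
  have hfinF : ∀ e, IsFiniteMeasure (μHE[d - 1].restrict (M.face e)) := fun e =>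
    ⟨by rw [Measure.restrict_apply_univ]; exact M.measure_face_lt_top e⟩
  have hfinE : ∀ i, IsFiniteMeasure (volume.restrict (M.elem i)) := fun i =>
    ⟨by rw [Measure.restrict_apply_univ]; exact (M.elem_polytope i).isBounded.measure_lt_top⟩
  have hmulF : ∀ e {s : Pt d → ℝ}, Continuous s →
      IntegrableOn (fun x => tr e x * s x) (M.face e) μHE[d - 1] := fun e s hs =>
    IntegrableOn.mul_continuous_of_bounded ((htr e).integrable hq1) (M.measurableSet_face e)
      (M.face_polytope e).isBounded hs
  have hmulE : ∀ i {s : Pt d → ℝ}, Continuous s →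
      IntegrableOn (fun x => u x * s x) (M.elem i) := fun i s hs =>
    IntegrableOn.mul_continuous_of_bounded
      ((hu.mono_measure (Measure.restrict_mono_set volume (M.elem_subset i))).integrable hq1)
      (M.isOpen_elem i).measurableSet (M.elem_polytope i).isBounded hs
  have hflux := PolytopalMesh.sum_face_eq_inflowPairing hΩ hb hq hu hu' hf hg hw htr hibp hsol
    (σ := fun e => val (lamh.boundary e).1) (fun e => continuous_val _) h.vanishes
  have hprimal := h.primal lamh h.vanishes
  have hdual := h.dual v
  -- The numerical primal variable drops out, the inflow data become traces of u, and the load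
  -- becomes an element integral of f. Subtracting the dual equation for `v` turns u into u - v.
  rw [h.dual uh, add_zero, ← hflux, loadPairing] at hprimal
  rw [bForm_eq] at hdual
  have hsub := congrArg₂ (· - ·) hprimal hdual.symm
  simp only [sub_zero] at hsub
  rw [hsub, ← Finset.sum_sub_distrib, ← Finset.sum_sub_distrib]
  refine Finset.sum_congr rfl fun i _ => ?_
  set P := (lamh.interior i).1 with hP
  have hI := PolytopalMesh.integral_elem_add_integral_elem hq hu hu' hf
    (PolytopalMesh.ae_eq_of_isWeakSolution hq hu hu' hf hw hsol i) (hibp i)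
    ((contDiff_val P).of_le le_top)
  have e1 : ∀ x, fderiv ℝ (val P) x (β i) - c i * val P x = transport (β i) (c i) P x := fun x => by
    rw [fderiv_val, transport]
  simp_rw [e1] at hI
  have e2 : (∫ x in M.elem i, (u x - val (v i) x) * transport (β i) (c i) P x) =
      (∫ x in M.elem i, u x * transport (β i) (c i) P x) -
      ∫ x in M.elem i, val (v i) x * transport (β i) (c i) P x := by
    have ht := continuous_transport (β i) (c i) P
    have i1 : IntegrableOn (fun x => val (v i) x * transport (β i) (c i) P x) (M.elem i) :=
      M.integrableOn_elem i (by fun_prop)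
    rw [← integral_sub (hmulE i ht) i1]
    simp_rw [sub_mul]
  have e3 : ∑ e ∈ M.facesOf i, ⟪β i, M.normal i e⟫_ℝ * ∫ x in M.face e,
      (tr e x - val (v i) x) * (val (lamh.boundary e) x - val P x) ∂μHE[d - 1] =
      (∑ e ∈ M.facesOf i, ⟪β i, M.normal i e⟫_ℝ * ∫ x in M.face e,
        tr e x * val (lamh.boundary e) x ∂μHE[d - 1]) -
      (∑ e ∈ M.facesOf i, ⟪β i, M.normal i e⟫_ℝ * ∫ x in M.face e,
        tr e x * val P x ∂μHE[d - 1]) -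
      ∑ e ∈ M.facesOf i, ⟪β i, M.normal i e⟫_ℝ * ∫ x in M.face e,
        val (v i) x * (val (lamh.boundary e) x - val P x) ∂μHE[d - 1] := by
    rw [← Finset.sum_sub_distrib, ← Finset.sum_sub_distrib]
    refine Finset.sum_congr rfl fun e _ => ?_
    have i1 := hmulF e (hv (lamh.boundary e))
    have i2 := hmulF e (hv P)
    have i3 : IntegrableOn (fun x => val (v i) x * (val (lamh.boundary e) x - val P x)) (M.face e)
      μHE[d - 1] := M.integrableOn_face e (by fun_prop)
    have i4 : IntegrableOn (fun x => tr e x * val (lamh.boundary e) x - tr e x * val P x)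
      (M.face e) μHE[d - 1] := i1.sub i2
    rw [← mul_sub, ← mul_sub, ← integral_sub i1 i2, ← integral_sub i4 i3]
    congr 1
    refine integral_congr_ae (Eventually.of_forall fun x => ?_)
    simp only
    ring
  rw [e2, e3]
  linarith

end ErrorEstimate

end LpPDWG
end


/-! ### Hölder inequalities for the error terms -/

noncomputable section

namespace LpPDWG

section ErrorEstimate

open ENNReal

variable {d : ℕ} {Ω : Set (Pt d)} {M : PolytopalMesh Ω}

/-- The weak derivative picked by choice need not be the one known to lie in L^q, but uniqueness
makes them agree almost everywhere. -/
theorem MemSobolev.memLp_weakPartial (hΩ : IsOpen Ω) {k : ℕ} {q : ℝ} {u : Pt d → ℝ}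
    (hu : MemSobolev Ω k q u) (α : Fin k → Fin d) :
    MemLp (weakPartial Ω u α) (ENNReal.ofReal q) (volume.restrict Ω) := by
  obtain ⟨v, hv, hv'⟩ := hu.2 k le_rfl α
  have hex : ∃ v, IsWeakPartial Ω u α v := ⟨v, hv'⟩
  have hw : IsWeakPartial Ω u α (weakPartial Ω u α) := by
    rw [weakPartial, dif_pos hex]
    exact hex.choose_spec
  refine (memLp_congr_ae (ae_eq_of_setIntegral_mul_eq hΩ hw.1 hv'.1 fun φ hφ hc hs => ?_)).2 hv
  exact mul_left_cancel₀ (pow_ne_zero _ (by norm_num)) ((hw.2 φ hφ hc hs).symm.trans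
    (hv'.2 φ hφ hc hs))

theorem MemSobolev.memLp_norm_weakPartial (hΩ : IsOpen Ω) {k : ℕ} {q : ℝ}
    {u : Pt d → ℝ} (hu : MemSobolev Ω k q u) :
    MemLp (fun x => √(∑ α : Fin k → Fin d, weakPartial Ω u α x ^ 2)) (ENNReal.ofReal q)
      (volume.restrict Ω) := by
  have h := fun α => hu.memLp_weakPartial hΩ α
  refine MemLp.mono' (memLp_finsetSum Finset.univ fun α _ => (h α).norm) ?_
    (Eventually.of_forall fun x => ?_)
  · refine Real.continuous_sqrt.comp_aestronglyMeasurable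
      (Finset.aestronglyMeasurable_fun_sum _ fun α _ => (h α).1.pow 2)
  · rw [Real.norm_eq_abs, abs_of_nonneg (Real.sqrt_nonneg _)]
    refine Real.sqrt_le_iff.2 ⟨Finset.sum_nonneg fun α _ => norm_nonneg _, ?_⟩
    have := Finset.sum_sq_le_sq_sum_of_nonneg (s := Finset.univ)
      (f := fun α : Fin k → Fin d => ‖weakPartial Ω u α x‖) fun α _ => norm_nonneg _
    simpa using this

/-- Hölder's inequality. -/
theorem abs_integral_mul_le_eLpNorm {p q : ℝ} (hpq : p.HolderConjugate q) {μ : Measure (Pt d)}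
    {F s : Pt d → ℝ} (hF : MemLp F (ENNReal.ofReal q) μ) (hs : MemLp s (ENNReal.ofReal p) μ) :
    |∫ x, F x * s x ∂μ| ≤
      (eLpNorm F (ENNReal.ofReal q) μ).toReal * (∫ x, |s x| ^ p ∂μ) ^ (1 / p) := by
  have h1 : (eLpNorm F (ENNReal.ofReal q) μ).toReal = (∫ x, ‖F x‖ ^ q ∂μ) ^ (1 / q) := by
    rw [hF.eLpNorm_eq_integral_rpow_norm (by simpa using hpq.symm.pos) ofReal_ne_top,
      ENNReal.toReal_ofReal hpq.symm.nonneg, ENNReal.toReal_ofReal, one_div]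
    exact Real.rpow_nonneg (integral_nonneg fun _ => by positivity) _
  rw [h1]
  refine (abs_integral_le_integral_abs).trans ?_
  simp_rw [abs_mul]
  exact integral_mul_norm_le_Lp_mul_Lq hpq.symm hF hs

/-- With s the sum of the a i, Hölder's inequality gives s ≤ K R^(1/q) s^(1/p). Dividing by s^(1/p)
leaves s^(1/q), and the power q/p produces the asymmetric exponents of the final estimate. -/
theorem rpow_inv_le_of_le_sum {p q : ℝ} (hpq : p.HolderConjugate q) {ι : Type*} [Fintype ι]
    {a b : ι → ℝ} (ha : ∀ i, 0 ≤ a i) (hb : ∀ i, 0 ≤ b i) {K R : ℝ} (hK : 0 ≤ K)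
    (hle : ∑ i, a i ≤ K * ∑ i, b i * a i ^ (1 / p)) (hR : ∑ i, b i ^ q ≤ R) :
    (∑ i, a i) ^ (1 / p) ≤ K ^ (q / p) * R ^ (1 / p) := by
  have hp := hpq.pos
  have hq := hpq.symm.pos
  have hR0 : 0 ≤ R := (Finset.sum_nonneg fun i _ => Real.rpow_nonneg (hb i) _).trans hR
  set s := ∑ i, a i with hs
  have hs0 : 0 ≤ s := Finset.sum_nonneg fun i _ => ha i
  rcases hs0.eq_or_lt with h0 | h0
  · rw [← h0, Real.zero_rpow (by positivity)]
    positivity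
  have h1 : ∑ i, b i * a i ^ (1 / p) ≤ R ^ (1 / q) * s ^ (1 / p) := by
    refine (Real.inner_le_Lp_mul_Lq_of_nonneg Finset.univ hpq.symm (fun i _ => hb i)
      fun i _ => Real.rpow_nonneg (ha i) _).trans ?_
    have h2 : ∀ i, (a i ^ (1 / p)) ^ p = a i := fun i => by
      rw [← Real.rpow_mul (ha i), one_div_mul_cancel hp.ne', Real.rpow_one]
    simp_rw [h2]
    refine mul_le_mul_of_nonneg_right (Real.rpow_le_rpow
      (Finset.sum_nonneg fun i _ => Real.rpow_nonneg (hb i) _) hR (by positivity))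
      (Real.rpow_nonneg h0.le _)
  have h2 : s ^ (1 / q) ≤ K * R ^ (1 / q) := by
    refine le_of_mul_le_mul_right ?_ (Real.rpow_pos_of_pos h0 (1 / p))
    rw [← Real.rpow_add h0, one_div, one_div, hpq.symm.inv_add_inv_eq_one, Real.rpow_one, mul_assoc]
    simpa only [one_div] using hle.trans (mul_le_mul_of_nonneg_left h1 hK)
  calc s ^ (1 / p) = (s ^ (1 / q)) ^ (q / p) := by
        rw [← Real.rpow_mul h0.le]
        congr 1
        field_simp
    _ ≤ (K * R ^ (1 / q)) ^ (q / p) := Real.rpow_le_rpow (by positivity) h2 (by positivity)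
    _ = K ^ (q / p) * R ^ (1 / p) := by
        rw [Real.mul_rpow hK (by positivity), ← Real.rpow_mul hR0]
        congr 2
        field_simp

/-- The face terms of the stabilizer control the jumps. -/
theorem rpow_one_div_le_of_mul_le {p q : ℝ} (hpq : p.HolderConjugate q) {ρ h X a : ℝ} (hρ : 0 < ρ)
    (hh : 0 < h) (hX : 0 ≤ X) (hle : ρ * h ^ (1 - p) * X ≤ a) :
    h ^ (-(1 / q)) * X ^ (1 / p) ≤ (ρ⁻¹) ^ (1 / p) * a ^ (1 / p) := by
  have hp := hpq.pos
  have ha : 0 ≤ a := le_trans (by positivity) hle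
  have h1 : h ^ (-(1 / q)) * X ^ (1 / p) = (h ^ (1 - p) * X) ^ (1 / p) := by
    rw [Real.mul_rpow (by positivity) hX, ← Real.rpow_mul hh.le]
    congr 2
    -- Conjugacy of the exponents in the form (1 - p)/p = -1/q.
    have := hpq.inv_add_inv_eq_one
    rw [sub_mul, mul_one_div_cancel hp.ne', one_div, one_div]
    linarith
  rw [h1, ← Real.mul_rpow (by positivity) ha]
  refine Real.rpow_le_rpow (by positivity) ?_ (by positivity)
  rw [← div_eq_inv_mul, le_div_iff₀ hρ]
  linarith

end ErrorEstimate

end LpPDWG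

end
-- The error estimate for the dual variable
open LpPDWG in
theorem theorem7p1 (d : ℕ) (hd : d = 2 ∨ d = 3) (Ω : Set (Pt d)) (hΩ : IsLipschitzDomain Ω)
    (k j : ℕ) (hk : 1 ≤ k) (p q : ℝ) (hpq : p.HolderConjugate q) (ρ τ : ℝ) (hρ : 0 < ρ)
    (hj : (j = k - 1 ∧ 0 ≤ τ) ∨ (j = k ∧ 0 < τ)) (γ : ℝ) (hγ : 0 < γ) (N : ℕ) (B : ℝ) :
    ∃ C : ℝ, 0 < C ∧
      ∀ M : PolytopalMesh Ω, M.ShapeRegular γ N →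
      ∀ (β : Fin M.numElem → Pt d) (c : Fin M.numElem → ℝ), (∀ i, ‖β i‖ ≤ B) →
      ∀ f g u : Pt d → ℝ,
        MemLp f (ENNReal.ofReal q) (volume.restrict Ω) →
        (∀ e, M.IsInflow β e → MemLp g (ENNReal.ofReal q) (μHE[d - 1].restrict (M.face e))) →
        MemSobolev Ω k q u →
        IsWeakSolution M β c f g u →
      ∀ (uh : PiecewisePoly M (k - 1)) (lamh : WeakFun M j),
        IsPDWGSolution M β c p ρ τ f g uh lamh →
        tripleNorm M β c p ρ τ lamh ≤
          C * M.meshSize ^ (q * k / p) * gradNorm Ω k q u ^ (q / p) := by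
  have hd1 : 1 ≤ d := by omega
  have hp := hpq.pos
  have hq0 := hpq.symm.pos
  have hq : 1 ≤ q := hpq.symm.lt.le
  have hτ : 0 ≤ τ := by rcases hj with h | h <;> linarith [h.2]
  obtain ⟨κ, hκ, K, hK, happ⟩ := PolytopalMesh.ShapeRegular.exists_local_approx hΩ hd1 hk hq hγ
  set t : ℝ := (2 ^ q * 2 ^ (d - 1) * γ⁻¹) ^ (1 / q) with ht
  set A : ℝ := γ⁻¹ * (κ + 1) ^ d * (d * volume.real (Metric.ball (0 : Pt d) 1)) with hA
  -- The first summand serves the element terms, the second the at most N faces of an element. For τ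
  -- = 0 the inverse is 0 by convention; this is harmless, since then j = k - 1 and the element
  -- terms vanish.
  set L : ℝ := K * (τ⁻¹) ^ (1 / p) + N * (|B| * (t * K * (ρ⁻¹) ^ (1 / p))) with hL
  have ht0 : 0 ≤ t := by positivity
  have hA0 : 0 ≤ A := by positivity
  have hL0 : 0 ≤ L := by positivity
  -- The summand 1 only secures strict positivity.
  refine ⟨L ^ (q / p) * A ^ (1 / p) + 1, by positivity, ?_⟩
  intro M hsr β c hβ f g u hf hg hu hsol uh lamh hsolh
  obtain ⟨v, hv, rfl, hvG⟩ := hu.exists_jet hΩ.isOpen hq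
  set G : Pt d → ℝ := fun x => √(∑ α : Fin k → Fin d, weakPartial Ω (v 0) α x ^ 2) with hGdef
  have hG : MemLp G (ENNReal.ofReal q) (volume.restrict Ω) := hu.memLp_norm_weakPartial hΩ.isOpen
  have hv0 := hv.memLp 0 (by simp)
  have hv1 : ∀ l, MemLp (v (Finsupp.single l 1)) (ENNReal.ofReal q) (volume.restrict Ω) := fun l =>
    hv.memLp _ (by rw [Finsupp.degree_single]; exact hk)
  have hwg : HasWeakGrad Ω (v 0) fun l => v (Finsupp.single l 1) := by
    simpa using hv.hasWeakGrad 0 (by simpa using Nat.pos_of_ne_zero (by omega))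
  obtain ⟨tr, htr, htrb, hibp⟩ := hsr.exists_trace hΩ hγ hd1 hq hwg hv0 hv1
  have hH := M.meshSize_nonneg
  choose x hx using fun i => (M.elem_polytope i).isConnected.nonempty
  choose U hUo hUΩ hUb P hPorth hPE hPF using
    fun i => happ hsr hv hvG htr htrb i (x i) (hx i)
  have hEfin : ∀ i, eLpNorm G (ENNReal.ofReal q) (volume.restrict (U i)) ≠ ⊤ := fun i =>
    (hG.mono_measure (Measure.restrict_mono_set _ (hUΩ i))).2.ne
  set E : Fin M.numElem → ℝ := fun i =>
    (eLpNorm G (ENNReal.ofReal q) (volume.restrict (U i))).toReal with hE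
  have hE0 : ∀ i, 0 ≤ E i := fun i => ENNReal.toReal_nonneg
  have hh0 : ∀ i, 0 < M.hElem i := M.hElem_pos hd1
  set X : Fin M.numElem → Fin M.numFace → ℝ := fun i e => ∫ x in M.face e,
    |val (lamh.interior i) x - val (lamh.boundary e) x| ^ p ∂μHE[d - 1] with hX
  set Y : Fin M.numElem → ℝ := fun i =>
    ∫ x in M.elem i, |transport (β i) (c i) (lamh.interior i) x| ^ p with hY
  have hX0 : ∀ i e, 0 ≤ X i e := fun i e => integral_nonneg fun _ => by positivity
  have hY0 : ∀ i, 0 ≤ Y i := fun i => integral_nonneg fun _ => by positivity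
  set a : Fin M.numElem → ℝ := fun i =>
    ρ * M.hElem i ^ (1 - p) * ∑ e ∈ M.facesOf i, X i e + τ * Y i with ha
  have hstab : stab M β c p ρ τ lamh lamh = ∑ i, a i := stab_self β c hp ρ τ lamh
  have hfac : ∀ i, 0 ≤ ρ * M.hElem i ^ (1 - p) := fun i =>
    mul_nonneg hρ.le (Real.rpow_nonneg (hh0 i).le _)
  have hsX : ∀ i, 0 ≤ ∑ e ∈ M.facesOf i, X i e := fun i => Finset.sum_nonneg fun e _ => hX0 i e
  have ha0 : ∀ i, 0 ≤ a i := fun i =>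
    add_nonneg (mul_nonneg (hfac i) (hsX i)) (mul_nonneg hτ (hY0 i))
  have ha1 : ∀ i, 0 ≤ a i ^ (1 / p) := fun i => Real.rpow_nonneg (ha0 i) _
  have hcE : ∀ i {F : Pt d → ℝ} {r : ENNReal}, Continuous F →
      MemLp F r (volume.restrict (M.elem i)) := fun i _ _ hF =>
    memLp_restrict_of_continuous (M.elem_polytope i).isBounded
      (M.elem_polytope i).isBounded.measure_lt_top.ne hF
  have hcF : ∀ e {F : Pt d → ℝ} {r : ENNReal}, Continuous F →
      MemLp F r (μHE[d - 1].restrict (M.face e)) := fun e _ _ hF =>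
    memLp_restrict_of_continuous (M.face_polytope e).isBounded (M.measure_face_lt_top e).ne hF
  -- the contributions of the elements
  have hI : ∀ i, (∫ x in M.elem i, (v 0 x - val (P i) x) *
      transport (β i) (c i) (lamh.interior i) x) ≤
      K * (τ⁻¹) ^ (1 / p) * (M.hElem i ^ k * E i * a i ^ (1 / p)) := by
    intro i
    have hnn : 0 ≤ K * (τ⁻¹) ^ (1 / p) * (M.hElem i ^ k * E i * a i ^ (1 / p)) :=
      mul_nonneg (by positivity) (mul_nonneg (mul_nonneg (pow_nonneg (hh0 i).le _) (hE0 i)) (ha1 i))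
    -- For j = k - 1 the transport polynomial has degree at most k - 1 and is orthogonal to the
    -- projection error. For j = k it can have degree k, and the stabilizer with τ > 0 controls it.
    rcases hj with ⟨hjk, -⟩ | ⟨-, hτ0⟩
    · have := hPorth i ⟨transportPoly (β i) (c i) (lamh.interior i).1,
        transportPoly_mem _ _ (hjk ▸ (lamh.interior i).2)⟩
      simp only [val_transportPoly] at this
      exact this.trans_le hnn
    · have h1 := (le_abs_self _).trans (abs_integral_mul_le_eLpNorm hpq
        ((hv0.mono_measure (Measure.restrict_mono_set _ (M.elem_subset i))).sub
          (hcE i (continuous_val (P i).1)))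
        (hcE i (continuous_transport (β i) (c i) (lamh.interior i).1)))
      refine h1.trans ?_
      have h2 : (eLpNorm (fun x => v 0 x - val (P i).1 x) (ENNReal.ofReal q)
          (volume.restrict (M.elem i))).toReal ≤ K * M.hElem i ^ k * E i := by
        have := ENNReal.toReal_mono (ENNReal.mul_ne_top ENNReal.ofReal_ne_top (hEfin i)) (hPE i)
        rwa [ENNReal.toReal_mul, ENNReal.toReal_ofReal
          (mul_nonneg hK (pow_nonneg (hh0 i).le _))] at this
      have h3 : Y i ^ (1 / p) ≤ (τ⁻¹) ^ (1 / p) * a i ^ (1 / p) := by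
        rw [← Real.mul_rpow (by positivity) (ha0 i)]
        refine Real.rpow_le_rpow (hY0 i) ?_ (by positivity)
        rw [← div_eq_inv_mul, le_div_iff₀ hτ0, mul_comm]
        exact le_add_of_nonneg_left (mul_nonneg (hfac i) (hsX i))
      refine (mul_le_mul h2 h3 (Real.rpow_nonneg (hY0 i) _)
        (mul_nonneg (mul_nonneg hK (pow_nonneg (hh0 i).le _)) (hE0 i))).trans (le_of_eq ?_)
      ring
  -- the contributions of the faces
  have hII : ∀ i, ∀ e ∈ M.facesOf i, (⟪β i, M.normal i e⟫_ℝ * ∫ x in M.face e,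
      (tr e x - val (P i) x) * (val (lamh.boundary e) x - val (lamh.interior i) x) ∂μHE[d - 1]) ≤
      |B| * (t * K * (ρ⁻¹) ^ (1 / p)) * (M.hElem i ^ k * E i * a i ^ (1 / p)) := by
    intro i e he
    have hn : |⟪β i, M.normal i e⟫_ℝ| ≤ |B| := by
      refine (abs_real_inner_le_norm _ _).trans ?_
      rw [M.normal_norm i e he, mul_one]
      exact (hβ i).trans (le_abs_self B)
    have h1 := abs_integral_mul_le_eLpNorm hpq ((htr e).sub (hcF e (continuous_val (P i).1)))
      (hcF e ((continuous_val (lamh.boundary e).1).sub (continuous_val (lamh.interior i).1)))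
    have hXe : (∫ x in M.face e, |(val (lamh.boundary e).1 - val (lamh.interior i).1) x| ^ p
        ∂μHE[d - 1]) = X i e := by
      simp only [hX, Pi.sub_apply]
      simp_rw [abs_sub_comm]
    have h2 : (eLpNorm (fun x => tr e x - val (P i).1 x) (ENNReal.ofReal q)
        (μHE[d - 1].restrict (M.face e))).toReal ≤
        t * M.hElem i ^ (-(1 / q)) * (K * M.hElem i ^ k * E i) := by
      have h3 := hPF i e he
      rw [PolytopalMesh.traceConst_eq d hγ (hh0 i)] at h3
      have := ENNReal.toReal_mono (ENNReal.mul_ne_top ENNReal.ofReal_ne_top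
        (ENNReal.mul_ne_top ENNReal.ofReal_ne_top (hEfin i))) h3
      rwa [ENNReal.toReal_mul, ENNReal.toReal_mul, ENNReal.toReal_ofReal
        (mul_nonneg ht0 (Real.rpow_nonneg (hh0 i).le _)), ENNReal.toReal_ofReal
        (mul_nonneg hK (pow_nonneg (hh0 i).le _))] at this
    -- The negative power of h from the trace inequality is absorbed by the weight of the face
    -- stabilizer, and the single face is bounded by the whole local stabilizer.
    have h4 : M.hElem i ^ (-(1 / q)) * X i e ^ (1 / p) ≤ (ρ⁻¹) ^ (1 / p) * a i ^ (1 / p) := by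
      refine rpow_one_div_le_of_mul_le hpq hρ (hh0 i) (hX0 i e) ?_
      exact (mul_le_mul_of_nonneg_left (Finset.single_le_sum (fun e _ => hX0 i e) he)
        (hfac i)).trans (le_add_of_nonneg_right (mul_nonneg hτ (hY0 i)))
    have h5 : 0 ≤ t * (K * M.hElem i ^ k * E i) :=
      mul_nonneg ht0 (mul_nonneg (mul_nonneg hK (pow_nonneg (hh0 i).le _)) (hE0 i))
    refine (le_abs_self _).trans ?_
    rw [abs_mul]
    calc _ ≤ |B| * (t * M.hElem i ^ (-(1 / q)) * (K * M.hElem i ^ k * E i) * X i e ^ (1 / p)) := by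
          refine mul_le_mul hn ?_ (abs_nonneg _) (abs_nonneg _)
          rw [hXe] at h1
          exact h1.trans (mul_le_mul_of_nonneg_right h2 (Real.rpow_nonneg (hX0 i e) _))
      _ = |B| * (t * (K * M.hElem i ^ k * E i) *
          (M.hElem i ^ (-(1 / q)) * X i e ^ (1 / p))) := by ring
      _ ≤ |B| * (t * (K * M.hElem i ^ k * E i) * ((ρ⁻¹) ^ (1 / p) * a i ^ (1 / p))) :=
          mul_le_mul_of_nonneg_left (mul_le_mul_of_nonneg_left h4 h5) (abs_nonneg _)
      _ = _ := by ring
  have hle : ∑ i, a i ≤ L * ∑ i, M.hElem i ^ k * E i * a i ^ (1 / p) := by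
    rw [← hstab, hsolh.stab_eq hΩ.isOpen hΩ.isBounded hq hv0 hv1 hf hg hwg htr hibp hsol P,
      Finset.mul_sum]
    refine Finset.sum_le_sum fun i _ => ?_
    have hb0 : 0 ≤ M.hElem i ^ k * E i * a i ^ (1 / p) :=
      mul_nonneg (mul_nonneg (pow_nonneg (hh0 i).le _) (hE0 i)) (ha1 i)
    rw [hL, add_mul]
    refine add_le_add (hI i) ((Finset.sum_le_sum (hII i)).trans ?_)
    rw [Finset.sum_const, nsmul_eq_mul, mul_assoc (N : ℝ)]
    refine mul_le_mul_of_nonneg_right (by exact_mod_cast hsr.card_faces i) ?_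
    exact mul_nonneg (by positivity) hb0
  have hR : ∑ i, (M.hElem i ^ k * E i) ^ q ≤
      A * M.meshSize ^ (q * k) * gradNorm Ω k q (v 0) ^ q := by
    -- An exponent of at least one is what the summation over overlapping patches requires.
    have hqk : 1 ≤ q * k := by
      have : (1 : ℝ) ≤ k := by exact_mod_cast hk
      nlinarith
    have h1 := M.sum_lintegral_patch_le hd1 hγ hsr.volume_elem hκ hx hUo hUb hUΩ hqk
      (G := fun x => ‖G x‖ₑ ^ q) (hG.1.enorm.pow_const q)
    simp_rw [← eLpNorm_rpow_eq _ hq] at h1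
    have hgN : ENNReal.ofReal (gradNorm Ω k q (v 0)) =
        eLpNorm G (ENNReal.ofReal q) (volume.restrict Ω) := ENNReal.ofReal_toReal hG.2.ne
    have hgN0 : 0 ≤ gradNorm Ω k q (v 0) := ENNReal.toReal_nonneg
    rw [← hgN, ENNReal.ofReal_rpow_of_nonneg hgN0 hq0.le, ← ENNReal.ofReal_mul (by positivity)] at h1
    have hbi : ∀ i, 0 ≤ M.hElem i ^ k * E i := fun i =>
      mul_nonneg (pow_nonneg (hh0 i).le _) (hE0 i)
    have h2 : ∀ i, ENNReal.ofReal (M.hElem i ^ (q * k)) *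
        eLpNorm G (ENNReal.ofReal q) (volume.restrict (U i)) ^ q =
        ENNReal.ofReal ((M.hElem i ^ k * E i) ^ q) := by
      intro i
      rw [← ENNReal.ofReal_toReal (hEfin i), ENNReal.ofReal_rpow_of_nonneg (hE0 i) hq0.le,
        ← ENNReal.ofReal_mul (Real.rpow_nonneg (hh0 i).le _),
        Real.mul_rpow (pow_nonneg (hh0 i).le _) (hE0 i), ← Real.rpow_natCast,
        ← Real.rpow_mul (hh0 i).le, mul_comm q]
    simp_rw [h2] at h1
    rw [← ENNReal.ofReal_sum_of_nonneg fun i _ => Real.rpow_nonneg (hbi i) _] at h1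
    exact (ENNReal.ofReal_le_ofReal_iff (by positivity)).1 h1
  have hgN0 : 0 ≤ gradNorm Ω k q (v 0) := ENNReal.toReal_nonneg
  have hfin := rpow_inv_le_of_le_sum hpq ha0
    (fun i => mul_nonneg (pow_nonneg (hh0 i).le k) (hE0 i)) hL0 hle hR
  rw [tripleNorm, hstab]
  refine hfin.trans ?_
  rw [Real.mul_rpow (by positivity) (by positivity), Real.mul_rpow hA0 (by positivity),
    ← Real.rpow_mul hH, ← Real.rpow_mul hgN0, mul_one_div, mul_one_div, ← mul_assoc, ← mul_assoc]
  refine mul_le_mul_of_nonneg_right (mul_le_mul_of_nonneg_right (by linarith) (by positivity))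
    (by positivity)
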